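/- Let $1<p<\infty$ and $\frac1p+\frac1{p'}=1$. Let $G:(0,1)\times\mathbb R\to\mathbb R$ and let $L>0$, $0<G_0\le G_1$ and $0=\xi_0<\xi_1<\dots<\xi_N=1$ be such that: $G_0\le G\le G_1$; $G(x,y+L)=G(x,y)$ for all $(x,y)$; on each $(\xi_{i-1},\xi_i)\times\mathbb R$ the function $G$ is $C^1$, the derivatives $\partial_xG$, $\partial_yG$ are bounded, and $G$, $\partial_xG$, $\partial_yG$ have, for each fixed $y$, limits as $x\to\xi_{i-1}^+$ and as $x\to\xi_i^-$. For $\varepsilon>0$ put $$R^\varepsilon=\{(x,y)\in\mathbb R^2:\ 0<x<1,\ 0<y<\varepsilon G(x,x/\varepsilon)\}.$$ Let $f^\varepsilon\in L^{p'}(R^\varepsilon)$, with $\|f^\varepsilon\|_{L^{p'}(R^\varepsilon)}$ bounded uniformly for all small $\varepsilon>0$, and let $u_\varepsilon\in W^{1,p}(R^\varepsilon)$ be the weak solution of $-\Delta_pu_\varepsilon+|u_\varepsilon|^{p-2}u_\varepsilon=f^\varepsilon$ in $R^\varepsilon$ with the homogeneous Neumann condition, that is, $$\int_{R^\varepsilon}\{|\nabla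 u_\varepsilon|^{p-2}\nabla u_\varepsilon\cdot\nabla\varphi+|u_\varepsilon|^{p-2}u_\varepsilon\varphi\}\,dx\,dy=\int_{R^\varepsilon}f^\varepsilon\varphi\,dx\,dy\qquad\forall\varphi\in W^{1,p}(R^\varepsilon).$$ Suppose that $\hat f^\varepsilon(x)=\frac1\varepsilon\int_0^{\varepsilon G(x,x/\varepsilon)}f^\varepsilon(x,y)\,dy$ satisfies $\hat f^\varepsilon\rightharpoonup\hat f$ weakly in $L^{p'}(0,1)$ as $\varepsilon\to0^+$. For $x\in(0,1)$ let $Y^*(x)=\{(y_1,y_2):0<y_1<L,\ 0<y_2<G(x,y_1)\}$, let $W^{1,p}_\#(Y^*(x))$ be the space of those $\varphi\in W^{1,p}(Y^*(x))$ whose traces on the left and right sides of $Y^*(x)$ coincide (functions $L$-periodic in $y_1$), and write $\langle\cdot\rangle$ for the average over $Y^*(x)$. Then for every $x\in(0,1)\setminus\{\xi_1,\dots,\xi_{N-1}\}$ there is a unique (up to null sets) $v$ with $v-y_1\in W^{1,p}_\#(Y^*(x))$, $\langle v-y_1\rangle=0$ and $$\int_{Y^*(x)}|\nabla v|^{p-2}\nabla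 v\cdot\nabla\varphi\,dy_1dy_2=0\qquad\forall\varphi\in W^{1,p}_\#(Y^*(x)),\ \langle\varphi\rangle=0 .$$ Define, for these $x$, $$q(x)=\frac1L\int_{Y^*(x)}|\nabla v|^{p-2}\,\partial_{y_1}v\,dy_1dy_2,\qquad r(x)=\frac{|Y^*(x)|}{L}.$$ Then there exists $u\in W^{1,p}(0,1)$ such that $$\frac{L}{|Y^*(x)|\,\varepsilon}\int_0^{\varepsilon G(x,x/\varepsilon)}u_\varepsilon(x,y)\,dy\ \rightharpoonup\ u\quad\text{weakly in }L^p(0,1)\text{ as }\varepsilon\to0^+,$$ and $u$ satisfies the homogenized Neumann problem $$\int_0^1\{q(x)|u'|^{p-2}u'\varphi'+r(x)|u|^{p-2}u\varphi\}\,dx=\int_0^1\hat f\varphi\,dx\qquad\forall\varphi\in W^{1,p}(0,1).$$ -/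

import Mathlib

open Set Filter Topology MeasureTheory
open scoped ContDiff NNReal ENNReal

noncomputable section

namespace RoughThin

/-- Vectors of the plane with the Euclidean norm and inner product: the values of gradients.
Points of the plane are written as pairs in `ℝ × ℝ`, which carries planar Lebesgue measure. -/
abbrev Vec2 : Type := EuclideanSpace ℝ (Fin 2)

/-- `g` is the weak derivative of `u` on `Ω` in the direction `w`, in the sense of distributions:
`∫_Ω u ∂_w φ = - ∫_Ω g φ` for every smooth `φ` with compact support contained in `Ω`. -/
def HasWeakDeriv {E : Type*} [NormedAddCommGroup E] [NormedSpace ℝ E] [MeasureSpace E]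
    (Ω : Set E) (u : E → ℝ) (w : E) (g : E → ℝ) : Prop :=
  ∀ φ : E → ℝ, ContDiff ℝ ∞ φ → HasCompactSupport φ → tsupport φ ⊆ Ω →
    ∫ z in Ω, u z * fderiv ℝ φ z w = - ∫ z in Ω, g z * φ z

/-- `g` is the weak gradient of `u` on the planar set `Ω`. -/
def HasWeakGrad (Ω : Set (ℝ × ℝ)) (u : ℝ × ℝ → ℝ) (g : ℝ × ℝ → Vec2) : Prop :=
  HasWeakDeriv Ω u (1, 0) (fun z => g z 0) ∧ HasWeakDeriv Ω u (0, 1) (fun z => g z 1)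

/-- `u ∈ W^{1,p}(Ω)`, `Ω` a subset of the plane, with weak gradient `g`. -/
def MemW (p : ℝ) (Ω : Set (ℝ × ℝ)) (u : ℝ × ℝ → ℝ) (g : ℝ × ℝ → Vec2) : Prop :=
  MemLp u (ENNReal.ofReal p) (volume.restrict Ω) ∧
    MemLp g (ENNReal.ofReal p) (volume.restrict Ω) ∧ HasWeakGrad Ω u g

/-- `u ∈ W^{1,p}(0,1)` with weak derivative `u'`. -/
def MemW01 (p : ℝ) (u u' : ℝ → ℝ) : Prop :=
  MemLp u (ENNReal.ofReal p) (volume.restrict (Ioo 0 1)) ∧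
    MemLp u' (ENNReal.ofReal p) (volume.restrict (Ioo 0 1)) ∧ HasWeakDeriv (Ioo 0 1) u 1 u'

/-- The scalar map `s ↦ |s|^{p-2} s`; its value at `0` is `0` for every `p`. -/
def pPow (p s : ℝ) : ℝ := |s| ^ (p - 2) * s

/-- The planar map `s ↦ |s|^{p-2} s`; its value at `0` is `0` for every `p`. -/
def pFlux (p : ℝ) (s : Vec2) : Vec2 := ‖s‖ ^ (p - 2) • s

/-- `h` has a right limit at `a` and a left limit at `b`. -/
def HasEndLimits (a b : ℝ) (h : ℝ → ℝ) : Prop :=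
  (∃ l, Tendsto h (𝓝[>] a) (𝓝 l)) ∧ ∃ l, Tendsto h (𝓝[<] b) (𝓝 l)

/-- The hypothesis on the profile `G : (0,1) × ℝ → ℝ` (values `G x y` with `x ∉ (0,1)` play no
role): it is piecewise `C¹` in `x` with breakpoints `0 = ξ₀ < ⋯ < ξ_N = 1`, with bounded
derivatives that have limits at the breakpoints, it lies between positive constants, and it is
`L`-periodic in the second variable. -/
structure IsProfile (G : ℝ → ℝ → ℝ) (L G₀ G₁ : ℝ) {N : ℕ} (ξ : Fin (N + 1) → ℝ) : Prop where
  strictMono : StrictMono ξ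
  first : ξ 0 = 0
  last : ξ (Fin.last N) = 1
  contDiffOn : ∀ i : Fin N,
    ContDiffOn ℝ 1 (fun z : ℝ × ℝ => G z.1 z.2) (Ioo (ξ i.castSucc) (ξ i.succ) ×ˢ univ)
  deriv_bounded : ∃ M : ℝ, ∀ i : Fin N, ∀ x ∈ Ioo (ξ i.castSucc) (ξ i.succ), ∀ y : ℝ,
    |deriv (fun s => G s y) x| ≤ M ∧ |deriv (G x) y| ≤ M
  limits : ∀ (i : Fin N) (y : ℝ),
    HasEndLimits (ξ i.castSucc) (ξ i.succ) (fun x => G x y) ∧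
    HasEndLimits (ξ i.castSucc) (ξ i.succ) (fun x => deriv (fun s => G s y) x) ∧
    HasEndLimits (ξ i.castSucc) (ξ i.succ) (fun x => deriv (G x) y)
  lower_pos : 0 < G₀
  bounds : ∀ x ∈ Ioo (0 : ℝ) 1, ∀ y : ℝ, G₀ ≤ G x y ∧ G x y ≤ G₁
  period_pos : 0 < L
  periodic : ∀ x ∈ Ioo (0 : ℝ) 1, ∀ y : ℝ, G x (y + L) = G x y

/-- The thin domain `R^ε = {(x, y) : 0 < x < 1, 0 < y < ε G(x, x/ε)}`. -/
def thinDomain (G : ℝ → ℝ → ℝ) (ε : ℝ) : Set (ℝ × ℝ) :=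
  {z | z.1 ∈ Ioo (0 : ℝ) 1 ∧ 0 < z.2 ∧ z.2 < ε * G z.1 (z.1 / ε)}

/-- `(1/ε) ∫_0^{ε G(x, x/ε)} h(x, y) dy`, as a function of `x`. -/
def vertInt (G : ℝ → ℝ → ℝ) (ε : ℝ) (h : ℝ × ℝ → ℝ) (x : ℝ) : ℝ :=
  (1 / ε) * ∫ y in (0 : ℝ)..(ε * G x (x / ε)), h (x, y)

/-- `u` is the (weak) solution of `-Δ_p u + |u|^{p-2} u = f` in `Ω` with the homogeneous Neumann
condition `|∇u|^{p-2} ∇u · η = 0` on `∂Ω`. -/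
def IsNeumannSolution (p : ℝ) (Ω : Set (ℝ × ℝ)) (f u : ℝ × ℝ → ℝ) : Prop :=
  ∃ du : ℝ × ℝ → Vec2, MemW p Ω u du ∧
    ∀ (φ : ℝ × ℝ → ℝ) (dφ : ℝ × ℝ → Vec2), MemW p Ω φ dφ →
      ∫ z in Ω, (inner ℝ (pFlux p (du z)) (dφ z) + pPow p (u z) * φ z) = ∫ z in Ω, f z * φ z

/-- Weak convergence `F ε ⇀ F₀` in `L^p(0,1)` as `ε → 0⁺`, where `p'` is the exponent conjugate
to `p`. -/
def WeakTendsto (p p' : ℝ) (F : ℝ → ℝ → ℝ) (F₀ : ℝ → ℝ) : Prop :=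
  (∀ ε > 0, MemLp (F ε) (ENNReal.ofReal p) (volume.restrict (Ioo 0 1))) ∧
    MemLp F₀ (ENNReal.ofReal p) (volume.restrict (Ioo 0 1)) ∧
    ∀ φ : ℝ → ℝ, MemLp φ (ENNReal.ofReal p') (volume.restrict (Ioo 0 1)) →
      Tendsto (fun ε => ∫ x in Ioo (0 : ℝ) 1, F ε x * φ x) (𝓝[>] 0)
        (𝓝 (∫ x in Ioo (0 : ℝ) 1, F₀ x * φ x))

/-- The representative cell `{(y₁, y₂) : 0 < y₁ < L, 0 < y₂ < Γ(y₁)}`; the cell `Y*(x)` is the one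
with `Γ = G(x, ·)`. -/
def cell (L : ℝ) (Γ : ℝ → ℝ) : Set (ℝ × ℝ) :=
  {y | y.1 ∈ Ioo (0 : ℝ) L ∧ 0 < y.2 ∧ y.2 < Γ y.1}

/-- The infinite strip `{(y₁, y₂) : 0 < y₂ < Γ(y₁)}` below the graph of `Γ`. -/
def strip (Γ : ℝ → ℝ) : Set (ℝ × ℝ) :=
  {y | 0 < y.2 ∧ y.2 < Γ y.1}

/-- The extension of a function from the cell, `L`-periodic in the variable `y₁`. -/
def perExt {β : Type*} (L : ℝ) (h : ℝ × ℝ → β) : ℝ × ℝ → β :=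
  fun y => h (L * Int.fract (y.1 / L), y.2)

/-- `φ ∈ W^{1,p}_#` of the cell, with weak gradient `g`: `φ` belongs to `W^{1,p}` of the cell and
its traces on the left and right sides agree, that is, the periodic extension of `φ` has no
jump across the vertical sides: its weak gradient on the strip is the periodic extension of `g`
(`Γ` is `L`-periodic where this is used). -/
def MemWPer (p L : ℝ) (Γ : ℝ → ℝ) (φ : ℝ × ℝ → ℝ) (g : ℝ × ℝ → Vec2) : Prop :=
  MemW p (cell L Γ) φ g ∧ HasWeakGrad (strip Γ) (perExt L φ) (perExt L g)

/-- `v`, with weak gradient `dv`, solves the auxiliary cell problem: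
`v - y₁ ∈ W^{1,p}_#` has zero average, and `∫ |∇v|^{p-2} ∇v · ∇φ = 0` over the cell for every
`φ ∈ W^{1,p}_#` with zero average. -/
def IsCellSolution (p L : ℝ) (Γ : ℝ → ℝ) (v : ℝ × ℝ → ℝ) (dv : ℝ × ℝ → Vec2) : Prop :=
  MemWPer p L Γ (fun y => v y - y.1) (fun y => dv y - !₂[(1 : ℝ), 0]) ∧
    ⨍ y in cell L Γ, (v y - y.1) = 0 ∧
    ∀ (φ : ℝ × ℝ → ℝ) (dφ : ℝ × ℝ → Vec2), MemWPer p L Γ φ dφ →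
      ⨍ y in cell L Γ, φ y = 0 →
        ∫ y in cell L Γ, inner ℝ (pFlux p (dv y)) (dφ y) = 0

/-- The cell problem is well posed: it has a solution, and any two solutions agree, with their
gradients, almost everywhere in the cell. -/
def CellWellPosed (p L : ℝ) (Γ : ℝ → ℝ) : Prop :=
  (∃ v dv, IsCellSolution p L Γ v dv) ∧
    ∀ v₁ dv₁ v₂ dv₂, IsCellSolution p L Γ v₁ dv₁ → IsCellSolution p L Γ v₂ dv₂ →
      v₁ =ᵐ[volume.restrict (cell L Γ)] v₂ ∧ dv₁ =ᵐ[volume.restrict (cell L Γ)] dv₂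

open Classical in
/-- The gradient `∇v` of the solution of the cell problem (zero if there is no solution). -/
def cellGrad (p L : ℝ) (Γ : ℝ → ℝ) : ℝ × ℝ → Vec2 :=
  if h : ∃ dv : ℝ × ℝ → Vec2, ∃ v : ℝ × ℝ → ℝ, IsCellSolution p L Γ v dv then h.choose else 0

/-- The coefficient `q = (1/L) ∫ |∇v|^{p-2} ∂_{y₁} v` over the cell. -/
def qCoeff (p L : ℝ) (Γ : ℝ → ℝ) : ℝ :=
  (1 / L) * ∫ y in cell L Γ, pFlux p (cellGrad p L Γ y) 0

/-- The coefficient `r = |Y*| / L`. -/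
def rCoeff (L : ℝ) (Γ : ℝ → ℝ) : ℝ :=
  (volume (cell L Γ)).toReal / L

/-- `u`, with weak derivative `u'`, satisfies the one-dimensional problem
`-(q |u'|^{p-2} u')' + r |u|^{p-2} u = h` in `(0,1)`, `u'(0) = u'(1) = 0`, in its variational form;
all integrals are required to converge. -/
def SolvesHomogenized (p : ℝ) (q r h u u' : ℝ → ℝ) : Prop :=
  ∀ φ φ' : ℝ → ℝ, MemW01 p φ φ' →
    IntegrableOn (fun x => q x * pPow p (u' x) * φ' x + r x * pPow p (u x) * φ x) (Ioo 0 1) ∧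
    IntegrableOn (fun x => h x * φ x) (Ioo 0 1) ∧
    ∫ x in Ioo (0 : ℝ) 1, (q x * pPow p (u' x) * φ' x + r x * pPow p (u x) * φ x)
      = ∫ x in Ioo (0 : ℝ) 1, h x * φ x

end RoughThin

end

/-!
# Homogenization of the `p`-Laplacian in a thin domain with a rough boundary

Stretching the thin domain vertically by `1/ε` gives domains `0 < y < h_ε(x) = G(x, x/ε)` of height
of order one, in which the vertical derivative carries a factor `1/ε`. The energy bounds then force
the solutions to be asymptotically independent of `y`: along a subsequence their vertical means
converge strongly in `L^p(0,1)` to a function `u₀ ∈ W^{1,p}(0,1)`, while the vertical integrals of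
the horizontal flux converge weakly to some `σ` (`IsThinSequence.exists_isThinLimit`). Testing
with functions of `x` alone gives `∫ σ φ' + r |u₀|^{p-2} u₀ φ = ∫ f̂ φ` (`IsThinLimit.integral_eq`);
here `r` is the weak limit of the heights, computed by averaging (`tendsto_integral_height`).

The point is to identify `σ = q |u₀'|^{p-2} u₀'`. Near a point `x₀` the rough height is squeezed
between the purely periodic heights `(1 ± δ) G(x₀, x/ε)`. For a purely periodic profile the cell
solution `v` provides oscillating trial gradients `s ∇v(x/ε, y)`, and its flux, cut off by the
periodic profile, is orthogonal to all scaled gradients of compactly supported functions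
(`IsCellSolution.integral_osc_eq_zero`, proved by periodizing the test function) and has constant
vertical integrals (`IsCellSolution.fiberInt_osc`, since the flux is divergence free). Young's
inequality between the flux of the solution and the oscillating trial gradient then bounds `σ s`
for every slope `s` (`IsThinLimit.integral_comparison`). The coefficient `q` is monotone in the
profile and nearly homogeneous under vertical stretching (`qCoeff_mono`, `qCoeff_const_mul_le`), so
letting `δ → 0` and varying the rational slope `s` around `u₀'(x)` gives the claim
(`eq_mul_flux_of_forall_rat`, `IsThinLimit.flux_eq`).

The homogenized problem has at most one solution by strict monotonicity
(`SolvesHomogenized.ae_eq`), so every subsequence has the same limit and the whole family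
converges. The cell problem itself is the Euler equation of a strictly convex minimization over the
affine space `e₁ + ∇W^{1,p}_#` in `L^p`, which is closed by Poincaré's inequality
(`cellWellPosed`).
-/

set_option linter.unusedSectionVars false

/-! ### The monotone map `|s|^{p-2} s` -/

namespace RoughThin

section Flux

variable {E : Type*} [NormedAddCommGroup E] [InnerProductSpace ℝ E] {p p' : ℝ}

/-- The map `s ↦ |s|^{p-2} s` on an inner product space. Both `pPow` (for `E = ℝ`) and `pFlux`
(for the plane) are instances of it. -/
noncomputable def flux (p : ℝ) (s : E) : E := ‖s‖ ^ (p - 2) • s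

theorem pPow_eq_flux (p s : ℝ) : pPow p s = flux p s := rfl

theorem pFlux_eq_flux (p : ℝ) (s : Vec2) : pFlux p s = flux p s := rfl

@[simp] theorem flux_zero : flux p (0 : E) = 0 := by simp [flux]

theorem norm_flux (hp : 1 < p) (s : E) : ‖flux p s‖ = ‖s‖ ^ (p - 1) := by
  by_cases hs : s = 0
  · simp [hs, Real.zero_rpow (by linarith : p - 1 ≠ 0)]
  · have h : 0 < ‖s‖ := norm_pos_iff.2 hs
    rw [flux, norm_smul, Real.norm_of_nonneg (by positivity), ← Real.rpow_add_one h.ne']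
    ring_nf

theorem inner_flux_self (hp : 1 < p) (s : E) : inner ℝ (flux p s) s = ‖s‖ ^ p := by
  by_cases hs : s = 0
  · simp [hs, Real.zero_rpow (by linarith : p ≠ 0)]
  · have h : 0 < ‖s‖ := norm_pos_iff.2 hs
    rw [flux, real_inner_smul_left, real_inner_self_eq_norm_sq, ← Real.rpow_natCast,
      ← Real.rpow_add h]
    norm_num

theorem norm_flux_rpow (hp : p.HolderConjugate p') (s : E) : ‖flux p s‖ ^ p' = ‖s‖ ^ p := by
  rw [norm_flux hp.lt, ← Real.rpow_mul (norm_nonneg _), hp.sub_one_mul_conj]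

theorem flux_smul (c : ℝ) (s : E) : flux p (c • s) = flux p c • flux p s := by
  simp only [flux, norm_smul, Real.mul_rpow (norm_nonneg c) (norm_nonneg s), smul_smul,
    smul_eq_mul]
  ring_nf

theorem continuous_flux (hp : 1 < p) : Continuous (flux p : E → E) := by
  rw [continuous_iff_continuousAt]
  intro s
  by_cases hs : s = 0
  · subst hs
    rw [ContinuousAt, flux_zero, tendsto_zero_iff_norm_tendsto_zero]
    simp_rw [norm_flux hp]
    have : Continuous fun s : E => ‖s‖ ^ (p - 1) :=
      continuous_norm.rpow_const fun _ => Or.inr (by linarith)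
    simpa [Real.zero_rpow (by linarith : p - 1 ≠ 0)] using this.tendsto 0
  · exact (continuousAt_id.norm.rpow_const (Or.inl (norm_ne_zero_iff.2 hs))).smul continuousAt_id

/-- Young's inequality for the pairing of `|s|^{p-2} s` with `t`. -/
theorem inner_flux_le (hp : p.HolderConjugate p') (s t : E) :
    inner ℝ (flux p s) t ≤ ‖s‖ ^ p / p' + ‖t‖ ^ p / p := by
  calc inner ℝ (flux p s) t ≤ ‖flux p s‖ * ‖t‖ := real_inner_le_norm _ _
    _ ≤ ‖flux p s‖ ^ p' / p' + ‖t‖ ^ p / p :=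
        Real.young_inequality_of_nonneg (norm_nonneg _) (norm_nonneg _) hp.symm
    _ = _ := by rw [norm_flux_rpow hp]

theorem add_div_conj (hp : p.HolderConjugate p') (a : ℝ) : a / p' + a / p = a := by
  rw [div_eq_mul_inv, div_eq_mul_inv, ← mul_add, add_comm p'⁻¹, hp.inv_add_inv_eq_one, mul_one]

/-- The equality case of Young's inequality `inner_flux_le`. -/
theorem eq_of_inner_flux_eq (hp : p.HolderConjugate p') {s t : E}
    (h : inner ℝ (flux p s) t = ‖s‖ ^ p / p' + ‖t‖ ^ p / p) : s = t := by
  have h1 := real_inner_le_norm (flux p s) t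
  have h2 := Real.young_inequality_of_nonneg (norm_nonneg (flux p s)) (norm_nonneg t) hp.symm
  have h3 := h2
  rw [norm_flux_rpow hp, ← h] at h2
  have h4 : ‖flux p s‖ * ‖t‖ = ‖flux p s‖ ^ p' / p' + ‖t‖ ^ p / p := by
    rw [norm_flux_rpow hp, ← h]; exact le_antisymm h2 h1
  rw [Real.young_inequality_eq_iff_of_nonneg (norm_nonneg _) (norm_nonneg _) hp.symm,
    norm_flux_rpow hp] at h4
  have hst : ‖s‖ = ‖t‖ := by
    have := congrArg (fun x : ℝ => x ^ (p⁻¹)) h4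
    simpa [Real.rpow_rpow_inv (norm_nonneg _) hp.ne_zero] using this
  by_cases hs : s = 0
  · subst hs; rw [norm_zero] at hst; exact (norm_eq_zero.1 hst.symm).symm
  have hs' : 0 < ‖s‖ := norm_pos_iff.2 hs
  rw [← hst, add_div_conj hp, flux, real_inner_smul_left] at h
  have h5 : inner ℝ s t = ‖s‖ ^ 2 := by
    have : ‖s‖ ^ p = ‖s‖ ^ (p - 2) * ‖s‖ ^ 2 := by
      rw [← Real.rpow_natCast, ← Real.rpow_add hs']; norm_num
    rw [this] at h
    exact mul_left_cancel₀ (Real.rpow_pos_of_pos hs' _).ne' h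
  have h6 := norm_sub_sq_real s t
  rw [h5, ← hst] at h6
  have h7 : ‖s - t‖ ^ 2 = 0 := by rw [h6]; ring
  exact sub_eq_zero.1 (norm_eq_zero.1 (pow_eq_zero_iff (two_ne_zero) |>.1 h7))

/-- Convexity of `|s|^p`: its graph lies above its tangents. -/
theorem flux_convex (hp : p.HolderConjugate p') (s t : E) :
    ‖s‖ ^ p + p * inner ℝ (flux p s) (t - s) ≤ ‖t‖ ^ p := by
  have h := inner_flux_le hp s t
  have h1 := inner_flux_self hp.lt s
  rw [inner_sub_right, h1]
  have h2 : p * (‖s‖ ^ p / p' + ‖t‖ ^ p / p) = (p - 1) * ‖s‖ ^ p + ‖t‖ ^ p := by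
    have := hp.div_conj_eq_sub_one
    have h0 := hp.ne_zero
    rw [mul_add, mul_div_cancel₀ _ h0, ← this]; ring
  have h3 := mul_le_mul_of_nonneg_left h hp.nonneg
  rw [h2] at h3
  linarith

theorem flux_mono_expand (hp : 1 < p) (s t : E) :
    inner ℝ (flux p s - flux p t) (s - t) =
      ‖s‖ ^ p + ‖t‖ ^ p - inner ℝ (flux p s) t - inner ℝ (flux p t) s := by
  rw [inner_sub_left, inner_sub_right, inner_sub_right, inner_flux_self hp, inner_flux_self hp]
  ring

theorem flux_mono (hp : p.HolderConjugate p') (s t : E) :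
    0 ≤ inner ℝ (flux p s - flux p t) (s - t) := by
  rw [flux_mono_expand hp.lt]
  have h1 := inner_flux_le hp s t
  have h2 := inner_flux_le hp t s
  have h3 := add_div_conj hp (‖s‖ ^ p)
  have h4 := add_div_conj hp (‖t‖ ^ p)
  linarith

theorem eq_of_flux_mono_eq_zero (hp : p.HolderConjugate p') {s t : E}
    (h : inner ℝ (flux p s - flux p t) (s - t) = 0) : s = t := by
  rw [flux_mono_expand hp.lt] at h
  have h1 := inner_flux_le hp s t
  have h2 := inner_flux_le hp t s
  have h3 := add_div_conj hp (‖s‖ ^ p)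
  have h4 := add_div_conj hp (‖t‖ ^ p)
  exact eq_of_inner_flux_eq hp (by linarith)

theorem abs_inner_flux_le (hp : 1 < p) (s t : E) :
    |inner ℝ (flux p s) t| ≤ ‖s‖ ^ (p - 1) * ‖t‖ := by
  rw [← norm_flux hp]; exact abs_real_inner_le_norm _ _

/-- A compactness principle for functions that are positively homogeneous of the same degree: if
`f ≤ 0` on the zero set of `g ≥ 0`, then `f` is controlled by `g` up to a small multiple of the
`p`-th power of the norms. -/
theorem homogeneous_compactness [FiniteDimensional ℝ E] (hp : 1 < p) {f g : E × E → ℝ}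
    (hf : Continuous f) (hg : Continuous g) (hg0 : ∀ z, 0 ≤ g z) (hfg : ∀ z, g z = 0 → f z ≤ 0)
    (hfh : ∀ c : ℝ, 0 < c → ∀ z, f (c • z) = c ^ p * f z)
    (hgh : ∀ c : ℝ, 0 < c → ∀ z, g (c • z) = c ^ p * g z) {η : ℝ} (hη : 0 < η) :
    ∃ C : ℝ, 0 ≤ C ∧ ∀ z, f z ≤ η * (‖z.1‖ ^ p + ‖z.2‖ ^ p) + C * g z := by
  have : ProperSpace E := FiniteDimensional.proper_real E
  have hK : IsCompact (Metric.sphere (0 : E × E) 1) := isCompact_sphere _ _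
  -- on the unit sphere the increasing open sets `{f < η + n g}` cover everything
  obtain ⟨n, hn⟩ := hK.elim_directed_cover (fun n : ℕ => {z | f z < η + n * g z})
    (fun n => isOpen_lt hf (by fun_prop))
    (by
      intro z _
      rw [mem_iUnion]
      by_cases h0 : g z = 0
      · exact ⟨0, by simpa [h0] using (hfg z h0).trans_lt hη⟩
      · have hpos : 0 < g z := lt_of_le_of_ne (hg0 z) (Ne.symm h0)
        obtain ⟨n, hn⟩ := exists_nat_gt (f z / g z)
        refine ⟨n, ?_⟩
        rw [div_lt_iff₀ hpos] at hn
        simp only [mem_ofPred_eq]; linarith)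
    (by
      intro a b
      refine ⟨max a b, ?_, ?_⟩ <;> intro z hz <;> simp only [mem_ofPred_eq] at hz ⊢ <;>
        refine hz.trans_le ?_ <;> gcongr <;> simp [hg0])
  refine ⟨n, n.cast_nonneg, fun z => ?_⟩
  by_cases hz : z = 0
  · subst hz
    have h1 : f 0 = 0 := by
      have := hfh 2 two_pos 0
      rw [smul_zero] at this
      have h2 : (1 : ℝ) < 2 ^ p := Real.one_lt_rpow one_lt_two (by linarith)
      nlinarith
    have h0 := mul_nonneg (n.cast_nonneg (α := ℝ)) (hg0 0)
    rw [h1]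
    simp only [Prod.fst_zero, norm_zero, Prod.snd_zero, Real.zero_rpow (by linarith : p ≠ 0)]
    linarith
  · have hc : 0 < ‖z‖ := norm_pos_iff.2 hz
    -- the general case follows from the sphere by homogeneity
    set w := ‖z‖⁻¹ • z with hw
    have hzw : z = ‖z‖ • w := by rw [hw, smul_smul, mul_inv_cancel₀ hc.ne', one_smul]
    have hwn : ‖w‖ = 1 := by rw [hw, norm_smul, norm_inv, norm_norm, inv_mul_cancel₀ hc.ne']
    have h1 : f w < η + n * g w := hn (by simpa using hwn)
    have h2 : ‖z‖ ^ p ≤ ‖z.1‖ ^ p + ‖z.2‖ ^ p := by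
      rcases max_choice ‖z.1‖ ‖z.2‖ with h | h <;> rw [Prod.norm_def, h] <;>
        linarith [Real.rpow_nonneg (norm_nonneg z.1) p, Real.rpow_nonneg (norm_nonneg z.2) p]
    have h3 : f z = ‖z‖ ^ p * f w := by conv_lhs => rw [hzw, hfh _ hc]
    have h4 : g z = ‖z‖ ^ p * g w := by conv_lhs => rw [hzw, hgh _ hc]
    have h5 : 0 < ‖z‖ ^ p := Real.rpow_pos_of_pos hc _
    rw [h3, h4]
    nlinarith [mul_le_mul_of_nonneg_left h1.le h5.le, mul_le_mul_of_nonneg_left h2 hη.le]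

/-- The defect in the midpoint convexity of `|s|^p`. -/
noncomputable def midpointDefect (p : ℝ) (s t : E) : ℝ :=
  (‖s‖ ^ p + ‖t‖ ^ p) / 2 - ‖(1 / 2 : ℝ) • (s + t)‖ ^ p

theorem midpointDefect_nonneg (hp : p.HolderConjugate p') (s t : E) :
    0 ≤ midpointDefect p s t := by
  have h1 := flux_convex hp ((1 / 2 : ℝ) • (s + t)) s
  have h2 := flux_convex hp ((1 / 2 : ℝ) • (s + t)) t
  have h3 : t - (1 / 2 : ℝ) • (s + t) = -(s - (1 / 2 : ℝ) • (s + t)) := by module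
  rw [h3, inner_neg_right] at h2
  rw [midpointDefect]; linarith

theorem eq_of_midpointDefect_eq_zero (hp : p.HolderConjugate p') {s t : E}
    (h : midpointDefect p s t = 0) : s = t := by
  set m := (1 / 2 : ℝ) • (s + t) with hm
  have h1 := inner_flux_le hp m s
  have h2 := inner_flux_le hp m t
  have h5 : inner ℝ (flux p m) s + inner ℝ (flux p m) t = 2 * ‖m‖ ^ p := by
    rw [← inner_flux_self hp.lt m, ← inner_add_right]
    conv_rhs => rw [hm, inner_smul_right]
    ring
  have h6 := add_div_conj hp (‖m‖ ^ p)
  rw [midpointDefect, ← hm] at h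
  have h7 : ‖s‖ ^ p / p + ‖t‖ ^ p / p = 2 * (‖m‖ ^ p / p) := by
    rw [← add_div]; have : ‖s‖ ^ p + ‖t‖ ^ p = 2 * ‖m‖ ^ p := by linarith
    rw [this]; ring
  -- both Young inequalities for the midpoint are equalities, since their sum is
  have e1 : m = s := eq_of_inner_flux_eq hp (by linarith)
  have e2 : m = t := eq_of_inner_flux_eq hp (by linarith)
  rw [← e1, ← e2]

variable [FiniteDimensional ℝ E]

/-- A uniform convexity estimate for `|s|^p`. -/
theorem norm_sub_rpow_le_midpointDefect (hp : p.HolderConjugate p') {η : ℝ} (hη : 0 < η) :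
    ∃ C : ℝ, 0 ≤ C ∧ ∀ s t : E,
      ‖s - t‖ ^ p ≤ η * (‖s‖ ^ p + ‖t‖ ^ p) + C * midpointDefect p s t := by
  have hpc : ∀ {X : Type _} [TopologicalSpace X] {f : X → E}, Continuous f →
      Continuous fun x => ‖f x‖ ^ p := fun hf =>
    hf.norm.rpow_const fun _ => Or.inr hp.nonneg
  obtain ⟨C, hC, h⟩ := homogeneous_compactness (E := E) hp.lt
    (f := fun z => ‖z.1 - z.2‖ ^ p) (g := fun z => midpointDefect p z.1 z.2)
    (hpc (by fun_prop))
    ((((hpc continuous_fst).add (hpc continuous_snd)).div_const _).sub (hpc (by fun_prop)))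
    (fun z => midpointDefect_nonneg hp _ _)
    (fun z hz => by
      simp [eq_of_midpointDefect_eq_zero hp hz, Real.zero_rpow hp.ne_zero])
    (fun c hc z => by
      simp only [Prod.smul_fst, Prod.smul_snd, ← smul_sub, norm_smul, Real.norm_of_nonneg hc.le]
      rw [Real.mul_rpow hc.le (norm_nonneg _)])
    (fun c hc z => by
      simp only [midpointDefect, Prod.smul_fst, Prod.smul_snd, ← smul_add, smul_comm _ c, norm_smul c,
        Real.norm_of_nonneg hc.le]
      simp only [Real.mul_rpow hc.le (norm_nonneg _)]
      ring)
    hη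
  exact ⟨C, hC, fun s t => h (s, t)⟩

/-- A quantitative form of the continuity of `s ↦ |s|^{p-2} s` from `L^p` to `L^{p'}`. -/
theorem norm_flux_sub_rpow_le (hp : p.HolderConjugate p') {η : ℝ} (hη : 0 < η) :
    ∃ C : ℝ, 0 ≤ C ∧ ∀ s t : E,
      ‖flux p s - flux p t‖ ^ p' ≤ η * (‖s‖ ^ p + ‖t‖ ^ p) + C * ‖s - t‖ ^ p := by
  have hc := continuous_flux (E := E) hp.lt
  obtain ⟨C, hC, h⟩ := homogeneous_compactness (E := E) hp.lt
    (f := fun z => ‖flux p z.1 - flux p z.2‖ ^ p') (g := fun z => ‖z.1 - z.2‖ ^ p)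
    (((hc.comp continuous_fst).sub (hc.comp continuous_snd)).norm.rpow_const
      fun _ => Or.inr hp.symm.nonneg)
    ((continuous_fst.sub continuous_snd).norm.rpow_const fun _ => Or.inr hp.nonneg)
    (fun z => by positivity)
    (fun z hz => by
      have : z.1 = z.2 := sub_eq_zero.1 (norm_eq_zero.1
        ((Real.rpow_eq_zero (norm_nonneg _) hp.ne_zero).1 hz))
      simp [this, Real.zero_rpow hp.symm.ne_zero])
    (fun c hc z => by
      have h1 : flux p c = c ^ (p - 1) := by
        rw [flux, Real.norm_of_nonneg hc.le, smul_eq_mul, ← Real.rpow_add_one hc.ne']; ring_nf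
      have h2 : 0 < c ^ (p - 1) := Real.rpow_pos_of_pos hc _
      simp only [Prod.smul_fst, Prod.smul_snd, flux_smul, ← smul_sub, norm_smul, h1,
        Real.norm_of_nonneg h2.le]
      rw [Real.mul_rpow h2.le (norm_nonneg _), ← Real.rpow_mul hc.le, hp.sub_one_mul_conj])
    (fun c hc z => by
      simp only [Prod.smul_fst, Prod.smul_snd, ← smul_sub, norm_smul, Real.norm_of_nonneg hc.le]
      rw [Real.mul_rpow hc.le (norm_nonneg _)])
    hη
  exact ⟨C, hC, fun s t => h (s, t)⟩

end Flux

end RoughThin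

/-! ### `L^p` tools -/

namespace RoughThin

section LpTools

variable {α : Type*} [MeasurableSpace α] {μ : Measure α}
  {E : Type*} [NormedAddCommGroup E] {p p' : ℝ}

theorem norm_add_rpow_le (hp : 1 < p) (a b : E) :
    ‖a + b‖ ^ p ≤ 2 ^ (p - 1) * (‖a‖ ^ p + ‖b‖ ^ p) := by
  refine (Real.rpow_le_rpow (norm_nonneg _) (norm_add_le a b) (by linarith)).trans ?_
  have := NNReal.rpow_add_le_mul_rpow_add_rpow ‖a‖₊ ‖b‖₊ hp.le
  exact_mod_cast this

theorem integrable_norm_rpow (hp : 1 < p) {f : α → E} (hf : MemLp f (ENNReal.ofReal p) μ) :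
    Integrable (fun x => ‖f x‖ ^ p) μ := by
  have := hf.integrable_norm_rpow (by simp; linarith) (by simp)
  rwa [ENNReal.toReal_ofReal (by linarith)] at this

theorem memLp_of_integrable_norm_rpow (hp : 1 < p) {f : α → E} (hm : AEStronglyMeasurable f μ)
    (hf : Integrable (fun x => ‖f x‖ ^ p) μ) : MemLp f (ENNReal.ofReal p) μ := by
  rw [← integrable_norm_rpow_iff hm (by simp; linarith) (by simp),
    ENNReal.toReal_ofReal (by linarith)]
  exact hf

theorem integral_norm_rpow_nonneg (f : α → E) : 0 ≤ ∫ x, ‖f x‖ ^ p ∂μ :=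
  integral_nonneg fun _ => by positivity

theorem eLpNorm_eq_ofReal (hp : 1 < p) {f : α → E} (hf : MemLp f (ENNReal.ofReal p) μ) :
    eLpNorm f (ENNReal.ofReal p) μ = ENNReal.ofReal ((∫ x, ‖f x‖ ^ p ∂μ) ^ p⁻¹) := by
  rw [hf.eLpNorm_eq_integral_rpow_norm (by simp; linarith) (by simp),
    ENNReal.toReal_ofReal (by linarith)]

theorem integral_norm_rpow_le_of_eLpNorm_le (hp : 1 < p) {f : α → E}
    (hf : MemLp f (ENNReal.ofReal p) μ) {C : ℝ} (hC : 0 ≤ C)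
    (h : eLpNorm f (ENNReal.ofReal p) μ ≤ ENNReal.ofReal C) : ∫ x, ‖f x‖ ^ p ∂μ ≤ C ^ p := by
  rw [eLpNorm_eq_ofReal hp hf, ENNReal.ofReal_le_ofReal_iff hC] at h
  have h0 := integral_norm_rpow_nonneg (p := p) (μ := μ) f
  have := Real.rpow_le_rpow (Real.rpow_nonneg h0 _) h (by linarith : 0 ≤ p)
  rwa [Real.rpow_inv_rpow h0 (by linarith)] at this

theorem integral_norm_add_rpow_le (hp : 1 < p) {f g : α → E}
    (hf : MemLp f (ENNReal.ofReal p) μ) (hg : MemLp g (ENNReal.ofReal p) μ) :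
    ∫ x, ‖f x + g x‖ ^ p ∂μ ≤
      2 ^ (p - 1) * (∫ x, ‖f x‖ ^ p ∂μ + ∫ x, ‖g x‖ ^ p ∂μ) := by
  rw [← integral_add (integrable_norm_rpow hp hf) (integrable_norm_rpow hp hg),
    ← integral_const_mul]
  exact integral_mono (integrable_norm_rpow hp (hf.add hg))
    (((integrable_norm_rpow hp hf).add (integrable_norm_rpow hp hg)).const_mul _)
    fun x => norm_add_rpow_le hp _ _

theorem integral_norm_sub_rpow_le (hp : 1 < p) {f g : α → E}
    (hf : MemLp f (ENNReal.ofReal p) μ) (hg : MemLp g (ENNReal.ofReal p) μ) :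
    ∫ x, ‖f x - g x‖ ^ p ∂μ ≤
      2 ^ (p - 1) * (∫ x, ‖f x‖ ^ p ∂μ + ∫ x, ‖g x‖ ^ p ∂μ) := by
  simpa [sub_eq_add_neg] using integral_norm_add_rpow_le hp hf hg.neg

theorem integral_norm_rpow_mono (hp : 1 < p) {F : Type*} [NormedAddCommGroup F] {f : α → E}
    {g : α → F} (hg : MemLp g (ENNReal.ofReal p) μ) (h : ∀ᵐ x ∂μ, ‖f x‖ ≤ ‖g x‖) :
    ∫ x, ‖f x‖ ^ p ∂μ ≤ ∫ x, ‖g x‖ ^ p ∂μ := by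
  refine integral_mono_of_nonneg (ae_of_all _ fun _ => by positivity)
    (integrable_norm_rpow hp hg) ?_
  filter_upwards [h] with x hx
  exact Real.rpow_le_rpow (norm_nonneg _) hx (by linarith)

theorem lp_norm_rpow (hp : 1 < p) (f : Lp E (ENNReal.ofReal p) μ) :
    ‖f‖ ^ p = ∫ x, ‖f x‖ ^ p ∂μ := by
  have h0 := integral_norm_rpow_nonneg (p := p) (μ := μ) f
  rw [Lp.norm_def, eLpNorm_eq_ofReal hp (Lp.memLp f), ENNReal.toReal_ofReal
    (Real.rpow_nonneg h0 _), Real.rpow_inv_rpow h0 (by linarith)]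

theorem fact_one_le_ofReal (hp : 1 < p) : Fact (1 ≤ ENNReal.ofReal p) :=
  ⟨by simpa using hp.le⟩

variable [InnerProductSpace ℝ E]

theorem memLp_flux (hp : p.HolderConjugate p') {f : α → E}
    (hf : MemLp f (ENNReal.ofReal p) μ) : MemLp (fun x => flux p (f x)) (ENNReal.ofReal p') μ := by
  refine memLp_of_integrable_norm_rpow hp.symm.lt
    ((continuous_flux hp.lt).comp_aestronglyMeasurable hf.1) ?_
  simp_rw [norm_flux_rpow hp]
  exact integrable_norm_rpow hp.lt hf

theorem integrable_inner_of_memLp (hp : p.HolderConjugate p') {f g : α → E}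
    (hf : MemLp f (ENNReal.ofReal p') μ) (hg : MemLp g (ENNReal.ofReal p) μ) :
    Integrable (fun x => inner ℝ (f x) (g x)) μ := by
  have : ENNReal.HolderConjugate (ENNReal.ofReal p') (ENNReal.ofReal p) := hp.symm.ennrealOfReal
  exact memLp_one_iff_integrable.1 ((innerSL ℝ (E := E)).memLp_of_bilin 1 hf hg)

theorem integrable_mul_of_memLp (hp : p.HolderConjugate p') {f g : α → ℝ}
    (hf : MemLp f (ENNReal.ofReal p') μ) (hg : MemLp g (ENNReal.ofReal p) μ) :
    Integrable (fun x => f x * g x) μ := by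
  have : ENNReal.HolderConjugate (ENNReal.ofReal p') (ENNReal.ofReal p) := hp.symm.ennrealOfReal
  exact hf.integrable_mul hg

/-- Hölder's inequality for the pairing of two vector fields. -/
theorem abs_integral_inner_le (hp : p.HolderConjugate p') {f g : α → E}
    (hf : MemLp f (ENNReal.ofReal p') μ) (hg : MemLp g (ENNReal.ofReal p) μ) :
    |∫ x, inner ℝ (f x) (g x) ∂μ| ≤
      (∫ x, ‖f x‖ ^ p' ∂μ) ^ p'⁻¹ * (∫ x, ‖g x‖ ^ p ∂μ) ^ p⁻¹ := by
  have h := integral_mul_norm_le_Lp_mul_Lq hp.symm hf hg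
  rw [one_div, one_div] at h
  refine (abs_integral_le_integral_abs).trans (le_trans ?_ h)
  have : ENNReal.HolderConjugate (ENNReal.ofReal p') (ENNReal.ofReal p) := hp.symm.ennrealOfReal
  exact integral_mono (integrable_inner_of_memLp hp hf hg).abs (hf.norm.integrable_mul hg.norm)
    fun x => abs_real_inner_le_norm _ _

theorem abs_integral_mul_le (hp : p.HolderConjugate p') {f g : α → ℝ}
    (hf : MemLp f (ENNReal.ofReal p') μ) (hg : MemLp g (ENNReal.ofReal p) μ) :
    |∫ x, f x * g x ∂μ| ≤
      (∫ x, ‖f x‖ ^ p' ∂μ) ^ p'⁻¹ * (∫ x, ‖g x‖ ^ p ∂μ) ^ p⁻¹ := by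
  have := abs_integral_inner_le hp hf hg
  simpa [mul_comm] using this

/-- If `f n` is bounded in `L^{p'}` and `g n → 0` in `L^p`, possibly over varying measures, then
the pairings tend to zero. -/
theorem tendsto_integral_mul_zero {ι : Type*} {l : Filter ι} (hp : p.HolderConjugate p')
    {ν : ι → Measure α} {f g : ι → α → ℝ}
    (hf : ∀ n, MemLp (f n) (ENNReal.ofReal p') (ν n))
    (hg : ∀ n, MemLp (g n) (ENNReal.ofReal p) (ν n))
    {C : ℝ} (hC : ∀ n, ∫ x, ‖f n x‖ ^ p' ∂ν n ≤ C)
    (h : Tendsto (fun n => ∫ x, ‖g n x‖ ^ p ∂ν n) l (𝓝 0)) :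
    Tendsto (fun n => ∫ x, f n x * g n x ∂ν n) l (𝓝 0) := by
  have h1 : Tendsto (fun n => C ^ p'⁻¹ * (∫ x, ‖g n x‖ ^ p ∂ν n) ^ p⁻¹) l (𝓝 0) := by
    have := (h.rpow_const (p := p⁻¹) (Or.inr (inv_nonneg.2 hp.nonneg))).const_mul (C ^ p'⁻¹)
    rwa [Real.zero_rpow (inv_ne_zero hp.ne_zero), mul_zero] at this
  refine squeeze_zero_norm (fun n => ?_) h1
  refine (abs_integral_mul_le hp (hf n) (hg n)).trans ?_
  exact mul_le_mul_of_nonneg_right (Real.rpow_le_rpow (integral_norm_rpow_nonneg _) (hC n)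
    (inv_nonneg.2 hp.symm.nonneg)) (Real.rpow_nonneg (integral_norm_rpow_nonneg _) _)

theorem integrable_midpointDefect (hp : 1 < p) {f g : α → E}
    (hf : MemLp f (ENNReal.ofReal p) μ) (hg : MemLp g (ENNReal.ofReal p) μ) :
    Integrable (fun x => midpointDefect p (f x) (g x)) μ :=
  (((integrable_norm_rpow hp hf).add (integrable_norm_rpow hp hg)).div_const _).sub
    (integrable_norm_rpow hp ((hf.add hg).const_smul (1 / 2 : ℝ)))

/-- Every closed affine subspace of `L^p`, `1 < p < ∞`, has an element of minimal norm: a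
minimizing sequence is Cauchy, by the uniform convexity of `|s|^p`. -/
theorem exists_norm_minimizer [FiniteDimensional ℝ E] (hp : p.HolderConjugate p')
    [Fact (1 ≤ ENNReal.ofReal p)] (V : Submodule ℝ (Lp E (ENNReal.ofReal p) μ))
    (hV : IsClosed (V : Set (Lp E (ENNReal.ofReal p) μ))) (a : Lp E (ENNReal.ofReal p) μ) :
    ∃ g ∈ V, ∀ h ∈ V, ‖a + g‖ ≤ ‖a + h‖ := by
  set d := sInf ((fun h => ‖a + h‖ ^ p) '' (V : Set (Lp E (ENNReal.ofReal p) μ))) with hd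
  have hbdd : BddBelow ((fun h => ‖a + h‖ ^ p) '' (V : Set (Lp E (ENNReal.ofReal p) μ))) :=
    ⟨0, by rintro _ ⟨h, -, rfl⟩; exact Real.rpow_nonneg (norm_nonneg _) _⟩
  have hdle : ∀ h ∈ V, d ≤ ‖a + h‖ ^ p := fun h hh => csInf_le hbdd ⟨h, hh, rfl⟩
  have hd0 : 0 ≤ d := le_csInf ⟨_, ⟨0, V.zero_mem, rfl⟩⟩ (by
    rintro _ ⟨h, -, rfl⟩; exact Real.rpow_nonneg (norm_nonneg _) _)
  have hex : ∀ n : ℕ, ∃ h ∈ V, ‖a + h‖ ^ p < d + 1 / (n + 1) := by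
    intro n
    obtain ⟨_, ⟨h, hh, rfl⟩, hlt⟩ := exists_lt_of_csInf_lt (Set.Nonempty.image _ ⟨0, V.zero_mem⟩)
      (show d < d + 1 / (n + 1) by have : (0 : ℝ) < 1 / (n + 1) := by positivity
                                   linarith)
    exact ⟨h, hh, hlt⟩
  choose h hhV hh using hex
  -- the midpoint of two almost minimizers lies in `V`, so their midpoint defect is small
  have key : ∀ η > 0, ∃ C, 0 ≤ C ∧ ∀ m n, ‖h m - h n‖ ^ p ≤
      η * ((d + 1 / (m + 1)) + (d + 1 / (n + 1))) + C * ((1 / (m + 1) + 1 / (n + 1)) / 2) := by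
    intro η hη
    obtain ⟨C, hC, hle⟩ := norm_sub_rpow_le_midpointDefect (E := E) hp hη
    refine ⟨C, hC, fun m n => ?_⟩
    have i1 := integrable_norm_rpow hp.lt (Lp.memLp (a + h m))
    have i2 := integrable_norm_rpow hp.lt (Lp.memLp (a + h n))
    have i4 : Integrable (fun x => ‖(a + h m : Lp E (ENNReal.ofReal p) μ) x‖ ^ p +
        ‖(a + h n : Lp E (ENNReal.ofReal p) μ) x‖ ^ p) μ := i1.add i2
    have i3 := integrable_midpointDefect hp.lt (Lp.memLp (a + h m)) (Lp.memLp (a + h n))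
    have e1 : h m - h n = (a + h m) - (a + h n) := by abel
    have e2 : ∫ x, midpointDefect p ((a + h m : Lp E (ENNReal.ofReal p) μ) x)
        ((a + h n : Lp E (ENNReal.ofReal p) μ) x) ∂μ
        = (‖a + h m‖ ^ p + ‖a + h n‖ ^ p) / 2
          - ‖a + (1 / 2 : ℝ) • (h m + h n)‖ ^ p := by
      have e3 : a + (1 / 2 : ℝ) • (h m + h n) = (1 / 2 : ℝ) • ((a + h m) + (a + h n)) := by
        module
      rw [lp_norm_rpow hp.lt, lp_norm_rpow hp.lt, e3, lp_norm_rpow hp.lt, ← integral_add i1 i2,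
        ← integral_div, ← integral_sub]
      · refine integral_congr_ae ?_
        filter_upwards [Lp.coeFn_smul (1 / 2 : ℝ) ((a + h m) + (a + h n)),
          Lp.coeFn_add (a + h m) (a + h n)] with x hx1 hx2
        rw [hx1, Pi.smul_apply, hx2]; rfl
      · exact i4.div_const _
      · exact integrable_norm_rpow hp.lt (Lp.memLp _)
    have h4 := hdle _ (V.smul_mem (1 / 2 : ℝ) (V.add_mem (hhV m) (hhV n)))
    have h5 : ‖h m - h n‖ ^ p ≤ η * (‖a + h m‖ ^ p + ‖a + h n‖ ^ p) +
        C * ((‖a + h m‖ ^ p + ‖a + h n‖ ^ p) / 2 - ‖a + (1 / 2 : ℝ) • (h m + h n)‖ ^ p) := by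
      rw [← e2, e1, lp_norm_rpow hp.lt, lp_norm_rpow hp.lt (a + h m),
        lp_norm_rpow hp.lt (a + h n), ← integral_add i1 i2, ← integral_const_mul,
        ← integral_const_mul, ← integral_add (i4.const_mul _) (i3.const_mul _)]
      refine integral_mono_ae (integrable_norm_rpow hp.lt (Lp.memLp _))
        ((i4.const_mul _).add (i3.const_mul _)) ?_
      filter_upwards [Lp.coeFn_sub (a + h m) (a + h n)] with x hx
      rw [hx]; exact hle _ _
    refine h5.trans ?_
    have hm := hh m
    have hn := hh n
    refine add_le_add (mul_le_mul_of_nonneg_left (by linarith) hη.le)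
      (mul_le_mul_of_nonneg_left ?_ hC)
    linarith
  have hcau : CauchySeq h := by
    rw [Metric.cauchySeq_iff]
    intro e he
    have hep : 0 < e ^ p := Real.rpow_pos_of_pos he _
    obtain ⟨C, hC, hk⟩ := key (e ^ p / (4 * (d + 1))) (by positivity)
    obtain ⟨N, hN⟩ := exists_nat_gt (4 * C / e ^ p)
    rw [div_lt_iff₀ hep] at hN
    refine ⟨N, fun m hm n hn => ?_⟩
    rw [dist_eq_norm]
    have hb : ∀ k ≥ N, (1 : ℝ) / (k + 1) ≤ 1 / (N + 1) := fun k hk => by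
      have : (N : ℝ) ≤ k := by exact_mod_cast hk
      gcongr
    have hb1 : (1 : ℝ) / (N + 1) ≤ 1 := by
      rw [div_le_one (by positivity)]; linarith [N.cast_nonneg (α := ℝ)]
    have h1 := hk m n
    have h2 : e ^ p / (4 * (d + 1)) * ((d + 1 / (m + 1)) + (d + 1 / (n + 1))) ≤ e ^ p / 2 := by
      have : (d + 1 / ((m : ℝ) + 1)) + (d + 1 / (n + 1)) ≤ 2 * (d + 1) := by
        linarith [hb m hm, hb n hn]
      calc _ ≤ e ^ p / (4 * (d + 1)) * (2 * (d + 1)) := by gcongr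
        _ = e ^ p / 2 := by field_simp; norm_num
    have h3 : C * ((1 / ((m : ℝ) + 1) + 1 / (n + 1)) / 2) < e ^ p / 2 := by
      calc _ ≤ C * (1 / (N + 1)) := by
            refine mul_le_mul_of_nonneg_left ?_ hC
            linarith [hb m hm, hb n hn]
        _ < e ^ p / 2 := by
            rw [mul_one_div, div_lt_iff₀ (by positivity)]
            nlinarith
    have h4 : ‖h m - h n‖ ^ p < e ^ p := by linarith
    exact (Real.rpow_lt_rpow_iff (norm_nonneg _) he.le hp.pos).1 h4
  obtain ⟨g, hg⟩ := cauchySeq_tendsto_of_complete hcau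
  refine ⟨g, hV.mem_of_tendsto hg (Eventually.of_forall hhV), fun k hk => ?_⟩
  have hlim : Tendsto (fun n => ‖a + h n‖ ^ p) atTop (𝓝 (‖a + g‖ ^ p)) :=
    ((hg.const_add a).norm).rpow_const (Or.inr hp.nonneg)
  have hlim2 : Tendsto (fun n : ℕ => d + 1 / ((n : ℝ) + 1)) atTop (𝓝 (d + 0)) :=
    tendsto_const_nhds.add tendsto_one_div_add_atTop_nhds_zero_nat
  have : ‖a + g‖ ^ p ≤ d := by
    simpa using le_of_tendsto_of_tendsto' hlim hlim2 fun n => (hh n).le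
  exact (Real.rpow_le_rpow_iff (norm_nonneg _) (norm_nonneg _) hp.pos).1 (this.trans (hdle k hk))

/-- The Euler–Lagrange equation of an `L^p` function of minimal norm along a line. -/
theorem integral_inner_flux_eq_zero (hp : p.HolderConjugate p') {A b : α → E}
    (hA : MemLp A (ENNReal.ofReal p) μ) (hb : MemLp b (ENNReal.ofReal p) μ)
    (hmin : ∀ t : ℝ, ∫ x, ‖A x‖ ^ p ∂μ ≤ ∫ x, ‖A x + t • b x‖ ^ p ∂μ) :
    ∫ x, inner ℝ (flux p (A x)) (b x) ∂μ = 0 := by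
  have key : ∀ {c : α → E}, MemLp c (ENNReal.ofReal p) μ →
      (∀ t : ℝ, ∫ x, ‖A x‖ ^ p ∂μ ≤ ∫ x, ‖A x + t • c x‖ ^ p ∂μ) →
      0 ≤ ∫ x, inner ℝ (flux p (A x)) (c x) ∂μ := by
    intro c hc hminc
    have hmem : ∀ t : ℝ, MemLp (fun x => A x + t • c x) (ENNReal.ofReal p) μ := fun t =>
      hA.add (hc.const_smul t)
    -- the tangent inequality at `A + t c` avoids differentiating under the integral: only `t → 0`
    -- in the flux is needed, by dominated convergence
    have hpos : ∀ t : ℝ, 0 < t → 0 ≤ ∫ x, inner ℝ (flux p (A x + t • c x)) (c x) ∂μ := by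
      intro t ht
      have hint := integrable_inner_of_memLp hp (memLp_flux hp (hmem t)) hc
      have h1 : ∫ x, ‖A x + t • c x‖ ^ p ∂μ - ∫ x, ‖A x‖ ^ p ∂μ ≤
          p * t * ∫ x, inner ℝ (flux p (A x + t • c x)) (c x) ∂μ := by
        rw [← integral_const_mul, ← integral_sub (integrable_norm_rpow hp.lt (hmem t))
          (integrable_norm_rpow hp.lt hA)]
        refine integral_mono ((integrable_norm_rpow hp.lt (hmem t)).sub
          (integrable_norm_rpow hp.lt hA)) (hint.const_mul _) fun x => ?_
        have := flux_convex hp (A x + t • c x) (A x)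
        rw [show A x - (A x + t • c x) = (-t) • c x by module, inner_smul_right] at this
        simp only
        linarith
      have h2 := hminc t
      have h3 : 0 < p * t := mul_pos hp.pos ht
      by_contra hneg
      push Not at hneg
      nlinarith
    have hlim : Tendsto (fun t : ℝ => ∫ x, inner ℝ (flux p (A x + t • c x)) (c x) ∂μ) (𝓝[>] 0)
        (𝓝 (∫ x, inner ℝ (flux p (A x)) (c x) ∂μ)) := by
      have hAc : MemLp (fun x => ‖A x‖ + ‖c x‖) (ENNReal.ofReal p) μ := hA.norm.add hc.norm
      refine tendsto_integral_filter_of_dominated_convergence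
        (fun x => (‖A x‖ + ‖c x‖) ^ (p - 1) * ‖c x‖) ?_ ?_ ?_ ?_
      · exact Eventually.of_forall fun t =>
          (integrable_inner_of_memLp hp (memLp_flux hp (hmem t)) hc).1
      · have : ∀ᶠ t : ℝ in 𝓝[>] 0, t ∈ Ioo (0 : ℝ) 1 := Ioo_mem_nhdsGT one_pos
        filter_upwards [this] with t ht
        refine ae_of_all _ fun x => (abs_inner_flux_le hp.lt _ _).trans ?_
        gcongr
        · linarith [hp.lt]
        · refine (norm_add_le _ _).trans ?_
          rw [norm_smul, Real.norm_of_nonneg ht.1.le]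
          nlinarith [norm_nonneg (c x), ht.2]
      · have := integrable_inner_of_memLp hp (memLp_flux hp hAc) hc.norm
        refine this.congr (ae_of_all _ fun x => ?_)
        have hnn : 0 ≤ ‖A x‖ + ‖c x‖ := by positivity
        have h0 : flux p (‖A x‖ + ‖c x‖) = (‖A x‖ + ‖c x‖) ^ (p - 1) := by
          have h1 := norm_flux hp.lt (‖A x‖ + ‖c x‖)
          rw [Real.norm_of_nonneg hnn] at h1
          rw [← h1, Real.norm_of_nonneg]
          exact smul_nonneg (Real.rpow_nonneg (norm_nonneg _) _) hnn
        simp [h0, mul_comm]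
      · refine ae_of_all _ fun x => ?_
        have hc' : Continuous fun t : ℝ => inner ℝ (flux p (A x + t • c x)) (c x) :=
          ((continuous_flux hp.lt).comp (by fun_prop)).inner continuous_const
        have := hc'.tendsto 0
        simp only [zero_smul, add_zero] at this
        exact this.mono_left nhdsWithin_le_nhds
    refine ge_of_tendsto hlim ?_
    filter_upwards [self_mem_nhdsWithin] with t ht using hpos t ht
  refine le_antisymm ?_ (key hb hmin)
  have h := key hb.neg (fun t => by
    have := hmin (-t)
    simpa using this)
  simp only [Pi.neg_apply, inner_neg_right, integral_neg] at h
  linarith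

/-- Riesz representation: bounded functionals on `L^p` are given by `L^{p'}` functions. The
representative is a multiple of `|A|^{p-2} A` for `A` of minimal norm with prescribed value. -/
theorem exists_riesz (hp : p.HolderConjugate p') [Fact (1 ≤ ENNReal.ofReal p)]
    (ℓ : Lp ℝ (ENNReal.ofReal p) μ →L[ℝ] ℝ) :
    ∃ f : α → ℝ, MemLp f (ENNReal.ofReal p') μ ∧
      ∀ φ : Lp ℝ (ENNReal.ofReal p) μ, ℓ φ = ∫ x, f x * φ x ∂μ := by
  by_cases hℓ : ℓ = 0
  · exact ⟨0, MemLp.zero, fun φ => by simp [hℓ]⟩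
  obtain ⟨a₁, ha₁⟩ : ∃ a, ℓ a ≠ 0 := by
    by_contra h; push Not at h; exact hℓ (ContinuousLinearMap.ext h)
  -- `A` minimizes the norm on the hyperplane `ℓ = 1`
  set a := (ℓ a₁)⁻¹ • a₁ with ha
  have hla : ℓ a = 1 := by simp [ha, ha₁]
  obtain ⟨g, hg, hmin⟩ := exists_norm_minimizer hp (LinearMap.ker (ℓ : _ →ₗ[ℝ] ℝ))
    ℓ.isClosed_ker a
  set A := a + g with hA
  have hlA : ℓ A = 1 := by
    rw [hA, map_add, hla, show ℓ g = 0 from hg, add_zero]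
  have hEL : ∀ b : Lp ℝ (ENNReal.ofReal p) μ, ℓ b = 0 → ∫ x, flux p (A x) * b x ∂μ = 0 := by
    intro b hb
    have := integral_inner_flux_eq_zero hp (Lp.memLp A) (Lp.memLp b) (fun t => by
      have h1 := hmin (g + t • b) (Submodule.add_mem _ hg
        (Submodule.smul_mem _ t (show b ∈ LinearMap.ker (ℓ : _ →ₗ[ℝ] ℝ) from hb)))
      rw [← add_assoc, ← hA] at h1
      have h2 := Real.rpow_le_rpow (norm_nonneg _) h1 hp.nonneg
      rw [lp_norm_rpow hp.lt, lp_norm_rpow hp.lt] at h2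
      refine h2.trans_eq (integral_congr_ae ?_)
      filter_upwards [Lp.coeFn_add A (t • b), Lp.coeFn_smul t b] with x hx1 hx2
      rw [hx1, Pi.add_apply, hx2, Pi.smul_apply])
    rw [← this]
    exact integral_congr_ae (ae_of_all _ fun x => by simp [mul_comm])
  set c := ∫ x, flux p (A x) * A x ∂μ with hc
  have hc' : c = ‖A‖ ^ p := by
    rw [hc, lp_norm_rpow hp.lt]
    exact integral_congr_ae (ae_of_all _ fun x => by
      have := inner_flux_self hp.lt (A x)
      simp only [← this]; simp [mul_comm])
  have hc0 : c ≠ 0 := by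
    rw [hc']
    have : A ≠ 0 := by rintro h; rw [h, map_zero] at hlA; exact zero_ne_one hlA
    exact (Real.rpow_pos_of_pos (norm_pos_iff.2 this) _).ne'
  have hfm := memLp_flux hp (Lp.memLp A)
  refine ⟨fun x => c⁻¹ * flux p (A x), hfm.const_mul _, fun φ => ?_⟩
  -- decompose `φ` along `A` and the kernel of `ℓ`
  have h1 := hEL (φ - ℓ φ • A) (by simp [hlA])
  have h2 : ∫ x, flux p (A x) * (φ - ℓ φ • A : Lp ℝ (ENNReal.ofReal p) μ) x ∂μ
      = ∫ x, flux p (A x) * φ x ∂μ - ℓ φ * c := by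
    rw [hc, ← integral_const_mul, ← integral_sub (integrable_mul_of_memLp hp hfm (Lp.memLp φ))
      ((integrable_mul_of_memLp hp hfm (Lp.memLp A)).const_mul _)]
    refine integral_congr_ae ?_
    filter_upwards [Lp.coeFn_sub φ (ℓ φ • A), Lp.coeFn_smul (ℓ φ) A] with x hx1 hx2
    rw [hx1, Pi.sub_apply, hx2, Pi.smul_apply, smul_eq_mul]; ring
  rw [h2] at h1
  simp_rw [mul_assoc]
  rw [integral_const_mul, sub_eq_zero.1 h1]
  field_simp

/-- The functional on `L^p` given by an `L^{p'}` function. -/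
theorem exists_pairing (hp : p.HolderConjugate p') [Fact (1 ≤ ENNReal.ofReal p)] {f : α → ℝ}
    (hf : MemLp f (ENNReal.ofReal p') μ) :
    ∃ ℓ : Lp ℝ (ENNReal.ofReal p) μ →L[ℝ] ℝ, (∀ φ, ℓ φ = ∫ x, f x * φ x ∂μ) ∧
      ‖ℓ‖ ≤ (∫ x, ‖f x‖ ^ p' ∂μ) ^ p'⁻¹ := by
  let ℓ₀ : Lp ℝ (ENNReal.ofReal p) μ →ₗ[ℝ] ℝ :=
    { toFun := fun φ => ∫ x, f x * φ x ∂μ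
      map_add' := fun φ ψ => by
        rw [← integral_add (integrable_mul_of_memLp hp hf (Lp.memLp φ))
          (integrable_mul_of_memLp hp hf (Lp.memLp ψ))]
        refine integral_congr_ae ?_
        filter_upwards [Lp.coeFn_add φ ψ] with x hx
        rw [hx, Pi.add_apply, mul_add]
      map_smul' := fun c φ => by
        rw [RingHom.id_apply, smul_eq_mul, ← integral_const_mul]
        refine integral_congr_ae ?_
        filter_upwards [Lp.coeFn_smul c φ] with x hx
        rw [hx, Pi.smul_apply, smul_eq_mul]; ring }
  have hb : ∀ φ, ‖ℓ₀ φ‖ ≤ (∫ x, ‖f x‖ ^ p' ∂μ) ^ p'⁻¹ * ‖φ‖ := fun φ => by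
    refine (abs_integral_mul_le hp hf (Lp.memLp φ)).trans_eq ?_
    rw [← lp_norm_rpow hp.lt, Real.rpow_rpow_inv (norm_nonneg _) hp.ne_zero]
  exact ⟨ℓ₀.mkContinuous _ hb, fun φ => rfl, LinearMap.mkContinuous_norm_le _
    (Real.rpow_nonneg (integral_norm_rpow_nonneg _) _) hb⟩

/-- Bounded sequences in `L^{p'}` have weakly convergent subsequences. -/
theorem exists_weak_subseq [MeasurableSpace.CountablyGenerated α] [SFinite μ]
    (hp : p.HolderConjugate p') {f : ℕ → α → ℝ}
    (hf : ∀ n, MemLp (f n) (ENNReal.ofReal p') μ) {C : ℝ}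
    (hC : ∀ n, ∫ x, ‖f n x‖ ^ p' ∂μ ≤ C) :
    ∃ (g : α → ℝ) (k : ℕ → ℕ), StrictMono k ∧ MemLp g (ENNReal.ofReal p') μ ∧
      ∀ φ, MemLp φ (ENNReal.ofReal p) μ →
        Tendsto (fun n => ∫ x, f (k n) x * φ x ∂μ) atTop (𝓝 (∫ x, g x * φ x ∂μ)) := by
  have : Fact (1 ≤ ENNReal.ofReal p) := fact_one_le_ofReal hp.lt
  have : Fact (ENNReal.ofReal p ≠ ⊤) := ⟨by simp⟩
  choose ℓ hℓ hℓn using fun n => exists_pairing hp (hf n)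
  have hball : ∀ n, (StrongDual.toWeakDual (ℓ n)) ∈
      WeakDual.toStrongDual ⁻¹' Metric.closedBall (0 : StrongDual ℝ (Lp ℝ (ENNReal.ofReal p) μ))
        (C ^ p'⁻¹) := by
    intro n
    simp only [mem_preimage, mem_closedBall_zero_iff]
    refine (hℓn n).trans ?_
    exact Real.rpow_le_rpow (integral_norm_rpow_nonneg _) (hC n) (inv_nonneg.2 hp.symm.nonneg)
  obtain ⟨ℓ', -, k, hk, hlim⟩ := WeakDual.isSeqCompact_closedBall ℝ
    (Lp ℝ (ENNReal.ofReal p) μ) 0 (C ^ p'⁻¹) hball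
  obtain ⟨g, hg, hgℓ⟩ := exists_riesz hp (WeakDual.toStrongDual ℓ')
  refine ⟨g, k, hk, hg, fun φ hφ => ?_⟩
  have h1 := ((WeakDual.eval_continuous (hφ.toLp φ)).tendsto ℓ').comp hlim
  have e : ∀ F : α → ℝ, ∫ x, F x * (hφ.toLp φ) x ∂μ = ∫ x, F x * φ x ∂μ := fun F => by
    refine integral_congr_ae ?_
    filter_upwards [hφ.coeFn_toLp] with x hx
    rw [hx]
  have h2 : ℓ' (hφ.toLp φ) = ∫ x, g x * φ x ∂μ := (hgℓ (hφ.toLp φ)).trans (e g)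
  rw [h2] at h1
  refine h1.congr fun n => ?_
  exact (hℓ (k n) (hφ.toLp φ)).trans (e _)

/-- Banach–Steinhaus: a weakly convergent sequence in `L^{p'}` is bounded as a sequence of
functionals on `L^p`. -/
theorem exists_bound_of_weak_tendsto (hp : p.HolderConjugate p') {f : ℕ → α → ℝ}
    (hf : ∀ n, MemLp (f n) (ENNReal.ofReal p') μ) {g : α → ℝ}
    (h : ∀ φ, MemLp φ (ENNReal.ofReal p) μ →
      Tendsto (fun n => ∫ x, f n x * φ x ∂μ) atTop (𝓝 (∫ x, g x * φ x ∂μ))) :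
    ∃ C : ℝ, 0 ≤ C ∧ ∀ n φ, MemLp φ (ENNReal.ofReal p) μ →
      |∫ x, f n x * φ x ∂μ| ≤ C * (∫ x, ‖φ x‖ ^ p ∂μ) ^ p⁻¹ := by
  have : Fact (1 ≤ ENNReal.ofReal p) := fact_one_le_ofReal hp.lt
  choose ℓ hℓ _ using fun n => exists_pairing hp (hf n)
  have e : ∀ n φ (hφ : MemLp φ (ENNReal.ofReal p) μ), ℓ n (hφ.toLp φ) = ∫ x, f n x * φ x ∂μ :=
    fun n φ hφ => by
      rw [hℓ]
      refine integral_congr_ae ?_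
      filter_upwards [hφ.coeFn_toLp] with x hx
      rw [hx]
  obtain ⟨C, hC⟩ := banach_steinhaus (g := ℓ) fun φ => by
    obtain ⟨C, hC⟩ := (h φ (Lp.memLp φ)).norm.bddAbove_range
    refine ⟨C, fun n => ?_⟩
    rw [hℓ]
    exact hC ⟨n, rfl⟩
  refine ⟨C, (norm_nonneg _).trans (hC 0), fun n φ hφ => ?_⟩
  rw [← e n φ hφ]
  refine ((ℓ n).le_opNorm _).trans ?_
  have h1 : ‖hφ.toLp φ‖ = (∫ x, ‖φ x‖ ^ p ∂μ) ^ p⁻¹ := by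
    rw [Lp.norm_toLp, eLpNorm_eq_ofReal hp.lt hφ, ENNReal.toReal_ofReal
      (Real.rpow_nonneg (integral_norm_rpow_nonneg _) _)]
  rw [h1]
  exact mul_le_mul_of_nonneg_right (hC n) (Real.rpow_nonneg (integral_norm_rpow_nonneg _) _)

end LpTools

end RoughThin

/-! ### Test functions and weak derivatives -/

namespace RoughThin

section TestFunctions

variable {E : Type*} [NormedAddCommGroup E] [NormedSpace ℝ E]

/-- `φ` is a test function on `Ω`: smooth, with compact support contained in `Ω`. -/
structure IsTest (Ω : Set E) (φ : E → ℝ) : Prop where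
  smooth : ContDiff ℝ ∞ φ
  compact : HasCompactSupport φ
  subset : tsupport φ ⊆ Ω

/-- `u` is integrable on every compact subset of `Ω`. -/
def LocInt [MeasureSpace E] (Ω : Set E) (u : E → ℝ) : Prop :=
  ∀ K ⊆ Ω, IsCompact K → IntegrableOn u K

theorem IsTest.mono {Ω Ω' : Set E} {φ : E → ℝ} (h : IsTest Ω φ) (hs : Ω ⊆ Ω') : IsTest Ω' φ :=
  ⟨h.smooth, h.compact, h.subset.trans hs⟩

theorem IsTest.continuous {Ω : Set E} {φ : E → ℝ} (h : IsTest Ω φ) : Continuous φ :=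
  h.smooth.continuous

theorem IsTest.continuous_fderiv {Ω : Set E} {φ : E → ℝ} (h : IsTest Ω φ) (w : E) :
    Continuous fun z => fderiv ℝ φ z w :=
  (h.smooth.continuous_fderiv (by simp)).clm_apply continuous_const

theorem IsTest.eq_zero {Ω : Set E} {φ : E → ℝ} (h : IsTest Ω φ) {z : E} (hz : z ∉ Ω) :
    φ z = 0 := image_eq_zero_of_notMem_tsupport fun hh => hz (h.subset hh)

theorem fderiv_eq_zero_of_notMem_tsupport {φ : E → ℝ} {z : E} (hz : z ∉ tsupport φ) :
    fderiv ℝ φ z = 0 :=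
  image_eq_zero_of_notMem_tsupport fun h => hz (tsupport_fderiv_subset ℝ h)

theorem IsTest.fderiv_eq_zero {Ω : Set E} {φ : E → ℝ} (h : IsTest Ω φ) {z : E} (hz : z ∉ Ω) :
    fderiv ℝ φ z = 0 := fderiv_eq_zero_of_notMem_tsupport fun hh => hz (h.subset hh)

/-- The product of a test function with a smooth function. -/
theorem IsTest.mul_smooth {Ω Ω₁ : Set E} {φ θ : E → ℝ} (h : IsTest Ω φ) (hθ : ContDiff ℝ ∞ θ)
    (hs : tsupport θ ∩ Ω ⊆ Ω₁) : IsTest Ω₁ (fun z => θ z * φ z) :=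
  ⟨hθ.mul h.smooth, h.compact.mul_left,
    fun _ hz => hs ⟨tsupport_mul_subset_left hz, h.subset (tsupport_mul_subset_right hz)⟩⟩

variable [MeasureSpace E]

/-- Weak derivatives can be tested over the whole space, as test functions vanish off `Ω`. -/
theorem hasWeakDeriv_iff {Ω : Set E} {u g : E → ℝ} {w : E} :
    HasWeakDeriv Ω u w g ↔
      ∀ φ, IsTest Ω φ → ∫ z, u z * fderiv ℝ φ z w = - ∫ z, g z * φ z := by
  have key : ∀ φ, IsTest Ω φ → (∫ z in Ω, u z * fderiv ℝ φ z w = ∫ z, u z * fderiv ℝ φ z w) ∧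
      ∫ z in Ω, g z * φ z = ∫ z, g z * φ z := fun φ hφ =>
    ⟨setIntegral_eq_integral_of_forall_compl_eq_zero fun z hz => by
      simp [hφ.fderiv_eq_zero hz],
     setIntegral_eq_integral_of_forall_compl_eq_zero fun z hz => by simp [hφ.eq_zero hz]⟩
  constructor
  · intro h φ hφ
    rw [← (key φ hφ).1, ← (key φ hφ).2]
    exact h φ hφ.smooth hφ.compact hφ.subset
  · intro h φ h1 h2 h3
    have hφ : IsTest Ω φ := ⟨h1, h2, h3⟩
    rw [(key φ hφ).1, (key φ hφ).2]
    exact h φ hφ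

theorem HasWeakDeriv.mono {Ω Ω' : Set E} {u g : E → ℝ} {w : E} (h : HasWeakDeriv Ω u w g)
    (hs : Ω' ⊆ Ω) : HasWeakDeriv Ω' u w g := by
  rw [hasWeakDeriv_iff] at *
  exact fun φ hφ => h φ (hφ.mono hs)

theorem HasWeakDeriv.congr_ae {Ω : Set E} {u g u' g' : E → ℝ} {w : E} (h : HasWeakDeriv Ω u w g)
    (hu : u =ᵐ[volume.restrict Ω] u') (hg : g =ᵐ[volume.restrict Ω] g') :
    HasWeakDeriv Ω u' w g' := by
  intro φ h1 h2 h3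
  have e1 : ∫ z in Ω, u' z * fderiv ℝ φ z w = ∫ z in Ω, u z * fderiv ℝ φ z w :=
    integral_congr_ae (by filter_upwards [hu] with z hz; rw [hz])
  have e2 : ∫ z in Ω, g' z * φ z = ∫ z in Ω, g z * φ z :=
    integral_congr_ae (by filter_upwards [hg] with z hz; rw [hz])
  rw [e1, e2]
  exact h φ h1 h2 h3

theorem HasWeakDeriv.congr_on {Ω : Set E} {u g u' g' : E → ℝ} {w : E} (h : HasWeakDeriv Ω u w g)
    (hu : ∀ z ∈ Ω, u z = u' z) (hg : ∀ z ∈ Ω, g z = g' z) : HasWeakDeriv Ω u' w g' := by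
  rw [hasWeakDeriv_iff] at *
  intro φ hφ
  have e1 : ∫ z, u' z * fderiv ℝ φ z w = ∫ z, u z * fderiv ℝ φ z w := by
    congr 1; ext z
    by_cases hz : z ∈ Ω
    · rw [hu z hz]
    · simp [hφ.fderiv_eq_zero hz]
  have e2 : ∫ z, g' z * φ z = ∫ z, g z * φ z := by
    congr 1; ext z
    by_cases hz : z ∈ Ω
    · rw [hg z hz]
    · simp [hφ.eq_zero hz]
  rw [e1, e2, h φ hφ]

theorem HasWeakDeriv.smul_dir {Ω : Set E} {u g : E → ℝ} {w : E} (h : HasWeakDeriv Ω u w g)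
    (c : ℝ) : HasWeakDeriv Ω u (c • w) (fun z => c * g z) := by
  intro φ h1 h2 h3
  have := h φ h1 h2 h3
  simp only [map_smul, smul_eq_mul, mul_assoc, integral_const_mul]
  simp_rw [mul_left_comm _ c, integral_const_mul, this, mul_neg]

theorem HasWeakDeriv.const_mul {Ω : Set E} {u g : E → ℝ} {w : E} (h : HasWeakDeriv Ω u w g)
    (c : ℝ) : HasWeakDeriv Ω (fun z => c * u z) w (fun z => c * g z) := by
  intro φ h1 h2 h3
  simp only [mul_assoc, integral_const_mul, h φ h1 h2 h3, mul_neg]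

variable [BorelSpace E]

theorem LocInt.integrable_mul {Ω : Set E} {u φ : E → ℝ} (h : LocInt Ω u) (hφ : Continuous φ)
    {K : Set E} (hK : IsCompact K) (hKΩ : K ⊆ Ω) (h0 : ∀ z ∉ K, φ z = 0) :
    Integrable fun z => u z * φ z := by
  have h1 := (h K hKΩ hK).mul_continuousOn hφ.continuousOn hK
  refine (integrableOn_iff_integrable_of_support_subset ?_).1 h1
  intro z hz
  by_contra hzK
  exact hz (by simp [h0 z hzK])

theorem LocInt.integrable_mul_test {Ω : Set E} {u φ : E → ℝ} (h : LocInt Ω u)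
    (hφ : IsTest Ω φ) : Integrable fun z => u z * φ z :=
  h.integrable_mul hφ.continuous hφ.compact hφ.subset fun _ => image_eq_zero_of_notMem_tsupport

theorem LocInt.integrable_mul_fderiv {Ω : Set E} {u φ : E → ℝ} (h : LocInt Ω u)
    (hφ : IsTest Ω φ) (w : E) : Integrable fun z => u z * fderiv ℝ φ z w :=
  h.integrable_mul (hφ.continuous_fderiv w) hφ.compact hφ.subset fun _ hz => by
    simp [fderiv_eq_zero_of_notMem_tsupport hz]

theorem LocInt.of_continuous [IsLocallyFiniteMeasure (volume : Measure E)] {Ω : Set E} {u : E → ℝ}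
    (h : Continuous u) : LocInt Ω u :=
  fun _ _ hc => h.continuousOn.integrableOn_compact hc

theorem LocInt.of_memLp [IsLocallyFiniteMeasure (volume : Measure E)] {Ω : Set E} {u : E → ℝ}
    {p : ℝ} (hp : 1 < p) (h : MemLp u (ENNReal.ofReal p) (volume.restrict Ω)) : LocInt Ω u := by
  intro K hK hc
  have : IsFiniteMeasure (volume.restrict K) := ⟨by simpa using hc.measure_lt_top⟩
  exact (h.mono_measure (Measure.restrict_mono hK le_rfl)).integrable (by simpa using hp.le)

theorem HasWeakDeriv.add {Ω : Set E} {u g u' g' : E → ℝ} {w : E} (h : HasWeakDeriv Ω u w g)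
    (h' : HasWeakDeriv Ω u' w g') (hu : LocInt Ω u) (hg : LocInt Ω g) (hu' : LocInt Ω u')
    (hg' : LocInt Ω g') : HasWeakDeriv Ω (fun z => u z + u' z) w (fun z => g z + g' z) := by
  rw [hasWeakDeriv_iff] at *
  intro φ hφ
  simp only [add_mul]
  rw [integral_add (hu.integrable_mul_fderiv hφ w) (hu'.integrable_mul_fderiv hφ w),
    integral_add (hg.integrable_mul_test hφ) (hg'.integrable_mul_test hφ), h φ hφ, h' φ hφ]
  ring

theorem HasWeakDeriv.sub {Ω : Set E} {u g u' g' : E → ℝ} {w : E} (h : HasWeakDeriv Ω u w g)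
    (h' : HasWeakDeriv Ω u' w g') (hu : LocInt Ω u) (hg : LocInt Ω g) (hu' : LocInt Ω u')
    (hg' : LocInt Ω g') : HasWeakDeriv Ω (fun z => u z - u' z) w (fun z => g z - g' z) := by
  rw [hasWeakDeriv_iff] at *
  intro φ hφ
  simp only [sub_mul]
  rw [integral_sub (hu.integrable_mul_fderiv hφ w) (hu'.integrable_mul_fderiv hφ w),
    integral_sub (hg.integrable_mul_test hφ) (hg'.integrable_mul_test hφ), h φ hφ, h' φ hφ]
  ring

/-- The product rule with a smooth function `θ`. If `u` has a weak derivative only on `Ω₁`, then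
`θ u` has one on every set that meets the support of `θ` inside `Ω₁`. -/
theorem HasWeakDeriv.smooth_mul {Ω Ω₁ : Set E} {u g θ : E → ℝ} {w : E}
    (h : HasWeakDeriv Ω₁ u w g) (hθ : ContDiff ℝ ∞ θ) (hs : tsupport θ ∩ Ω ⊆ Ω₁)
    (hu : LocInt Ω₁ u) (hg : LocInt Ω₁ g) :
    HasWeakDeriv Ω (fun z => θ z * u z) w (fun z => θ z * g z + fderiv ℝ θ z w * u z) := by
  rw [hasWeakDeriv_iff] at *
  intro φ hφ
  have hθφ := hφ.mul_smooth hθ hs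
  have hd : ∀ z, fderiv ℝ (fun z => θ z * φ z) z w = θ z * fderiv ℝ φ z w + fderiv ℝ θ z w * φ z := by
    intro z
    rw [fderiv_fun_mul (hθ.differentiable (by simp) z) (hφ.smooth.differentiable (by simp) z)]
    simp; ring
  have hc : Continuous fun z => fderiv ℝ θ z w :=
    (hθ.continuous_fderiv (by simp)).clm_apply continuous_const
  have hsub : tsupport θ ∩ tsupport φ ⊆ Ω₁ := fun z hz => hs ⟨hz.1, hφ.subset hz.2⟩
  have hK : IsCompact (tsupport θ ∩ tsupport φ) :=
    IsCompact.inter_left hφ.compact (isClosed_tsupport θ)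
  have i2 : Integrable fun z => u z * (fderiv ℝ θ z w * φ z) := by
    refine hu.integrable_mul (hc.mul hφ.continuous) hK hsub fun z hz => ?_
    by_cases h1 : z ∈ tsupport θ
    · simp [image_eq_zero_of_notMem_tsupport (fun h2 => hz ⟨h1, h2⟩)]
    · simp [fderiv_eq_zero_of_notMem_tsupport h1]
  have := h _ hθφ
  simp only [hd, mul_add] at this
  rw [integral_add _ i2] at this
  · have e1 : ∫ z, θ z * u z * fderiv ℝ φ z w = ∫ z, u z * (θ z * fderiv ℝ φ z w) := by
      congr 1; ext z; ring
    have e2 : ∫ z, (θ z * g z + fderiv ℝ θ z w * u z) * φ z =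
        (∫ z, g z * (θ z * φ z)) + ∫ z, u z * (fderiv ℝ θ z w * φ z) := by
      rw [← integral_add (hg.integrable_mul_test hθφ) i2]
      congr 1; ext z; ring
    rw [e1, e2]; linarith
  · refine hu.integrable_mul (hθ.continuous.mul (hφ.continuous_fderiv w)) hK hsub fun z hz => ?_
    by_cases h1 : z ∈ tsupport θ
    · simp [fderiv_eq_zero_of_notMem_tsupport (fun h2 => hz ⟨h1, h2⟩)]
    · simp [image_eq_zero_of_notMem_tsupport h1]

variable [FiniteDimensional ℝ E] [(volume : Measure E).IsAddHaarMeasure]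

/-- The classical derivative of a smooth function is its weak derivative. -/
theorem hasWeakDeriv_of_smooth {Ω : Set E} {u : E → ℝ} (hu : ContDiff ℝ ∞ u) (w : E) :
    HasWeakDeriv Ω u w (fun z => fderiv ℝ u z w) := by
  rw [hasWeakDeriv_iff]
  intro φ hφ
  have hc : Continuous fun z => fderiv ℝ u z w :=
    (hu.continuous_fderiv (by simp)).clm_apply continuous_const
  have l1 : LocInt Ω u := .of_continuous hu.continuous
  have l2 : LocInt Ω (fun z => fderiv ℝ u z w) := .of_continuous hc
  exact integral_mul_fderiv_eq_neg_fderiv_mul_of_integrable (l2.integrable_mul_test hφ)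
    (l1.integrable_mul_fderiv hφ w) (l1.integrable_mul_test hφ)
    (fun x _ => hu.differentiable (by simp) x) (fun x _ => hφ.smooth.differentiable (by simp) x)

theorem hasWeakDeriv_const {Ω : Set E} (c : ℝ) (w : E) :
    HasWeakDeriv Ω (fun _ => c) w (fun _ => 0) := by
  simpa using hasWeakDeriv_of_smooth (Ω := Ω) (u := fun _ => c) contDiff_const w

/-- A function whose integrals against all nonnegative test functions on an open set are
nonnegative is nonnegative there: it is the limit of its convolutions with bump functions. -/
theorem ae_nonneg_of_integral_test_nonneg {Ω : Set E} (hΩ : IsOpen Ω) {f : E → ℝ}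
    (hf : IntegrableOn f Ω) (h : ∀ φ, IsTest Ω φ → (∀ z, 0 ≤ φ z) → 0 ≤ ∫ z in Ω, φ z * f z) :
    ∀ᵐ z ∂volume.restrict Ω, 0 ≤ f z := by
  rw [ae_restrict_iff' hΩ.measurableSet]
  have hf' : Integrable (Ω.indicator f) := hf.integrable_indicator hΩ.measurableSet
  let φ : ℕ → ContDiffBump (0 : E) := fun n =>
    ⟨1 / (n + 1) / 2, 1 / (n + 1), by positivity, by
      have : (0 : ℝ) < 1 / (n + 1) := by positivity
      linarith⟩
  have hrOut : Tendsto (fun n => (φ n).rOut) atTop (𝓝 0) :=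
    tendsto_one_div_add_atTop_nhds_zero_nat
  have := ContDiffBump.ae_convolution_tendsto_right_of_locallyIntegrable (μ := volume) (K := 2)
    hrOut (Eventually.of_forall fun n => by simp only [φ]; linarith) hf'.locallyIntegrable
  filter_upwards [this] with x hx hxΩ
  rw [indicator_of_mem hxΩ] at hx
  -- at a point of `Ω` the bumps are eventually test functions on `Ω`, so the convolutions are `≥ 0`
  refine ge_of_tendsto hx ?_
  obtain ⟨r, hr, hball⟩ := Metric.isOpen_iff.1 hΩ x hxΩ
  filter_upwards [hrOut.eventually_lt_const hr] with n hn
  rw [← convolution_flip, convolution_def]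
  simp only [ContinuousLinearMap.flip_apply, ContinuousLinearMap.lsmul_apply, smul_eq_mul]
  have ht : IsTest Ω (fun t => (φ n).normed volume (x - t)) := by
    have hsupp : ∀ t, t ∉ Metric.closedBall x (φ n).rOut → (φ n).normed volume (x - t) = 0 := by
      intro t ht
      rw [← Function.notMem_support, (φ n).support_normed_eq]
      intro hb
      rw [Metric.mem_ball, dist_zero_right] at hb
      refine ht ?_
      rw [Metric.mem_closedBall, dist_comm, dist_eq_norm]
      exact hb.le
    have : ProperSpace E := FiniteDimensional.proper_real E
    refine ⟨(φ n).contDiff_normed.comp (contDiff_const.sub contDiff_id),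
      HasCompactSupport.intro (isCompact_closedBall x (φ n).rOut) hsupp, ?_⟩
    refine (closure_minimal (fun t ht => ?_) Metric.isClosed_closedBall).trans
      ((Metric.closedBall_subset_ball hn).trans hball)
    by_contra hb
    exact ht (hsupp t hb)
  have h1 := h _ ht fun t => (φ n).nonneg_normed _
  rw [← integral_indicator hΩ.measurableSet] at h1
  refine h1.trans_eq (integral_congr_ae (ae_of_all _ fun t => ?_))
  by_cases htΩ : t ∈ Ω <;> simp [htΩ]

end TestFunctions

section Diag

/-- The map `(x, y) ↦ (α x + β, γ y)` of the plane. -/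
def diagMap (α β γ : ℝ) (z : ℝ × ℝ) : ℝ × ℝ := (α * z.1 + β, γ * z.2)

variable {α β γ : ℝ}

theorem contDiff_diagMap : ContDiff ℝ ∞ (diagMap α β γ) :=
  ((contDiff_const.mul contDiff_fst).add contDiff_const).prodMk (contDiff_const.mul contDiff_snd)

theorem diagMap_symm_left (hα : α ≠ 0) (hγ : γ ≠ 0) (z : ℝ × ℝ) :
    diagMap α⁻¹ (-(α⁻¹ * β)) γ⁻¹ (diagMap α β γ z) = z := by
  ext <;> simp [diagMap] <;> field_simp
  ring

theorem diagMap_symm_right (hα : α ≠ 0) (hγ : γ ≠ 0) (z : ℝ × ℝ) :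
    diagMap α β γ (diagMap α⁻¹ (-(α⁻¹ * β)) γ⁻¹ z) = z := by
  ext <;> simp [diagMap] <;> field_simp
  ring

/-- `diagMap` as a homeomorphism. -/
noncomputable def diagHomeo (hα : α ≠ 0) (hγ : γ ≠ 0) (β : ℝ) : ℝ × ℝ ≃ₜ ℝ × ℝ where
  toFun := diagMap α β γ
  invFun := diagMap α⁻¹ (-(α⁻¹ * β)) γ⁻¹
  left_inv := diagMap_symm_left hα hγ
  right_inv := diagMap_symm_right hα hγ
  continuous_toFun := contDiff_diagMap.continuous
  continuous_invFun := contDiff_diagMap.continuous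

theorem measurableEmbedding_diagMap (hα : α ≠ 0) (hγ : γ ≠ 0) :
    MeasurableEmbedding (diagMap α β γ) := (diagHomeo hα hγ β).measurableEmbedding

theorem map_diagMap (hα : α ≠ 0) (hγ : γ ≠ 0) :
    Measure.map (diagMap α β γ) volume = ENNReal.ofReal |α⁻¹ * γ⁻¹| • volume := by
  have h1 : Measure.map (fun x : ℝ => α * x + β) volume = ENNReal.ofReal |α⁻¹| • volume := by
    have : (fun x : ℝ => α * x + β) = (fun x => x + β) ∘ (fun x => α * x) := rfl
    rw [this, ← Measure.map_map (by fun_prop) (by fun_prop), Real.map_volume_mul_left hα,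
      Measure.map_smul, map_add_right_eq_self]
  have h2 := Measure.map_prod_map (volume : Measure ℝ) (volume : Measure ℝ)
    (f := fun x : ℝ => α * x + β) (g := fun y : ℝ => γ * y) (by fun_prop) (by fun_prop)
  rw [h1, Real.map_volume_mul_left hγ, Measure.prod_smul_left, Measure.prod_smul_right,
    smul_smul, ← ENNReal.ofReal_mul (abs_nonneg _), ← abs_mul] at h2
  exact h2.symm

theorem setIntegral_comp_diagMap {F : Type*} [NormedAddCommGroup F] [NormedSpace ℝ F]
    (hα : α ≠ 0) (hγ : γ ≠ 0) (Ω : Set (ℝ × ℝ)) (f : ℝ × ℝ → F) :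
    ∫ z in diagMap α β γ ⁻¹' Ω, f (diagMap α β γ z) = |α⁻¹ * γ⁻¹| • ∫ z in Ω, f z := by
  rw [← (measurableEmbedding_diagMap hα hγ).setIntegral_map, map_diagMap hα hγ,
    Measure.restrict_smul, integral_smul_measure, ENNReal.toReal_ofReal (abs_nonneg _)]

theorem map_restrict_diagMap (hα : α ≠ 0) (hγ : γ ≠ 0) (Ω : Set (ℝ × ℝ)) :
    Measure.map (diagMap α β γ) (volume.restrict (diagMap α β γ ⁻¹' Ω)) =
      ENNReal.ofReal |α⁻¹ * γ⁻¹| • volume.restrict Ω := by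
  rw [← (measurableEmbedding_diagMap hα hγ).restrict_map, map_diagMap hα hγ,
    Measure.restrict_smul]

theorem memLp_comp_diagMap {F : Type*} [NormedAddCommGroup F] {q : ℝ≥0∞}
    (hα : α ≠ 0) (hγ : γ ≠ 0) {Ω : Set (ℝ × ℝ)} {f : ℝ × ℝ → F}
    (hf : MemLp f q (volume.restrict Ω)) :
    MemLp (fun z => f (diagMap α β γ z)) q (volume.restrict (diagMap α β γ ⁻¹' Ω)) := by
  have h : MemLp f q (Measure.map (diagMap α β γ) (volume.restrict (diagMap α β γ ⁻¹' Ω))) := by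
    rw [map_restrict_diagMap hα hγ]; exact hf.smul_measure ENNReal.ofReal_ne_top
  exact ((measurableEmbedding_diagMap hα hγ).memLp_map_measure_iff).1 h

theorem ae_comp_diagMap (hα : α ≠ 0) (hγ : γ ≠ 0) {Ω : Set (ℝ × ℝ)} {P : ℝ × ℝ → Prop}
    (h : ∀ᵐ z ∂volume.restrict Ω, P z) :
    ∀ᵐ z ∂volume.restrict (diagMap α β γ ⁻¹' Ω), P (diagMap α β γ z) := by
  rw [← (measurableEmbedding_diagMap hα hγ).ae_map_iff, map_restrict_diagMap hα hγ]
  exact Measure.ae_smul_measure h _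

theorem fderiv_comp_diagMap {φ : ℝ × ℝ → ℝ} (hφ : Differentiable ℝ φ) (z w : ℝ × ℝ) :
    fderiv ℝ (fun z => φ (diagMap α β γ z)) z w =
      fderiv ℝ φ (diagMap α β γ z) (α * w.1, γ * w.2) := by
  have h1 : HasFDerivAt (diagMap α β γ)
      ((α • ContinuousLinearMap.fst ℝ ℝ ℝ).prod (γ • ContinuousLinearMap.snd ℝ ℝ ℝ)) z :=
    (((hasFDerivAt_fst (𝕜 := ℝ) (p := z)).const_mul α).add_const β).prodMk
      ((hasFDerivAt_snd (𝕜 := ℝ) (p := z)).const_mul γ)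
  have h2 := (hφ (diagMap α β γ z)).hasFDerivAt.comp z h1
  have h3 : fderiv ℝ (fun z => φ (diagMap α β γ z)) z = _ := h2.fderiv
  rw [h3]; simp

/-- Weak derivatives under the change of variables `diagMap`. -/
theorem HasWeakDeriv.comp_diagMap (hα : α ≠ 0) (hγ : γ ≠ 0) {Ω : Set (ℝ × ℝ)}
    {u g : ℝ × ℝ → ℝ} {w : ℝ × ℝ} (h : HasWeakDeriv Ω u (α * w.1, γ * w.2) g) :
    HasWeakDeriv (diagMap α β γ ⁻¹' Ω) (fun z => u (diagMap α β γ z)) w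
      (fun z => g (diagMap α β γ z)) := by
  intro φ h1 h2 h3
  set B := diagMap α⁻¹ (-(α⁻¹ * β)) γ⁻¹ with hB
  have hBA : ∀ z, B (diagMap α β γ z) = z := diagMap_symm_left hα hγ
  have hψ : ContDiff ℝ ∞ (fun z => φ (B z)) := h1.comp contDiff_diagMap
  have hsupp : ∀ z, z ∉ B ⁻¹' tsupport φ → φ (B z) = 0 := fun z hz =>
    image_eq_zero_of_notMem_tsupport hz
  have hcomp : IsCompact (B ⁻¹' tsupport φ) :=
    (diagHomeo hα hγ β).symm.isCompact_preimage.2 h2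
  have hts : tsupport (fun z => φ (B z)) ⊆ B ⁻¹' tsupport φ :=
    closure_minimal (fun z hz => by by_contra hh; exact hz (hsupp z hh)) hcomp.isClosed
  have := h _ hψ (HasCompactSupport.intro hcomp hsupp) (fun z hz => by
    have h4 : diagMap α β γ (B z) ∈ Ω := h3 (hts hz)
    rwa [hB, diagMap_symm_right hα hγ] at h4)
  have e1 := setIntegral_comp_diagMap (β := β) hα hγ Ω
    (fun z => u z * fderiv ℝ (fun z => φ (B z)) z (α * w.1, γ * w.2))
  have e2 := setIntegral_comp_diagMap (β := β) hα hγ Ω (fun z => g z * φ (B z))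
  have e3 : ∀ z, fderiv ℝ (fun z => φ (B z)) (diagMap α β γ z) (α * w.1, γ * w.2)
      = fderiv ℝ φ z w := by
    intro z
    rw [hB, fderiv_comp_diagMap (h1.differentiable (by simp)), ← hB, hBA]
    congr 1
    ext
    · simp [hα]
    · simp [hγ]
  simp only [e3, hBA] at e1 e2
  rw [e1, e2, this, smul_neg]

theorem HasWeakDeriv.comp_diagMap_fst (hα : α ≠ 0) (hγ : γ ≠ 0) {Ω : Set (ℝ × ℝ)}
    {u g : ℝ × ℝ → ℝ} (h : HasWeakDeriv Ω u (1, 0) g) :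
    HasWeakDeriv (diagMap α β γ ⁻¹' Ω) (fun z => u (diagMap α β γ z)) (1, 0)
      (fun z => α * g (diagMap α β γ z)) :=
  HasWeakDeriv.comp_diagMap (g := fun z => α * g z) hα hγ (by simpa using h.smul_dir α)

theorem HasWeakDeriv.comp_diagMap_snd (hα : α ≠ 0) (hγ : γ ≠ 0) {Ω : Set (ℝ × ℝ)}
    {u g : ℝ × ℝ → ℝ} (h : HasWeakDeriv Ω u (0, 1) g) :
    HasWeakDeriv (diagMap α β γ ⁻¹' Ω) (fun z => u (diagMap α β γ z)) (0, 1)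
      (fun z => γ * g (diagMap α β γ z)) :=
  HasWeakDeriv.comp_diagMap (g := fun z => γ * g z) hα hγ (by simpa using h.smul_dir γ)

end Diag

end RoughThin

/-! ### Subgraphs and integration along vertical fibres -/

namespace RoughThin

section Subgraph

/-- The open set between the axis and the graph of `h` over `A`. Thin domains, cells and strips
are all of this form. -/
def subgraph (A : Set ℝ) (h : ℝ → ℝ) : Set (ℝ × ℝ) := {z | z.1 ∈ A ∧ 0 < z.2 ∧ z.2 < h z.1}

theorem cell_eq_subgraph (L : ℝ) (Γ : ℝ → ℝ) : cell L Γ = subgraph (Ioo 0 L) Γ := rfl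

theorem strip_eq_subgraph (Γ : ℝ → ℝ) : strip Γ = subgraph univ Γ := by
  ext z; simp [strip, subgraph]

variable {A : Set ℝ} {h : ℝ → ℝ} {H₁ p p' : ℝ}

theorem isOpen_subgraph (hA : IsOpen A) (hh : ContinuousOn h A) : IsOpen (subgraph A h) := by
  rw [isOpen_iff_mem_nhds]
  rintro z ⟨h1, h2, h3⟩
  have hc : ContinuousAt (fun z : ℝ × ℝ => h z.1) z :=
    ContinuousAt.comp (f := Prod.fst) (hh.continuousAt (hA.mem_nhds h1)) continuousAt_fst
  filter_upwards [continuousAt_fst.preimage_mem_nhds (hA.mem_nhds h1),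
    continuousAt_snd.eventually_const_lt h2,
    (continuousAt_snd.prodMk hc).eventually (isOpen_lt continuous_fst continuous_snd |>.mem_nhds h3)]
    with w hw1 hw2 hw3
  exact ⟨hw1, hw2, hw3⟩

theorem subgraph_mono {A' : Set ℝ} {h' : ℝ → ℝ} (hA : A ⊆ A') (hh : ∀ x ∈ A, h x ≤ h' x) :
    subgraph A h ⊆ subgraph A' h' := fun _ hz => ⟨hA hz.1, hz.2.1, hz.2.2.trans_le (hh _ hz.1)⟩

theorem subgraph_subset_prod (hH : ∀ x ∈ A, h x ≤ H₁) : subgraph A h ⊆ A ×ˢ Ioo 0 H₁ :=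
  fun _ hz => ⟨hz.1, hz.2.1, hz.2.2.trans_le (hH _ hz.1)⟩

theorem indicator_subgraph {F : Type*} [Zero F] (f : ℝ × ℝ → F) (x y : ℝ) :
    (subgraph A h).indicator f (x, y) =
      A.indicator (fun x => (Ioo 0 (h x)).indicator (fun y => f (x, y)) y) x := by
  by_cases hx : x ∈ A
  · by_cases hy : y ∈ Ioo 0 (h x)
    · rw [indicator_of_mem (show (x, y) ∈ subgraph A h from ⟨hx, hy⟩), indicator_of_mem hx,
        indicator_of_mem hy]
    · rw [indicator_of_notMem (fun hz : (x, y) ∈ subgraph A h => hy hz.2), indicator_of_mem hx,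
        indicator_of_notMem hy]
  · rw [indicator_of_notMem (fun hz : (x, y) ∈ subgraph A h => hx hz.1), indicator_of_notMem hx]

/-- Two base sets that differ by a null set give subgraphs that differ by a null set. -/
theorem restrict_subgraph_eq {U : Set ℝ} (hU : U ⊆ A) (h0 : volume (A \ U) = 0) :
    volume.restrict (subgraph A h) = volume.restrict (subgraph U h) := by
  refine (Measure.restrict_congr_set ?_).symm
  refine LE.le.eventuallyLE (subgraph_mono hU fun _ _ => le_rfl) |>.antisymm ?_
  have hn : volume ((A \ U) ×ˢ (univ : Set ℝ)) = 0 := by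
    rw [Measure.volume_eq_prod, Measure.prod_prod, h0, zero_mul]
  have : ∀ᵐ z : ℝ × ℝ, z ∉ (A \ U) ×ˢ (univ : Set ℝ) := measure_eq_zero_iff_ae_notMem.1 hn
  filter_upwards [this] with z hz hzA
  refine ⟨?_, hzA.2⟩
  by_contra hh
  exact hz ⟨⟨hzA.1, hh⟩, trivial⟩

variable {F : Type*} [NormedAddCommGroup F]

/-- Fubini's theorem on a subgraph. -/
theorem integral_subgraph [NormedSpace ℝ F] (hA : IsOpen A) (hh : ContinuousOn h A)
    {f : ℝ × ℝ → F} (hf : IntegrableOn f (subgraph A h)) :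
    ∫ z in subgraph A h, f z = ∫ x in A, ∫ y in Ioo 0 (h x), f (x, y) := by
  have hm := (isOpen_subgraph hA hh).measurableSet
  have hi : Integrable ((subgraph A h).indicator f) ((volume : Measure ℝ).prod volume) :=
    hf.integrable_indicator hm
  rw [← integral_indicator hm, Measure.volume_eq_prod, integral_prod _ hi,
    ← integral_indicator hA.measurableSet]
  congr 1; ext x
  by_cases hx : x ∈ A
  · simp only [indicator_subgraph, indicator_of_mem hx, integral_indicator measurableSet_Ioo]
  · simp [indicator_subgraph, hx]

theorem integrableOn_fiber_integral [NormedSpace ℝ F] (hA : IsOpen A) (hh : ContinuousOn h A)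
    {f : ℝ × ℝ → F} (hf : IntegrableOn f (subgraph A h)) :
    IntegrableOn (fun x => ∫ y in Ioo 0 (h x), f (x, y)) A := by
  have hm := (isOpen_subgraph hA hh).measurableSet
  have hi : Integrable ((subgraph A h).indicator f) ((volume : Measure ℝ).prod volume) :=
    hf.integrable_indicator hm
  have := hi.integral_prod_left
  rw [← integrable_indicator_iff hA.measurableSet]
  refine this.congr (ae_of_all _ fun x => ?_)
  by_cases hx : x ∈ A
  · simp only [indicator_subgraph, indicator_of_mem hx, integral_indicator measurableSet_Ioo]
  · simp [indicator_subgraph, hx]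

theorem ae_integrableOn_fiber (hA : IsOpen A) (hh : ContinuousOn h A)
    {f : ℝ × ℝ → F} (hf : IntegrableOn f (subgraph A h)) :
    ∀ᵐ x ∂volume.restrict A, IntegrableOn (fun y => f (x, y)) (Ioo 0 (h x)) := by
  have hm := (isOpen_subgraph hA hh).measurableSet
  have hi : Integrable ((subgraph A h).indicator f) ((volume : Measure ℝ).prod volume) :=
    hf.integrable_indicator hm
  rw [ae_restrict_iff' hA.measurableSet]
  filter_upwards [hi.prod_right_ae] with x hx hxA
  rw [← integrable_indicator_iff measurableSet_Ioo]
  refine hx.congr (ae_of_all _ fun y => ?_)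
  simp only [indicator_subgraph, indicator_of_mem hxA]

/-- A function of the horizontal variable alone, on a subgraph of bounded height. -/
theorem integrableOn_comp_fst (hH : ∀ x ∈ A, h x ≤ H₁)
    {φ : ℝ → ℝ} (hφ : IntegrableOn φ A) :
    IntegrableOn (fun z : ℝ × ℝ => φ z.1) (subgraph A h) := by
  have h1 : Integrable (fun z : ℝ × ℝ => φ z.1 * (1 : ℝ))
      ((volume.restrict A).prod (volume.restrict (Ioo 0 H₁))) :=
    Integrable.mul_prod (L := ℝ) (g := fun _ => (1 : ℝ)) hφ (integrable_const _)
  rw [Measure.prod_restrict, ← Measure.volume_eq_prod] at h1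
  simp only [mul_one] at h1
  exact IntegrableOn.mono_set h1 (subgraph_subset_prod hH)

theorem aestronglyMeasurable_comp_fst {φ : ℝ → F} (hφ : AEStronglyMeasurable φ (volume.restrict A)) :
    AEStronglyMeasurable (fun z : ℝ × ℝ => φ z.1) (volume.restrict (subgraph A h)) := by
  have h1 : AEStronglyMeasurable (fun z : ℝ × ℝ => φ z.1)
      ((volume.restrict A).prod (volume.restrict (univ : Set ℝ))) := hφ.comp_fst
  rw [Measure.prod_restrict, ← Measure.volume_eq_prod] at h1
  exact h1.mono_set (show subgraph A h ⊆ A ×ˢ univ from fun z hz => ⟨hz.1, trivial⟩)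

theorem memLp_comp_fst (hp : 1 < p) (hH : ∀ x ∈ A, h x ≤ H₁) {φ : ℝ → F}
    (hφ : MemLp φ (ENNReal.ofReal p) (volume.restrict A)) :
    MemLp (fun z : ℝ × ℝ => φ z.1) (ENNReal.ofReal p) (volume.restrict (subgraph A h)) :=
  memLp_of_integrable_norm_rpow hp (aestronglyMeasurable_comp_fst hφ.1)
    (integrableOn_comp_fst hH (integrable_norm_rpow hp hφ))

theorem integral_comp_fst (hA : IsOpen A) (hh : ContinuousOn h A) (hH : ∀ x ∈ A, h x ≤ H₁)
    (h0 : ∀ x ∈ A, 0 ≤ h x) {φ : ℝ → ℝ} (hφ : IntegrableOn φ A) :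
    ∫ z in subgraph A h, φ z.1 = ∫ x in A, h x * φ x := by
  rw [integral_subgraph hA hh (integrableOn_comp_fst hH hφ)]
  refine setIntegral_congr_fun hA.measurableSet fun x hx => ?_
  simp [h0 x hx]

theorem integral_norm_rpow_comp_fst_le (hp : 1 < p) (hA : IsOpen A) (hh : ContinuousOn h A)
    (hH : ∀ x ∈ A, h x ≤ H₁) (h0 : ∀ x ∈ A, 0 ≤ h x) {φ : ℝ → F}
    (hφ : MemLp φ (ENNReal.ofReal p) (volume.restrict A)) :
    ∫ z in subgraph A h, ‖φ z.1‖ ^ p ≤ H₁ * ∫ x in A, ‖φ x‖ ^ p := by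
  have hi := integrable_norm_rpow hp hφ
  rw [integral_comp_fst hA hh hH h0 (φ := fun x => ‖φ x‖ ^ p) hi, ← integral_const_mul]
  refine integral_mono_of_nonneg ?_ (hi.const_mul _) ?_
  · filter_upwards [ae_restrict_mem hA.measurableSet] with x hx
    exact mul_nonneg (h0 x hx) (by positivity)
  · filter_upwards [ae_restrict_mem hA.measurableSet] with x hx
    exact mul_le_mul_of_nonneg_right (hH x hx) (by positivity)

theorem integrableOn_of_memLp_subgraph (hp : 1 < p) (hA : volume A < ⊤) (hH : ∀ x ∈ A, h x ≤ H₁)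
    {f : ℝ × ℝ → F} (hf : MemLp f (ENNReal.ofReal p) (volume.restrict (subgraph A h))) :
    IntegrableOn f (subgraph A h) := by
  have : IsFiniteMeasure (volume.restrict (subgraph A h)) := ⟨by
    rw [Measure.restrict_apply_univ]
    refine (measure_mono (subgraph_subset_prod hH)).trans_lt ?_
    rw [Measure.volume_eq_prod, Measure.prod_prod]
    exact ENNReal.mul_lt_top hA (by simp)⟩
  exact hf.integrable (by simpa using hp.le)

/-- Jensen's inequality on a fibre. -/
theorem fiber_integral_rpow_le (hp : p.HolderConjugate p') {b : ℝ} (hH1 : 0 ≤ H₁) (hb : b ≤ H₁)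
    {f : ℝ → F} (hf : IntegrableOn f (Ioo 0 b))
    (hfp : IntegrableOn (fun y => ‖f y‖ ^ p) (Ioo 0 b)) :
    (∫ y in Ioo 0 b, ‖f y‖) ^ p ≤ H₁ ^ (p - 1) * ∫ y in Ioo 0 b, ‖f y‖ ^ p := by
  have hm : MemLp f (ENNReal.ofReal p) (volume.restrict (Ioo 0 b)) :=
    memLp_of_integrable_norm_rpow hp.lt hf.1 hfp
  have h1 := abs_integral_mul_le hp (f := fun _ => (1 : ℝ)) (memLp_const 1) hm.norm
  have h0 : 0 ≤ ∫ y in Ioo 0 b, ‖f y‖ := integral_nonneg fun _ => norm_nonneg _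
  have h0' : 0 ≤ ∫ y in Ioo 0 b, ‖f y‖ ^ p := integral_norm_rpow_nonneg _
  simp only [one_mul, norm_norm, norm_one, Real.one_rpow, abs_of_nonneg h0] at h1
  have h2 : ∫ _ in Ioo (0 : ℝ) b, (1 : ℝ) ≤ H₁ := by
    simp only [integral_const, MeasurableSet.univ, measureReal_restrict_apply, univ_inter,
      smul_eq_mul, mul_one, Real.volume_real_Ioo, sub_zero]
    exact max_le hb hH1
  have h2' : 0 ≤ ∫ _ in Ioo (0 : ℝ) b, (1 : ℝ) := integral_nonneg fun _ => zero_le_one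
  have h3 := Real.rpow_le_rpow h0 h1 hp.nonneg
  rw [Real.mul_rpow (Real.rpow_nonneg h2' _) (Real.rpow_nonneg h0' _),
    Real.rpow_inv_rpow h0' hp.ne_zero, ← Real.rpow_mul h2', inv_mul_eq_div,
    hp.div_conj_eq_sub_one] at h3
  refine h3.trans (mul_le_mul_of_nonneg_right ?_ h0')
  exact Real.rpow_le_rpow h2' h2 hp.sub_one_pos.le

theorem memLp_fiber_integral_norm (hp : p.HolderConjugate p') (hA : IsOpen A)
    (hAf : volume A < ⊤) (hh : ContinuousOn h A) (hH1 : 0 ≤ H₁) (hH : ∀ x ∈ A, h x ≤ H₁)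
    {f : ℝ × ℝ → F} (hf : MemLp f (ENNReal.ofReal p) (volume.restrict (subgraph A h))) :
    MemLp (fun x => ∫ y in Ioo 0 (h x), ‖f (x, y)‖) (ENNReal.ofReal p) (volume.restrict A) ∧
    ∫ x in A, (∫ y in Ioo 0 (h x), ‖f (x, y)‖) ^ p ≤
      H₁ ^ (p - 1) * ∫ z in subgraph A h, ‖f z‖ ^ p := by
  have hfi := integrableOn_of_memLp_subgraph hp.lt hAf hH hf
  have hfp : IntegrableOn (fun z => ‖f z‖ ^ p) (subgraph A h) := integrable_norm_rpow hp.lt hf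
  have hm := integrableOn_fiber_integral hA hh hfi.norm
  have hle : ∀ᵐ x ∂volume.restrict A, (∫ y in Ioo 0 (h x), ‖f (x, y)‖) ^ p ≤
      H₁ ^ (p - 1) * ∫ y in Ioo 0 (h x), ‖f (x, y)‖ ^ p := by
    filter_upwards [ae_integrableOn_fiber hA hh hfi, ae_integrableOn_fiber hA hh hfp,
      ae_restrict_mem hA.measurableSet] with x h1 h2 h3
    exact fiber_integral_rpow_le hp hH1 (hH x h3) h1 h2
  have hnn : ∀ x, 0 ≤ ∫ y in Ioo 0 (h x), ‖f (x, y)‖ := fun x =>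
    integral_nonneg fun _ => norm_nonneg _
  have hI := (integrableOn_fiber_integral hA hh hfp).const_mul (H₁ ^ (p - 1))
  constructor
  · refine memLp_of_integrable_norm_rpow hp.lt hm.1 (Integrable.mono' hI
      ((continuous_norm.comp_aestronglyMeasurable hm.1).aemeasurable.pow_const p
        |>.aestronglyMeasurable) ?_)
    filter_upwards [hle] with x hx
    rw [Real.norm_of_nonneg (by positivity), Real.norm_of_nonneg (hnn x)]
    exact hx
  · rw [integral_subgraph hA hh hfp, ← integral_const_mul]
    exact integral_mono_of_nonneg (ae_of_all _ fun x => Real.rpow_nonneg (hnn x) _) hI hle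

end Subgraph

section FiberPrimitive

variable {ψ : ℝ × ℝ → ℝ} {k : Set ℝ}

/-- The vertical primitive of a smooth function with compact vertical support is jointly smooth:
it is a vertical convolution with the indicator of a half line. -/
theorem contDiff_fiber_primitive (hψ : ContDiff ℝ ∞ ψ) (hk : IsCompact k)
    (h0 : ∀ x, ∀ y ∉ k, ψ (x, y) = 0) :
    ContDiff ℝ ∞ fun z : ℝ × ℝ => ∫ r in Iic z.2, ψ (z.1, r) := by
  have hf : LocallyIntegrable ((Ici (0 : ℝ)).indicator fun _ => (1 : ℝ)) volume :=
    (locallyIntegrable_const 1).indicator measurableSet_Ici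
  have h := contDiffOn_convolution_right_with_param (𝕜 := ℝ) (μ := volume) (n := ⊤)
    (ContinuousLinearMap.mul ℝ ℝ) (g := fun x y => ψ (x, y)) (s := univ) isOpen_univ hk
    (fun x y _ hy => h0 x y hy) hf (by rw [univ_prod_univ, contDiffOn_univ]; exact hψ)
  rw [univ_prod_univ, contDiffOn_univ] at h
  convert h using 2 with z
  rw [convolution_def]
  simp only [ContinuousLinearMap.mul_apply']
  rw [← integral_sub_left_eq_self _ volume z.2, ← integral_indicator measurableSet_Iic]
  congr 1; ext t
  by_cases ht : t ≤ z.2 <;> simp [indicator, ht]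

theorem contDiff_fiber_integral (hψ : ContDiff ℝ ∞ ψ) (hk : IsCompact k)
    (h0 : ∀ x, ∀ y ∉ k, ψ (x, y) = 0) : ContDiff ℝ ∞ fun x : ℝ => ∫ r, ψ (x, r) := by
  obtain ⟨b, hb⟩ := hk.bddAbove
  have h := (contDiff_fiber_primitive hψ hk h0).comp
    (contDiff_id.prodMk (contDiff_const (c := b)) : ContDiff ℝ ∞ fun x : ℝ => (x, b))
  convert h using 2 with x
  simp only [Function.comp_apply, id]
  rw [setIntegral_eq_integral_of_forall_compl_eq_zero]
  intro y hy
  exact h0 x y fun hyk => hy (hb hyk)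

theorem fderiv_fiber_primitive (hψ : ContDiff ℝ ∞ ψ) (hk : IsCompact k)
    (h0 : ∀ x, ∀ y ∉ k, ψ (x, y) = 0) (z : ℝ × ℝ) :
    fderiv ℝ (fun z : ℝ × ℝ => ∫ r in Iic z.2, ψ (z.1, r)) z (0, 1) = ψ z := by
  have h1 := ((contDiff_fiber_primitive hψ hk h0).differentiable (by simp) z).hasFDerivAt
  have h2 : HasDerivAt (fun y : ℝ => ((z.1, y) : ℝ × ℝ)) (0, 1) z.2 :=
    (hasDerivAt_const z.2 z.1).prodMk (hasDerivAt_id z.2)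
  have h3 : HasDerivAt (fun y : ℝ => ∫ r in Iic y, ψ (z.1, r)) _ z.2 :=
    HasFDerivAt.comp_hasDerivAt (f := fun y : ℝ => ((z.1, y) : ℝ × ℝ)) z.2 h1 h2
  have hc : Continuous fun r => ψ (z.1, r) := hψ.continuous.comp (by fun_prop)
  have hi : Integrable fun r => ψ (z.1, r) :=
    hc.integrable_of_hasCompactSupport (HasCompactSupport.intro hk fun y hy => h0 z.1 y hy)
  have h4 : HasDerivAt (fun y : ℝ => ∫ r in Iic y, ψ (z.1, r)) (ψ (z.1, z.2)) z.2 := by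
    have h5 := (intervalIntegral.integral_hasDerivAt_right (hi.intervalIntegrable (a := 0))
      (hc.stronglyMeasurableAtFilter _ _) hc.continuousAt (b := z.2)).const_add
      (∫ r in Iic (0 : ℝ), ψ (z.1, r))
    refine h5.congr_of_eventuallyEq (Eventually.of_forall fun y => ?_)
    simp only
    rw [← intervalIntegral.integral_Iic_sub_Iic hi.integrableOn hi.integrableOn]
    ring
  exact h3.unique h4

end FiberPrimitive

section Vertical

variable {A : Set ℝ} {h : ℝ → ℝ} {H₀ H₁ : ℝ}

/-- `χ` is a smooth probability density with compact support in `(0, H₀)`. -/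
structure IsWeight (H₀ : ℝ) (χ : ℝ → ℝ) : Prop where
  smooth : ContDiff ℝ ∞ χ
  compact : HasCompactSupport χ
  subset : tsupport χ ⊆ Ioo 0 H₀
  nonneg : ∀ y, 0 ≤ χ y
  integral_eq : ∫ y, χ y = 1

theorem IsWeight.isTest {χ : ℝ → ℝ} (h : IsWeight H₀ χ) : IsTest (Ioo 0 H₀) χ :=
  ⟨h.smooth, h.compact, h.subset⟩

theorem exists_isWeight (h0 : 0 < H₀) : ∃ χ, IsWeight H₀ χ := by
  let φ : ContDiffBump (H₀ / 2) := ⟨H₀ / 8, H₀ / 4, by positivity, by linarith⟩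
  refine ⟨φ.normed volume, φ.contDiff_normed, φ.hasCompactSupport_normed, ?_, φ.nonneg_normed,
    φ.integral_normed⟩
  rw [φ.tsupport_normed_eq, Real.closedBall_eq_Icc]
  intro y hy
  simp only [φ] at hy
  constructor <;> linarith [hy.1, hy.2]

theorem IsWeight.integrable {χ : ℝ → ℝ} (h : IsWeight H₀ χ) : Integrable χ :=
  h.smooth.continuous.integrable_of_hasCompactSupport h.compact

/-- The vertical test function attached to `ψ`: its vertical derivative is
`χ(y) ∫ ψ(x, r) dr - ψ(x, y)`. -/
noncomputable def verticalTest (χ : ℝ → ℝ) (ψ : ℝ × ℝ → ℝ) (z : ℝ × ℝ) : ℝ :=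
  (∫ r in Iic z.2, χ r) * (∫ r, ψ (z.1, r)) - ∫ r in Iic z.2, ψ (z.1, r)

/-- The bound behind the vertical Poincaré inequality: no constant depending on `χ` appears. -/
theorem abs_verticalTest_le {χ : ℝ → ℝ} (hχ : IsWeight H₀ χ) {ψ : ℝ × ℝ → ℝ}
    (h0 : ∀ z, 0 ≤ ψ z) (hi : ∀ x, Integrable fun y => ψ (x, y)) (z : ℝ × ℝ) :
    |verticalTest χ ψ z| ≤ ∫ r, ψ (z.1, r) := by
  have h1 : 0 ≤ ∫ r in Iic z.2, χ r := integral_nonneg fun _ => hχ.nonneg _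
  have h2 : ∫ r in Iic z.2, χ r ≤ 1 := by
    rw [← hχ.integral_eq]
    exact setIntegral_le_integral hχ.integrable (ae_of_all _ hχ.nonneg)
  have h3 : 0 ≤ ∫ r in Iic z.2, ψ (z.1, r) := integral_nonneg fun _ => h0 _
  have h4 : ∫ r in Iic z.2, ψ (z.1, r) ≤ ∫ r, ψ (z.1, r) :=
    setIntegral_le_integral (hi _) (ae_of_all _ fun _ => h0 _)
  rw [verticalTest, abs_le]
  constructor <;> nlinarith

/-- The vertical test function is supported in the vertical hull of the supports of `ψ` and `χ`:
below it both primitives vanish, and above it they cancel as `∫ χ = 1`. -/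
theorem isTest_verticalTest {χ : ℝ → ℝ} (hχ : IsWeight H₀ χ) (hH0 : ∀ x ∈ A, H₀ ≤ h x)
    {ψ : ℝ × ℝ → ℝ} (hψ : IsTest (subgraph A h) ψ) :
    IsTest (subgraph A h) (verticalTest χ ψ) ∧
      ∀ z, fderiv ℝ (verticalTest χ ψ) z (0, 1) = χ z.2 * (∫ r, ψ (z.1, r)) - ψ z := by
  set K := tsupport ψ with hK
  have hKc : IsCompact K := hψ.compact
  have hk : IsCompact (Prod.snd '' K) := hKc.image continuous_snd
  have h0 : ∀ x, ∀ y ∉ Prod.snd '' K, ψ (x, y) = 0 := fun x y hy =>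
    image_eq_zero_of_notMem_tsupport fun hz => hy ⟨(x, y), hz, rfl⟩
  have hχ0 : ∀ x : ℝ, ∀ y ∉ tsupport χ, (fun z : ℝ × ℝ => χ z.2) (x, y) = 0 := fun x y hy =>
    image_eq_zero_of_notMem_tsupport hy
  have hχ2 : ContDiff ℝ ∞ fun z : ℝ × ℝ => χ z.2 := hχ.smooth.comp contDiff_snd
  have cX := contDiff_fiber_primitive hχ2 hχ.compact hχ0
  have cP : ContDiff ℝ ∞ fun z : ℝ × ℝ => ∫ r, ψ (z.1, r) :=
    (contDiff_fiber_integral hψ.smooth hk h0).comp contDiff_fst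
  have cQ := contDiff_fiber_primitive hψ.smooth hk h0
  have hsm : ContDiff ℝ ∞ (verticalTest χ ψ) := (cX.mul cP).sub cQ
  have hi : ∀ x, Integrable fun y => ψ (x, y) := fun x =>
    (hψ.continuous.comp (by fun_prop : Continuous fun y : ℝ => (x, y))).integrable_of_hasCompactSupport
      (HasCompactSupport.intro hk fun y hy => h0 x y hy)
  -- a common positive lower bound for the heights of the supports of `χ` and `ψ`
  obtain ⟨c, hc0, hcχ, hcK⟩ : ∃ c > 0, (∀ y ∈ tsupport χ, c ≤ y) ∧ ∀ z ∈ K, c ≤ z.2 := by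
    have hcomp : IsCompact (tsupport χ ∪ Prod.snd '' K) := IsCompact.union hχ.compact hk
    have hpos : ∀ y ∈ tsupport χ ∪ Prod.snd '' K, 0 < y := by
      rintro y (hy | ⟨z, hz, rfl⟩)
      · exact (hχ.subset hy).1
      · exact (hψ.subset hz).2.1
    rcases (tsupport χ ∪ Prod.snd '' K).eq_empty_or_nonempty with he | hne
    · refine ⟨1, one_pos, fun y hy => ?_, fun z hz => ?_⟩
      · exact absurd (he ▸ Or.inl hy : y ∈ (∅ : Set ℝ)) (notMem_empty _)
      · exact absurd (he ▸ Or.inr ⟨z, hz, rfl⟩ : z.2 ∈ (∅ : Set ℝ)) (notMem_empty _)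
    · obtain ⟨c, hc, hmin⟩ := hcomp.exists_isMinOn hne continuousOn_id
      exact ⟨c, hpos c hc, fun y hy => hmin (Or.inl hy), fun z hz => hmin (Or.inr ⟨z, hz, rfl⟩)⟩
  obtain ⟨d, hd⟩ : ∃ d < H₀, ∀ y ∈ tsupport χ, y ≤ d := by
    have hne : (tsupport χ).Nonempty := by
      by_contra he
      rw [not_nonempty_iff_eq_empty, tsupport_eq_empty_iff] at he
      have := hχ.integral_eq
      simp [he] at this
    obtain ⟨d, hd, hmax⟩ := IsCompact.exists_isMaxOn (f := fun y : ℝ => y) hχ.compact hne continuousOn_id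
    exact ⟨d, (hχ.subset hd).2, fun y hy => hmax hy⟩
  -- the vertical hull of the two supports
  let K' : Set (ℝ × ℝ) :=
    (fun q : (ℝ × ℝ) × ℝ => ((q.1.1, c + q.2 * (max q.1.2 (max d c) - c)) : ℝ × ℝ)) ''
      (K ×ˢ Icc (0 : ℝ) 1)
  have hK'c : IsCompact K' := (hKc.prod isCompact_Icc).image (by fun_prop)
  have hcH : ∀ z ∈ K, c < h z.1 := fun z hz => (hcK z hz).trans_lt (hψ.subset hz).2.2
  have hK'sub : K' ⊆ subgraph A h := by
    rintro _ ⟨⟨z, t⟩, ⟨hz, ht⟩, rfl⟩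
    have hzS := hψ.subset hz
    have h1 : max z.2 (max d c) < h z.1 :=
      max_lt hzS.2.2 (max_lt (hd.1.trans_le (hH0 _ hzS.1)) (hcH z hz))
    have h2 : c ≤ max z.2 (max d c) := (le_max_right d c).trans (le_max_right _ _)
    have h3 : 0 ≤ t := ht.1
    have h4 : t ≤ 1 := ht.2
    refine ⟨hzS.1, ?_, ?_⟩ <;> simp only <;> nlinarith
  have hzero : ∀ z ∉ K', verticalTest χ ψ z = 0 := by
    intro z hz
    by_cases hzlow : z.2 < c
    · have e1 : ∫ r in Iic z.2, χ r = 0 := setIntegral_eq_zero_of_forall_eq_zero fun r hr =>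
        image_eq_zero_of_notMem_tsupport fun hm => by
          have := hcχ r hm
          exact absurd (mem_Iic.1 hr) (by linarith)
      have e2 : ∫ r in Iic z.2, ψ (z.1, r) = 0 := setIntegral_eq_zero_of_forall_eq_zero fun r hr =>
        image_eq_zero_of_notMem_tsupport fun hm => by
          have := hcK _ hm
          simp only at this
          exact absurd (mem_Iic.1 hr) (by linarith)
      rw [verticalTest, e1, e2]; ring
    · push Not at hzlow
      have hno : ∀ y', (z.1, y') ∈ K → max y' (max d c) < z.2 := by
        intro y' hy'
        by_contra hle
        push Not at hle
        refine hz ⟨((z.1, y'), (z.2 - c) / (max y' (max d c) - c)), ⟨hy', ?_, ?_⟩, ?_⟩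
        · exact div_nonneg (by linarith) (by linarith)
        · exact div_le_one_of_le₀ (by linarith) (by linarith)
        · ext
          · rfl
          · simp only
            by_cases he : max y' (max d c) - c = 0
            · rw [he]; simp only [div_zero, mul_zero, add_zero]; linarith
            · rw [div_mul_cancel₀ _ he]; ring
      have e2 : ∫ r in Iic z.2, ψ (z.1, r) = ∫ r, ψ (z.1, r) :=
        setIntegral_eq_integral_of_forall_compl_eq_zero fun r hr =>
          image_eq_zero_of_notMem_tsupport fun hm => by
            have := (le_max_left _ _).trans_lt (hno r hm)
            exact hr this.le
      by_cases hex : ∃ y', (z.1, y') ∈ K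
      · obtain ⟨y', hy'⟩ := hex
        have hdz : d < z.2 := ((le_max_left d c).trans (le_max_right _ _)).trans_lt (hno y' hy')
        have e1 : ∫ r in Iic z.2, χ r = 1 := by
          rw [← hχ.integral_eq]
          exact setIntegral_eq_integral_of_forall_compl_eq_zero fun r hr =>
            image_eq_zero_of_notMem_tsupport fun hm => hr ((hd.2 r hm).trans hdz.le)
        rw [verticalTest, e1, e2]; ring
      · have e3 : ∫ r, ψ (z.1, r) = 0 := integral_eq_zero_of_ae (ae_of_all _ fun r =>
          image_eq_zero_of_notMem_tsupport fun hm => hex ⟨r, hm⟩)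
        rw [verticalTest, e2, e3]; ring
  refine ⟨⟨hsm, HasCompactSupport.intro hK'c hzero, ?_⟩, fun z => ?_⟩
  · refine (closure_minimal (fun z hz => ?_) hK'c.isClosed).trans hK'sub
    by_contra hh
    exact hz (hzero z hh)
  · have dX := (cX.differentiable (by simp) z)
    have dP := (cP.differentiable (by simp) z)
    have dQ := (cQ.differentiable (by simp) z)
    have fP : fderiv ℝ (fun z : ℝ × ℝ => ∫ r, ψ (z.1, r)) z (0, 1) = 0 := by
      have h1 : HasDerivAt (fun y : ℝ => ((z.1, y) : ℝ × ℝ)) (0, 1) z.2 :=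
        (hasDerivAt_const z.2 z.1).prodMk (hasDerivAt_id z.2)
      have h2 := HasFDerivAt.comp_hasDerivAt (f := fun y : ℝ => ((z.1, y) : ℝ × ℝ)) z.2
        dP.hasFDerivAt h1
      exact h2.unique (hasDerivAt_const z.2 (∫ r, ψ (z.1, r)))
    have h1 : fderiv ℝ (verticalTest χ ψ) z = _ :=
      ((dX.hasFDerivAt.mul dP.hasFDerivAt).sub dQ.hasFDerivAt).fderiv
    rw [h1]
    simp only [sub_apply, add_apply,
      smul_apply, fP, fderiv_fiber_primitive hψ.smooth hk h0,
      fderiv_fiber_primitive hχ2 hχ.compact hχ0, smul_eq_mul]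
    ring

end Vertical

end RoughThin

/-! ### Vertical means -/

namespace RoughThin

section Vertical

variable {A : Set ℝ} {h : ℝ → ℝ} {H₀ H₁ : ℝ}

/-- The weighted vertical mean `∫ u(x, y) χ(y) dy`. -/
noncomputable def vertMean (χ : ℝ → ℝ) (u : ℝ × ℝ → ℝ) (x : ℝ) : ℝ := ∫ y, u (x, y) * χ y

theorem vertMean_eq_fiber {χ : ℝ → ℝ} (hχ : IsWeight H₀ χ) (hH0 : ∀ x ∈ A, H₀ ≤ h x)
    (u : ℝ × ℝ → ℝ) {x : ℝ} (hx : x ∈ A) :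
    vertMean χ u x = ∫ y in Ioo 0 (h x), u (x, y) * χ y := by
  refine (setIntegral_eq_integral_of_forall_compl_eq_zero fun y hy => ?_).symm
  rw [hχ.isTest.eq_zero fun hh => hy ⟨hh.1, hh.2.trans_le (hH0 x hx)⟩, mul_zero]

theorem IsWeight.exists_bound {χ : ℝ → ℝ} (hχ : IsWeight H₀ χ) :
    ∃ M, 0 ≤ M ∧ ∀ y, χ y ≤ M := by
  obtain ⟨M, hM⟩ := hχ.compact.exists_bound_of_continuous hχ.smooth.continuous
  exact ⟨M, (norm_nonneg _).trans (hM 0), fun y => (le_abs_self _).trans (hM y)⟩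

theorem IntegrableOn.mul_weight {χ : ℝ → ℝ} (hχ : IsWeight H₀ χ) {u : ℝ × ℝ → ℝ}
    {S : Set (ℝ × ℝ)} (hu : IntegrableOn u S) : IntegrableOn (fun z => u z * χ z.2) S := by
  obtain ⟨M, -, hM⟩ := hχ.exists_bound
  refine Integrable.mul_bdd (c := M) hu
    (hχ.smooth.continuous.comp continuous_snd).aestronglyMeasurable (ae_of_all _ fun z => ?_)
  simpa [abs_of_nonneg (hχ.nonneg _)] using hM z.2

theorem integrableOn_vertMean {χ : ℝ → ℝ} (hχ : IsWeight H₀ χ) (hA : IsOpen A)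
    (hh : ContinuousOn h A) (hH0 : ∀ x ∈ A, H₀ ≤ h x) {u : ℝ × ℝ → ℝ}
    (hu : IntegrableOn u (subgraph A h)) : IntegrableOn (vertMean χ u) A := by
  refine (integrableOn_fiber_integral hA hh (IntegrableOn.mul_weight hχ hu)).congr_fun
    (fun x hx => ?_) hA.measurableSet
  exact (vertMean_eq_fiber hχ hH0 u hx).symm

/-- A function differs from its weighted vertical mean by at most the integral of its vertical
derivative over the fibre. -/
theorem abs_sub_vertMean_le (hA : IsOpen A) (hh : ContinuousOn h A)
    (hH0 : ∀ x ∈ A, H₀ ≤ h x) (hH : ∀ x ∈ A, h x ≤ H₁) {χ : ℝ → ℝ} (hχ : IsWeight H₀ χ)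
    {u g : ℝ × ℝ → ℝ} (hu : IntegrableOn u (subgraph A h)) (hg : IntegrableOn g (subgraph A h))
    (hw : HasWeakDeriv (subgraph A h) u (0, 1) g) :
    ∀ᵐ z ∂volume.restrict (subgraph A h),
      |u z - vertMean χ u z.1| ≤ ∫ s in Ioo 0 (h z.1), |g (z.1, s)| := by
  set S := subgraph A h with hS
  have hSo : IsOpen S := isOpen_subgraph hA hh
  have hm : IntegrableOn (fun z : ℝ × ℝ => vertMean χ u z.1) S :=
    integrableOn_comp_fst hH (integrableOn_vertMean hχ hA hh hH0 hu)
  have hVi := integrableOn_fiber_integral hA hh hg.abs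
  have hV : IntegrableOn (fun z : ℝ × ℝ => ∫ s in Ioo 0 (h z.1), |g (z.1, s)|) S :=
    integrableOn_comp_fst hH hVi
  have key : ∀ ψ, IsTest S ψ → (∀ z, 0 ≤ ψ z) →
      |∫ z in S, ψ z * (u z - vertMean χ u z.1)| ≤
        ∫ z in S, ψ z * ∫ s in Ioo 0 (h z.1), |g (z.1, s)| := by
    intro ψ hψ hψ0
    obtain ⟨hΨ, hΨd⟩ := isTest_verticalTest hχ hH0 hψ
    obtain ⟨M, hM⟩ := hψ.compact.exists_bound_of_continuous hψ.continuous
    have bdd : ∀ {f : ℝ × ℝ → ℝ}, IntegrableOn f S → IntegrableOn (fun z => ψ z * f z) S :=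
      fun hf => Integrable.bdd_mul (c := M) hf hψ.continuous.aestronglyMeasurable (ae_of_all _ hM)
    have hk : IsCompact (Prod.snd '' tsupport ψ) := IsCompact.image hψ.compact continuous_snd
    have h0 : ∀ x, ∀ y ∉ Prod.snd '' tsupport ψ, ψ (x, y) = 0 := fun x y hy =>
      image_eq_zero_of_notMem_tsupport fun hz => hy ⟨(x, y), hz, rfl⟩
    have hi : ∀ x, Integrable fun y => ψ (x, y) := fun x =>
      (hψ.continuous.comp (by fun_prop :
        Continuous fun y : ℝ => (x, y))).integrable_of_hasCompactSupport
        (HasCompactSupport.intro hk fun y hy => h0 x y hy)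
    -- testing with `verticalTest χ ψ` moves the difference `u - vertMean` onto the derivative `g`
    set P : ℝ → ℝ := fun x => ∫ r, ψ (x, r) with hP
    have hPc : Continuous P := (contDiff_fiber_integral hψ.smooth hk h0).continuous
    have hPfib : ∀ x ∈ A, P x = ∫ y in Ioo 0 (h x), ψ (x, y) := fun x hx =>
      (setIntegral_eq_integral_of_forall_compl_eq_zero fun y hy =>
        hψ.eq_zero (fun hz => hy hz.2)).symm
    obtain ⟨MP, hMP⟩ : ∃ MP, ∀ x, ‖P x‖ ≤ MP := by
      refine (HasCompactSupport.intro (IsCompact.image hψ.compact continuous_fst)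
        (fun x hx => ?_)).exists_bound_of_continuous hPc
      exact integral_eq_zero_of_ae (ae_of_all _ fun r =>
        image_eq_zero_of_notMem_tsupport fun hz => hx ⟨(x, r), hz, rfl⟩)
    have bddP : ∀ {f : ℝ × ℝ → ℝ}, IntegrableOn f S → IntegrableOn (fun z => P z.1 * f z) S :=
      fun hf => Integrable.bdd_mul (c := MP) hf
        (hPc.comp continuous_fst).aestronglyMeasurable (ae_of_all _ fun z => hMP z.1)
    -- integrals of `ψ` against a function of `x`, computed fibrewise
    have fubψ : ∀ {f : ℝ → ℝ}, IntegrableOn f A →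
        ∫ z in S, ψ z * f z.1 = ∫ x in A, P x * f x := by
      intro f hf
      rw [integral_subgraph hA hh (bdd (f := fun z => f z.1) (integrableOn_comp_fst hH hf))]
      refine setIntegral_congr_fun hA.measurableSet fun x hx => ?_
      simp only [hPfib x hx, integral_mul_const]
    have e1 : ∫ z in S, P z.1 * (u z * χ z.2) = ∫ z in S, ψ z * vertMean χ u z.1 := by
      rw [fubψ (integrableOn_vertMean hχ hA hh hH0 hu),
        integral_subgraph hA hh (bddP (IntegrableOn.mul_weight hχ hu))]
      refine setIntegral_congr_fun hA.measurableSet fun x hx => ?_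
      simp only [vertMean_eq_fiber hχ hH0 u hx, integral_const_mul]
    have e2 : ∫ z in S, ψ z * (u z - vertMean χ u z.1) = ∫ z in S, g z * verticalTest χ ψ z := by
      have := hw _ hΨ.smooth hΨ.compact hΨ.subset
      simp only [hΨd] at this
      have e3 : ∫ z in S, u z * (χ z.2 * P z.1 - ψ z) =
          (∫ z in S, P z.1 * (u z * χ z.2)) - ∫ z in S, ψ z * u z := by
        rw [← integral_sub (bddP (IntegrableOn.mul_weight hχ hu)) (bdd hu)]
        congr 1; ext z; ring
      rw [e3, e1] at this
      simp only [mul_sub]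
      rw [integral_sub (bdd hu) (bdd hm)]
      linarith
    rw [e2]
    have hgP : IntegrableOn (fun z => P z.1 * |g z|) S := bddP hg.abs
    calc |∫ z in S, g z * verticalTest χ ψ z| ≤ ∫ z in S, P z.1 * |g z| := by
          refine norm_integral_le_of_norm_le (f := fun z => g z * verticalTest χ ψ z) hgP
            (ae_of_all _ fun z => ?_)
          rw [norm_mul, mul_comm]
          exact mul_le_mul_of_nonneg_right (abs_verticalTest_le hχ hψ0 hi z) (norm_nonneg _)
      _ = ∫ z in S, ψ z * ∫ s in Ioo 0 (h z.1), |g (z.1, s)| := by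
          rw [fubψ hVi, integral_subgraph hA hh hgP]
          refine setIntegral_congr_fun hA.measurableSet fun x hx => ?_
          simp only [integral_const_mul]
  have bdd : ∀ {ψ f : ℝ × ℝ → ℝ}, IsTest S ψ → IntegrableOn f S →
      IntegrableOn (fun z => ψ z * f z) S := fun hψ hf => by
    obtain ⟨M, hM⟩ := hψ.compact.exists_bound_of_continuous hψ.continuous
    exact Integrable.bdd_mul (c := M) hf hψ.continuous.aestronglyMeasurable (ae_of_all _ hM)
  have hd : IntegrableOn (fun z => u z - vertMean χ u z.1) S := Integrable.sub hu hm
  -- the two one-sided bounds, each tested against nonnegative functions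
  have p1 := ae_nonneg_of_integral_test_nonneg hSo
    (f := (fun z : ℝ × ℝ => ∫ s in Ioo 0 (h z.1), |g (z.1, s)|) - fun z => u z - vertMean χ u z.1)
    (Integrable.sub hV hd) fun ψ hψ hψ0 => by
    simp only [Pi.sub_apply, mul_sub]
    have := integral_sub (bdd hψ hV) (bdd hψ hd)
    simp only [mul_sub] at this
    rw [this]
    have := (abs_le.1 (key ψ hψ hψ0)).2
    simp only [mul_sub] at this
    linarith
  have p2 := ae_nonneg_of_integral_test_nonneg hSo
    (f := (fun z : ℝ × ℝ => ∫ s in Ioo 0 (h z.1), |g (z.1, s)|) + fun z => u z - vertMean χ u z.1)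
    (Integrable.add hV hd) fun ψ hψ hψ0 => by
    simp only [Pi.add_apply, mul_add]
    have := integral_add (bdd hψ hV) (bdd hψ hd)
    rw [this]
    have := (abs_le.1 (key ψ hψ hψ0)).1
    linarith
  filter_upwards [p1, p2] with z h1 h2
  simp only [Pi.sub_apply, Pi.add_apply] at h1 h2
  rw [abs_le]
  constructor <;> linarith

/-- The weighted vertical mean of a function with a weak horizontal derivative. -/
theorem hasWeakDeriv_vertMean {χ : ℝ → ℝ} (hχ : IsWeight H₀ χ) {Ω : Set (ℝ × ℝ)}
    (hΩ : A ×ˢ Ioo 0 H₀ ⊆ Ω) {u g : ℝ × ℝ → ℝ} (hu : LocInt Ω u) (hg : LocInt Ω g)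
    (hw : HasWeakDeriv Ω u (1, 0) g) :
    HasWeakDeriv A (vertMean χ u) 1 (vertMean χ g) := by
  rw [hasWeakDeriv_iff] at *
  intro φ hφ
  have hsub : tsupport φ ×ˢ tsupport χ ⊆ Ω := (prod_mono hφ.subset hχ.subset).trans hΩ
  have hcomp : IsCompact (tsupport φ ×ˢ tsupport χ) := IsCompact.prod hφ.compact hχ.compact
  have hzero : ∀ z : ℝ × ℝ, z ∉ tsupport φ ×ˢ tsupport χ → φ z.1 * χ z.2 = 0 := by
    intro z hz
    by_cases h1 : z.1 ∈ tsupport φ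
    · rw [image_eq_zero_of_notMem_tsupport (f := χ) (fun h2 => hz ⟨h1, h2⟩), mul_zero]
    · rw [image_eq_zero_of_notMem_tsupport h1, zero_mul]
  have htest : IsTest Ω fun z : ℝ × ℝ => φ z.1 * χ z.2 := by
    refine ⟨(hφ.smooth.comp contDiff_fst).mul (hχ.smooth.comp contDiff_snd),
      HasCompactSupport.intro hcomp hzero, ?_⟩
    refine (closure_minimal (fun z hz => ?_) hcomp.isClosed).trans hsub
    by_contra hh
    exact hz (hzero z hh)
  have hd : ∀ z : ℝ × ℝ, fderiv ℝ (fun z : ℝ × ℝ => φ z.1 * χ z.2) z (1, 0) =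
      fderiv ℝ φ z.1 1 * χ z.2 := by
    intro z
    have h1 : HasFDerivAt (fun z : ℝ × ℝ => φ z.1) _ z :=
      (hφ.smooth.differentiable (by simp) z.1).hasFDerivAt.comp z hasFDerivAt_fst
    have h2 : HasFDerivAt (fun z : ℝ × ℝ => χ z.2) _ z :=
      (hχ.smooth.differentiable (by simp) z.2).hasFDerivAt.comp z hasFDerivAt_snd
    have h3 : fderiv ℝ (fun z : ℝ × ℝ => φ z.1 * χ z.2) z = _ := (h1.mul h2).fderiv
    rw [h3]
    simp [mul_comm]
  have := hw _ htest
  simp only [hd] at this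
  have i1 : Integrable (fun z : ℝ × ℝ => u z * (fderiv ℝ φ z.1 1 * χ z.2))
      ((volume : Measure ℝ).prod volume) := by
    refine hu.integrable_mul (((hφ.continuous_fderiv 1).comp continuous_fst).mul
      (hχ.smooth.continuous.comp continuous_snd)) hcomp hsub fun z hz => ?_
    by_cases h1 : z.1 ∈ tsupport φ
    · rw [image_eq_zero_of_notMem_tsupport (f := χ) (fun h2 => hz ⟨h1, h2⟩), mul_zero]
    · simp [fderiv_eq_zero_of_notMem_tsupport h1]
  have i2 : Integrable (fun z : ℝ × ℝ => g z * (φ z.1 * χ z.2))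
      ((volume : Measure ℝ).prod volume) := hg.integrable_mul_test htest
  rw [Measure.volume_eq_prod, integral_prod _ i1, integral_prod _ i2] at this
  have e1 : ∀ x, ∫ y, u (x, y) * (fderiv ℝ φ x 1 * χ y) = vertMean χ u x * fderiv ℝ φ x 1 :=
    fun x => by rw [vertMean, ← integral_mul_const]; congr 1; ext y; ring
  have e2 : ∀ x, ∫ y, g (x, y) * (φ x * χ y) = vertMean χ g x * φ x :=
    fun x => by rw [vertMean, ← integral_mul_const]; congr 1; ext y; ring
  simpa only [e1, e2] using this

end Vertical

section Lift

theorem IsTest.comp_prodMk_left {Ω : Set (ℝ × ℝ)} {φ : ℝ × ℝ → ℝ} (hφ : IsTest Ω φ) (y : ℝ)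
    {a b : ℝ} (hΩ : ∀ z ∈ Ω, z.1 ∈ Ioo a b) :
    IsTest (Ioo a b) (fun x => φ (x, y)) ∧
      ∀ x, fderiv ℝ (fun x => φ (x, y)) x 1 = fderiv ℝ φ (x, y) (1, 0) := by
  have hz : ∀ x, x ∉ Prod.fst '' tsupport φ → φ (x, y) = 0 := fun x hx =>
    image_eq_zero_of_notMem_tsupport fun h => hx ⟨(x, y), h, rfl⟩
  have hc : IsCompact (Prod.fst '' tsupport φ) := IsCompact.image hφ.compact continuous_fst
  refine ⟨⟨hφ.smooth.comp
    (contDiff_id.prodMk contDiff_const : ContDiff ℝ ∞ fun x : ℝ => ((x, y) : ℝ × ℝ)),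
    HasCompactSupport.intro hc hz, ?_⟩,
    fun x => ?_⟩
  · refine (closure_minimal (fun x hx => ?_) hc.isClosed).trans ?_
    · by_contra hh; exact hx (hz x hh)
    · rintro _ ⟨z, hz, rfl⟩
      exact hΩ z (hφ.subset hz)
  · have h1 : HasFDerivAt (fun x : ℝ => ((x, y) : ℝ × ℝ)) _ x :=
      (hasFDerivAt_id (𝕜 := ℝ) x).prodMk (hasFDerivAt_const y x)
    have h2 := (hφ.smooth.differentiable (by simp) (x, y)).hasFDerivAt.comp x h1
    have h3 : fderiv ℝ (fun x => φ (x, y)) x = _ := h2.fderiv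
    rw [h3]; simp

theorem IsTest.comp_prodMk_right {Ω : Set (ℝ × ℝ)} {φ : ℝ × ℝ → ℝ} (hφ : IsTest Ω φ) (x : ℝ)
    {a b : ℝ} (hΩ : ∀ z ∈ Ω, z.2 ∈ Ioo a b) :
    IsTest (Ioo a b) (fun y => φ (x, y)) ∧
      ∀ y, fderiv ℝ (fun y => φ (x, y)) y 1 = fderiv ℝ φ (x, y) (0, 1) := by
  have hz : ∀ y, y ∉ Prod.snd '' tsupport φ → φ (x, y) = 0 := fun y hy =>
    image_eq_zero_of_notMem_tsupport fun h => hy ⟨(x, y), h, rfl⟩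
  have hc : IsCompact (Prod.snd '' tsupport φ) := IsCompact.image hφ.compact continuous_snd
  refine ⟨⟨hφ.smooth.comp
    (contDiff_const.prodMk contDiff_id : ContDiff ℝ ∞ fun y : ℝ => ((x, y) : ℝ × ℝ)),
    HasCompactSupport.intro hc hz, ?_⟩,
    fun y => ?_⟩
  · refine (closure_minimal (fun y hy => ?_) hc.isClosed).trans ?_
    · by_contra hh; exact hy (hz y hh)
    · rintro _ ⟨z, hz, rfl⟩
      exact hΩ z (hφ.subset hz)
  · have h1 : HasFDerivAt (fun y : ℝ => ((x, y) : ℝ × ℝ)) _ y :=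
      (hasFDerivAt_const (𝕜 := ℝ) x y).prodMk (hasFDerivAt_id y)
    have h2 := (hφ.smooth.differentiable (by simp) (x, y)).hasFDerivAt.comp y h1
    have h3 : fderiv ℝ (fun y => φ (x, y)) y = _ := h2.fderiv
    rw [h3]; simp

variable {a b : ℝ} {Ω : Set (ℝ × ℝ)} {m m' : ℝ → ℝ}

/-- Products of a function of `x` with a compactly supported continuous function of `(x, y)` that
vanishes off `(a, b) × ℝ`. -/
theorem integrable_fst_mul (hm : IntegrableOn m (Ioo a b)) {φ : ℝ × ℝ → ℝ} (hφ : Continuous φ)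
    {K : Set (ℝ × ℝ)} (hK : IsCompact K) (h0 : ∀ z ∉ K, φ z = 0)
    (hΩ : ∀ z ∈ K, z.1 ∈ Ioo a b) : Integrable fun z : ℝ × ℝ => m z.1 * φ z := by
  have hloc : LocInt (Ioo a b ×ˢ (univ : Set ℝ)) (fun z : ℝ × ℝ => m z.1) := by
    intro K hK hc
    obtain ⟨c, d, hcd⟩ : ∃ c d, Prod.snd '' K ⊆ Icc c d := by
      have := (hc.image continuous_snd).isBounded
      exact ⟨_, _, this.subset_Icc_sInf_sSup⟩
    have h1 : Integrable (fun z : ℝ × ℝ => m z.1 * (1 : ℝ))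
        ((volume.restrict (Ioo a b)).prod (volume.restrict (Icc c d))) :=
      Integrable.mul_prod (L := ℝ) (g := fun _ => (1 : ℝ)) hm (integrable_const _)
    rw [Measure.prod_restrict, ← Measure.volume_eq_prod] at h1
    simp only [mul_one] at h1
    exact IntegrableOn.mono_set h1 fun z hz => ⟨(hK hz).1, hcd ⟨z, hz, rfl⟩⟩
  exact hloc.integrable_mul hφ hK (fun z hz => ⟨hΩ z hz, trivial⟩) h0

/-- A function of `x` alone has the expected weak gradient on planar sets over `(a, b)`. -/
theorem hasWeakDeriv_comp_fst (hΩ : ∀ z ∈ Ω, z.1 ∈ Ioo a b) (hm : IntegrableOn m (Ioo a b))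
    (hm' : IntegrableOn m' (Ioo a b)) (h : HasWeakDeriv (Ioo a b) m 1 m') :
    HasWeakDeriv Ω (fun z => m z.1) (1, 0) (fun z => m' z.1) ∧
      HasWeakDeriv Ω (fun z => m z.1) (0, 1) (fun _ => 0) := by
  rw [hasWeakDeriv_iff] at h
  have hK0 : ∀ {φ : ℝ × ℝ → ℝ} {w : ℝ × ℝ}, ∀ z ∉ tsupport φ, fderiv ℝ φ z w = 0 :=
    fun z hz => by simp [fderiv_eq_zero_of_notMem_tsupport hz]
  constructor <;> rw [hasWeakDeriv_iff] <;> intro φ hφ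
  · have i1 : Integrable (fun z : ℝ × ℝ => m z.1 * fderiv ℝ φ z (1, 0))
        ((volume : Measure ℝ).prod volume) :=
      integrable_fst_mul hm (hφ.continuous_fderiv _) hφ.compact hK0
        fun z hz => hΩ z (hφ.subset hz)
    have i2 : Integrable (fun z : ℝ × ℝ => m' z.1 * φ z) ((volume : Measure ℝ).prod volume) :=
      integrable_fst_mul hm' hφ.continuous hφ.compact
        (fun z hz => image_eq_zero_of_notMem_tsupport hz) fun z hz => hΩ z (hφ.subset hz)
    rw [Measure.volume_eq_prod, integral_prod_symm _ i1, integral_prod_symm _ i2, ← integral_neg]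
    congr 1; ext y
    obtain ⟨h1, h2⟩ := hφ.comp_prodMk_left y hΩ
    simp only [← h2]
    exact h _ h1
  · have i1 : Integrable (fun z : ℝ × ℝ => m z.1 * fderiv ℝ φ z (0, 1))
        ((volume : Measure ℝ).prod volume) :=
      integrable_fst_mul hm (hφ.continuous_fderiv _) hφ.compact hK0
        fun z hz => hΩ z (hφ.subset hz)
    rw [Measure.volume_eq_prod, integral_prod _ i1]
    simp only [zero_mul, integral_zero, neg_zero, integral_const_mul]
    refine integral_eq_zero_of_ae (ae_of_all _ fun x => ?_)
    obtain ⟨c, d, hcd⟩ : ∃ c d, Prod.snd '' tsupport φ ⊆ Icc c d :=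
      ⟨_, _, (IsCompact.image hφ.compact continuous_snd).isBounded.subset_Icc_sInf_sSup⟩
    have hφu : IsTest {z : ℝ × ℝ | z.2 ∈ Ioo (c - 1) (d + 1)} φ :=
      ⟨hφ.smooth, hφ.compact, fun z hz => by
        have := hcd ⟨z, hz, rfl⟩
        exact ⟨by linarith [this.1], by linarith [this.2]⟩⟩
    obtain ⟨h1, h2⟩ := hφu.comp_prodMk_right x (fun z hz => hz)
    -- the vertical derivative of a test function has zero integral over every fibre
    have h3 := (hasWeakDeriv_iff.1 (hasWeakDeriv_const (Ω := Ioo (c - 1) (d + 1)) 1 (1 : ℝ))) _ h1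
    simp only [h2, one_mul, zero_mul, integral_zero, neg_zero] at h3
    simp [h3]

/-- A function of `y` alone has the expected vertical weak derivative on planar sets in the strip
`a < y < b`. -/
theorem hasWeakDeriv_comp_snd (hΩ : ∀ z ∈ Ω, z.2 ∈ Ioo a b) (hm : IntegrableOn m (Ioo a b))
    (hm' : IntegrableOn m' (Ioo a b)) (h : HasWeakDeriv (Ioo a b) m 1 m') :
    HasWeakDeriv Ω (fun z => m z.2) (0, 1) (fun z => m' z.2) := by
  rw [hasWeakDeriv_iff] at h ⊢
  intro φ hφ
  have sw : ∀ {f : ℝ → ℝ} {ψ : ℝ × ℝ → ℝ}, IntegrableOn f (Ioo a b) → Continuous ψ →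
      (∀ z ∉ tsupport φ, ψ z = 0) → Integrable fun z : ℝ × ℝ => f z.2 * ψ z := by
    intro f ψ hf hψ h0
    have h1 : Integrable fun z : ℝ × ℝ => f z.1 * ψ z.swap := by
      refine integrable_fst_mul hf (hψ.comp continuous_swap)
        (IsCompact.image hφ.compact continuous_swap) (fun z hz => h0 _ fun hh => hz ⟨_, hh, by simp⟩) ?_
      rintro _ ⟨z, hz, rfl⟩
      exact hΩ z (hφ.subset hz)
    exact h1.swap
  have i1 : Integrable (fun z : ℝ × ℝ => m z.2 * fderiv ℝ φ z (0, 1))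
      ((volume : Measure ℝ).prod volume) := sw hm (hφ.continuous_fderiv _) fun z hz => by
        simp [fderiv_eq_zero_of_notMem_tsupport hz]
  have i2 : Integrable (fun z : ℝ × ℝ => m' z.2 * φ z) ((volume : Measure ℝ).prod volume) :=
    sw hm' hφ.continuous fun z hz => image_eq_zero_of_notMem_tsupport hz
  rw [Measure.volume_eq_prod, integral_prod _ i1, integral_prod _ i2, ← integral_neg]
  congr 1; ext x
  obtain ⟨h1, h2⟩ := hφ.comp_prodMk_right x hΩ
  simp only [← h2]
  exact h _ h1

end Lift

section OneDim

variable {ℓ : ℝ} {m m' : ℝ → ℝ}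

/-- A function on an interval differs from some constant by at most the integral of its weak
derivative. -/
theorem exists_abs_sub_le_integral (hℓ : 0 < ℓ) (hm : IntegrableOn m (Ioo 0 ℓ))
    (hm' : IntegrableOn m' (Ioo 0 ℓ)) (h : HasWeakDeriv (Ioo 0 ℓ) m 1 m') :
    ∃ c, ∀ᵐ x ∂volume.restrict (Ioo 0 ℓ), |m x - c| ≤ ∫ s in Ioo 0 ℓ, |m' s| := by
  -- apply the vertical estimate to the function `m(y)` on the rectangle `(0,1) × (0,ℓ)`
  obtain ⟨χ, hχ⟩ := exists_isWeight hℓ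
  have hS : ∀ z ∈ subgraph (Ioo (0 : ℝ) 1) (fun _ => ℓ), z.2 ∈ Ioo 0 ℓ := fun z hz => hz.2
  have hint : ∀ {f : ℝ → ℝ}, IntegrableOn f (Ioo 0 ℓ) →
      IntegrableOn (fun z : ℝ × ℝ => f z.2) (subgraph (Ioo (0 : ℝ) 1) (fun _ => ℓ)) := by
    intro f hf
    have h1 : Integrable (fun z : ℝ × ℝ => (1 : ℝ) * f z.2)
        ((volume.restrict (Ioo (0 : ℝ) 1)).prod (volume.restrict (Ioo 0 ℓ))) :=
      Integrable.mul_prod (L := ℝ) (f := fun _ => (1 : ℝ)) (integrable_const _) hf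
    rw [Measure.prod_restrict, ← Measure.volume_eq_prod] at h1
    simp only [one_mul] at h1
    exact h1
  have hae := abs_sub_vertMean_le isOpen_Ioo continuousOn_const (H₀ := ℓ) (H₁ := ℓ)
    (fun _ _ => le_rfl) (fun _ _ => le_rfl) hχ (hint hm) (hint hm')
    (hasWeakDeriv_comp_snd hS hm hm' h)
  refine ⟨∫ y, m y * χ y, ?_⟩
  have hprod : subgraph (Ioo (0 : ℝ) 1) (fun _ => ℓ) = Ioo (0 : ℝ) 1 ×ˢ Ioo 0 ℓ := rfl
  rw [hprod, Measure.volume_eq_prod, ← Measure.prod_restrict] at hae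
  have h2 := Measure.ae_ae_of_ae_prod hae
  have hne : (volume.restrict (Ioo (0 : ℝ) 1)) ≠ 0 := by simp
  have : (ae (volume.restrict (Ioo (0 : ℝ) 1))).NeBot := ae_neBot.2 hne
  obtain ⟨x, hx⟩ := h2.exists
  exact hx

/-- A function with zero weak derivative on an interval is constant. -/
theorem exists_ae_eq_const (hℓ : 0 < ℓ) (hm : IntegrableOn m (Ioo 0 ℓ))
    (h : HasWeakDeriv (Ioo 0 ℓ) m 1 (fun _ => 0)) :
    ∃ c, ∀ᵐ x ∂volume.restrict (Ioo 0 ℓ), m x = c := by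
  obtain ⟨c, hc⟩ := exists_abs_sub_le_integral hℓ hm integrableOn_zero h
  refine ⟨c, ?_⟩
  filter_upwards [hc] with x hx
  simpa [sub_eq_zero] using hx

end OneDim

end RoughThin

/-! ### Periodic extension and periodization -/

namespace RoughThin

section Periodic

/-- A continuous `L`-periodic profile between two positive constants. -/
structure IsCellProfile (L : ℝ) (Γ : ℝ → ℝ) (H₀ H₁ : ℝ) : Prop where
  period_pos : 0 < L
  lower_pos : 0 < H₀
  continuous : Continuous Γ
  periodic : ∀ y, Γ (y + L) = Γ y
  lower : ∀ y, H₀ ≤ Γ y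
  upper : ∀ y, Γ y ≤ H₁

variable {L H₀ H₁ p p' : ℝ} {Γ : ℝ → ℝ}

namespace IsCellProfile

theorem periodic_int (hΓ : IsCellProfile L Γ H₀ H₁) (j : ℤ) (y : ℝ) : Γ (y + j * L) = Γ y :=
  (show Function.Periodic Γ L from hΓ.periodic).int_mul j y

theorem isOpen_cell (hΓ : IsCellProfile L Γ H₀ H₁) : IsOpen (cell L Γ) :=
  isOpen_subgraph isOpen_Ioo hΓ.continuous.continuousOn

theorem isOpen_strip (hΓ : IsCellProfile L Γ H₀ H₁) : IsOpen (strip Γ) := by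
  rw [strip_eq_subgraph]; exact isOpen_subgraph isOpen_univ hΓ.continuous.continuousOn

theorem upper_pos (hΓ : IsCellProfile L Γ H₀ H₁) : 0 < H₁ :=
  hΓ.lower_pos.trans_le ((hΓ.lower 0).trans (hΓ.upper 0))

theorem finite_cell (hΓ : IsCellProfile L Γ H₀ H₁) :
    IsFiniteMeasure (volume.restrict (cell L Γ)) := ⟨by
  rw [Measure.restrict_apply_univ]
  refine (measure_mono (subgraph_subset_prod (H₁ := H₁) fun x _ => hΓ.upper x)).trans_lt ?_
  rw [Measure.volume_eq_prod, Measure.prod_prod]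
  exact ENNReal.mul_lt_top (by simp) (by simp)⟩

end IsCellProfile

theorem cell_subset_strip : cell L Γ ⊆ strip Γ := fun _ hz => hz.2

/-- The translate of the cell by `j` periods. -/
def shiftedCell (L : ℝ) (Γ : ℝ → ℝ) (j : ℤ) : Set (ℝ × ℝ) :=
  diagMap 1 (-(j * L)) 1 ⁻¹' cell L Γ

theorem mem_shiftedCell (hΓ : IsCellProfile L Γ H₀ H₁) {j : ℤ} {z : ℝ × ℝ} :
    z ∈ shiftedCell L Γ j ↔ z ∈ strip Γ ∧ j * L < z.1 ∧ z.1 < (j + 1) * L := by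
  have h := hΓ.periodic_int (-j) z.1
  push_cast at h
  rw [neg_mul, ← sub_eq_add_neg] at h
  simp only [shiftedCell, diagMap, cell, strip, mem_preimage, Set.mem_ofPred_eq, mem_Ioo, one_mul,
    ← sub_eq_add_neg, h]
  constructor
  · rintro ⟨⟨h1, h2⟩, h3⟩; exact ⟨h3, by linarith, by linarith⟩
  · rintro ⟨h3, h1, h2⟩; exact ⟨⟨by linarith, by linarith⟩, h3⟩

theorem perExt_of_mem_shiftedCell {β : Type*} (hL : 0 < L) {j : ℤ} {z : ℝ × ℝ}
    (hz : z ∈ shiftedCell L Γ j) (h : ℝ × ℝ → β) :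
    perExt L h z = h (z.1 - j * L, z.2) := by
  have h1 : 0 < z.1 - j * L ∧ z.1 - j * L < L := by
    have := hz.1
    simpa [diagMap, ← sub_eq_add_neg] using this
  have hfl : ⌊z.1 / L⌋ = j := by
    rw [Int.floor_eq_iff]
    constructor
    · rw [le_div_iff₀ hL]; linarith
    · rw [div_lt_iff₀ hL]; linarith
  rw [perExt, Int.fract, hfl, mul_sub, mul_div_cancel₀ _ hL.ne', mul_comm L]

theorem perExt_of_mem_cell {β : Type*} (hL : 0 < L) {z : ℝ × ℝ} (hz : z ∈ cell L Γ)
    (h : ℝ × ℝ → β) : perExt L h z = h z := by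
  have : z ∈ shiftedCell L Γ 0 := by simpa [shiftedCell, diagMap] using hz
  rw [perExt_of_mem_shiftedCell hL this]; simp

theorem ae_strip_mem_shiftedCell (hΓ : IsCellProfile L Γ H₀ H₁) :
    ∀ᵐ z ∂volume.restrict (strip Γ), ∃ j : ℤ, z ∈ shiftedCell L Γ j := by
  have h1 : ∀ᵐ z : ℝ × ℝ, z.1 ∉ range fun j : ℤ => (j : ℝ) * L := by
    have hn : volume (range fun j : ℤ => (j : ℝ) * L) = 0 := (countable_range _).measure_zero _
    have : volume ((range fun j : ℤ => (j : ℝ) * L) ×ˢ (univ : Set ℝ)) = 0 := by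
      rw [Measure.volume_eq_prod, Measure.prod_prod, hn, zero_mul]
    filter_upwards [measure_eq_zero_iff_ae_notMem.1 this] with z hz hh
    exact hz ⟨hh, trivial⟩
  filter_upwards [ae_restrict_of_ae h1, ae_restrict_mem hΓ.isOpen_strip.measurableSet] with z hz hzs
  refine ⟨⌊z.1 / L⌋, (mem_shiftedCell hΓ).2 ⟨hzs, ?_, ?_⟩⟩
  · have h2 : (⌊z.1 / L⌋ : ℝ) * L ≤ z.1 := by
      rw [← le_div_iff₀ hΓ.period_pos]; exact Int.floor_le _
    exact lt_of_le_of_ne h2 fun he => hz ⟨_, he⟩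
  · rw [← div_lt_iff₀ hΓ.period_pos]; exact Int.lt_floor_add_one _

theorem measurableSet_shiftedCell (hΓ : IsCellProfile L Γ H₀ H₁) (j : ℤ) :
    MeasurableSet (shiftedCell L Γ j) :=
  hΓ.isOpen_cell.measurableSet.preimage contDiff_diagMap.continuous.measurable

/-- Statements that hold almost everywhere in the cell hold, after periodic extension, almost
everywhere in the strip. -/
theorem ae_strip_of_ae_cell (hΓ : IsCellProfile L Γ H₀ H₁) {P : ℝ × ℝ → Prop}
    (h : ∀ᵐ z ∂volume.restrict (cell L Γ), P z) :
    ∀ᵐ z ∂volume.restrict (strip Γ), P (L * Int.fract (z.1 / L), z.2) := by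
  have h1 : ∀ j : ℤ, ∀ᵐ z : ℝ × ℝ, z ∈ shiftedCell L Γ j → P (z.1 - j * L, z.2) := by
    intro j
    rw [← ae_restrict_iff' (measurableSet_shiftedCell hΓ j)]
    have := ae_comp_diagMap (α := 1) (β := -(j * L)) (γ := 1) one_ne_zero one_ne_zero h
    simpa [shiftedCell, diagMap, ← sub_eq_add_neg] using this
  filter_upwards [ae_strip_mem_shiftedCell hΓ, ae_restrict_of_ae (ae_all_iff.2 h1)] with z ⟨j, hj⟩ hz
  have := perExt_of_mem_shiftedCell hΓ.period_pos hj (fun y => y)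
  simp only [perExt] at this
  rw [this]
  exact hz j hj

/-- The sum of all translates of `η` by multiples of the period. -/
noncomputable def perSum {F : Type*} [AddCommMonoid F] [TopologicalSpace F] (L : ℝ)
    (η : ℝ × ℝ → F) (z : ℝ × ℝ) : F := ∑' j : ℤ, η (z.1 + j * L, z.2)

/-- Over a bounded range of `x` only boundedly many translates contribute to the periodization, so
it is a finite sum there. -/
theorem perSum_eq_sum {F : Type*} [AddCommMonoid F] [TopologicalSpace F] (hL : 0 < L) {R R' : ℝ}
    {η : ℝ × ℝ → F} (hη : ∀ z : ℝ × ℝ, R < |z.1| → η z = 0) {J : ℕ} (hJ : R + R' < J * L)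
    {z : ℝ × ℝ} (hz : |z.1| ≤ R') :
    perSum L η z = ∑ j ∈ Finset.Icc (-(J : ℤ)) J, η (z.1 + j * L, z.2) := by
  refine tsum_eq_sum fun j hj => hη _ ?_
  simp only
  have h1 : (J : ℝ) < |(j : ℝ)| := by
    rw [Finset.mem_Icc, ← abs_le, not_le] at hj
    exact_mod_cast hj
  have h2 : |(j : ℝ)| * L = |(j : ℝ) * L| := by rw [abs_mul, abs_of_pos hL]
  have h3 : |(j : ℝ) * L| ≤ |z.1 + j * L| + |z.1| := by
    have := abs_sub (z.1 + j * L) z.1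
    simpa using this
  nlinarith

theorem perSum_add_int {F : Type*} [AddCommMonoid F] [TopologicalSpace F] [T2Space F]
    (η : ℝ × ℝ → F) (k : ℤ) (x y : ℝ) : perSum L η (x - k * L, y) = perSum L η (x, y) := by
  simp only [perSum]
  rw [← (Equiv.addRight k).tsum_eq]
  congr 1; ext j
  simp only [Equiv.coe_addRight]
  congr 2
  push_cast; ring

/-- A periodization is its own periodic extension, everywhere and not only almost everywhere. -/
theorem perExt_perSum {F : Type*} [AddCommMonoid F] [TopologicalSpace F] [T2Space F]
    (hL : 0 < L) (η : ℝ × ℝ → F) : perExt L (perSum L η) = perSum L η := by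
  ext z
  rw [perExt, Int.fract, mul_sub, mul_div_cancel₀ _ hL.ne', mul_comm L, perSum_add_int]

theorem exists_nat_mul_gt (hL : 0 < L) (R : ℝ) : ∃ J : ℕ, R < J * L := by
  obtain ⟨J, hJ⟩ := exists_nat_gt (R / L)
  exact ⟨J, by rwa [div_lt_iff₀ hL] at hJ⟩

/-- Unfolding: the integral over the strip of a function of bounded horizontal support is the
integral over one cell of the sum of its translates. -/
theorem integral_strip_eq (hΓ : IsCellProfile L Γ H₀ H₁) {R : ℝ} {f : ℝ × ℝ → ℝ}
    (hf : ∀ z : ℝ × ℝ, R < |z.1| → f z = 0)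
    (hi : ∀ j : ℤ, IntegrableOn (fun z : ℝ × ℝ => f (z.1 + j * L, z.2)) (cell L Γ)) :
    IntegrableOn f (strip Γ) ∧ ∫ z in strip Γ, f z = ∫ z in cell L Γ, perSum L f z := by
  obtain ⟨J, hJ⟩ := exists_nat_mul_gt hΓ.period_pos (R + L)
  have hpre : ∀ j : ℤ, IntegrableOn f (shiftedCell L Γ j) ∧
      ∫ z in shiftedCell L Γ j, f z = ∫ z in cell L Γ, f (z.1 + j * L, z.2) := by
    intro j
    have h1 : ∀ z : ℝ × ℝ, (((diagMap 1 (-(j * L)) 1 z).1 + j * L, (diagMap 1 (-(j * L)) 1 z).2) :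
        ℝ × ℝ) = z := fun z => by ext <;> simp [diagMap]
    constructor
    · have h2 := memLp_comp_diagMap (q := 1) (α := 1) (β := -(j * L)) (γ := 1) one_ne_zero
        one_ne_zero (memLp_one_iff_integrable.2 (hi j))
      simp only [h1] at h2
      exact memLp_one_iff_integrable.1 h2
    · have h2 := setIntegral_comp_diagMap (α := 1) (β := -(j * L)) (γ := 1) one_ne_zero
        one_ne_zero (cell L Γ) (fun z : ℝ × ℝ => f (z.1 + j * L, z.2))
      simp only [h1] at h2
      simpa [shiftedCell] using h2
  have hdisj : Set.Pairwise (↑(Finset.Icc (-(J : ℤ)) J))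
      (Function.onFun Disjoint (shiftedCell L Γ)) := by
    intro i _ j _ hij
    rw [Function.onFun, Set.disjoint_left]
    intro z hzi hzj
    obtain ⟨-, h1, h2⟩ := (mem_shiftedCell hΓ).1 hzi
    obtain ⟨-, h3, h4⟩ := (mem_shiftedCell hΓ).1 hzj
    have h5 : (i : ℝ) < j + 1 := lt_of_mul_lt_mul_right (h1.trans h4) hΓ.period_pos.le
    have h6 : (j : ℝ) < i + 1 := lt_of_mul_lt_mul_right (h3.trans h2) hΓ.period_pos.le
    have h7 : i < j + 1 := by exact_mod_cast h5
    have h8 : j < i + 1 := by exact_mod_cast h6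
    omega
  -- up to null sets, `f` lives on finitely many disjoint translates of the cell
  set W := ⋃ j ∈ Finset.Icc (-(J : ℤ)) J, shiftedCell L Γ j with hW
  have hWs : W ⊆ strip Γ := by
    intro z hz
    simp only [hW, mem_iUnion] at hz
    obtain ⟨j, -, hj⟩ := hz
    exact ((mem_shiftedCell hΓ).1 hj).1
  have hWm : MeasurableSet W := Finset.measurableSet_biUnion _ fun j _ => measurableSet_shiftedCell hΓ j
  have hWi : IntegrableOn f W := by
    rw [hW, integrableOn_finset_iUnion]
    exact fun j _ => (hpre j).1
  have hzero : ∀ᵐ z ∂volume.restrict (strip Γ), z ∉ W → f z = 0 := by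
    filter_upwards [ae_strip_mem_shiftedCell hΓ] with z ⟨j, hj⟩ hz
    refine hf z ?_
    have hjJ : j ∉ Finset.Icc (-(J : ℤ)) J := fun hh => hz (by
      simp only [hW, mem_iUnion]; exact ⟨j, hh, hj⟩)
    obtain ⟨-, h1, h2⟩ := (mem_shiftedCell hΓ).1 hj
    have hL := hΓ.period_pos
    rw [Finset.mem_Icc, not_and_or, not_le, not_le] at hjJ
    rcases hjJ with h | h
    · have h3 : (j : ℝ) + 1 ≤ -J := by exact_mod_cast h
      rw [lt_abs]; right; nlinarith
    · have h3 : (J : ℝ) + 1 ≤ j := by exact_mod_cast h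
      rw [lt_abs]; left; nlinarith
  have hind : f =ᵐ[volume.restrict (strip Γ)] W.indicator f := by
    filter_upwards [hzero] with z hz
    by_cases hzW : z ∈ W
    · rw [indicator_of_mem hzW]
    · rw [indicator_of_notMem hzW, hz hzW]
  constructor
  · refine Integrable.congr ?_ hind.symm
    rw [integrable_indicator_iff hWm, IntegrableOn, Measure.restrict_restrict hWm,
      inter_eq_left.2 hWs]
    exact hWi
  · rw [integral_congr_ae hind, integral_indicator hWm, Measure.restrict_restrict hWm,
      inter_eq_left.2 hWs, hW, integral_biUnion_finset _ (fun j _ => measurableSet_shiftedCell hΓ j)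
        hdisj (fun j _ => (hpre j).1)]
    simp only [(hpre _).2]
    rw [← integral_finsetSum _ fun j _ => hi j]
    refine setIntegral_congr_fun hΓ.isOpen_cell.measurableSet fun z hz => ?_
    refine (perSum_eq_sum hΓ.period_pos hf hJ ?_).symm
    rw [abs_le]
    exact ⟨by linarith [hz.1.1, hΓ.period_pos], hz.1.2.le⟩

/-- Testing a periodic extension against `ρ` amounts to testing on the cell against the
periodization of `ρ`. -/
theorem integral_perExt_mul (hΓ : IsCellProfile L Γ H₀ H₁) {R : ℝ} {f ρ : ℝ × ℝ → ℝ}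
    (hρ : ∀ z : ℝ × ℝ, R < |z.1| → ρ z = 0)
    (hi : ∀ j : ℤ, IntegrableOn (fun z : ℝ × ℝ => f z * ρ (z.1 + j * L, z.2)) (cell L Γ)) :
    IntegrableOn (fun z => perExt L f z * ρ z) (strip Γ) ∧
    ∫ z in strip Γ, perExt L f z * ρ z = ∫ z in cell L Γ, f z * perSum L ρ z := by
  have hcm := hΓ.isOpen_cell.measurableSet
  have hsh : ∀ (j : ℤ), ∀ z ∈ cell L Γ, perExt L f (z.1 + j * L, z.2) = f z := by
    intro j z hz
    have : ((z.1 + j * L, z.2) : ℝ × ℝ) ∈ shiftedCell L Γ j := by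
      simpa [shiftedCell, diagMap] using hz
    rw [perExt_of_mem_shiftedCell hΓ.period_pos this]; simp
  obtain ⟨h1, h2⟩ := integral_strip_eq hΓ (R := R) (f := fun z => perExt L f z * ρ z)
    (fun z hz => by simp [hρ z hz]) (fun j => (hi j).congr_fun (fun z hz => by
      simp only [hsh j z hz]) hcm)
  refine ⟨h1, h2.trans (setIntegral_congr_fun hcm fun z hz => ?_)⟩
  simp only [perSum, ← tsum_mul_left]
  congr 1; ext j
  rw [hsh j z hz]

/-- Local integrability follows by unfolding against the indicator of the compact set. -/
theorem locInt_perExt (hΓ : IsCellProfile L Γ H₀ H₁) {f : ℝ × ℝ → ℝ}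
    (hf : IntegrableOn f (cell L Γ)) : LocInt (strip Γ) (perExt L f) := by
  intro K hK hc
  obtain ⟨R, hR⟩ := (hc.image continuous_fst).isBounded.exists_norm_le
  have hind : ∀ z : ℝ × ℝ, R < |z.1| → K.indicator (fun _ => (1 : ℝ)) z = 0 := fun z hz => by
    refine indicator_of_notMem (fun hzK => ?_) _
    exact absurd (hR _ ⟨z, hzK, rfl⟩) (by rw [Real.norm_eq_abs]; linarith)
  have h1 := (integral_perExt_mul hΓ (f := f) hind fun j => by
    refine Integrable.mul_bdd (c := 1) hf ?_ (ae_of_all _ fun z => ?_)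
    · refine (Measurable.indicator measurable_const hc.measurableSet).comp ?_ |>.aestronglyMeasurable
      fun_prop
    · by_cases hz : ((z.1 + j * L, z.2) : ℝ × ℝ) ∈ K <;> simp [hz]).1
  have h2 : (fun z => perExt L f z * K.indicator (fun _ => (1 : ℝ)) z) =
      K.indicator (perExt L f) := by
    ext z; by_cases hz : z ∈ K <;> simp [hz]
  rw [h2] at h1
  have h3 := (integrable_indicator_iff hc.measurableSet).1 h1
  rwa [IntegrableOn, Measure.restrict_restrict hc.measurableSet, inter_eq_left.2 hK] at h3

theorem exists_bound_fst_of_isCompact {K : Set (ℝ × ℝ)} (hc : IsCompact K) :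
    ∃ R : ℝ, ∀ z : ℝ × ℝ, R < |z.1| → z ∉ K := by
  obtain ⟨R, hR⟩ := (hc.image continuous_fst).isBounded.exists_norm_le
  exact ⟨R, fun z hz hzK => absurd (hR _ ⟨z, hzK, rfl⟩) (by rw [Real.norm_eq_abs]; linarith)⟩

/-- The periodization of a bounded measurable function of bounded horizontal support is bounded
on the cell. -/
theorem exists_bound_perSum (hL : 0 < L) {R M : ℝ} {ρ : ℝ × ℝ → ℝ} (hc : Measurable ρ)
    (hρ : ∀ z : ℝ × ℝ, R < |z.1| → ρ z = 0) (hM : ∀ z, |ρ z| ≤ M) :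
    ∃ M', (∀ z ∈ cell L Γ, |perSum L ρ z| ≤ M') ∧ ∃ s : ℝ × ℝ → ℝ, Measurable s ∧
      ∀ z ∈ cell L Γ, perSum L ρ z = s z := by
  obtain ⟨J, hJ⟩ := exists_nat_mul_gt hL (R + L)
  have he : ∀ z ∈ cell L Γ, perSum L ρ z =
      ∑ j ∈ Finset.Icc (-(J : ℤ)) J, ρ (z.1 + j * L, z.2) := fun z hz =>
    perSum_eq_sum hL hρ hJ (by rw [abs_le]; exact ⟨by linarith [hz.1.1], hz.1.2.le⟩)
  refine ⟨∑ j ∈ Finset.Icc (-(J : ℤ)) J, M, fun z hz => ?_, _, ?_, he⟩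
  · rw [he z hz]
    exact (Finset.abs_sum_le_sum_abs _ _).trans (Finset.sum_le_sum fun j _ => hM _)
  · exact Finset.measurable_sum _ fun j _ => hc.comp (by fun_prop)

/-- The weak derivative of a periodic extension, tested on the cell only. -/
theorem hasWeakDeriv_perExt_iff (hΓ : IsCellProfile L Γ H₀ H₁) {f g : ℝ × ℝ → ℝ} {w : ℝ × ℝ}
    (hf : IntegrableOn f (cell L Γ)) (hg : IntegrableOn g (cell L Γ)) :
    HasWeakDeriv (strip Γ) (perExt L f) w (perExt L g) ↔
      ∀ φ, IsTest (strip Γ) φ →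
        ∫ z in cell L Γ, f z * perSum L (fun z => fderiv ℝ φ z w) z =
          - ∫ z in cell L Γ, g z * perSum L φ z := by
  have key : ∀ {f ρ : ℝ × ℝ → ℝ}, IntegrableOn f (cell L Γ) → Continuous ρ → HasCompactSupport ρ →
      ∫ z in strip Γ, perExt L f z * ρ z = ∫ z in cell L Γ, f z * perSum L ρ z := by
    intro f ρ hf hρ hc
    obtain ⟨R, hR⟩ := exists_bound_fst_of_isCompact hc
    obtain ⟨M, hM⟩ := hc.exists_bound_of_continuous hρ
    refine (integral_perExt_mul hΓ (fun z hz => image_eq_zero_of_notMem_tsupport (hR z hz))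
      fun j => ?_).2
    exact Integrable.mul_bdd (c := M) hf (hρ.comp (by fun_prop)).aestronglyMeasurable
      (ae_of_all _ fun z => hM _)
  constructor
  · intro h φ hφ
    rw [← key hf (hφ.continuous_fderiv w) (hφ.compact.fderiv_apply ℝ w),
      ← key hg hφ.continuous hφ.compact]
    exact h φ hφ.smooth hφ.compact hφ.subset
  · intro h φ h1 h2 h3
    have hφ : IsTest (strip Γ) φ := ⟨h1, h2, h3⟩
    rw [key hf (hφ.continuous_fderiv w) (hφ.compact.fderiv_apply ℝ w),
      key hg hφ.continuous hφ.compact]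
    exact h φ hφ

/-- The periodization of a function with a weak derivative on the strip and bounded horizontal
support. -/
theorem hasWeakDeriv_perSum (hΓ : IsCellProfile L Γ H₀ H₁) {η g : ℝ × ℝ → ℝ} {w : ℝ × ℝ} {R : ℝ}
    (hη0 : ∀ z : ℝ × ℝ, R < |z.1| → η z = 0) (hg0 : ∀ z : ℝ × ℝ, R < |z.1| → g z = 0)
    (hη : LocInt (strip Γ) η) (hg : LocInt (strip Γ) g) (h : HasWeakDeriv (strip Γ) η w g) :
    HasWeakDeriv (strip Γ) (perSum L η) w (perSum L g) := by
  have hpre : ∀ j : ℤ, diagMap 1 (j * L) 1 ⁻¹' strip Γ = strip Γ := fun j => by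
    ext z; simp [diagMap, strip, hΓ.periodic_int]
  have hd : ∀ (f : ℝ × ℝ → ℝ) (j : ℤ) z, f (diagMap 1 (j * L) 1 z) = f (z.1 + j * L, z.2) :=
    fun f j z => by simp [diagMap]
  have hshift : ∀ j : ℤ, HasWeakDeriv (strip Γ) (fun z => η (z.1 + j * L, z.2)) w
      (fun z => g (z.1 + j * L, z.2)) := fun j => by
    have := HasWeakDeriv.comp_diagMap (α := 1) (β := j * L) (γ := 1) one_ne_zero one_ne_zero
      (w := w) (by simpa using h)
    simpa only [hpre, hd] using this
  have hloc : ∀ {f : ℝ × ℝ → ℝ}, LocInt (strip Γ) f → ∀ j : ℤ,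
      LocInt (strip Γ) (fun z => f (z.1 + j * L, z.2)) := by
    intro f hf j K hK hc
    have hB : IsCompact (diagMap 1 (j * L) 1 '' K) := hc.image contDiff_diagMap.continuous
    have hBs : diagMap 1 (j * L) 1 '' K ⊆ strip Γ := by
      rintro _ ⟨z, hz, rfl⟩
      have := hK hz
      rwa [← hpre j] at this
    have := memLp_comp_diagMap (q := 1) (α := 1) (β := j * L) (γ := 1) one_ne_zero
      one_ne_zero (memLp_one_iff_integrable.2 (hf _ hBs hB))
    simp only [hd] at this
    exact (memLp_one_iff_integrable.1 this).mono_measure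
      (Measure.restrict_mono (subset_preimage_image _ _) le_rfl)
  have hsumloc : ∀ {f : ℝ × ℝ → ℝ}, LocInt (strip Γ) f → ∀ s : Finset ℤ,
      LocInt (strip Γ) (fun z => ∑ j ∈ s, f (z.1 + j * L, z.2)) := fun hf s K hK hc =>
    integrable_finsetSum _ fun j _ => hloc hf j K hK hc
  have hsum : ∀ s : Finset ℤ, HasWeakDeriv (strip Γ) (fun z => ∑ j ∈ s, η (z.1 + j * L, z.2)) w
      (fun z => ∑ j ∈ s, g (z.1 + j * L, z.2)) := by
    classical
    intro s
    induction s using Finset.induction_on with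
    | empty => simpa using hasWeakDeriv_const (Ω := strip Γ) 0 w
    | insert a s ha ih =>
      simp only [Finset.sum_insert ha]
      exact (hshift a).add ih (hloc hη a) (hloc hg a) (hsumloc hη s) (hsumloc hg s)
  rw [hasWeakDeriv_iff]
  intro φ hφ
  obtain ⟨R', hR'⟩ := exists_bound_fst_of_isCompact hφ.compact
  obtain ⟨J, hJ⟩ := exists_nat_mul_gt hΓ.period_pos (R + R')
  have := hasWeakDeriv_iff.1 (hsum (Finset.Icc (-(J : ℤ)) J)) φ hφ
  -- on the support of the test function both periodizations are finite sums
  have e1 : ∫ z, perSum L η z * fderiv ℝ φ z w =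
      ∫ z, (∑ j ∈ Finset.Icc (-(J : ℤ)) J, η (z.1 + j * L, z.2)) * fderiv ℝ φ z w := by
    congr 1; ext z
    by_cases hz : |z.1| ≤ R'
    · rw [perSum_eq_sum hΓ.period_pos hη0 hJ hz]
    · simp [fderiv_eq_zero_of_notMem_tsupport (hR' z (not_le.1 hz))]
  have e2 : ∫ z, perSum L g z * φ z =
      ∫ z, (∑ j ∈ Finset.Icc (-(J : ℤ)) J, g (z.1 + j * L, z.2)) * φ z := by
    congr 1; ext z
    by_cases hz : |z.1| ≤ R'
    · rw [perSum_eq_sum hΓ.period_pos hg0 hJ hz]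
    · simp [image_eq_zero_of_notMem_tsupport (hR' z (not_le.1 hz))]
  rw [e1, e2, this]

end Periodic

end RoughThin

/-! ### Poincaré's inequality and periodic Sobolev functions on the cell -/

namespace RoughThin

section Poincare

variable {L H₀ H₁ p p' : ℝ} {Γ : ℝ → ℝ}

theorem ae_comp_fst {A : Set ℝ} {h : ℝ → ℝ} {P : ℝ → Prop} (hP : ∀ᵐ x ∂volume.restrict A, P x) :
    ∀ᵐ z ∂volume.restrict (subgraph A h), P z.1 := by
  have h1 : ∀ᵐ z ∂((volume.restrict A).prod (volume.restrict (univ : Set ℝ))), P z.1 :=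
    Measure.quasiMeasurePreserving_fst.ae hP
  rw [Measure.prod_restrict, ← Measure.volume_eq_prod] at h1
  exact ae_restrict_of_ae_restrict_of_subset
    (show subgraph A h ⊆ A ×ˢ univ from fun z hz => ⟨hz.1, trivial⟩) h1

theorem memLp_apply {α : Type*} [MeasurableSpace α] {μ : Measure α} {q : ℝ≥0∞} {g : α → Vec2}
    (hg : MemLp g q μ) (i : Fin 2) : MemLp (fun z => g z i) q μ :=
  (EuclideanSpace.proj i : Vec2 →L[ℝ] ℝ).comp_memLp' hg

theorem abs_apply_le (s : Vec2) (i : Fin 2) : |s i| ≤ ‖s‖ := PiLp.norm_apply_le s i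

namespace IsCellProfile

theorem integrableOn_cell (hΓ : IsCellProfile L Γ H₀ H₁) (hp : 1 < p) {F : Type*}
    [NormedAddCommGroup F] {f : ℝ × ℝ → F}
    (hf : MemLp f (ENNReal.ofReal p) (volume.restrict (cell L Γ))) : IntegrableOn f (cell L Γ) :=
  have := hΓ.finite_cell
  hf.integrable (by simpa using ENNReal.ofReal_le_ofReal hp.le)

theorem volume_cell_pos (hΓ : IsCellProfile L Γ H₀ H₁) : 0 < volume.real (cell L Γ) := by
  have hL := hΓ.period_pos
  have h0 := hΓ.lower_pos
  have hfin := hΓ.finite_cell.measure_univ_lt_top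
  rw [Measure.restrict_apply_univ] at hfin
  refine ENNReal.toReal_pos (ne_of_gt ?_) hfin.ne
  have hs : Ioo (0 : ℝ) L ×ˢ Ioo 0 H₀ ⊆ cell L Γ := fun z hz =>
    ⟨hz.1, hz.2.1, hz.2.2.trans_le (hΓ.lower _)⟩
  refine lt_of_lt_of_le ?_ (measure_mono hs)
  rw [Measure.volume_eq_prod, Measure.prod_prod]
  simp [hL, h0]

end IsCellProfile

/-- Poincaré's inequality on the cell: control the oscillation along vertical segments by
`∂₂φ`, and the vertical mean by `∂₁φ`. -/
theorem exists_poincare (hp : p.HolderConjugate p') (hΓ : IsCellProfile L Γ H₀ H₁) :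
    ∃ C : ℝ, 0 ≤ C ∧ ∀ (φ : ℝ × ℝ → ℝ) (g : ℝ × ℝ → Vec2), MemW p (cell L Γ) φ g →
      ∃ c : ℝ, ∫ z in cell L Γ, ‖φ z - c‖ ^ p ≤ C * ∫ z in cell L Γ, ‖g z‖ ^ p := by
  have := hΓ.finite_cell
  obtain ⟨χ, hχ⟩ := exists_isWeight hΓ.lower_pos
  obtain ⟨M, hM0, hM⟩ := hχ.exists_bound
  have hA : IsOpen (Ioo 0 L) := isOpen_Ioo
  have hc : ContinuousOn Γ (Ioo 0 L) := hΓ.continuous.continuousOn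
  have hl : ∀ x ∈ Ioo 0 L, H₀ ≤ Γ x := fun x _ => hΓ.lower x
  have hup : ∀ x ∈ Ioo 0 L, Γ x ≤ H₁ := fun x _ => hΓ.upper x
  have hΓ0 : ∀ x ∈ Ioo 0 L, 0 ≤ Γ x := fun x _ => hΓ.lower_pos.le.trans (hΓ.lower x)
  have hH1 := hΓ.upper_pos
  set V := volume.real (cell L Γ) with hV
  have hV0 : 0 ≤ V := measureReal_nonneg
  have hp0 := hp.pos
  refine ⟨2 ^ (p - 1) * (H₁ * H₁ ^ (p - 1) + V * (M * V ^ p'⁻¹) ^ p), by positivity,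
    fun φ g ⟨hφ, hg, hw0, hw1⟩ => ?_⟩
  set I := ∫ z in cell L Γ, ‖g z‖ ^ p with hI
  have hI0 : 0 ≤ I := integral_norm_rpow_nonneg _
  have hφi := hΓ.integrableOn_cell hp.lt hφ
  have hgi := hΓ.integrableOn_cell hp.lt hg
  have hg0 := hΓ.integrableOn_cell hp.lt (memLp_apply hg 0)
  have hg1 := hΓ.integrableOn_cell hp.lt (memLp_apply hg 1)
  have hm : HasWeakDeriv (Ioo 0 L) (vertMean χ φ) 1 (vertMean χ fun z => g z 0) :=
    hasWeakDeriv_vertMean hχ (show Ioo 0 L ×ˢ Ioo 0 H₀ ⊆ cell L Γ from fun z hz =>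
        ⟨hz.1, hz.2.1, hz.2.2.trans_le (hl _ hz.1)⟩)
      (LocInt.of_memLp hp.lt hφ) (LocInt.of_memLp hp.lt (memLp_apply hg 0)) hw0
  obtain ⟨c, hcc⟩ := exists_abs_sub_le_integral hΓ.period_pos
    (integrableOn_vertMean hχ hA hc hl hφi) (integrableOn_vertMean hχ hA hc hl hg0) hm
  -- `|φ - c| ≤ k(x) + K`, with `k` the fibre integral of `∂₂φ` and `K` the integral of the mean of
  -- `∂₁φ`; the constant adds up the `p`-th powers of both
  set K := ∫ s in Ioo 0 L, |vertMean χ (fun z => g z 0) s| with hK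
  have hK0 : 0 ≤ K := integral_nonneg fun _ => abs_nonneg _
  have hKle : K ≤ M * ∫ z in cell L Γ, ‖g z‖ := by
    have hi : IntegrableOn (fun z => ‖g z 0 * χ z.2‖) (cell L Γ) := (IntegrableOn.mul_weight hχ hg0).norm
    calc K ≤ ∫ s in Ioo 0 L, ∫ y in Ioo 0 (Γ s), ‖g (s, y) 0 * χ y‖ := by
          refine setIntegral_mono_on (integrableOn_vertMean hχ hA hc hl hg0).abs
            (integrableOn_fiber_integral hA hc hi) measurableSet_Ioo fun x hx => ?_
          rw [vertMean_eq_fiber hχ hl _ hx]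
          exact norm_integral_le_integral_norm (fun y => g (x, y) 0 * χ y)
      _ = ∫ z in cell L Γ, ‖g z 0 * χ z.2‖ := (integral_subgraph hA hc hi).symm
      _ ≤ ∫ z in cell L Γ, M * ‖g z‖ := by
          refine integral_mono hi (hgi.norm.const_mul M) fun z => ?_
          simp only [norm_mul, Real.norm_eq_abs, abs_of_nonneg (hχ.nonneg _)]
          rw [mul_comm]
          exact mul_le_mul (hM _) (abs_apply_le _ _) (abs_nonneg _) hM0
      _ = M * ∫ z in cell L Γ, ‖g z‖ := integral_const_mul _ _
  have hgl1 : ∫ z in cell L Γ, ‖g z‖ ≤ V ^ p'⁻¹ * I ^ p⁻¹ := by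
    have := abs_integral_mul_le hp (μ := volume.restrict (cell L Γ)) (f := fun _ => (1 : ℝ))
      (g := fun z => ‖g z‖) (memLp_const 1) hg.norm
    simp only [one_mul, norm_one, Real.one_rpow, norm_norm] at this
    rw [abs_of_nonneg (integral_nonneg fun _ => norm_nonneg _)] at this
    simpa [hV] using this
  have hKp : K ^ p ≤ (M * V ^ p'⁻¹) ^ p * I := by
    have h1 : K ≤ (M * V ^ p'⁻¹) * I ^ p⁻¹ := by
      refine hKle.trans ?_
      rw [mul_assoc]; gcongr
    calc K ^ p ≤ ((M * V ^ p'⁻¹) * I ^ p⁻¹) ^ p := by gcongr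
      _ = (M * V ^ p'⁻¹) ^ p * I := by
        rw [Real.mul_rpow (by positivity) (by positivity), ← Real.rpow_mul hI0,
          inv_mul_cancel₀ hp0.ne', Real.rpow_one]
  obtain ⟨hk, hkle⟩ := memLp_fiber_integral_norm hp hA (by simp) hc hH1.le hup (memLp_apply hg 1)
  have hg1le : ∫ z in cell L Γ, ‖g z 1‖ ^ p ≤ I :=
    integral_norm_rpow_mono hp.lt hg (ae_of_all _ fun z => abs_apply_le _ _)
  set k : ℝ → ℝ := fun x => ∫ y in Ioo 0 (Γ x), ‖g (x, y) 1‖ with hkdef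
  have hk0 : ∀ x, 0 ≤ k x := fun x => integral_nonneg fun _ => norm_nonneg _
  have hkc : MemLp (fun z : ℝ × ℝ => k z.1) (ENNReal.ofReal p) (volume.restrict (cell L Γ)) :=
    memLp_comp_fst hp.lt hup hk
  refine ⟨c, ?_⟩
  have hbound : ∀ᵐ z ∂volume.restrict (cell L Γ), ‖φ z - c‖ ≤ ‖k z.1 + K‖ := by
    filter_upwards [abs_sub_vertMean_le hA hc hl hup hχ hφi hg1 hw1, ae_comp_fst (h := Γ) hcc]
      with z h1 h2
    rw [Real.norm_eq_abs, Real.norm_eq_abs, abs_of_nonneg (add_nonneg (hk0 _) hK0)]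
    calc |φ z - c| = |(φ z - vertMean χ φ z.1) + (vertMean χ φ z.1 - c)| := by ring_nf
      _ ≤ _ := (abs_add_le _ _).trans (add_le_add h1 h2)
  calc ∫ z in cell L Γ, ‖φ z - c‖ ^ p
      ≤ ∫ z in cell L Γ, ‖k z.1 + K‖ ^ p :=
        integral_norm_rpow_mono hp.lt (hkc.add (memLp_const K)) hbound
    _ ≤ 2 ^ (p - 1) * ((∫ z in cell L Γ, ‖k z.1‖ ^ p) + ∫ z in cell L Γ, ‖K‖ ^ p) :=
        integral_norm_add_rpow_le hp.lt hkc (memLp_const K)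
    _ ≤ 2 ^ (p - 1) * (H₁ * (H₁ ^ (p - 1) * I) + V * ((M * V ^ p'⁻¹) ^ p * I)) := by
        gcongr
        · refine (integral_norm_rpow_comp_fst_le hp.lt hA hc hup hΓ0 hk).trans ?_
          gcongr
          simp only [Real.norm_of_nonneg (hk0 _)]
          exact hkle.trans (by gcongr; exact hg1le)
        · rw [integral_const, smul_eq_mul, Real.norm_of_nonneg hK0, measureReal_restrict_apply_univ]
          gcongr
    _ = _ := by ring

/-- Poincaré's inequality for functions of zero average: the average of `φ` controls the constant
`c` of `exists_poincare`. -/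
theorem exists_poincare_average (hp : p.HolderConjugate p') (hΓ : IsCellProfile L Γ H₀ H₁) :
    ∃ C : ℝ, 0 ≤ C ∧ ∀ (φ : ℝ × ℝ → ℝ) (g : ℝ × ℝ → Vec2), MemW p (cell L Γ) φ g →
      ⨍ z in cell L Γ, φ z = 0 →
      ∫ z in cell L Γ, ‖φ z‖ ^ p ≤ C * ∫ z in cell L Γ, ‖g z‖ ^ p := by
  have := hΓ.finite_cell
  obtain ⟨C, hC0, hC⟩ := exists_poincare hp hΓ
  have hVpos := hΓ.volume_cell_pos
  set V := volume.real (cell L Γ) with hV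
  have hp0 := hp.pos
  refine ⟨2 ^ (p - 1) * (1 + V * (V⁻¹ * V ^ p'⁻¹) ^ p) * C, by positivity, fun φ g hφ h0 => ?_⟩
  obtain ⟨c, hc⟩ := hC φ g hφ
  set X := ∫ z in cell L Γ, ‖φ z - c‖ ^ p with hX
  have hX0 : 0 ≤ X := integral_norm_rpow_nonneg _
  have hφi := hΓ.integrableOn_cell hp.lt hφ.1
  have hsub : MemLp (fun z => φ z - c) (ENNReal.ofReal p) (volume.restrict (cell L Γ)) :=
    hφ.1.sub (memLp_const c)
  have hcle : |c| ≤ V⁻¹ * V ^ p'⁻¹ * X ^ p⁻¹ := by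
    have h1 := abs_integral_mul_le hp (μ := volume.restrict (cell L Γ)) (f := fun _ => (1 : ℝ))
      (g := fun z => φ z - c) (memLp_const 1) hsub
    simp only [one_mul, norm_one, Real.one_rpow] at h1
    rw [integral_sub hφi (integrable_const c)] at h1
    have h2 : ∫ z in cell L Γ, φ z = 0 := by
      rw [setAverage_eq, smul_eq_mul, mul_eq_zero] at h0
      exact h0.resolve_left (inv_ne_zero hVpos.ne')
    rw [h2, zero_sub, abs_neg, integral_const, integral_const, smul_eq_mul, smul_eq_mul, mul_one,
      measureReal_restrict_apply_univ, abs_mul, abs_of_pos hVpos] at h1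
    rw [mul_assoc, ← div_eq_inv_mul, le_div_iff₀ hVpos, mul_comm]
    exact h1
  have hcp : |c| ^ p ≤ (V⁻¹ * V ^ p'⁻¹) ^ p * X := by
    calc |c| ^ p ≤ (V⁻¹ * V ^ p'⁻¹ * X ^ p⁻¹) ^ p := by gcongr
      _ = _ := by
        rw [Real.mul_rpow (by positivity) (by positivity), ← Real.rpow_mul hX0,
          inv_mul_cancel₀ hp0.ne', Real.rpow_one]
  have h3 := integral_norm_add_rpow_le hp.lt hsub (memLp_const (μ := volume.restrict (cell L Γ)) c)
  simp only [sub_add_cancel] at h3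
  calc ∫ z in cell L Γ, ‖φ z‖ ^ p ≤ 2 ^ (p - 1) * (X + ∫ z in cell L Γ, ‖c‖ ^ p) := h3
    _ ≤ 2 ^ (p - 1) * (X + V * ((V⁻¹ * V ^ p'⁻¹) ^ p * X)) := by
        gcongr
        rw [integral_const, smul_eq_mul, Real.norm_eq_abs, measureReal_restrict_apply_univ]
        gcongr
    _ = 2 ^ (p - 1) * (1 + V * (V⁻¹ * V ^ p'⁻¹) ^ p) * X := by ring
    _ ≤ _ := by
        rw [mul_assoc _ C]
        gcongr

end Poincare

section PeriodicSobolev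

variable {L H₀ H₁ p p' : ℝ} {Γ : ℝ → ℝ} {φ ψ : ℝ × ℝ → ℝ} {g k : ℝ × ℝ → Vec2}

theorem tendsto_integral_mul_of_tendsto {α ι : Type*} [MeasurableSpace α] {μ : Measure α}
    {l : Filter ι} (hp : p.HolderConjugate p') {f : ι → α → ℝ} {g ρ : α → ℝ}
    (hf : ∀ n, MemLp (f n) (ENNReal.ofReal p) μ) (hg : MemLp g (ENNReal.ofReal p) μ)
    (hρ : MemLp ρ (ENNReal.ofReal p') μ)
    (h : Tendsto (fun n => ∫ x, ‖f n x - g x‖ ^ p ∂μ) l (𝓝 0)) :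
    Tendsto (fun n => ∫ x, f n x * ρ x ∂μ) l (𝓝 (∫ x, g x * ρ x ∂μ)) := by
  have h1 := tendsto_integral_mul_zero hp (ν := fun _ => μ) (f := fun _ => ρ)
    (g := fun n x => f n x - g x) (fun _ => hρ) (fun n => (hf n).sub hg) (fun _ => le_rfl) h
  rw [← tendsto_sub_nhds_zero_iff]
  refine h1.congr fun n => ?_
  rw [← integral_sub]
  · congr 1; ext x; ring
  · simpa only [mul_comm] using integrable_mul_of_memLp hp hρ (hf n)
  · simpa only [mul_comm] using integrable_mul_of_memLp hp hρ hg

theorem MemWPer.add (hp : 1 < p) (hΓ : IsCellProfile L Γ H₀ H₁) (hφ : MemWPer p L Γ φ g)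
    (hψ : MemWPer p L Γ ψ k) : MemWPer p L Γ (fun z => φ z + ψ z) (fun z => g z + k z) := by
  obtain ⟨⟨h1, h2, h3, h4⟩, h5, h6⟩ := hφ
  obtain ⟨⟨k1, k2, k3, k4⟩, k5, k6⟩ := hψ
  have hl : ∀ {f : ℝ × ℝ → ℝ}, MemLp f (ENNReal.ofReal p) (volume.restrict (cell L Γ)) →
      LocInt (cell L Γ) f := fun h => LocInt.of_memLp hp h
  have hs : ∀ {f : ℝ × ℝ → ℝ}, MemLp f (ENNReal.ofReal p) (volume.restrict (cell L Γ)) →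
      LocInt (strip Γ) (perExt L f) := fun h => locInt_perExt hΓ (hΓ.integrableOn_cell hp h)
  exact ⟨⟨h1.add k1, h2.add k2,
    h3.add k3 (hl h1) (hl (memLp_apply h2 0)) (hl k1) (hl (memLp_apply k2 0)),
    h4.add k4 (hl h1) (hl (memLp_apply h2 1)) (hl k1) (hl (memLp_apply k2 1))⟩,
    h5.add k5 (hs h1) (hs (memLp_apply h2 0)) (hs k1) (hs (memLp_apply k2 0)),
    h6.add k6 (hs h1) (hs (memLp_apply h2 1)) (hs k1) (hs (memLp_apply k2 1))⟩

theorem MemWPer.const_smul (h : MemWPer p L Γ φ g) (c : ℝ) :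
    MemWPer p L Γ (fun z => c * φ z) (fun z => c • g z) := by
  obtain ⟨⟨h1, h2, h3, h4⟩, h5, h6⟩ := h
  exact ⟨⟨h1.const_mul c, h2.const_smul c, h3.const_mul c, h4.const_mul c⟩,
    h5.const_mul c, h6.const_mul c⟩

theorem memWPer_const (hΓ : IsCellProfile L Γ H₀ H₁) (c : ℝ) :
    MemWPer p L Γ (fun _ => c) (fun _ => 0) :=
  have := hΓ.finite_cell
  ⟨⟨memLp_const c, memLp_const 0, hasWeakDeriv_const c _, hasWeakDeriv_const c _⟩,
    hasWeakDeriv_const c _, hasWeakDeriv_const c _⟩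

theorem MemWPer.sub (hp : 1 < p) (hΓ : IsCellProfile L Γ H₀ H₁) (hφ : MemWPer p L Γ φ g)
    (hψ : MemWPer p L Γ ψ k) : MemWPer p L Γ (fun z => φ z - ψ z) (fun z => g z - k z) := by
  simpa [sub_eq_add_neg] using hφ.add hp hΓ (hψ.const_smul (-1))

theorem MemWPer.congr_ae (hΓ : IsCellProfile L Γ H₀ H₁) (h : MemWPer p L Γ φ g)
    (hφ : φ =ᵐ[volume.restrict (cell L Γ)] ψ) (hg : g =ᵐ[volume.restrict (cell L Γ)] k) :
    MemWPer p L Γ ψ k := by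
  obtain ⟨⟨h1, h2, h3, h4⟩, h5, h6⟩ := h
  have hg' : ∀ i : Fin 2, (fun z => g z i) =ᵐ[volume.restrict (cell L Γ)] fun z => k z i :=
    fun i => hg.fun_comp (fun s : Vec2 => s i)
  have hs : perExt L φ =ᵐ[volume.restrict (strip Γ)] perExt L ψ := ae_strip_of_ae_cell hΓ hφ
  have hk : ∀ i : Fin 2, (fun z => perExt L g z i) =ᵐ[volume.restrict (strip Γ)]
      fun z => perExt L k z i := fun i => ae_strip_of_ae_cell hΓ (hg' i)
  exact ⟨⟨h1.ae_eq hφ, h2.ae_eq hg, h3.congr_ae hφ (hg' 0), h4.congr_ae hφ (hg' 1)⟩,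
    h5.congr_ae hs (hk 0), h6.congr_ae hs (hk 1)⟩

/-- The condition on the strip contains the condition on the cell. -/
theorem memWPer_of_strip (hΓ : IsCellProfile L Γ H₀ H₁)
    (h1 : MemLp φ (ENNReal.ofReal p) (volume.restrict (cell L Γ)))
    (h2 : MemLp g (ENNReal.ofReal p) (volume.restrict (cell L Γ)))
    (h3 : HasWeakGrad (strip Γ) (perExt L φ) (perExt L g)) : MemWPer p L Γ φ g := by
  have hL := hΓ.period_pos
  refine ⟨⟨h1, h2, (h3.1.mono cell_subset_strip).congr_on (fun z hz => ?_) fun z hz => ?_,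
    (h3.2.mono cell_subset_strip).congr_on (fun z hz => ?_) fun z hz => ?_⟩, h3⟩ <;>
  simp only [perExt_of_mem_cell hL hz]

/-- `W^{1,p}_#` is closed under `L^p` convergence of functions and gradients, since its weak
derivatives are tested on the cell against bounded periodizations. -/
theorem MemWPer.of_tendsto (hp : p.HolderConjugate p') (hΓ : IsCellProfile L Γ H₀ H₁)
    {φn : ℕ → ℝ × ℝ → ℝ} {gn : ℕ → ℝ × ℝ → Vec2} (h : ∀ n, MemWPer p L Γ (φn n) (gn n))
    (hφ : MemLp φ (ENNReal.ofReal p) (volume.restrict (cell L Γ)))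
    (hg : MemLp g (ENNReal.ofReal p) (volume.restrict (cell L Γ)))
    (h1 : Tendsto (fun n => ∫ z in cell L Γ, ‖φn n z - φ z‖ ^ p) atTop (𝓝 0))
    (h2 : Tendsto (fun n => ∫ z in cell L Γ, ‖gn n z - g z‖ ^ p) atTop (𝓝 0)) :
    MemWPer p L Γ φ g := by
  have := hΓ.finite_cell
  have hcm := hΓ.isOpen_cell.measurableSet
  have hi : ∀ {f : ℝ × ℝ → ℝ}, MemLp f (ENNReal.ofReal p) (volume.restrict (cell L Γ)) →
      IntegrableOn f (cell L Γ) := fun hf => hΓ.integrableOn_cell hp.lt hf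
  have hper : ∀ {ρ : ℝ × ℝ → ℝ}, Continuous ρ → HasCompactSupport ρ →
      MemLp (perSum L ρ) (ENNReal.ofReal p') (volume.restrict (cell L Γ)) := by
    intro ρ hρ hc
    obtain ⟨R, hR⟩ := exists_bound_fst_of_isCompact hc
    obtain ⟨M, hM⟩ := hc.exists_bound_of_continuous hρ
    obtain ⟨M', hM', s, hs, he⟩ := exists_bound_perSum (Γ := Γ) hΓ.period_pos hρ.measurable
      (fun z hz => image_eq_zero_of_notMem_tsupport (hR z hz)) hM
    refine MemLp.of_bound ?_ M' ((ae_restrict_iff' hcm).2 (ae_of_all _ hM'))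
    exact hs.aestronglyMeasurable.congr
      ((ae_restrict_iff' hcm).2 (ae_of_all _ fun z hz => (he z hz).symm))
  have hlim : ∀ {fn : ℕ → ℝ × ℝ → ℝ} {f k : ℝ × ℝ → ℝ} {kn : ℕ → ℝ × ℝ → ℝ} {w : ℝ × ℝ},
      (∀ n, MemLp (fn n) (ENNReal.ofReal p) (volume.restrict (cell L Γ))) →
      MemLp f (ENNReal.ofReal p) (volume.restrict (cell L Γ)) →
      (∀ n, MemLp (kn n) (ENNReal.ofReal p) (volume.restrict (cell L Γ))) →
      MemLp k (ENNReal.ofReal p) (volume.restrict (cell L Γ)) →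
      Tendsto (fun n => ∫ z in cell L Γ, ‖fn n z - f z‖ ^ p) atTop (𝓝 0) →
      Tendsto (fun n => ∫ z in cell L Γ, ‖kn n z - k z‖ ^ p) atTop (𝓝 0) →
      (∀ n, HasWeakDeriv (strip Γ) (perExt L (fn n)) w (perExt L (kn n))) →
      HasWeakDeriv (strip Γ) (perExt L f) w (perExt L k) := by
    intro fn f k kn w hfn hf hkn hk t1 t2 hw
    rw [hasWeakDeriv_perExt_iff hΓ (hi hf) (hi hk)]
    intro ρ hρ
    have e := fun n => (hasWeakDeriv_perExt_iff hΓ (hi (hfn n)) (hi (hkn n))).1 (hw n) ρ hρ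
    have s1 := tendsto_integral_mul_of_tendsto hp hfn hf
      (hper (hρ.continuous_fderiv w) (hρ.compact.fderiv_apply ℝ w)) t1
    have s2 := (tendsto_integral_mul_of_tendsto hp hkn hk (hper hρ.continuous hρ.compact) t2).neg
    exact tendsto_nhds_unique s1 (by simpa only [e] using s2)
  have hcomp : ∀ i : Fin 2, Tendsto (fun n => ∫ z in cell L Γ, ‖gn n z i - g z i‖ ^ p) atTop
      (𝓝 0) := fun i => by
    refine tendsto_of_tendsto_of_tendsto_of_le_of_le tendsto_const_nhds h2
      (fun n => integral_norm_rpow_nonneg _) fun n => ?_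
    exact integral_norm_rpow_mono hp.lt ((h n).1.2.1.sub hg)
      (ae_of_all _ fun z => abs_apply_le (gn n z - g z) i)
  exact memWPer_of_strip hΓ hφ hg
    ⟨hlim (fun n => (h n).1.1) hφ (fun n => memLp_apply (h n).1.2.1 0) (memLp_apply hg 0) h1
      (hcomp 0) (fun n => (h n).2.1),
    hlim (fun n => (h n).1.1) hφ (fun n => memLp_apply (h n).1.2.1 1) (memLp_apply hg 1) h1
      (hcomp 1) (fun n => (h n).2.2)⟩

/-- Subtracting the average from a periodic function. -/
theorem MemWPer.sub_average (hp : 1 < p) (hΓ : IsCellProfile L Γ H₀ H₁)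
    (h : MemWPer p L Γ φ g) :
    MemWPer p L Γ (fun z => φ z - ⨍ y in cell L Γ, φ y) g ∧
      ⨍ z in cell L Γ, (φ z - ⨍ y in cell L Γ, φ y) = 0 := by
  have := hΓ.finite_cell
  have hV := hΓ.volume_cell_pos
  refine ⟨by simpa using h.sub hp hΓ (memWPer_const hΓ _), ?_⟩
  rw [setAverage_eq, integral_sub (hΓ.integrableOn_cell hp h.1.1) (integrable_const _),
    integral_const, measureReal_restrict_apply_univ, setAverage_eq, smul_eq_mul, smul_eq_mul,
    smul_eq_mul, mul_inv_cancel_left₀ hV.ne', sub_self, mul_zero]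

end PeriodicSobolev

end RoughThin

/-! ### The cell problem and its coefficient -/

namespace RoughThin

section CellProblem

variable {L H₀ H₁ p p' : ℝ} {Γ : ℝ → ℝ}

/-- The gradients of functions in `W^{1,p}_#`, as a subspace of `L^p` of the cell. -/
noncomputable def perGrads [Fact (1 ≤ ENNReal.ofReal p)] (hp : 1 < p)
    (hΓ : IsCellProfile L Γ H₀ H₁) :
    Submodule ℝ (Lp Vec2 (ENNReal.ofReal p) (volume.restrict (cell L Γ))) where
  carrier := {F | ∃ φ, MemWPer p L Γ φ F}
  add_mem' := by
    rintro F K ⟨φ, hφ⟩ ⟨ψ, hψ⟩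
    exact ⟨_, (hφ.add hp hΓ hψ).congr_ae hΓ EventuallyEq.rfl (Lp.coeFn_add F K).symm⟩
  zero_mem' := ⟨_, (memWPer_const hΓ 0).congr_ae hΓ EventuallyEq.rfl (Lp.coeFn_zero _ _ _).symm⟩
  smul_mem' := by
    rintro c F ⟨φ, hφ⟩
    exact ⟨_, (hφ.const_smul c).congr_ae hΓ EventuallyEq.rfl (Lp.coeFn_smul c F).symm⟩

/-- Poincaré's inequality turns convergence of gradients into convergence of the functions of zero
average, so the limit is again a gradient. -/
theorem isClosed_perGrads [Fact (1 ≤ ENNReal.ofReal p)] (hp : p.HolderConjugate p')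
    (hΓ : IsCellProfile L Γ H₀ H₁) :
    IsClosed (perGrads hp.lt hΓ : Set (Lp Vec2 (ENNReal.ofReal p) (volume.restrict (cell L Γ)))) := by
  have := hΓ.finite_cell
  have hp0 := hp.pos
  obtain ⟨C, hC0, hC⟩ := exists_poincare_average hp hΓ
  refine IsSeqClosed.isClosed fun F F₀ hF hlim => ?_
  have hex : ∀ n, ∃ φ, MemWPer p L Γ φ (F n) ∧ ⨍ z in cell L Γ, φ z = 0 := fun n => by
    obtain ⟨φ, hφ⟩ := hF n
    exact ⟨_, hφ.sub_average hp.lt hΓ⟩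
  choose φ hφ h0 using hex
  set Φ : ℕ → Lp ℝ (ENNReal.ofReal p) (volume.restrict (cell L Γ)) :=
    fun n => (hφ n).1.1.toLp (φ n) with hΦ
  have hΦc : ∀ n, Φ n =ᵐ[volume.restrict (cell L Γ)] φ n := fun n => (hφ n).1.1.coeFn_toLp
  have hdist : ∀ n m, ‖Φ n - Φ m‖ ≤ C ^ p⁻¹ * ‖F n - F m‖ := by
    intro n m
    have h1 : ‖Φ n - Φ m‖ ^ p ≤ (C ^ p⁻¹ * ‖F n - F m‖) ^ p := by
      rw [Real.mul_rpow (by positivity) (norm_nonneg _), ← Real.rpow_mul hC0,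
        inv_mul_cancel₀ hp0.ne', Real.rpow_one, lp_norm_rpow hp.lt, lp_norm_rpow hp.lt]
      have h2 := hC _ _ ((hφ n).sub hp.lt hΓ (hφ m)).1 (by
        rw [setAverage_eq, integral_sub (hΓ.integrableOn_cell hp.lt (hφ n).1.1)
          (hΓ.integrableOn_cell hp.lt (hφ m).1.1), smul_sub, ← setAverage_eq, ← setAverage_eq,
          h0, h0, sub_zero])
      refine le_of_eq_of_le (integral_congr_ae ?_) (h2.trans_eq ?_)
      · filter_upwards [Lp.coeFn_sub (Φ n) (Φ m), hΦc n, hΦc m] with z e1 e2 e3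
        rw [e1, Pi.sub_apply, e2, e3]
      · congr 1
        refine integral_congr_ae ?_
        filter_upwards [Lp.coeFn_sub (F n) (F m)] with z e1
        rw [e1, Pi.sub_apply]
    exact (Real.rpow_le_rpow_iff (norm_nonneg _) (by positivity) hp0).1 h1
  have hcau : CauchySeq Φ := by
    rw [Metric.cauchySeq_iff]
    intro δ hδ
    have hb : 0 < C ^ p⁻¹ + 1 := by positivity
    obtain ⟨N, hN⟩ := Metric.cauchySeq_iff.1 hlim.cauchySeq (δ / (C ^ p⁻¹ + 1)) (by positivity)
    refine ⟨N, fun m hm n hn => ?_⟩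
    have h2 := hN m hm n hn
    rw [dist_eq_norm, lt_div_iff₀ hb] at h2
    rw [dist_eq_norm]
    nlinarith [hdist m n, norm_nonneg (F m - F n)]
  obtain ⟨Φ₀, hΦ₀⟩ := cauchySeq_tendsto_of_complete hcau
  have hto : ∀ {E : Type} [NormedAddCommGroup E]
      {f : ℕ → Lp E (ENNReal.ofReal p) (volume.restrict (cell L Γ))}
      {f₀ : Lp E (ENNReal.ofReal p) (volume.restrict (cell L Γ))}, Tendsto f atTop (𝓝 f₀) →
      Tendsto (fun n => ∫ z in cell L Γ, ‖f n z - f₀ z‖ ^ p) atTop (𝓝 0) := by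
    intro E _ f f₀ hf
    have h1 : Tendsto (fun n => ‖f n - f₀‖ ^ p) atTop (𝓝 0) := by
      have := (tendsto_iff_norm_sub_tendsto_zero.1 hf).rpow_const (p := p) (Or.inr hp0.le)
      rwa [Real.zero_rpow hp0.ne'] at this
    refine h1.congr fun n => ?_
    rw [lp_norm_rpow hp.lt]
    refine integral_congr_ae ?_
    filter_upwards [Lp.coeFn_sub (f n) f₀] with z e1
    rw [e1, Pi.sub_apply]
  refine ⟨Φ₀, MemWPer.of_tendsto hp hΓ (fun n => (hφ n).congr_ae hΓ (hΦc n).symm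
    EventuallyEq.rfl) (Lp.memLp _) (Lp.memLp _) (hto hΦ₀) (hto hlim)⟩

/-- The first unit vector. -/
noncomputable def e₁ : Vec2 := !₂[(1 : ℝ), 0]

theorem inner_e₁ (s : Vec2) : inner ℝ s e₁ = s 0 := by
  simp [e₁, PiLp.inner_apply, Fin.sum_univ_two]

variable {v : ℝ × ℝ → ℝ} {dv : ℝ × ℝ → Vec2}

/-- The cell solution has gradient of minimal `L^p` norm in `e₁ + perGrads`. -/
theorem exists_isCellSolution (hp : p.HolderConjugate p') (hΓ : IsCellProfile L Γ H₀ H₁) :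
    ∃ v dv, IsCellSolution p L Γ v dv := by
  have := hΓ.finite_cell
  have := fact_one_le_ofReal hp.lt
  have he : MemLp (fun _ : ℝ × ℝ => e₁) (ENNReal.ofReal p) (volume.restrict (cell L Γ)) :=
    memLp_const _
  obtain ⟨F, ⟨φ, hφ⟩, hmin⟩ := exists_norm_minimizer hp (perGrads hp.lt hΓ)
    (isClosed_perGrads hp hΓ) (he.toLp _)
  obtain ⟨hw, hw0⟩ := hφ.sub_average hp.lt hΓ
  set w : ℝ × ℝ → ℝ := fun z => φ z - ⨍ y in cell L Γ, φ y
  have hA : MemLp (fun z => e₁ + F z) (ENNReal.ofReal p) (volume.restrict (cell L Γ)) :=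
    he.add hφ.1.2.1
  refine ⟨fun z => w z + z.1, fun z => e₁ + F z, ?_, by simpa using hw0, fun ψ k hψ _ => ?_⟩
  · simpa [e₁] using hw
  · refine integral_inner_flux_eq_zero hp hA hψ.1.2.1 fun t => ?_
    set K := hψ.1.2.1.toLp k with hK
    have hKc : K =ᵐ[volume.restrict (cell L Γ)] k := hψ.1.2.1.coeFn_toLp
    have hmem : F + t • K ∈ perGrads hp.lt hΓ :=
      (perGrads hp.lt hΓ).add_mem ⟨φ, hφ⟩ ((perGrads hp.lt hΓ).smul_mem t
        ⟨ψ, hψ.congr_ae hΓ EventuallyEq.rfl hKc.symm⟩)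
    have h1 := hmin _ hmem
    have h2 := Real.rpow_le_rpow (norm_nonneg _) h1 hp.pos.le
    rw [lp_norm_rpow hp.lt, lp_norm_rpow hp.lt] at h2
    refine (le_of_eq_of_le (integral_congr_ae ?_) h2).trans_eq (integral_congr_ae ?_)
    · filter_upwards [Lp.coeFn_add (he.toLp _) F, he.coeFn_toLp] with z e1 e2
      rw [e1, Pi.add_apply, e2]
    · filter_upwards [Lp.coeFn_add (he.toLp _) (F + t • K), he.coeFn_toLp, Lp.coeFn_add F (t • K),
        Lp.coeFn_smul t K, hKc] with z e1 e2 e3 e4 e5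
      rw [e1, Pi.add_apply, e2, e3, Pi.add_apply, e4, Pi.smul_apply, e5, add_assoc]

namespace IsCellSolution

theorem memLp (hΓ : IsCellProfile L Γ H₀ H₁) (h : IsCellSolution p L Γ v dv) :
    MemLp dv (ENNReal.ofReal p) (volume.restrict (cell L Γ)) := by
  have := hΓ.finite_cell
  exact (h.1.1.2.1.add (memLp_const (!₂[(1 : ℝ), 0] : Vec2))).ae_eq (ae_of_all _ fun z => by simp)

/-- The restriction to test functions of zero average is immaterial. -/
theorem integral_inner_eq_zero (hp : 1 < p) (hΓ : IsCellProfile L Γ H₀ H₁)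
    (h : IsCellSolution p L Γ v dv) {φ : ℝ × ℝ → ℝ} {g : ℝ × ℝ → Vec2} (hφ : MemWPer p L Γ φ g) :
    ∫ y in cell L Γ, inner ℝ (flux p (dv y)) (g y) = 0 :=
  h.2.2 _ _ (hφ.sub_average hp hΓ).1 (hφ.sub_average hp hΓ).2

theorem memLp_flux (hp : p.HolderConjugate p') (hΓ : IsCellProfile L Γ H₀ H₁)
    (h : IsCellSolution p L Γ v dv) :
    MemLp (fun z => flux p (dv z)) (ENNReal.ofReal p') (volume.restrict (cell L Γ)) :=
  RoughThin.memLp_flux hp (h.memLp hΓ)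

/-- Pairing the cell flux with any competitor `e₁ + ∇φ` gives the same value. -/
theorem integral_inner_add (hp : p.HolderConjugate p') (hΓ : IsCellProfile L Γ H₀ H₁)
    (h : IsCellSolution p L Γ v dv) {φ : ℝ × ℝ → ℝ} {g : ℝ × ℝ → Vec2} (hφ : MemWPer p L Γ φ g) :
    ∫ y in cell L Γ, inner ℝ (flux p (dv y)) (e₁ + g y) = ∫ y in cell L Γ, flux p (dv y) 0 := by
  have := hΓ.finite_cell
  simp only [inner_add_right]
  rw [integral_add (integrable_inner_of_memLp hp (h.memLp_flux hp hΓ) (memLp_const _))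
    (integrable_inner_of_memLp hp (h.memLp_flux hp hΓ) hφ.1.2.1),
    h.integral_inner_eq_zero hp.lt hΓ hφ, add_zero]
  simp only [inner_e₁]

/-- The competitor `∇v` itself: the mean horizontal flux is the energy. -/
theorem integral_energy (hp : p.HolderConjugate p') (hΓ : IsCellProfile L Γ H₀ H₁)
    (h : IsCellSolution p L Γ v dv) :
    ∫ y in cell L Γ, flux p (dv y) 0 = ∫ y in cell L Γ, ‖dv y‖ ^ p := by
  rw [← h.integral_inner_add hp hΓ h.1]
  congr 1; ext y
  rw [← inner_flux_self hp.lt]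
  simp [e₁]

/-- The solution of the cell problem minimizes the energy. -/
theorem integral_energy_le (hp : p.HolderConjugate p') (hΓ : IsCellProfile L Γ H₀ H₁)
    (h : IsCellSolution p L Γ v dv) {φ : ℝ × ℝ → ℝ} {g : ℝ × ℝ → Vec2} (hφ : MemWPer p L Γ φ g) :
    ∫ y in cell L Γ, ‖dv y‖ ^ p ≤ ∫ y in cell L Γ, ‖e₁ + g y‖ ^ p := by
  have := hΓ.finite_cell
  have hA : MemLp (fun z => e₁ + g z) (ENNReal.ofReal p) (volume.restrict (cell L Γ)) :=
    (memLp_const e₁).add hφ.1.2.1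
  have h1 := h.integral_inner_add hp hΓ hφ
  rw [h.integral_energy hp hΓ] at h1
  have i1 : Integrable (fun y => ‖dv y‖ ^ p / p') (volume.restrict (cell L Γ)) :=
    (integrable_norm_rpow hp.lt (h.memLp hΓ)).div_const _
  have i2 : Integrable (fun y => ‖e₁ + g y‖ ^ p / p) (volume.restrict (cell L Γ)) :=
    (integrable_norm_rpow hp.lt hA).div_const _
  have i0 : Integrable (fun y => (inner ℝ (flux p (dv y)) (e₁ + g y) : ℝ))
      (volume.restrict (cell L Γ)) :=
    integrable_inner_of_memLp hp (h.memLp_flux hp hΓ) hA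
  have h2 : ∫ y in cell L Γ, inner ℝ (flux p (dv y)) (e₁ + g y) ≤
      ∫ y in cell L Γ, (‖dv y‖ ^ p / p' + ‖e₁ + g y‖ ^ p / p) :=
    integral_mono i0 (i1.add i2) fun y => inner_flux_le hp (dv y) (e₁ + g y)
  rw [integral_add i1 i2, integral_div, integral_div, h1] at h2
  set X := ∫ y in cell L Γ, ‖dv y‖ ^ p
  have h3 := add_div_conj hp X
  have h4 : X / p ≤ (∫ y in cell L Γ, ‖e₁ + g y‖ ^ p) / p := by linarith
  exact (div_le_div_iff_of_pos_right hp.pos).1 h4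

end IsCellSolution

/-- Existence by minimization; uniqueness of the gradient by strict monotonicity of the flux, and
of the function by Poincaré's inequality and the normalization of the average. -/
theorem cellWellPosed (hp : p.HolderConjugate p') (hΓ : IsCellProfile L Γ H₀ H₁) :
    CellWellPosed p L Γ := by
  refine ⟨exists_isCellSolution hp hΓ, fun v₁ dv₁ v₂ dv₂ h₁ h₂ => ?_⟩
  have := hΓ.finite_cell
  have hd := h₁.1.sub hp.lt hΓ h₂.1
  simp only [sub_sub_sub_cancel_right] at hd
  have hi := (integrable_inner_of_memLp hp (h₁.memLp_flux hp hΓ) hd.1.2.1)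
  have hi' := (integrable_inner_of_memLp hp (h₂.memLp_flux hp hΓ) hd.1.2.1)
  have h0 : ∫ y in cell L Γ, inner ℝ (flux p (dv₁ y) - flux p (dv₂ y)) (dv₁ y - dv₂ y) = 0 := by
    simp only [inner_sub_left]
    rw [integral_sub hi hi', h₁.integral_inner_eq_zero hp.lt hΓ hd,
      h₂.integral_inner_eq_zero hp.lt hΓ hd, sub_zero]
  have hint : Integrable (fun y => inner ℝ (flux p (dv₁ y) - flux p (dv₂ y)) (dv₁ y - dv₂ y))
      (volume.restrict (cell L Γ)) :=
    (hi.sub hi').congr (ae_of_all _ fun y => by simp [inner_sub_left])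
  rw [integral_eq_zero_iff_of_nonneg (fun y => flux_mono hp _ _) hint] at h0
  have hdv : dv₁ =ᵐ[volume.restrict (cell L Γ)] dv₂ := by
    filter_upwards [h0] with y hy
    exact eq_of_flux_mono_eq_zero hp hy
  refine ⟨?_, hdv⟩
  obtain ⟨C, hC0, hC⟩ := exists_poincare_average hp hΓ
  have hav : ⨍ y in cell L Γ, (v₁ y - v₂ y) = 0 := by
    have e1 := hΓ.integrableOn_cell hp.lt h₁.1.1.1
    have e2 := hΓ.integrableOn_cell hp.lt h₂.1.1.1
    have e3 : ∀ y : ℝ × ℝ, v₁ y - v₂ y = (v₁ y - y.1) - (v₂ y - y.1) := fun y => by ring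
    simp only [e3]
    rw [setAverage_eq, integral_sub e1 e2, smul_sub, ← setAverage_eq, ← setAverage_eq, h₁.2.1,
      h₂.2.1, sub_zero]
  have h1 := hC _ _ hd.1 hav
  have h2 : ∫ z in cell L Γ, ‖dv₁ z - dv₂ z‖ ^ p = 0 := by
    rw [integral_eq_zero_of_ae]
    filter_upwards [hdv] with y hy
    simp [hy, Real.zero_rpow hp.pos.ne']
  rw [h2, mul_zero] at h1
  have h3 := le_antisymm h1 (integral_norm_rpow_nonneg _)
  rw [integral_eq_zero_iff_of_nonneg (fun y => by positivity)
    (integrable_norm_rpow hp.lt hd.1.1)] at h3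
  filter_upwards [h3] with y hy
  have := (Real.rpow_eq_zero (norm_nonneg _) hp.pos.ne').1 hy
  exact sub_eq_zero.1 (norm_eq_zero.1 this)

/-- The chosen gradient `cellGrad` is not a junk value: it solves the cell problem. -/
theorem exists_isCellSolution_cellGrad (hp : p.HolderConjugate p')
    (hΓ : IsCellProfile L Γ H₀ H₁) : ∃ v, IsCellSolution p L Γ v (cellGrad p L Γ) := by
  obtain ⟨v, dv, h⟩ := exists_isCellSolution hp hΓ
  have hex : ∃ dv : ℝ × ℝ → Vec2, ∃ v : ℝ × ℝ → ℝ, IsCellSolution p L Γ v dv := ⟨dv, v, h⟩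
  rw [cellGrad, dif_pos hex]
  exact hex.choose_spec

theorem qCoeff_eq_energy (hp : p.HolderConjugate p') (hΓ : IsCellProfile L Γ H₀ H₁) :
    qCoeff p L Γ = (1 / L) * ∫ y in cell L Γ, ‖cellGrad p L Γ y‖ ^ p := by
  obtain ⟨v, h⟩ := exists_isCellSolution_cellGrad hp hΓ
  rw [qCoeff]
  congr 1
  exact h.integral_energy hp hΓ

theorem qCoeff_nonneg (hp : p.HolderConjugate p') (hΓ : IsCellProfile L Γ H₀ H₁) :
    0 ≤ qCoeff p L Γ := by
  have := hΓ.period_pos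
  rw [qCoeff_eq_energy hp hΓ]
  exact mul_nonneg (by positivity) (integral_norm_rpow_nonneg _)

/-- Enlarging the profile increases `q`: the solution in the larger cell restricts to a competitor
in the smaller one. -/
theorem qCoeff_mono (hp : p.HolderConjugate p') {Γ' : ℝ → ℝ} {H₀' H₁' : ℝ}
    (hΓ : IsCellProfile L Γ H₀ H₁) (hΓ' : IsCellProfile L Γ' H₀' H₁') (hle : ∀ y, Γ y ≤ Γ' y) :
    qCoeff p L Γ ≤ qCoeff p L Γ' := by
  have := hΓ.period_pos
  obtain ⟨v, h⟩ := exists_isCellSolution_cellGrad hp hΓ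
  obtain ⟨v', h'⟩ := exists_isCellSolution_cellGrad hp hΓ'
  rw [qCoeff_eq_energy hp hΓ, qCoeff_eq_energy hp hΓ']
  have hs : cell L Γ ⊆ cell L Γ' := subgraph_mono le_rfl fun x _ => hle x
  have hs' : strip Γ ⊆ strip Γ' := fun z hz => ⟨hz.1, hz.2.trans_le (hle _)⟩
  have hm : ∀ {E : Type} [NormedAddCommGroup E] {f : ℝ × ℝ → E},
      MemLp f (ENNReal.ofReal p) (volume.restrict (cell L Γ')) →
      MemLp f (ENNReal.ofReal p) (volume.restrict (cell L Γ)) := fun hf =>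
    hf.mono_measure (Measure.restrict_mono hs le_rfl)
  have hw : MemWPer p L Γ (fun y => v' y - y.1) (fun y => cellGrad p L Γ' y - !₂[(1 : ℝ), 0]) :=
    memWPer_of_strip hΓ (hm h'.1.1.1) (hm h'.1.1.2.1) ⟨h'.1.2.1.mono hs', h'.1.2.2.mono hs'⟩
  gcongr
  refine (h.integral_energy_le hp hΓ hw).trans ?_
  simp only [e₁, add_sub_cancel]
  exact setIntegral_mono_set (integrable_norm_rpow hp.lt (h'.memLp hΓ'))
    (ae_of_all _ fun y => by positivity) hs.eventuallyLE

theorem IsCellProfile.const_mul (hΓ : IsCellProfile L Γ H₀ H₁) {c : ℝ} (hc : 0 < c) :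
    IsCellProfile L (fun y => c * Γ y) (c * H₀) (c * H₁) where
  period_pos := hΓ.period_pos
  lower_pos := mul_pos hc hΓ.lower_pos
  continuous := hΓ.continuous.const_mul c
  periodic y := by rw [hΓ.periodic]
  lower y := by gcongr; exact hΓ.lower y
  upper y := by gcongr; exact hΓ.upper y

/-- Stretching the cell vertically by a factor `c ≥ 1` increases `q` at most by this factor. -/
theorem qCoeff_const_mul_le (hp : p.HolderConjugate p') (hΓ : IsCellProfile L Γ H₀ H₁) {c : ℝ}
    (hc : 1 ≤ c) : qCoeff p L (fun y => c * Γ y) ≤ c * qCoeff p L Γ := by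
  have hc0 : 0 < c := by linarith
  have hL := hΓ.period_pos
  have hΓc := hΓ.const_mul hc0
  obtain ⟨v, h⟩ := exists_isCellSolution_cellGrad hp hΓ
  obtain ⟨v', h'⟩ := exists_isCellSolution_cellGrad hp hΓc
  rw [qCoeff_eq_energy hp hΓ, qCoeff_eq_energy hp hΓc]
  set B := cellGrad p L Γ
  have hci : c⁻¹ ≠ 0 := inv_ne_zero hc0.ne'
  have hiff : ∀ a b : ℝ, c⁻¹ * a < b ↔ a < c * b := fun a b => by
    rw [inv_mul_lt_iff₀ hc0]
  have hcell : diagMap 1 0 c⁻¹ ⁻¹' cell L Γ = cell L fun y => c * Γ y := by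
    ext z; simp [diagMap, cell, hc0, hiff]
  have hstrip : diagMap 1 0 c⁻¹ ⁻¹' strip Γ = strip fun y => c * Γ y := by
    ext z; simp [diagMap, strip, hc0, hiff]
  -- the competitor in the stretched cell is `v(y₁, y₂ / c)`; stretching only decreases `|∂₂v|`
  set K : ℝ × ℝ → Vec2 := fun z => !₂[B (diagMap 1 0 c⁻¹ z) 0 - 1, c⁻¹ * B (diagMap 1 0 c⁻¹ z) 1]
    with hK
  have hsub := memLp_comp_diagMap (α := 1) (β := 0) one_ne_zero hci h.1.1.1
  have hsub2 := memLp_comp_diagMap (α := 1) (β := 0) one_ne_zero hci (h.memLp hΓ)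
  rw [hcell] at hsub hsub2
  have := hΓc.finite_cell
  have hKle : ∀ z, ‖e₁ + K z‖ ≤ ‖B (diagMap 1 0 c⁻¹ z)‖ := by
    intro z
    rw [EuclideanSpace.norm_eq, EuclideanSpace.norm_eq]
    apply Real.sqrt_le_sqrt
    simp only [Fin.sum_univ_two, e₁, hK, PiLp.add_apply, Real.norm_eq_abs, sq_abs]
    simp only [Matrix.cons_val_zero, Matrix.cons_val_one, add_sub_cancel, zero_add, mul_pow,
      Matrix.cons_val_fin_one]
    have : (c⁻¹) ^ 2 ≤ 1 := pow_le_one₀ (by positivity) (inv_le_one_of_one_le₀ hc)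
    gcongr
    nlinarith [sq_nonneg (B (diagMap 1 0 c⁻¹ z) 1)]
  have hKm : MemLp K (ENNReal.ofReal p) (volume.restrict (cell L fun y => c * Γ y)) := by
    have h1 : MemLp (fun z => e₁ + K z) (ENNReal.ofReal p)
        (volume.restrict (cell L fun y => c * Γ y)) := by
      refine hsub2.mono ?_ (ae_of_all _ hKle)
      have e : (fun z => e₁ + K z) = fun z =>
          !₂[B (diagMap 1 0 c⁻¹ z) 0, c⁻¹ * B (diagMap 1 0 c⁻¹ z) 1] := by
        ext z i; fin_cases i <;> simp [e₁, hK]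
      rw [e]
      have hc2 : Continuous fun s : Vec2 => (!₂[s 0, c⁻¹ * s 1] : Vec2) := by fun_prop
      exact hc2.comp_aestronglyMeasurable hsub2.1
    exact (h1.sub (memLp_const e₁)).ae_eq (ae_of_all _ fun z => by simp)
  have hw : MemWPer p L (fun y => c * Γ y)
      (fun z => v (diagMap 1 0 c⁻¹ z) - (diagMap 1 0 c⁻¹ z).1) K := by
    refine memWPer_of_strip hΓc hsub hKm ⟨?_, ?_⟩
    · have := h.1.2.1.comp_diagMap_fst (α := 1) (β := 0) one_ne_zero hci
      rw [hstrip] at this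
      refine this.congr_on (fun z _ => ?_) fun z _ => ?_
      · simp [perExt, diagMap]
      · simp [perExt, diagMap, hK]
    · have := h.1.2.2.comp_diagMap_snd (α := 1) (β := 0) one_ne_zero hci
      rw [hstrip] at this
      refine this.congr_on (fun z _ => ?_) fun z _ => ?_
      · simp [perExt, diagMap]
      · simp [perExt, diagMap, hK]
  have h1 := h'.integral_energy_le hp hΓc hw
  have h2 := setIntegral_comp_diagMap (α := 1) (β := 0) one_ne_zero hci (cell L Γ)
    fun z => ‖B z‖ ^ p
  rw [hcell, inv_inv, inv_one, one_mul, abs_of_pos hc0, smul_eq_mul] at h2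
  have h3 := integral_norm_rpow_mono hp.lt hsub2 (ae_of_all _ hKle)
  rw [h2] at h3
  calc _ ≤ 1 / L * (c * ∫ z in cell L Γ, ‖B z‖ ^ p) := by
        gcongr; exact h1.trans h3
    _ = _ := by ring

end CellProblem

end RoughThin

/-! ### Compactness on the interval -/

namespace RoughThin

section OneDimCompactness

variable {p p' : ℝ}

theorem absolutelyContinuousOnInterval_primitive {f : ℝ → ℝ} (hf : IntegrableOn f (Ioo 0 1)) :
    AbsolutelyContinuousOnInterval (fun x => ∫ s in (0 : ℝ)..x, f s) 0 1 := by
  refine IntervalIntegrable.absolutelyContinuousOnInterval_intervalIntegral ?_ (by simp)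
  rwa [intervalIntegrable_iff_integrableOn_Ioo_of_le zero_le_one]

theorem continuousOn_primitive {f : ℝ → ℝ} (hf : IntegrableOn f (Ioo 0 1)) :
    ContinuousOn (fun x => ∫ s in (0 : ℝ)..x, f s) (Ioo 0 1) := by
  refine (absolutelyContinuousOnInterval_primitive hf).continuousOn.mono ?_
  rw [uIcc_of_le zero_le_one]
  exact Ioo_subset_Icc_self

theorem hasWeakDeriv_primitive {f : ℝ → ℝ} (hf : IntegrableOn f (Ioo 0 1)) :
    HasWeakDeriv (Ioo 0 1) (fun x => ∫ s in (0 : ℝ)..x, f s) 1 f := by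
  intro φ hφ hc hs
  have hii : IntervalIntegrable f volume 0 1 := by
    rwa [intervalIntegrable_iff_integrableOn_Ioo_of_le zero_le_one]
  have h0 : ∀ x ∉ Ioo (0 : ℝ) 1, φ x = 0 := fun x hx =>
    image_eq_zero_of_notMem_tsupport fun hh => hx (hs hh)
  have h1 := (absolutelyContinuousOnInterval_primitive hf).integral_mul_deriv_eq_deriv_mul
    (g := φ) ((hφ.of_le (by exact_mod_cast le_top)).contDiffOn.absolutelyContinuousOnInterval)
  rw [h0 1 (by simp), h0 0 (by simp), mul_zero, mul_zero, sub_zero, zero_sub] at h1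
  have h2 : ∫ x in (0 : ℝ)..1, deriv (fun x => ∫ s in (0 : ℝ)..x, f s) x * φ x =
      ∫ x in (0 : ℝ)..1, f x * φ x := by
    refine intervalIntegral.integral_congr_ae ?_
    filter_upwards [hii.ae_hasDerivAt_integral] with x hx hx'
    rw [(hx (uIoc_subset_uIcc hx') 0 (by simp)).deriv]
  rw [h2, intervalIntegral.integral_of_le zero_le_one, intervalIntegral.integral_of_le zero_le_one,
    integral_Ioc_eq_integral_Ioo, integral_Ioc_eq_integral_Ioo] at h1
  rw [← h1]
  congr 1

theorem integrableOn_unit (hp : 1 < p) {f : ℝ → ℝ}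
    (hf : MemLp f (ENNReal.ofReal p) (volume.restrict (Ioo 0 1))) : IntegrableOn f (Ioo 0 1) :=
  hf.integrable (by simpa using ENNReal.ofReal_le_ofReal hp.le)

/-- An integrable function with an integrable weak derivative is, up to a constant, the primitive
of that derivative. -/
theorem exists_eq_add_primitive {m m' : ℝ → ℝ} (hm : IntegrableOn m (Ioo 0 1))
    (hm' : IntegrableOn m' (Ioo 0 1)) (h : HasWeakDeriv (Ioo 0 1) m 1 m') :
    ∃ c, ∀ᵐ x ∂volume.restrict (Ioo 0 1), m x = c + ∫ s in (0 : ℝ)..x, m' s := by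
  have hP : IntegrableOn (fun x => ∫ s in (0 : ℝ)..x, m' s) (Ioo 0 1) := by
    have h1 := (absolutelyContinuousOnInterval_primitive hm').continuousOn
    rw [uIcc_of_le zero_le_one] at h1
    exact (h1.integrableOn_compact isCompact_Icc).mono_set Ioo_subset_Icc_self
  have hloc : ∀ {f : ℝ → ℝ}, IntegrableOn f (Ioo 0 1) → LocInt (Ioo 0 1) f :=
    fun hf K hK _ => hf.mono_set hK
  have h2 := h.sub (hasWeakDeriv_primitive hm') (hloc hm) (hloc hm') (hloc hP) (hloc hm')
  simp only [sub_self] at h2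
  obtain ⟨c, hc⟩ := exists_ae_eq_const one_pos (hm.sub hP) h2
  refine ⟨c, ?_⟩
  filter_upwards [hc] with x hx
  rw [← hx, Pi.sub_apply, sub_add_cancel]

/-- Compactness of the embedding of `W^{1,p}(0,1)` into `L^p(0,1)`. -/
theorem exists_subseq_tendsto (hp : p.HolderConjugate p') {m m' : ℕ → ℝ → ℝ}
    (h : ∀ n, MemW01 p (m n) (m' n)) {C : ℝ} (hC : ∀ n, ∫ x in Ioo (0 : ℝ) 1, ‖m n x‖ ^ p ≤ C)
    (hC' : ∀ n, ∫ x in Ioo (0 : ℝ) 1, ‖m' n x‖ ^ p ≤ C) :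
    ∃ (u u' : ℝ → ℝ) (k : ℕ → ℕ), StrictMono k ∧ MemW01 p u u' ∧
      Tendsto (fun n => ∫ x in Ioo (0 : ℝ) 1, ‖m (k n) x - u x‖ ^ p) atTop (𝓝 0) := by
  have hp0 := hp.pos
  have hC0 : 0 ≤ C := (integral_norm_rpow_nonneg _).trans (hC 0)
  obtain ⟨u', k, hk, hu', hlim⟩ := exists_weak_subseq hp.symm (fun n => (h n).2.1) hC'
  have hi' : ∀ n, IntegrableOn (m' n) (Ioo 0 1) := fun n => integrableOn_unit hp.lt (h n).2.1
  have hui := integrableOn_unit hp.lt hu'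
  set P : ℕ → ℝ → ℝ := fun n x => ∫ s in (0 : ℝ)..x, m' (k n) s with hP
  set Q : ℝ → ℝ := fun x => ∫ s in (0 : ℝ)..x, u' s with hQ
  -- weak convergence of the derivatives gives pointwise convergence of the primitives
  have hPQ : ∀ x ∈ Ioo (0 : ℝ) 1, Tendsto (fun n => P n x) atTop (𝓝 (Q x)) := by
    intro x hx
    have e : ∀ f : ℝ → ℝ, ∫ s in Ioo (0 : ℝ) 1, f s * (Ioc 0 x).indicator (fun _ => (1 : ℝ)) s =
        ∫ s in (0 : ℝ)..x, f s := by
      intro f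
      have e1 : (fun s => f s * (Ioc 0 x).indicator (fun _ => (1 : ℝ)) s) =
          (Ioc 0 x).indicator f := by
        ext s; by_cases hs : s ∈ Ioc 0 x <;> simp [hs]
      rw [e1, integral_indicator measurableSet_Ioc, Measure.restrict_restrict measurableSet_Ioc,
        inter_eq_left.2 (Ioc_subset_Ioo_right hx.2), intervalIntegral.integral_of_le hx.1.le]
    have h1 := hlim ((Ioc 0 x).indicator fun _ => (1 : ℝ))
      ((memLp_const (1 : ℝ)).indicator measurableSet_Ioc)
    simpa only [e] using h1
  set K := C ^ p⁻¹ with hK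
  have hPK : ∀ n, ∀ x ∈ Ioo (0 : ℝ) 1, |P n x| ≤ K := by
    intro n x hx
    have h1 := abs_integral_mul_le hp (μ := volume.restrict (Ioo (0 : ℝ) 1)) (f := fun _ => (1 : ℝ))
      (g := fun s => ‖m' (k n) s‖) (memLp_const 1) (h (k n)).2.1.norm
    simp only [one_mul, norm_one, Real.one_rpow, norm_norm] at h1
    rw [abs_of_nonneg (integral_nonneg fun _ => norm_nonneg _)] at h1
    simp only [integral_const, measureReal_restrict_apply_univ, Real.volume_real_Ioo, sub_zero,
      zero_le_one, sup_of_le_left, smul_eq_mul, mul_one, Real.one_rpow, one_mul] at h1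
    calc |P n x| ≤ ∫ s in Ioc 0 x, ‖m' (k n) s‖ := by
          rw [hP]; simp only
          rw [intervalIntegral.integral_of_le hx.1.le]
          exact norm_integral_le_integral_norm (m' (k n))
      _ ≤ ∫ s in Ioo 0 1, ‖m' (k n) s‖ :=
          setIntegral_mono_set (hi' _).norm (ae_of_all _ fun _ => norm_nonneg _)
            (Ioc_subset_Ioo_right hx.2).eventuallyLE
      _ ≤ _ := h1
      _ ≤ K := Real.rpow_le_rpow (integral_norm_rpow_nonneg _) (hC' _) (by positivity)
  have hQK : ∀ x ∈ Ioo (0 : ℝ) 1, |Q x| ≤ K := fun x hx =>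
    le_of_tendsto (hPQ x hx).abs (Eventually.of_forall fun n => hPK n x hx)
  have hPm : ∀ n, AEStronglyMeasurable (P n) (volume.restrict (Ioo 0 1)) := fun n =>
    (continuousOn_primitive (hi' _)).aestronglyMeasurable measurableSet_Ioo
  have hQm : AEStronglyMeasurable Q (volume.restrict (Ioo 0 1)) :=
    (continuousOn_primitive hui).aestronglyMeasurable measurableSet_Ioo
  have hPLp : ∀ n, MemLp (P n) (ENNReal.ofReal p) (volume.restrict (Ioo 0 1)) := fun n =>
    MemLp.of_bound (hPm n) K ((ae_restrict_iff' measurableSet_Ioo).2 (ae_of_all _ (hPK n)))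
  have hQLp : MemLp Q (ENNReal.ofReal p) (volume.restrict (Ioo 0 1)) :=
    MemLp.of_bound hQm K ((ae_restrict_iff' measurableSet_Ioo).2 (ae_of_all _ hQK))
  have hPQp : Tendsto (fun n => ∫ x in Ioo (0 : ℝ) 1, ‖P n x - Q x‖ ^ p) atTop (𝓝 0) := by
    have h1 := tendsto_integral_of_dominated_convergence (μ := volume.restrict (Ioo (0 : ℝ) 1))
      (F := fun n x => ‖P n x - Q x‖ ^ p) (f := fun _ => 0) (fun _ => (K + K) ^ p)
      (fun n => (integrable_norm_rpow hp.lt ((hPLp n).sub hQLp)).1) (integrable_const _)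
      (fun n => by
        refine (ae_restrict_iff' measurableSet_Ioo).2 (ae_of_all _ fun x hx => ?_)
        rw [Real.norm_of_nonneg (by positivity)]
        gcongr
        exact (norm_sub_le _ _).trans (add_le_add (hPK n x hx) (hQK x hx)))
      (by
        refine (ae_restrict_iff' measurableSet_Ioo).2 (ae_of_all _ fun x hx => ?_)
        have h2 := (tendsto_iff_norm_sub_tendsto_zero.1 (hPQ x hx)).rpow_const (p := p)
          (Or.inr hp0.le)
        rwa [Real.zero_rpow hp0.ne'] at h2)
    simpa using h1
  have hex : ∀ n, ∃ c, ∀ᵐ x ∂volume.restrict (Ioo 0 1), m (k n) x = c + P n x := fun n =>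
    exists_eq_add_primitive (integrableOn_unit hp.lt (h _).1) (hi' _) (h (k n)).2.2
  choose c hc using hex
  have hconst : ∀ a : ℝ, ∫ x in Ioo (0 : ℝ) 1, ‖a‖ ^ p = ‖a‖ ^ p := fun a => by simp
  -- the constants of integration are bounded, so they converge along a further subsequence
  set R := (2 ^ (p - 1) * (C + K ^ p)) ^ p⁻¹ with hR
  have hcR : ∀ n, c n ∈ Icc (-R) R := by
    intro n
    rw [mem_Icc, ← abs_le]
    have h1 := integral_norm_sub_rpow_le hp.lt (h (k n)).1 (hPLp n)
    have h2 : ∫ x in Ioo (0 : ℝ) 1, ‖m (k n) x - P n x‖ ^ p = ‖c n‖ ^ p := by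
      rw [← hconst]
      refine integral_congr_ae ?_
      filter_upwards [hc n] with x hx
      rw [hx, add_sub_cancel_right]
    have h3 : ∫ x in Ioo (0 : ℝ) 1, ‖P n x‖ ^ p ≤ K ^ p := by
      have h4 : ∫ x in Ioo (0 : ℝ) 1, ‖P n x‖ ^ p ≤ ∫ x in Ioo (0 : ℝ) 1, ‖K‖ ^ p := by
        refine integral_norm_rpow_mono hp.lt (memLp_const K)
          ((ae_restrict_iff' measurableSet_Ioo).2 (ae_of_all _ fun x hx => ?_))
        exact (hPK n x hx).trans (le_abs_self K)
      rwa [hconst, Real.norm_of_nonneg (by positivity)] at h4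
    rw [h2] at h1
    have h5 : ‖c n‖ ^ p ≤ 2 ^ (p - 1) * (C + K ^ p) :=
      h1.trans (by gcongr; exact hC _)
    calc |c n| = (‖c n‖ ^ p) ^ p⁻¹ := by
          rw [← Real.rpow_mul (norm_nonneg _), mul_inv_cancel₀ hp0.ne', Real.rpow_one]; rfl
      _ ≤ R := Real.rpow_le_rpow (by positivity) h5 (by positivity)
  obtain ⟨c₀, -, j, hj, hcj⟩ := tendsto_subseq_of_bounded (Metric.isBounded_Icc _ _) hcR
  refine ⟨fun x => c₀ + Q x, u', k ∘ j, hk.comp hj, ⟨(memLp_const c₀).add hQLp, hu', ?_⟩, ?_⟩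
  · have h1 := (hasWeakDeriv_const (Ω := Ioo (0 : ℝ) 1) c₀ 1).add (hasWeakDeriv_primitive hui)
      (LocInt.of_continuous continuous_const) (LocInt.of_continuous continuous_const)
      (LocInt.of_memLp hp.lt hQLp) (LocInt.of_memLp hp.lt hu')
    simpa only [zero_add] using h1
  · have hcs : Tendsto (fun n => ‖c (j n) - c₀‖ ^ p) atTop (𝓝 0) := by
      have h2 := (tendsto_iff_norm_sub_tendsto_zero.1 hcj).rpow_const (p := p) (Or.inr hp0.le)
      rwa [Real.zero_rpow hp0.ne'] at h2
    have hup := (hcs.add (hPQp.comp hj.tendsto_atTop)).const_mul (2 ^ (p - 1))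
    rw [add_zero, mul_zero] at hup
    refine tendsto_of_tendsto_of_tendsto_of_le_of_le tendsto_const_nhds hup
      (fun n => integral_norm_rpow_nonneg _) fun n => ?_
    have h1 := integral_norm_add_rpow_le hp.lt (μ := volume.restrict (Ioo (0 : ℝ) 1))
      (memLp_const (c (j n) - c₀)) ((hPLp (j n)).sub hQLp)
    rw [hconst] at h1
    refine le_of_eq_of_le (integral_congr_ae ?_) h1
    filter_upwards [hc (j n)] with x hx
    simp only [Function.comp, hx, Pi.sub_apply]
    ring_nf

end OneDimCompactness

end RoughThin

/-! ### Rescaled thin domains -/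

namespace RoughThin

section ThinDomain

/-- The rescaled thin domain `{(x, y) : 0 < x < 1, 0 < y < h(x)}`. -/
abbrev thin (h : ℝ → ℝ) : Set (ℝ × ℝ) := subgraph (Ioo 0 1) h

/-- `h` is bounded between positive constants on `(0,1)`, and continuous on the open set `U` of
full measure. -/
structure IsHeight (U : Set ℝ) (h : ℝ → ℝ) (H₀ H₁ : ℝ) : Prop where
  isOpen : IsOpen U
  subset : U ⊆ Ioo 0 1
  null : volume (Ioo 0 1 \ U) = 0
  continuousOn : ContinuousOn h U
  lower_pos : 0 < H₀
  lower : ∀ x ∈ Ioo (0 : ℝ) 1, H₀ ≤ h x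
  upper : ∀ x ∈ Ioo (0 : ℝ) 1, h x ≤ H₁

variable {U : Set ℝ} {h : ℝ → ℝ} {H₀ H₁ p p' : ℝ} {F : Type*} [NormedAddCommGroup F]

/-- The integral of `f` over the vertical fibre at `x`. -/
noncomputable def fiberInt (h : ℝ → ℝ) (f : ℝ × ℝ → ℝ) (x : ℝ) : ℝ := ∫ y in Ioo 0 (h x), f (x, y)

theorem fiberInt_norm_nonneg (h : ℝ → ℝ) (f : ℝ × ℝ → F) (x : ℝ) :
    0 ≤ fiberInt h (fun z => ‖f z‖) x := integral_nonneg fun _ => norm_nonneg _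

theorem integral_apply_rpow_le {α : Type*} [MeasurableSpace α] {μ : Measure α} (hp : 1 < p)
    {k : α → Vec2} (hk : MemLp k (ENNReal.ofReal p) μ) (i : Fin 2) :
    ∫ z, ‖k z i‖ ^ p ∂μ ≤ ∫ z, ‖k z‖ ^ p ∂μ :=
  integral_norm_rpow_mono hp hk (ae_of_all _ fun z => abs_apply_le (k z) i)

namespace IsHeight

theorem restrict_unit (hh : IsHeight U h H₀ H₁) :
    volume.restrict (Ioo (0 : ℝ) 1) = volume.restrict U := by
  refine (Measure.restrict_congr_set ?_).symm
  refine (LE.le.eventuallyLE hh.subset).antisymm ?_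
  filter_upwards [measure_eq_zero_iff_ae_notMem.1 hh.null] with x hx hxA
  by_contra hh
  exact hx ⟨hxA, hh⟩

theorem restrict_thin (hh : IsHeight U h H₀ H₁) :
    volume.restrict (thin h) = volume.restrict (subgraph U h) :=
  restrict_subgraph_eq hh.subset hh.null

theorem measurableSet (hh : IsHeight U h H₀ H₁) : MeasurableSet (subgraph U h) :=
  (isOpen_subgraph hh.isOpen hh.continuousOn).measurableSet

theorem ae_mem (hh : IsHeight U h H₀ H₁) :
    ∀ᵐ z ∂volume.restrict (thin h), z ∈ subgraph U h := by
  rw [hh.restrict_thin]; exact ae_restrict_mem hh.measurableSet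

theorem volume_lt_top (hh : IsHeight U h H₀ H₁) : volume U < ⊤ :=
  (measure_mono hh.subset).trans_lt (by simp)

theorem upper_pos (hh : IsHeight U h H₀ H₁) : 0 < H₁ := by
  have hx : (1 / 2 : ℝ) ∈ Ioo (0 : ℝ) 1 := by constructor <;> norm_num
  exact hh.lower_pos.trans_le ((hh.lower _ hx).trans (hh.upper _ hx))

theorem lowerU (hh : IsHeight U h H₀ H₁) : ∀ x ∈ U, H₀ ≤ h x := fun x hx =>
  hh.lower x (hh.subset hx)

theorem upperU (hh : IsHeight U h H₀ H₁) : ∀ x ∈ U, h x ≤ H₁ := fun x hx =>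
  hh.upper x (hh.subset hx)

theorem nonnegU (hh : IsHeight U h H₀ H₁) : ∀ x ∈ U, 0 ≤ h x := fun x hx =>
  hh.lower_pos.le.trans (hh.lowerU x hx)

theorem isFiniteMeasure (hh : IsHeight U h H₀ H₁) :
    IsFiniteMeasure (volume.restrict (thin h)) := ⟨by
  rw [Measure.restrict_apply_univ]
  refine (measure_mono (subgraph_subset_prod (H₁ := H₁) hh.upper)).trans_lt ?_
  rw [Measure.volume_eq_prod, Measure.prod_prod]
  exact ENNReal.mul_lt_top (by simp) (by simp)⟩

theorem integrableOn (hh : IsHeight U h H₀ H₁) (hp : 1 < p) {f : ℝ × ℝ → F}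
    (hf : MemLp f (ENNReal.ofReal p) (volume.restrict (thin h))) : IntegrableOn f (thin h) :=
  have := hh.isFiniteMeasure
  hf.integrable (by simpa using ENNReal.ofReal_le_ofReal hp.le)

theorem integral_eq (hh : IsHeight U h H₀ H₁) {f : ℝ × ℝ → ℝ} (hf : IntegrableOn f (thin h)) :
    ∫ z in thin h, f z = ∫ x in Ioo (0 : ℝ) 1, fiberInt h f x := by
  rw [IntegrableOn, hh.restrict_thin] at hf
  rw [hh.restrict_thin, hh.restrict_unit]
  exact integral_subgraph hh.isOpen hh.continuousOn hf

theorem integrableOn_fiberInt (hh : IsHeight U h H₀ H₁) {f : ℝ × ℝ → ℝ}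
    (hf : IntegrableOn f (thin h)) : IntegrableOn (fiberInt h f) (Ioo 0 1) := by
  rw [IntegrableOn, hh.restrict_thin] at hf
  rw [IntegrableOn, hh.restrict_unit]
  exact integrableOn_fiber_integral hh.isOpen hh.continuousOn hf

theorem integral_mul_comp_fst (hh : IsHeight U h H₀ H₁) {f : ℝ × ℝ → ℝ} {φ : ℝ → ℝ}
    (hf : IntegrableOn (fun z => f z * φ z.1) (thin h)) :
    ∫ z in thin h, f z * φ z.1 = ∫ x in Ioo (0 : ℝ) 1, fiberInt h f x * φ x := by
  rw [hh.integral_eq hf]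
  congr 1; ext x
  exact integral_mul_const (φ x) fun y => f (x, y)

theorem integral_comp_fst (hh : IsHeight U h H₀ H₁) {φ : ℝ → ℝ} (hφ : IntegrableOn φ (Ioo 0 1)) :
    ∫ z in thin h, φ z.1 = ∫ x in Ioo (0 : ℝ) 1, h x * φ x := by
  rw [IntegrableOn, hh.restrict_unit] at hφ
  rw [hh.restrict_thin, hh.restrict_unit]
  exact RoughThin.integral_comp_fst hh.isOpen hh.continuousOn hh.upperU hh.nonnegU hφ

theorem memLp_comp_fst (hh : IsHeight U h H₀ H₁) (hp : 1 < p) {φ : ℝ → F}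
    (hφ : MemLp φ (ENNReal.ofReal p) (volume.restrict (Ioo 0 1))) :
    MemLp (fun z : ℝ × ℝ => φ z.1) (ENNReal.ofReal p) (volume.restrict (thin h)) :=
  RoughThin.memLp_comp_fst hp hh.upper hφ

theorem integral_norm_rpow_comp_fst_le (hh : IsHeight U h H₀ H₁) (hp : 1 < p) {φ : ℝ → F}
    (hφ : MemLp φ (ENNReal.ofReal p) (volume.restrict (Ioo 0 1))) :
    ∫ z in thin h, ‖φ z.1‖ ^ p ≤ H₁ * ∫ x in Ioo (0 : ℝ) 1, ‖φ x‖ ^ p := by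
  rw [hh.restrict_unit] at hφ
  rw [hh.restrict_thin, hh.restrict_unit]
  exact RoughThin.integral_norm_rpow_comp_fst_le hp hh.isOpen hh.continuousOn hh.upperU hh.nonnegU hφ

/-- Vertical integration is bounded from `L^p` of the thin domain to `L^p(0,1)`. -/
theorem memLp_fiberInt_norm (hh : IsHeight U h H₀ H₁) (hp : p.HolderConjugate p') {f : ℝ × ℝ → F}
    (hf : MemLp f (ENNReal.ofReal p) (volume.restrict (thin h))) :
    MemLp (fiberInt h fun z => ‖f z‖) (ENNReal.ofReal p) (volume.restrict (Ioo 0 1)) ∧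
    ∫ x in Ioo (0 : ℝ) 1, ‖fiberInt h (fun z => ‖f z‖) x‖ ^ p ≤
      H₁ ^ (p - 1) * ∫ z in thin h, ‖f z‖ ^ p := by
  rw [hh.restrict_thin] at hf ⊢
  rw [hh.restrict_unit]
  obtain ⟨h1, h2⟩ := memLp_fiber_integral_norm hp hh.isOpen hh.volume_lt_top hh.continuousOn
    hh.upper_pos.le hh.upperU hf
  refine ⟨h1, le_of_eq_of_le ?_ h2⟩
  congr 1; ext x
  rw [Real.norm_of_nonneg (fiberInt_norm_nonneg _ _ _)]
  rfl

theorem memLp_fiberInt (hh : IsHeight U h H₀ H₁) (hp : p.HolderConjugate p') {f : ℝ × ℝ → ℝ}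
    (hf : MemLp f (ENNReal.ofReal p) (volume.restrict (thin h))) :
    MemLp (fiberInt h f) (ENNReal.ofReal p) (volume.restrict (Ioo 0 1)) ∧
    ∫ x in Ioo (0 : ℝ) 1, ‖fiberInt h f x‖ ^ p ≤ H₁ ^ (p - 1) * ∫ z in thin h, ‖f z‖ ^ p := by
  obtain ⟨h1, h2⟩ := hh.memLp_fiberInt_norm hp hf
  have hle : ∀ x, ‖fiberInt h f x‖ ≤ ‖fiberInt h (fun z => ‖f z‖) x‖ := fun x => by
    rw [Real.norm_of_nonneg (fiberInt_norm_nonneg h f x)]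
    exact norm_integral_le_integral_norm fun y => f (x, y)
  exact ⟨h1.mono (hh.integrableOn_fiberInt (hh.integrableOn hp.lt hf)).1 (ae_of_all _ hle),
    (integral_norm_rpow_mono hp.lt h1 (ae_of_all _ hle)).trans h2⟩

end IsHeight

/-- `φ ∈ W^{1,p}(Ω)` in the variables rescaled by `ε` in the vertical direction: `k` is the
gradient of `φ` in the original variables, so that the vertical derivative is `ε k₂`. -/
structure MemScaledW (p ε : ℝ) (Ω : Set (ℝ × ℝ)) (φ : ℝ × ℝ → ℝ) (k : ℝ × ℝ → Vec2) : Prop where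
  memLp : MemLp φ (ENNReal.ofReal p) (volume.restrict Ω)
  memLp_grad : MemLp k (ENNReal.ofReal p) (volume.restrict Ω)
  deriv_fst : HasWeakDeriv Ω φ (1, 0) (fun z => k z 0)
  deriv_snd : HasWeakDeriv Ω φ (0, 1) (fun z => ε * k z 1)

variable {ε : ℝ} {φ V : ℝ × ℝ → ℝ} {k : ℝ × ℝ → Vec2}

theorem memScaledW_comp_fst (hh : IsHeight U h H₀ H₁) (hp : 1 < p) {ψ ψ' : ℝ → ℝ}
    (hψ : MemW01 p ψ ψ') :
    MemScaledW p ε (thin h) (fun z => ψ z.1) (fun z => ψ' z.1 • e₁) := by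
  obtain ⟨h1, h2, h3⟩ := hψ
  obtain ⟨h4, h5⟩ := hasWeakDeriv_comp_fst (Ω := thin h) (fun z hz => hz.1)
    (integrableOn_unit hp h1) (integrableOn_unit hp h2) h3
  refine ⟨hh.memLp_comp_fst hp h1, ?_, by simpa [e₁] using h4, by simpa [e₁] using h5⟩
  have h6 := hh.memLp_comp_fst (F := Vec2) (φ := fun x => ψ' x • e₁) hp
    (((ContinuousLinearMap.toSpanSingleton ℝ e₁).comp_memLp' h2))
  exact h6

variable {hS : ℝ → ℝ} {S₀ S₁ : ℝ} {θ : ℝ → ℝ}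

theorem ae_mem_of_mem_tsupport (hh : IsHeight U h H₀ H₁)
    (hle : ∀ x ∈ Ioo (0 : ℝ) 1, x ∈ tsupport θ → h x ≤ hS x) :
    ∀ᵐ z ∂volume.restrict (thin h), z.1 ∈ tsupport θ → z ∈ subgraph U hS := by
  filter_upwards [hh.ae_mem] with z hz hθ
  exact ⟨hz.1, hz.2.1, hz.2.2.trans_le (hle _ (hh.subset hz.1) hθ)⟩

/-- A function on one domain, multiplied by a cut-off over whose support another domain is
contained in the first, is a function on that other domain. -/
theorem memLp_cutoff_smul [NormedSpace ℝ F] (hp : 1 < p) (hh : IsHeight U h H₀ H₁)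
    (hhS : IsHeight U hS S₀ S₁) (hθ : Continuous θ) {M : ℝ} (hM : ∀ x, |θ x| ≤ M)
    (hle : ∀ x ∈ Ioo (0 : ℝ) 1, x ∈ tsupport θ → h x ≤ hS x) {f : ℝ × ℝ → F}
    (hf : MemLp f (ENNReal.ofReal p) (volume.restrict (thin hS))) :
    MemLp (fun z => θ z.1 • f z) (ENNReal.ofReal p) (volume.restrict (thin h)) ∧
    ∫ z in thin h, ‖θ z.1 • f z‖ ^ p ≤ M ^ p * ∫ z in thin hS, ‖f z‖ ^ p := by
  have hM0 : 0 ≤ M := (abs_nonneg _).trans (hM 0)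
  rw [hhS.restrict_thin] at hf
  have hind : MemLp ((subgraph U hS).indicator f) (ENNReal.ofReal p) volume :=
    (memLp_indicator_iff_restrict hhS.measurableSet).2 hf
  have hcm : MemLp (fun z => θ z.1 • (subgraph U hS).indicator f z) (ENNReal.ofReal p) volume := by
    refine (hind.const_smul M).mono ?_ (ae_of_all _ fun z => ?_)
    · exact (hθ.comp continuous_fst).aestronglyMeasurable.smul hind.1
    · rw [Pi.smul_apply, norm_smul, norm_smul, Real.norm_eq_abs, Real.norm_of_nonneg hM0]
      gcongr; exact hM _
  have hae : (fun z => θ z.1 • (subgraph U hS).indicator f z)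
      =ᵐ[volume.restrict (thin h)] fun z => θ z.1 • f z := by
    filter_upwards [ae_mem_of_mem_tsupport hh hle] with z hz
    by_cases h0 : θ z.1 = 0
    · simp [h0]
    · rw [indicator_of_mem (hz (subset_tsupport _ h0))]
  refine ⟨(hcm.restrict _).ae_eq hae, ?_⟩
  calc ∫ z in thin h, ‖θ z.1 • f z‖ ^ p
      = ∫ z in thin h, ‖θ z.1 • (subgraph U hS).indicator f z‖ ^ p :=
        integral_congr_ae (hae.symm.fun_comp fun s => ‖s‖ ^ p)
    _ ≤ ∫ z, ‖θ z.1 • (subgraph U hS).indicator f z‖ ^ p :=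
        setIntegral_le_integral (integrable_norm_rpow hp hcm) (ae_of_all _ fun _ => by positivity)
    _ ≤ ∫ z, ‖M • (subgraph U hS).indicator f z‖ ^ p := by
        refine integral_norm_rpow_mono hp (hind.const_smul M) (ae_of_all _ fun z => ?_)
        rw [norm_smul, norm_smul, Real.norm_eq_abs, Real.norm_of_nonneg hM0]
        gcongr; exact hM _
    _ = M ^ p * ∫ z in thin hS, ‖f z‖ ^ p := by
        rw [hhS.restrict_thin, ← integral_const_mul, ← integral_indicator hhS.measurableSet]
        congr 1; ext z
        by_cases hz : z ∈ subgraph U hS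
        · rw [indicator_of_mem hz, indicator_of_mem hz, norm_smul, Real.norm_of_nonneg hM0,
            Real.mul_rpow hM0 (norm_nonneg _)]
        · rw [indicator_of_notMem hz, indicator_of_notMem hz, smul_zero, norm_zero,
            Real.zero_rpow (by linarith)]

/-- Monotonicity in the domain of the integral of a nonnegative function against a cut-off. -/
theorem integral_cutoff_mul_mono (hh : IsHeight U h H₀ H₁) (hhS : IsHeight U hS S₀ S₁)
    (hθ : ∀ x, 0 ≤ θ x) (hle : ∀ x ∈ Ioo (0 : ℝ) 1, x ∈ tsupport θ → h x ≤ hS x) {f : ℝ × ℝ → ℝ}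
    (hf0 : ∀ z, 0 ≤ f z) (hf : IntegrableOn (fun z => θ z.1 * f z) (thin hS)) :
    ∫ z in thin h, θ z.1 * f z ≤ ∫ z in thin hS, θ z.1 * f z := by
  rw [IntegrableOn, hhS.restrict_thin] at hf
  have hae : (fun z => θ z.1 * f z) =ᵐ[volume.restrict (thin h)]
      (subgraph U hS).indicator fun z => θ z.1 * f z := by
    filter_upwards [ae_mem_of_mem_tsupport hh hle] with z hz
    by_cases h0 : θ z.1 = 0
    · rw [eq_comm, h0, zero_mul]
      exact indicator_apply_eq_zero.2 fun _ => by rw [h0, zero_mul]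
    · rw [indicator_of_mem (hz (subset_tsupport _ h0))]
  rw [integral_congr_ae hae, hhS.restrict_thin, ← integral_indicator hhS.measurableSet]
  exact setIntegral_le_integral ((integrable_indicator_iff hhS.measurableSet).2 hf)
    (ae_of_all _ fun z => indicator_nonneg (fun z _ => mul_nonneg (hθ _) (hf0 _)) z)

theorem exists_bound_of_hasCompactSupport (hθ : Continuous θ) (hc : HasCompactSupport θ) :
    ∃ M, 0 ≤ M ∧ ∀ x, |θ x| ≤ M := by
  obtain ⟨M, hM⟩ := hc.exists_bound_of_continuous hθ
  exact ⟨M, (norm_nonneg _).trans (hM 0), hM⟩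

theorem fderiv_comp_fst (hθ : ContDiff ℝ ∞ θ) (z w : ℝ × ℝ) :
    fderiv ℝ (fun z : ℝ × ℝ => θ z.1) z w = deriv θ z.1 * w.1 := by
  have h1 : HasFDerivAt (fun z : ℝ × ℝ => θ z.1)
      ((fderiv ℝ θ z.1).comp (ContinuousLinearMap.fst ℝ ℝ ℝ)) z :=
    (hθ.differentiable (by simp) z.1).hasFDerivAt.comp z hasFDerivAt_fst
  rw [h1.fderiv, ContinuousLinearMap.comp_apply, fderiv_eq_smul_deriv,
    smul_eq_mul, mul_comm]
  rfl

theorem tsupport_comp_fst_subset : tsupport (fun z : ℝ × ℝ => θ z.1) ⊆ Prod.fst ⁻¹' tsupport θ :=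
  closure_minimal (fun _ hz => subset_tsupport θ hz)
    ((isClosed_tsupport θ).preimage continuous_fst)

/-- Transfer of a function between domains: where the cut-off lives, the domain under `h` is
contained in the domain under `hS`, so the product is a function on the former. -/
theorem MemScaledW.cutoff_mul (hp : 1 < p) (hh : IsHeight U h H₀ H₁) (hhS : IsHeight U hS S₀ S₁)
    (hV : MemScaledW p ε (thin hS) V k) (hθ : ContDiff ℝ ∞ θ) (hc : HasCompactSupport θ)
    (hle : ∀ x ∈ Ioo (0 : ℝ) 1, x ∈ tsupport θ → h x ≤ hS x) :
    MemScaledW p ε (thin h) (fun z => θ z.1 * V z)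
      (fun z => θ z.1 • k z + (deriv θ z.1 * V z) • e₁) := by
  have hθ' : Continuous (deriv θ) := hθ.continuous_deriv (by simp)
  obtain ⟨M, hM0, hM⟩ := exists_bound_of_hasCompactSupport hθ.continuous hc
  obtain ⟨M', hM0', hM'⟩ := exists_bound_of_hasCompactSupport hθ' hc.deriv
  have hle' : ∀ x ∈ Ioo (0 : ℝ) 1, x ∈ tsupport (deriv θ) → h x ≤ hS x := fun x hx hxs =>
    hle x hx (tsupport_deriv_subset hxs)
  have hs : tsupport (fun z : ℝ × ℝ => θ z.1) ∩ thin h ⊆ thin hS := fun z hz =>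
    ⟨hz.2.1, hz.2.2.1, hz.2.2.2.trans_le (hle _ hz.2.1 (tsupport_comp_fst_subset hz.1))⟩
  have hloc := LocInt.of_memLp hp hV.memLp
  have h1 := hV.deriv_fst.smooth_mul (hθ.comp contDiff_fst) hs hloc
    (LocInt.of_memLp hp (memLp_apply hV.memLp_grad 0))
  have h2 := hV.deriv_snd.smooth_mul (hθ.comp contDiff_fst) hs hloc
    (LocInt.of_memLp hp ((memLp_apply hV.memLp_grad 1).const_mul ε))
  refine ⟨(memLp_cutoff_smul hp hh hhS hθ.continuous hM hle hV.memLp).1,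
    (memLp_cutoff_smul hp hh hhS hθ.continuous hM hle hV.memLp_grad).1.add
      ((ContinuousLinearMap.toSpanSingleton ℝ e₁).comp_memLp'
        (memLp_cutoff_smul hp hh hhS hθ' hM' hle' hV.memLp).1), ?_, ?_⟩
  · refine h1.congr_on (fun _ _ => rfl) fun z _ => ?_
    have := fderiv_comp_fst hθ z (1, 0)
    simp only [Function.comp_def, this]
    simp [e₁]
  · refine h2.congr_on (fun _ _ => rfl) fun z _ => ?_
    have := fderiv_comp_fst hθ z (0, 1)
    simp only [Function.comp_def, this]
    simp [e₁]; ring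

/-- The vertical means of a function in the rescaled space. -/
theorem MemScaledW.vertMean (hp : p.HolderConjugate p') (hh : IsHeight U h H₀ H₁) {χ : ℝ → ℝ}
    (hχ : IsWeight H₀ χ) {M : ℝ} (hM0 : 0 ≤ M) (hM : ∀ y, χ y ≤ M) (hV : MemScaledW p ε (thin h) V k) :
    MemW01 p (vertMean χ V) (vertMean χ fun z => k z 0) ∧
    ∫ x in Ioo (0 : ℝ) 1, ‖RoughThin.vertMean χ V x‖ ^ p ≤
      M ^ p * H₁ ^ (p - 1) * ∫ z in thin h, ‖V z‖ ^ p ∧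
    ∫ x in Ioo (0 : ℝ) 1, ‖RoughThin.vertMean χ (fun z => k z 0) x‖ ^ p ≤
      M ^ p * H₁ ^ (p - 1) * ∫ z in thin h, ‖k z‖ ^ p := by
  have key : ∀ {f : ℝ × ℝ → ℝ}, MemLp f (ENNReal.ofReal p) (volume.restrict (thin h)) →
      MemLp (RoughThin.vertMean χ f) (ENNReal.ofReal p) (volume.restrict (Ioo 0 1)) ∧
      ∫ x in Ioo (0 : ℝ) 1, ‖RoughThin.vertMean χ f x‖ ^ p ≤
        M ^ p * H₁ ^ (p - 1) * ∫ z in thin h, ‖f z‖ ^ p := by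
    intro f hf
    have h1 : MemLp (fun z => f z * χ z.2) (ENNReal.ofReal p) (volume.restrict (thin h)) := by
      refine (hf.const_mul M).mono (hf.1.mul
        (hχ.smooth.continuous.comp continuous_snd).aestronglyMeasurable) (ae_of_all _ fun z => ?_)
      rw [norm_mul, norm_mul, Real.norm_of_nonneg (hχ.nonneg _), Real.norm_of_nonneg hM0, mul_comm]
      gcongr; exact hM _
    obtain ⟨h2, h3⟩ := hh.memLp_fiberInt hp h1
    have he : ∀ x ∈ Ioo (0 : ℝ) 1, fiberInt h (fun z => f z * χ z.2) x =
        RoughThin.vertMean χ f x := fun x hx => (vertMean_eq_fiber hχ hh.lower f hx).symm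
    have hae : fiberInt h (fun z => f z * χ z.2) =ᵐ[volume.restrict (Ioo 0 1)]
        RoughThin.vertMean χ f := (ae_restrict_iff' measurableSet_Ioo).2 (ae_of_all _ he)
    refine ⟨h2.ae_eq hae, ?_⟩
    refine (integral_congr_ae (hae.symm.fun_comp fun s => ‖s‖ ^ p)).trans_le (h3.trans ?_)
    have h4 : ∫ z in thin h, ‖f z * χ z.2‖ ^ p ≤ M ^ p * ∫ z in thin h, ‖f z‖ ^ p := by
      calc ∫ z in thin h, ‖f z * χ z.2‖ ^ p ≤ ∫ z in thin h, ‖M * f z‖ ^ p := by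
            refine integral_norm_rpow_mono hp.lt (hf.const_mul M) (ae_of_all _ fun z => ?_)
            rw [norm_mul, norm_mul, Real.norm_of_nonneg (hχ.nonneg _), Real.norm_of_nonneg hM0,
              mul_comm]
            gcongr; exact hM _
        _ = _ := by
            rw [← integral_const_mul]
            congr 1; ext z
            rw [norm_mul, Real.norm_of_nonneg hM0, Real.mul_rpow hM0 (norm_nonneg _)]
    have := hh.upper_pos
    calc _ ≤ H₁ ^ (p - 1) * (M ^ p * ∫ z in thin h, ‖f z‖ ^ p) := by gcongr
      _ = _ := by ring
  have h0 := memLp_apply hV.memLp_grad 0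
  refine ⟨⟨(key hV.memLp).1, (key h0).1, ?_⟩, (key hV.memLp).2, (key h0).2.trans ?_⟩
  · exact hasWeakDeriv_vertMean hχ (show Ioo (0 : ℝ) 1 ×ˢ Ioo 0 H₀ ⊆ thin h from fun z hz =>
      ⟨hz.1, hz.2.1, hz.2.2.trans_le (hh.lower _ hz.1)⟩) (LocInt.of_memLp hp.lt hV.memLp)
      (LocInt.of_memLp hp.lt h0) hV.deriv_fst
  · have := hh.upper_pos
    exact mul_le_mul_of_nonneg_left (integral_apply_rpow_le hp.lt hV.memLp_grad 0) (by positivity)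

/-- In a thin domain a function is close to its vertical means. -/
theorem MemScaledW.integral_sub_vertMean_le (hp : p.HolderConjugate p') (hh : IsHeight U h H₀ H₁)
    {χ : ℝ → ℝ} (hχ : IsWeight H₀ χ) (hε : 0 ≤ ε) (hV : MemScaledW p ε (thin h) V k) :
    ∫ z in thin h, ‖V z - RoughThin.vertMean χ V z.1‖ ^ p ≤
      (H₁ * ε) ^ p * ∫ z in thin h, ‖k z‖ ^ p := by
  have h1 := (memLp_apply hV.memLp_grad 1)
  obtain ⟨h2, h3⟩ := hh.memLp_fiberInt_norm hp h1
  have hH := hh.upper_pos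
  have hVi := hh.integrableOn hp.lt hV.memLp
  have hgi := hh.integrableOn hp.lt (h1.const_mul ε)
  rw [IntegrableOn, hh.restrict_thin] at hVi hgi
  have hae := abs_sub_vertMean_le hh.isOpen hh.continuousOn hh.lowerU hh.upperU hχ hVi hgi
    (hV.deriv_snd.mono (subgraph_mono hh.subset fun _ _ => le_rfl))
  rw [← hh.restrict_thin] at hae
  calc ∫ z in thin h, ‖V z - RoughThin.vertMean χ V z.1‖ ^ p
      ≤ ∫ z in thin h, ‖(fun x => ε * fiberInt h (fun z => ‖k z 1‖) x) z.1‖ ^ p := by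
        refine integral_norm_rpow_mono hp.lt (hh.memLp_comp_fst hp.lt (h2.const_mul ε)) ?_
        filter_upwards [hae] with z hz
        rw [Real.norm_eq_abs, Real.norm_of_nonneg (mul_nonneg hε
          (fiberInt_norm_nonneg _ _ _)), fiberInt, ← integral_const_mul]
        simpa only [abs_mul, abs_of_nonneg hε, Real.norm_eq_abs] using hz
    _ ≤ H₁ * ∫ x in Ioo (0 : ℝ) 1, ‖ε * fiberInt h (fun z => ‖k z 1‖) x‖ ^ p :=
        hh.integral_norm_rpow_comp_fst_le hp.lt (h2.const_mul ε)
    _ = H₁ * (ε ^ p * ∫ x in Ioo (0 : ℝ) 1, ‖fiberInt h (fun z => ‖k z 1‖) x‖ ^ p) := by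
        simp only [norm_mul, Real.norm_of_nonneg hε, Real.mul_rpow hε (norm_nonneg _),
          integral_const_mul]
    _ ≤ H₁ * (ε ^ p * (H₁ ^ (p - 1) * ∫ z in thin h, ‖k z‖ ^ p)) := by
        gcongr
        exact h3.trans (mul_le_mul_of_nonneg_left
          (integral_apply_rpow_le hp.lt hV.memLp_grad 1) (by positivity))
    _ = _ := by
        rw [Real.mul_rpow hH.le hε, show H₁ ^ p = H₁ ^ (p - 1) * H₁ by
          rw [← Real.rpow_add_one hH.ne', sub_add_cancel]]
        ring

end ThinDomain

end RoughThin

/-! ### Sequences of solutions: bounds and compactness -/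

namespace RoughThin

section ThinSequence

/-- A sequence of solutions of the rescaled Neumann problem in the thin domains
`{0 < x < 1, 0 < y < h n x}`, with data whose vertical integrals converge weakly to `fhat`, and
with heights that converge weakly to `r`. -/
structure IsThinSequence (p p' : ℝ) (U : Set ℝ) (H₀ H₁ : ℝ) (ε : ℕ → ℝ) (h : ℕ → ℝ → ℝ)
    (f u : ℕ → ℝ × ℝ → ℝ) (g : ℕ → ℝ × ℝ → Vec2) (fhat r : ℝ → ℝ) : Prop where
  eps_pos : ∀ n, 0 < ε n
  eps_tendsto : Tendsto ε atTop (𝓝 0)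
  height : ∀ n, IsHeight U (h n) H₀ H₁
  memLp_force : ∀ n, MemLp (f n) (ENNReal.ofReal p') (volume.restrict (thin (h n)))
  memScaledW : ∀ n, MemScaledW p (ε n) (thin (h n)) (u n) (g n)
  eq : ∀ n φ k, MemScaledW p (ε n) (thin (h n)) φ k →
    ∫ z in thin (h n), (inner ℝ (flux p (g n z)) (k z) + flux p (u n z) * φ z) =
      ∫ z in thin (h n), f n z * φ z
  force : Tendsto (fun n => ε n ^ p' * ∫ z in thin (h n), ‖f n z‖ ^ p') atTop (𝓝 0)
  memLp_fhat : MemLp fhat (ENNReal.ofReal p') (volume.restrict (Ioo 0 1))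
  weak_force : ∀ φ, MemLp φ (ENNReal.ofReal p) (volume.restrict (Ioo 0 1)) →
    Tendsto (fun n => ∫ x in Ioo (0 : ℝ) 1, fiberInt (h n) (f n) x * φ x) atTop
      (𝓝 (∫ x in Ioo (0 : ℝ) 1, fhat x * φ x))
  weak_height : ∀ ψ, IntegrableOn ψ (Ioo 0 1) →
    Tendsto (fun n => ∫ x in Ioo (0 : ℝ) 1, h n x * ψ x) atTop
      (𝓝 (∫ x in Ioo (0 : ℝ) 1, r x * ψ x))

variable {p p' : ℝ} {U : Set ℝ} {H₀ H₁ : ℝ} {ε : ℕ → ℝ} {h : ℕ → ℝ → ℝ}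
    {f u : ℕ → ℝ × ℝ → ℝ} {g : ℕ → ℝ × ℝ → Vec2} {fhat r : ℝ → ℝ}

theorem rpow_inv_mul_rpow {p a ε : ℝ} (hp : 0 < p) (ha : 0 ≤ a) (hε : 0 ≤ ε) :
    (ε ^ p * a) ^ p⁻¹ = ε * a ^ p⁻¹ := by
  rw [Real.mul_rpow (by positivity) ha, ← Real.rpow_mul hε, mul_inv_cancel₀ hp.ne', Real.rpow_one]

theorem inner_smul_e₁ (s : Vec2) (c : ℝ) : inner ℝ s (c • e₁) = s 0 * c := by
  rw [real_inner_smul_right, inner_e₁, mul_comm]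

namespace IsThinSequence

theorem comp (H : IsThinSequence p p' U H₀ H₁ ε h f u g fhat r) {k : ℕ → ℕ} (hk : StrictMono k) :
    IsThinSequence p p' U H₀ H₁ (ε ∘ k) (h ∘ k) (f ∘ k) (u ∘ k) (g ∘ k) fhat r where
  eps_pos _ := H.eps_pos _
  eps_tendsto := H.eps_tendsto.comp hk.tendsto_atTop
  height _ := H.height _
  memLp_force _ := H.memLp_force _
  memScaledW _ := H.memScaledW _
  eq _ := H.eq _
  force := H.force.comp hk.tendsto_atTop
  memLp_fhat := H.memLp_fhat
  weak_force φ hφ := (H.weak_force φ hφ).comp hk.tendsto_atTop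
  weak_height ψ hψ := (H.weak_height ψ hψ).comp hk.tendsto_atTop

/-- The force may blow up in `L^{p'}` slower than `1/ε`, so its pairing with functions of size `ε`
is under control. -/
theorem abs_integral_force_le (H : IsThinSequence p p' U H₀ H₁ ε h f u g fhat r)
    (hp : p.HolderConjugate p') {n : ℕ} {W : ℝ × ℝ → ℝ}
    (hW : MemLp W (ENNReal.ofReal p) (volume.restrict (thin (h n)))) {C : ℝ} (hC : 0 ≤ C)
    (hle : ∫ z in thin (h n), ‖W z‖ ^ p ≤ ε n ^ p * C) :
    |∫ z in thin (h n), f n z * W z| ≤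
      (ε n ^ p' * ∫ z in thin (h n), ‖f n z‖ ^ p') ^ p'⁻¹ * C ^ p⁻¹ := by
  have hε := (H.eps_pos n).le
  have hp0 := hp.pos
  have hI : 0 ≤ ∫ z in thin (h n), ‖f n z‖ ^ p' := integral_norm_rpow_nonneg _
  calc |∫ z in thin (h n), f n z * W z|
      ≤ (∫ z in thin (h n), ‖f n z‖ ^ p') ^ p'⁻¹ * (∫ z in thin (h n), ‖W z‖ ^ p) ^ p⁻¹ :=
        abs_integral_mul_le hp (H.memLp_force n) hW
    _ ≤ (∫ z in thin (h n), ‖f n z‖ ^ p') ^ p'⁻¹ * (ε n ^ p * C) ^ p⁻¹ := by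
        gcongr
    _ = _ := by
        rw [rpow_inv_mul_rpow hp0 hC hε, rpow_inv_mul_rpow hp.symm.pos hI hε]; ring

theorem tendsto_integral_force (H : IsThinSequence p p' U H₀ H₁ ε h f u g fhat r)
    (hp : p.HolderConjugate p') {W : ℕ → ℝ × ℝ → ℝ}
    (hW : ∀ n, MemLp (W n) (ENNReal.ofReal p) (volume.restrict (thin (h n)))) {C : ℝ} (hC : 0 ≤ C)
    (hle : ∀ n, ∫ z in thin (h n), ‖W n z‖ ^ p ≤ ε n ^ p * C) :
    Tendsto (fun n => ∫ z in thin (h n), f n z * W n z) atTop (𝓝 0) := by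
  have h1 := (H.force.rpow_const (p := p'⁻¹) (Or.inr hp.symm.inv_nonneg)).mul_const (C ^ p⁻¹)
  rw [Real.zero_rpow hp.symm.inv_ne_zero, zero_mul] at h1
  exact squeeze_zero_norm (fun n => H.abs_integral_force_le hp (hW n) hC (hle n)) h1

theorem integrable_force_mul (H : IsThinSequence p p' U H₀ H₁ ε h f u g fhat r)
    (hp : p.HolderConjugate p') {n : ℕ} {W : ℝ × ℝ → ℝ}
    (hW : MemLp W (ENNReal.ofReal p) (volume.restrict (thin (h n)))) :
    IntegrableOn (fun z => f n z * W z) (thin (h n)) :=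
  integrable_mul_of_memLp hp (H.memLp_force n) hW

/-- The energy estimate: the part of `u` that varies vertically is of order `ε` and pairs with
the force, the vertical mean pairs with the vertical integral of the force, which is weakly
convergent and hence bounded. -/
theorem exists_bound (H : IsThinSequence p p' U H₀ H₁ ε h f u g fhat r)
    (hp : p.HolderConjugate p') (hH₀ : 0 < H₀) :
    ∃ C, 0 ≤ C ∧ ∀ n, ∫ z in thin (h n), ‖g n z‖ ^ p ≤ C ∧ ∫ z in thin (h n), ‖u n z‖ ^ p ≤ C := by
  have hp0 := hp.pos
  have hH1 := (H.height 0).upper_pos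
  obtain ⟨χ, hχ⟩ := exists_isWeight hH₀
  obtain ⟨M, hM0, hM⟩ := hχ.exists_bound
  obtain ⟨K₁, hK₁⟩ := H.force.bddAbove_range
  have hK₁' : ∀ n, ε n ^ p' * ∫ z in thin (h n), ‖f n z‖ ^ p' ≤ K₁ := fun n => hK₁ ⟨n, rfl⟩
  have hK₁0 : 0 ≤ K₁ := le_trans (mul_nonneg (Real.rpow_nonneg (H.eps_pos 0).le _)
    (integral_norm_rpow_nonneg _)) (hK₁' 0)
  obtain ⟨K₂, hK₂0, hK₂⟩ := exists_bound_of_weak_tendsto hp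
    (fun n => ((H.height n).memLp_fiberInt hp.symm (H.memLp_force n)).1) H.weak_force
  -- `K₁` bounds the pairing with the oscillating part, `K₂` the pairing with the mean, and `D` is
  -- the constant in the bound of the mean by `u`
  set D := M ^ p * H₁ ^ (p - 1) with hD
  have hD0 : 0 ≤ D := by positivity
  set K := K₁ ^ p'⁻¹ * H₁ + K₂ * D ^ p⁻¹ with hK
  have hK0 : 0 ≤ K := by positivity
  refine ⟨K ^ p', by positivity, fun n => ?_⟩
  have hε := (H.eps_pos n).le
  have hn := H.height n
  set A := ∫ z in thin (h n), ‖g n z‖ ^ p with hA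
  set B := ∫ z in thin (h n), ‖u n z‖ ^ p with hB
  have hA0 : 0 ≤ A := integral_norm_rpow_nonneg _
  have hB0 : 0 ≤ B := integral_norm_rpow_nonneg _
  obtain ⟨hm, hmle, -⟩ := (H.memScaledW n).vertMean hp hn hχ hM0 hM
  have hcl := (H.memScaledW n).integral_sub_vertMean_le hp hn hχ hε
  set m := vertMean χ (u n) with hmdef
  have hmc := hn.memLp_comp_fst hp.lt hm.1
  have hum : MemLp (fun z => u n z - m z.1) (ENNReal.ofReal p) (volume.restrict (thin (h n))) :=
    (H.memScaledW n).memLp.sub hmc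
  have henergy : A + B = ∫ z in thin (h n), f n z * u n z := by
    rw [← H.eq n _ _ (H.memScaledW n), hA, hB, ← integral_add
      (integrable_norm_rpow hp.lt (H.memScaledW n).memLp_grad)
      (integrable_norm_rpow hp.lt (H.memScaledW n).memLp)]
    congr 1; ext z
    rw [inner_flux_self hp.lt, ← inner_flux_self hp.lt (u n z), real_inner_comm]
    rfl
  have hsplit : ∫ z in thin (h n), f n z * u n z =
      (∫ z in thin (h n), f n z * (u n z - m z.1)) +
        ∫ x in Ioo (0 : ℝ) 1, fiberInt (h n) (f n) x * m x := by
    rw [← hn.integral_mul_comp_fst (H.integrable_force_mul hp hmc),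
      ← integral_add (H.integrable_force_mul hp hum) (H.integrable_force_mul hp hmc)]
    congr 1; ext z; ring
  have hb1 := (le_abs_self _).trans (H.abs_integral_force_le hp hum (C := H₁ ^ p * A)
    (by positivity) (by rw [Real.mul_rpow hH1.le hε] at hcl; linarith))
  rw [rpow_inv_mul_rpow hp0 hA0 hH1.le] at hb1
  have hb2 := (le_abs_self _).trans (hK₂ n m hm.1)
  have hfin : A + B ≤ K * (A + B) ^ p⁻¹ := by
    have e1 : (ε n ^ p' * ∫ z in thin (h n), ‖f n z‖ ^ p') ^ p'⁻¹ ≤ K₁ ^ p'⁻¹ :=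
      Real.rpow_le_rpow (mul_nonneg (Real.rpow_nonneg hε _) (integral_norm_rpow_nonneg _)) (hK₁' n)
        hp.symm.inv_nonneg
    have e2 : A ^ p⁻¹ ≤ (A + B) ^ p⁻¹ := by gcongr; linarith
    have e3 : (∫ x in Ioo (0 : ℝ) 1, ‖m x‖ ^ p) ^ p⁻¹ ≤ D ^ p⁻¹ * (A + B) ^ p⁻¹ := by
      rw [← Real.mul_rpow hD0 (by positivity)]
      refine Real.rpow_le_rpow (integral_norm_rpow_nonneg _) (hmle.trans ?_) hp.inv_nonneg
      exact mul_le_mul_of_nonneg_left (by linarith) hD0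
    calc A + B ≤ _ := by rw [henergy, hsplit]; exact add_le_add hb1 hb2
      _ ≤ K₁ ^ p'⁻¹ * (H₁ * (A + B) ^ p⁻¹) + K₂ * (D ^ p⁻¹ * (A + B) ^ p⁻¹) :=
          add_le_add (mul_le_mul e1 (mul_le_mul_of_nonneg_left e2 hH1.le) (by positivity)
            (by positivity)) (mul_le_mul_of_nonneg_left e3 hK₂0)
      _ = _ := by ring
  -- `X ≤ K X^{1/p}` means `X ≤ K^{p'}`
  have hX : A + B ≤ K ^ p' := by
    rcases (add_nonneg hA0 hB0).eq_or_lt with h0 | h0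
    · rw [← h0]; positivity
    · have e1 : (A + B) ^ p'⁻¹ ≤ K := by
        rw [← mul_le_mul_iff_left₀ (Real.rpow_pos_of_pos h0 p⁻¹), ← Real.rpow_add h0,
          add_comm p'⁻¹, hp.inv_add_inv_eq_one, Real.rpow_one]
        exact hfin
      calc A + B = ((A + B) ^ p'⁻¹) ^ p' := by
            rw [← Real.rpow_mul h0.le, inv_mul_cancel₀ hp.symm.pos.ne', Real.rpow_one]
        _ ≤ K ^ p' := Real.rpow_le_rpow (by positivity) e1 hp.symm.nonneg
  exact ⟨by linarith, by linarith⟩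

end IsThinSequence

/-- A sequence of solutions together with its limits: `u₀`, with derivative `u₀'`, is the strong
limit of the solutions (through functions `m n` of the horizontal variable that are `ε`-close to
them), `σ` is the weak limit of the vertically integrated horizontal flux. -/
structure IsThinLimit (p p' : ℝ) (U : Set ℝ) (H₀ H₁ : ℝ) (ε : ℕ → ℝ) (h : ℕ → ℝ → ℝ)
    (f u : ℕ → ℝ × ℝ → ℝ) (g : ℕ → ℝ × ℝ → Vec2) (fhat r : ℝ → ℝ) (C : ℝ) (m : ℕ → ℝ → ℝ)
    (u₀ u₀' σ : ℝ → ℝ) : Prop extends IsThinSequence p p' U H₀ H₁ ε h f u g fhat r where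
  nonneg : 0 ≤ C
  bound_grad : ∀ n, ∫ z in thin (h n), ‖g n z‖ ^ p ≤ C
  bound : ∀ n, ∫ z in thin (h n), ‖u n z‖ ^ p ≤ C
  memW01 : MemW01 p u₀ u₀'
  memLp_mean : ∀ n, MemLp (m n) (ENNReal.ofReal p) (volume.restrict (Ioo 0 1))
  close : ∀ n, ∫ z in thin (h n), ‖u n z - m n z.1‖ ^ p ≤ ε n ^ p * C
  mean_tendsto : Tendsto (fun n => ∫ x in Ioo (0 : ℝ) 1, ‖m n x - u₀ x‖ ^ p) atTop (𝓝 0)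
  memLp_flux : MemLp σ (ENNReal.ofReal p') (volume.restrict (Ioo 0 1))
  weak_flux : ∀ φ, MemLp φ (ENNReal.ofReal p) (volume.restrict (Ioo 0 1)) →
    Tendsto (fun n => ∫ x in Ioo (0 : ℝ) 1, fiberInt (h n) (fun z => flux p (g n z) 0) x * φ x)
      atTop (𝓝 (∫ x in Ioo (0 : ℝ) 1, σ x * φ x))

theorem IsThinSequence.memLp_flux_apply (H : IsThinSequence p p' U H₀ H₁ ε h f u g fhat r)
    (hp : p.HolderConjugate p') (n : ℕ) (i : Fin 2) :
    MemLp (fun z => flux p (g n z) i) (ENNReal.ofReal p') (volume.restrict (thin (h n))) :=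
  memLp_apply (RoughThin.memLp_flux hp (H.memScaledW n).memLp_grad) i

theorem IsThinSequence.integral_flux_apply_le (H : IsThinSequence p p' U H₀ H₁ ε h f u g fhat r)
    (hp : p.HolderConjugate p') (n : ℕ) (i : Fin 2) :
    ∫ z in thin (h n), ‖flux p (g n z) i‖ ^ p' ≤ ∫ z in thin (h n), ‖g n z‖ ^ p := by
  refine (integral_apply_rpow_le hp.symm.lt
    (RoughThin.memLp_flux hp (H.memScaledW n).memLp_grad) i).trans_eq ?_
  simp only [norm_flux_rpow hp]

/-- Subsequences with limits: the weighted vertical means are bounded in `W^{1,p}(0,1)`, and the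
vertically integrated fluxes in `L^{p'}(0,1)`. -/
theorem IsThinSequence.exists_isThinLimit (H : IsThinSequence p p' U H₀ H₁ ε h f u g fhat r)
    (hp : p.HolderConjugate p') (hH₀ : 0 < H₀) :
    ∃ (k : ℕ → ℕ) (C : ℝ) (m : ℕ → ℝ → ℝ) (u₀ u₀' σ : ℝ → ℝ), StrictMono k ∧
      IsThinLimit p p' U H₀ H₁ (ε ∘ k) (h ∘ k) (f ∘ k) (u ∘ k) (g ∘ k) fhat r C m u₀ u₀' σ := by
  have hp0 := hp.pos
  have hH1 := (H.height 0).upper_pos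
  obtain ⟨C, hC0, hC⟩ := H.exists_bound hp hH₀
  obtain ⟨χ, hχ⟩ := exists_isWeight hH₀
  obtain ⟨M, hM0, hM⟩ := hχ.exists_bound
  have hm := fun n => (H.memScaledW n).vertMean hp (H.height n) hχ hM0 hM
  obtain ⟨u₀, u₀', k, hk, hu₀, hlim⟩ := exists_subseq_tendsto hp
    (C := M ^ p * H₁ ^ (p - 1) * C) (fun n => (hm n).1)
    (fun n => (hm n).2.1.trans (by gcongr; exact (hC n).2))
    (fun n => (hm n).2.2.trans (by gcongr; exact (hC n).1))
  have hfl := fun n => (H.height (k n)).memLp_fiberInt hp.symm (H.memLp_flux_apply hp (k n) 0)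
  obtain ⟨σ, j, hj, hσ, hσlim⟩ := exists_weak_subseq hp (C := H₁ ^ (p' - 1) * C)
    (fun n => (hfl n).1) fun n => (hfl n).2.trans (by
      refine mul_le_mul_of_nonneg_left ?_ (by positivity)
      exact (H.integral_flux_apply_le hp _ _).trans (hC _).1)
  refine ⟨k ∘ j, max C (H₁ ^ p * C), fun n => vertMean χ (u (k (j n))), u₀, u₀', σ, hk.comp hj, ?_⟩
  refine { H.comp (hk.comp hj) with
    nonneg := hC0.trans (le_max_left _ _)
    bound_grad := fun n => (hC _).1.trans (le_max_left _ _)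
    bound := fun n => (hC _).2.trans (le_max_left _ _)
    memW01 := hu₀
    memLp_mean := fun n => (hm _).1.1
    close := fun n => ?_
    mean_tendsto := hlim.comp hj.tendsto_atTop
    memLp_flux := hσ
    weak_flux := hσlim }
  have hε := (H.eps_pos (k (j n))).le
  refine ((H.memScaledW (k (j n))).integral_sub_vertMean_le hp (H.height _) hχ hε).trans ?_
  simp only [Function.comp]
  calc (H₁ * ε (k (j n))) ^ p * ∫ z in thin (h (k (j n))), ‖g (k (j n)) z‖ ^ p
      ≤ (H₁ * ε (k (j n))) ^ p * C := by gcongr; exact (hC _).1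
    _ = ε (k (j n)) ^ p * (H₁ ^ p * C) := by rw [Real.mul_rpow hH1.le hε]; ring
    _ ≤ _ := by gcongr; exact le_max_right _ _

end ThinSequence

end RoughThin

/-! ### Passage to the limit -/

namespace RoughThin

section PassageToLimit

variable {p p' : ℝ} {U : Set ℝ} {H₀ H₁ : ℝ} {ε : ℕ → ℝ} {h : ℕ → ℝ → ℝ}
    {f u : ℕ → ℝ × ℝ → ℝ} {g : ℕ → ℝ × ℝ → Vec2} {fhat r : ℝ → ℝ} {C : ℝ} {m : ℕ → ℝ → ℝ}
    {u₀ u₀' σ θ : ℝ → ℝ}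

theorem memLp_mul_of_ae_bound {α : Type*} [MeasurableSpace α] {μ : Measure α} {q : ℝ≥0∞}
    {w v : α → ℝ} (hw : AEStronglyMeasurable w μ) {M : ℝ} (hM : ∀ᵐ x ∂μ, |w x| ≤ M)
    (hv : MemLp v q μ) : MemLp (fun x => w x * v x) q μ := by
  refine hv.of_le_mul (c := M) (hw.mul hv.1) ?_
  filter_upwards [hM] with x hx
  rw [norm_mul]
  exact mul_le_mul_of_nonneg_right hx (norm_nonneg _)

theorem memLp_mul_of_bound {α : Type*} [MeasurableSpace α] {μ : Measure α} {q : ℝ≥0∞}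
    {θ v : α → ℝ} (hθ : AEStronglyMeasurable θ μ) {M : ℝ} (hM : ∀ x, |θ x| ≤ M) (hv : MemLp v q μ) :
    MemLp (fun x => θ x * v x) q μ :=
  memLp_mul_of_ae_bound hθ (ae_of_all _ hM) hv

theorem integral_mul_rpow_le (hp : 1 < p) {α : Type*} [MeasurableSpace α] {μ : Measure α}
    {θ v : α → ℝ} {M : ℝ} (hM : ∀ x, |θ x| ≤ M) (hM0 : 0 ≤ M)
    (hv : MemLp v (ENNReal.ofReal p) μ) :
    ∫ x, ‖θ x * v x‖ ^ p ∂μ ≤ M ^ p * ∫ x, ‖v x‖ ^ p ∂μ := by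
  calc ∫ x, ‖θ x * v x‖ ^ p ∂μ ≤ ∫ x, ‖M * v x‖ ^ p ∂μ := by
        refine integral_norm_rpow_mono hp (hv.const_mul M) (ae_of_all _ fun x => ?_)
        rw [norm_mul, norm_mul, Real.norm_eq_abs, Real.norm_of_nonneg hM0]
        gcongr; exact hM x
    _ = _ := by
        rw [← integral_const_mul]
        congr 1; ext x
        rw [norm_mul, Real.norm_of_nonneg hM0, Real.mul_rpow hM0 (norm_nonneg _)]

theorem MemW01.cutoff_mul (hp : 1 < p) {v v' : ℝ → ℝ} (hv : MemW01 p v v') (hθ : ContDiff ℝ ∞ θ)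
    (hc : HasCompactSupport θ) :
    MemW01 p (fun x => θ x * v x) (fun x => θ x * v' x + deriv θ x * v x) := by
  have hθ' : Continuous (deriv θ) := hθ.continuous_deriv (by simp)
  obtain ⟨M, -, hM⟩ := exists_bound_of_hasCompactSupport hθ.continuous hc
  obtain ⟨M', -, hM'⟩ := exists_bound_of_hasCompactSupport hθ' hc.deriv
  obtain ⟨h1, h2, h3⟩ := hv
  refine ⟨memLp_mul_of_bound hθ.continuous.aestronglyMeasurable hM h1,
    (memLp_mul_of_bound hθ.continuous.aestronglyMeasurable hM h2).add
      (memLp_mul_of_bound hθ'.aestronglyMeasurable hM' h1), ?_⟩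
  exact h3.smooth_mul hθ inter_subset_right (LocInt.of_memLp hp h1) (LocInt.of_memLp hp h2)

/-- The product of a weakly and a strongly convergent sequence. -/
theorem tendsto_integral_mul_weak_strong (hp : p.HolderConjugate p') {α : Type*}
    [MeasurableSpace α] {μ : Measure α} {a : ℕ → α → ℝ} {a₀ : α → ℝ} {v : ℕ → α → ℝ} {v₀ : α → ℝ}
    (ha : ∀ n, MemLp (a n) (ENNReal.ofReal p') μ)
    (hlim : ∀ φ, MemLp φ (ENNReal.ofReal p) μ →
      Tendsto (fun n => ∫ x, a n x * φ x ∂μ) atTop (𝓝 (∫ x, a₀ x * φ x ∂μ)))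
    (hv : ∀ n, MemLp (v n) (ENNReal.ofReal p) μ) (hv₀ : MemLp v₀ (ENNReal.ofReal p) μ)
    (hvlim : Tendsto (fun n => ∫ x, ‖v n x - v₀ x‖ ^ p ∂μ) atTop (𝓝 0)) :
    Tendsto (fun n => ∫ x, a n x * v n x ∂μ) atTop (𝓝 (∫ x, a₀ x * v₀ x ∂μ)) := by
  obtain ⟨K, -, hK⟩ := exists_bound_of_weak_tendsto hp ha hlim
  have h1 : Tendsto (fun n => ∫ x, a n x * (v n x - v₀ x) ∂μ) atTop (𝓝 0) := by
    have h2 := (hvlim.rpow_const (p := p⁻¹) (Or.inr hp.inv_nonneg)).const_mul K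
    rw [Real.zero_rpow hp.inv_ne_zero, mul_zero] at h2
    exact squeeze_zero_norm (fun n => hK n _ ((hv n).sub hv₀)) h2
  have h3 := h1.add (hlim v₀ hv₀)
  rw [zero_add] at h3
  refine h3.congr fun n => ?_
  have i1 : Integrable (fun x => a n x * (v n x - v₀ x)) μ :=
    integrable_mul_of_memLp hp (ha n) ((hv n).sub hv₀)
  rw [← integral_add i1 (integrable_mul_of_memLp hp (ha n) hv₀)]
  congr 1; ext x; ring

/-- Functions of both variables that are `ε`-close to functions of `x` with a strong limit. -/
theorem tendsto_of_close (hp : p.HolderConjugate p') (hε : Tendsto ε atTop (𝓝 0))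
    (hh : ∀ n, IsHeight U (h n) H₀ H₁) {V : ℕ → ℝ × ℝ → ℝ} {v : ℕ → ℝ → ℝ} {v₀ : ℝ → ℝ} {D : ℝ}
    (hV : ∀ n, MemLp (V n) (ENNReal.ofReal p) (volume.restrict (thin (h n))))
    (hv : ∀ n, MemLp (v n) (ENNReal.ofReal p) (volume.restrict (Ioo 0 1)))
    (hv₀ : MemLp v₀ (ENNReal.ofReal p) (volume.restrict (Ioo 0 1)))
    (hvlim : Tendsto (fun n => ∫ x in Ioo (0 : ℝ) 1, ‖v n x - v₀ x‖ ^ p) atTop (𝓝 0))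
    (hclose : ∀ n, ∫ z in thin (h n), ‖V n z - v n z.1‖ ^ p ≤ ε n ^ p * D) :
    Tendsto (fun n => ∫ z in thin (h n), ‖V n z - v₀ z.1‖ ^ p) atTop (𝓝 0) := by
  have hp0 := hp.pos
  have h1 : Tendsto (fun n => 2 ^ (p - 1) *
      (ε n ^ p * D + H₁ * ∫ x in Ioo (0 : ℝ) 1, ‖v n x - v₀ x‖ ^ p)) atTop (𝓝 0) := by
    have h2 := hε.rpow_const (p := p) (Or.inr hp0.le)
    rw [Real.zero_rpow hp0.ne'] at h2
    simpa using ((h2.mul_const D).add (hvlim.const_mul H₁)).const_mul (2 ^ (p - 1))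
  refine squeeze_zero (fun n => integral_norm_rpow_nonneg _) (fun n => ?_) h1
  have hvc : MemLp (fun z : ℝ × ℝ => v n z.1 - v₀ z.1) (ENNReal.ofReal p)
      (volume.restrict (thin (h n))) := (hh n).memLp_comp_fst hp.lt ((hv n).sub hv₀)
  have hVc : MemLp (fun z : ℝ × ℝ => V n z - v n z.1) (ENNReal.ofReal p)
      (volume.restrict (thin (h n))) := (hV n).sub ((hh n).memLp_comp_fst hp.lt (hv n))
  have h3 := integral_norm_add_rpow_le hp.lt hVc hvc
  simp only [sub_add_sub_cancel] at h3
  refine h3.trans ?_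
  gcongr
  · exact hclose n
  · exact (hh n).integral_norm_rpow_comp_fst_le hp.lt ((hv n).sub hv₀)

/-- Pairing a bounded sequence with a cut-off of a strongly convergent one. -/
theorem tendsto_integral_cutoff (hp : p.HolderConjugate p')
    (hh : ∀ n, IsHeight U (h n) H₀ H₁) {hS : ℕ → ℝ → ℝ} {S₀ S₁ : ℝ}
    (hhS : ∀ n, IsHeight U (hS n) S₀ S₁) {V : ℕ → ℝ × ℝ → ℝ} {v₀ : ℝ → ℝ}
    (hV : ∀ n, MemLp (V n) (ENNReal.ofReal p) (volume.restrict (thin (hS n))))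
    (hv₀ : MemLp v₀ (ENNReal.ofReal p) (volume.restrict (Ioo 0 1)))
    (hlim : Tendsto (fun n => ∫ z in thin (hS n), ‖V n z - v₀ z.1‖ ^ p) atTop (𝓝 0))
    {a : ℕ → ℝ × ℝ → ℝ} {A : ℝ}
    (ha : ∀ n, MemLp (a n) (ENNReal.ofReal p') (volume.restrict (thin (h n))))
    (hA : ∀ n, ∫ z in thin (h n), ‖a n z‖ ^ p' ≤ A) (hθ : Continuous θ) (hc : HasCompactSupport θ)
    (hle : ∀ n, ∀ x ∈ Ioo (0 : ℝ) 1, x ∈ tsupport θ → h n x ≤ hS n x) {ℓ : ℝ}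
    (hℓ : Tendsto (fun n => ∫ x in Ioo (0 : ℝ) 1, fiberInt (h n) (a n) x * (θ x * v₀ x)) atTop
      (𝓝 ℓ)) :
    Tendsto (fun n => ∫ z in thin (h n), a n z * (θ z.1 * V n z)) atTop (𝓝 ℓ) := by
  obtain ⟨M, hM0, hM⟩ := exists_bound_of_hasCompactSupport hθ hc
  have hW : ∀ n, MemLp (fun z => V n z - v₀ z.1) (ENNReal.ofReal p)
      (volume.restrict (thin (hS n))) := fun n => (hV n).sub ((hhS n).memLp_comp_fst hp.lt hv₀)
  have hcut := fun n => memLp_cutoff_smul hp.lt (hh n) (hhS n) hθ hM (hle n) (hW n)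
  have h1 : Tendsto (fun n => ∫ z in thin (h n), ‖θ z.1 • (V n z - v₀ z.1)‖ ^ p) atTop (𝓝 0) := by
    have h2 := hlim.const_mul (M ^ p)
    rw [mul_zero] at h2
    exact squeeze_zero (fun n => integral_norm_rpow_nonneg _) (fun n => (hcut n).2) h2
  have h3 := (tendsto_integral_mul_zero hp ha (fun n => (hcut n).1) hA h1).add hℓ
  rw [zero_add] at h3
  refine h3.congr fun n => ?_
  have hθv : MemLp (fun x => θ x * v₀ x) (ENNReal.ofReal p) (volume.restrict (Ioo 0 1)) :=
    memLp_mul_of_bound hθ.aestronglyMeasurable hM hv₀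
  have i2 := integrable_mul_of_memLp hp (ha n) ((hh n).memLp_comp_fst hp.lt hθv)
  rw [← (hh n).integral_mul_comp_fst (φ := fun x => θ x * v₀ x) i2,
    ← integral_add (integrable_mul_of_memLp hp (ha n) (hcut n).1) i2]
  congr 1; ext z
  simp only [smul_eq_mul]; ring

namespace IsThinLimit

/-- The solutions converge strongly, as functions of both variables, to `u₀`. -/
theorem tendsto (H : IsThinLimit p p' U H₀ H₁ ε h f u g fhat r C m u₀ u₀' σ)
    (hp : p.HolderConjugate p') :
    Tendsto (fun n => ∫ z in thin (h n), ‖u n z - u₀ z.1‖ ^ p) atTop (𝓝 0) :=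
  tendsto_of_close hp H.eps_tendsto H.height (fun n => (H.memScaledW n).memLp)
    H.memLp_mean H.memW01.1 H.mean_tendsto H.close

theorem memLp_flux_u (H : IsThinLimit p p' U H₀ H₁ ε h f u g fhat r C m u₀ u₀' σ)
    (hp : p.HolderConjugate p') (n : ℕ) :
    MemLp (fun z => flux p (u n z)) (ENNReal.ofReal p') (volume.restrict (thin (h n))) :=
  RoughThin.memLp_flux hp (H.memScaledW n).memLp

theorem integrableOn_flux_mul (H : IsThinLimit p p' U H₀ H₁ ε h f u g fhat r C m u₀ u₀' σ)
    (hp : p.HolderConjugate p') {φ : ℝ → ℝ}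
    (hφ : MemLp φ (ENNReal.ofReal p) (volume.restrict (Ioo 0 1))) :
    IntegrableOn (fun x => flux p (u₀ x) * φ x) (Ioo 0 1) :=
  integrable_mul_of_memLp hp (RoughThin.memLp_flux hp H.memW01.1) hφ

/-- The zero-order term in the limit. -/
theorem tendsto_integral_flux_u (H : IsThinLimit p p' U H₀ H₁ ε h f u g fhat r C m u₀ u₀' σ)
    (hp : p.HolderConjugate p') {φ : ℝ → ℝ}
    (hφ : MemLp φ (ENNReal.ofReal p) (volume.restrict (Ioo 0 1))) :
    Tendsto (fun n => ∫ x in Ioo (0 : ℝ) 1, fiberInt (h n) (fun z => flux p (u n z)) x * φ x) atTop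
      (𝓝 (∫ x in Ioo (0 : ℝ) 1, r x * (flux p (u₀ x) * φ x))) := by
  have hH1 := (H.height 0).upper_pos
  have hu₀ := H.memW01.1
  have hu₀c := fun n => (H.height n).memLp_comp_fst hp.lt hu₀
  set E := ∫ x in Ioo (0 : ℝ) 1, ‖u₀ x‖ ^ p with hE
  have hE0 : 0 ≤ E := integral_norm_rpow_nonneg _
  have hd : ∀ n, MemLp (fun z => flux p (u n z) - flux p (u₀ z.1)) (ENNReal.ofReal p')
      (volume.restrict (thin (h n))) := fun n =>
    (H.memLp_flux_u hp n).sub (RoughThin.memLp_flux hp (hu₀c n))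
  have hdiff : Tendsto (fun n => ∫ z in thin (h n), ‖flux p (u n z) - flux p (u₀ z.1)‖ ^ p') atTop
      (𝓝 0) := by
    rw [Metric.tendsto_atTop]
    intro δ hδ
    have hb : 0 < C + H₁ * E + 1 := by have := H.nonneg; positivity
    obtain ⟨K, hK0, hK⟩ := norm_flux_sub_rpow_le (E := ℝ) hp (η := δ / 2 / (C + H₁ * E + 1))
      (by positivity)
    have hlim := (H.tendsto hp).const_mul K
    rw [mul_zero] at hlim
    obtain ⟨N, hN⟩ := Metric.tendsto_atTop.1 hlim (δ / 2) (by positivity)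
    refine ⟨N, fun n hn => ?_⟩
    have h1 := hN n hn
    rw [Real.dist_eq, sub_zero] at h1
    replace h1 := (le_abs_self _).trans_lt h1
    rw [Real.dist_eq, sub_zero, abs_of_nonneg (integral_norm_rpow_nonneg _)]
    have i1 := integrable_norm_rpow hp.lt (H.memScaledW n).memLp
    have i2 := integrable_norm_rpow hp.lt (hu₀c n)
    have i3 := integrable_norm_rpow hp.lt ((H.memScaledW n).memLp.sub (hu₀c n))
    have h2 : ∫ z in thin (h n), ‖flux p (u n z) - flux p (u₀ z.1)‖ ^ p' ≤
        ∫ z in thin (h n), (δ / 2 / (C + H₁ * E + 1) * (‖u n z‖ ^ p + ‖u₀ z.1‖ ^ p) +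
          K * ‖u n z - u₀ z.1‖ ^ p) :=
      integral_mono (integrable_norm_rpow hp.symm.lt (hd n))
        (((i1.add i2).const_mul _).add (i3.const_mul K)) fun z => hK _ _
    have e1 : ∫ z in thin (h n), (δ / 2 / (C + H₁ * E + 1) * (‖u n z‖ ^ p + ‖u₀ z.1‖ ^ p) +
          K * ‖u n z - u₀ z.1‖ ^ p) = δ / 2 / (C + H₁ * E + 1) *
          ((∫ z in thin (h n), ‖u n z‖ ^ p) + ∫ z in thin (h n), ‖u₀ z.1‖ ^ p) +
          K * ∫ z in thin (h n), ‖u n z - u₀ z.1‖ ^ p := by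
      generalize δ / 2 / (C + H₁ * E + 1) = η
      rw [← integral_add i1 i2, ← integral_const_mul, ← integral_const_mul]
      exact integral_add (f := fun z : ℝ × ℝ => η * (‖u n z‖ ^ p + ‖u₀ z.1‖ ^ p))
        (g := fun z : ℝ × ℝ => K * ‖u n z - u₀ z.1‖ ^ p) ((i1.add i2).const_mul _) (i3.const_mul K)
    rw [e1] at h2
    have h3 : δ / 2 / (C + H₁ * E + 1) *
        ((∫ z in thin (h n), ‖u n z‖ ^ p) + ∫ z in thin (h n), ‖u₀ z.1‖ ^ p) ≤ δ / 2 := by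
      rw [div_mul_eq_mul_div, div_le_iff₀ hb]
      have := H.bound n
      have := (H.height n).integral_norm_rpow_comp_fst_le hp.lt hu₀
      exact mul_le_mul_of_nonneg_left (by linarith) (by positivity)
    linarith
  have hφc := fun n => (H.height n).memLp_comp_fst hp.lt hφ
  have h1 := tendsto_integral_mul_zero hp.symm hφc hd (C := H₁ * ∫ x in Ioo (0 : ℝ) 1, ‖φ x‖ ^ p)
    (fun n => (H.height n).integral_norm_rpow_comp_fst_le hp.lt hφ) hdiff
  have h2 := h1.add (H.weak_height _ (H.integrableOn_flux_mul hp hφ))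
  rw [zero_add] at h2
  refine h2.congr fun n => ?_
  have i1 := integrable_mul_of_memLp hp (H.memLp_flux_u hp n) (hφc n)
  have i2 := integrable_mul_of_memLp hp (RoughThin.memLp_flux hp (hu₀c n)) (hφc n)
  rw [← (H.height n).integral_mul_comp_fst i1,
    ← (H.height n).integral_comp_fst (H.integrableOn_flux_mul hp hφ),
    ← integral_add (integrable_mul_of_memLp hp.symm (hφc n) (hd n)) i2]
  congr 1; ext z; ring

/-- The limit equation, with the flux `σ` still to be identified. -/
theorem integral_eq (H : IsThinLimit p p' U H₀ H₁ ε h f u g fhat r C m u₀ u₀' σ)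
    (hp : p.HolderConjugate p') {φ φ' : ℝ → ℝ} (hφ : MemW01 p φ φ') :
    (∫ x in Ioo (0 : ℝ) 1, σ x * φ' x) + ∫ x in Ioo (0 : ℝ) 1, r x * (flux p (u₀ x) * φ x) =
      ∫ x in Ioo (0 : ℝ) 1, fhat x * φ x := by
  refine tendsto_nhds_unique (((H.weak_flux _ hφ.2.1).add (H.tendsto_integral_flux_u hp hφ.1)).congr
    fun n => ?_) (H.weak_force _ hφ.1)
  have h1 := H.eq n _ _ (memScaledW_comp_fst (H.height n) hp.lt hφ)
  have hφc := (H.height n).memLp_comp_fst hp.lt hφ.1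
  have hφc' := (H.height n).memLp_comp_fst hp.lt hφ.2.1
  have i1 := integrable_mul_of_memLp hp (H.memLp_flux_apply hp n 0) hφc'
  have i2 := integrable_mul_of_memLp hp (H.memLp_flux_u hp n) hφc
  have i3 := H.integrable_force_mul hp hφc
  simp only [inner_smul_e₁] at h1
  rw [integral_add i1 i2, (H.height n).integral_mul_comp_fst i1,
    (H.height n).integral_mul_comp_fst i2, (H.height n).integral_mul_comp_fst i3] at h1
  exact h1

/-- The limit of the pairing of the flux with the gradients of trial functions `V n` that are
`ε`-close to functions of `x`: testing the equation with a cut-off of `V n`, only terms with a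
strong limit remain. -/
theorem tendsto_integral_cutoff_inner (H : IsThinLimit p p' U H₀ H₁ ε h f u g fhat r C m u₀ u₀' σ)
    (hp : p.HolderConjugate p') {hS : ℕ → ℝ → ℝ} {S₀ S₁ : ℝ} (hhS : ∀ n, IsHeight U (hS n) S₀ S₁)
    {V : ℕ → ℝ × ℝ → ℝ} {k : ℕ → ℝ × ℝ → Vec2}
    (hV : ∀ n, MemScaledW p (ε n) (thin (hS n)) (V n) (k n)) {v : ℕ → ℝ → ℝ} {v₀ v₀' : ℝ → ℝ}
    (hv : ∀ n, MemLp (v n) (ENNReal.ofReal p) (volume.restrict (Ioo 0 1))) (hv₀ : MemW01 p v₀ v₀')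
    (hvlim : Tendsto (fun n => ∫ x in Ioo (0 : ℝ) 1, ‖v n x - v₀ x‖ ^ p) atTop (𝓝 0)) {D : ℝ}
    (hD : 0 ≤ D) (hclose : ∀ n, ∫ z in thin (hS n), ‖V n z - v n z.1‖ ^ p ≤ ε n ^ p * D)
    (hθ : ContDiff ℝ ∞ θ) (hc : HasCompactSupport θ)
    (hle : ∀ n, ∀ x ∈ Ioo (0 : ℝ) 1, x ∈ tsupport θ → h n x ≤ hS n x) :
    Tendsto (fun n => ∫ z in thin (h n), θ z.1 * inner ℝ (flux p (g n z)) (k n z)) atTop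
      (𝓝 (∫ x in Ioo (0 : ℝ) 1, θ x * (σ x * v₀' x))) := by
  have hθ' : Continuous (deriv θ) := hθ.continuous_deriv (by simp)
  obtain ⟨M, hM0, hM⟩ := exists_bound_of_hasCompactSupport hθ.continuous hc
  obtain ⟨M', hM0', hM'⟩ := exists_bound_of_hasCompactSupport hθ' hc.deriv
  have hle' : ∀ n, ∀ x ∈ Ioo (0 : ℝ) 1, x ∈ tsupport (deriv θ) → h n x ≤ hS n x :=
    fun n x hx hxs => hle n x hx (tsupport_deriv_subset hxs)
  have hVlim := tendsto_of_close hp H.eps_tendsto hhS (fun n => (hV n).memLp) hv hv₀.1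
    hvlim hclose
  have hθv := hv₀.cutoff_mul hp.lt hθ hc
  have hθ'v : MemLp (fun x => deriv θ x * v₀ x) (ENNReal.ofReal p) (volume.restrict (Ioo 0 1)) :=
    memLp_mul_of_bound hθ'.aestronglyMeasurable hM' hv₀.1
  have hθv' : MemLp (fun x => θ x * v₀' x) (ENNReal.ofReal p) (volume.restrict (Ioo 0 1)) :=
    memLp_mul_of_bound hθ.continuous.aestronglyMeasurable hM hv₀.2.1
  -- the term with the derivative of the cut-off
  have l1 := tendsto_integral_cutoff hp H.height hhS (fun n => (hV n).memLp) hv₀.1 hVlim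
    (fun n => H.memLp_flux_apply hp n 0)
    (fun n => (H.integral_flux_apply_le hp n 0).trans (H.bound_grad n)) hθ' hc.deriv hle'
    (H.weak_flux _ hθ'v)
  -- the zero-order term
  have l2 := tendsto_integral_cutoff hp H.height hhS (fun n => (hV n).memLp) hv₀.1 hVlim
    (fun n => H.memLp_flux_u hp n)
    (fun n => by simpa only [norm_flux_rpow hp] using H.bound n) hθ.continuous hc hle
    (H.tendsto_integral_flux_u hp hθv.1)
  -- the force term
  have hW : ∀ n, MemLp (fun z => V n z - v n z.1) (ENNReal.ofReal p)
      (volume.restrict (thin (hS n))) := fun n =>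
    (hV n).memLp.sub ((hhS n).memLp_comp_fst hp.lt (hv n))
  have hcut := fun n => memLp_cutoff_smul hp.lt (H.height n) (hhS n) hθ.continuous hM (hle n) (hW n)
  have l3 : Tendsto (fun n => ∫ z in thin (h n), f n z * (θ z.1 * V n z)) atTop
      (𝓝 (∫ x in Ioo (0 : ℝ) 1, fhat x * (θ x * v₀ x))) := by
    have e1 := H.tendsto_integral_force hp (fun n => (hcut n).1) (C := M ^ p * D) (by positivity)
      (fun n => (hcut n).2.trans (by nlinarith [hclose n, Real.rpow_nonneg hM0 p]))
    have hθvn : ∀ n, MemLp (fun x => θ x * v n x) (ENNReal.ofReal p) (volume.restrict (Ioo 0 1)) :=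
      fun n => memLp_mul_of_bound hθ.continuous.aestronglyMeasurable hM (hv n)
    have e2 := tendsto_integral_mul_weak_strong hp
      (fun n => ((H.height n).memLp_fiberInt hp.symm (H.memLp_force n)).1) H.weak_force hθvn hθv.1 (by
        have h2 := hvlim.const_mul (M ^ p)
        rw [mul_zero] at h2
        refine squeeze_zero (fun n => integral_norm_rpow_nonneg _) (fun n => ?_) h2
        simp only [← mul_sub]
        exact integral_mul_rpow_le hp.lt hM hM0 ((hv n).sub hv₀.1))
    have e3 := e1.add e2
    rw [zero_add] at e3
    refine e3.congr fun n => ?_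
    have i2 := H.integrable_force_mul hp ((H.height n).memLp_comp_fst hp.lt (hθvn n))
    rw [← (H.height n).integral_mul_comp_fst i2,
      ← integral_add (H.integrable_force_mul hp (hcut n).1) i2]
    congr 1; ext z
    simp only [smul_eq_mul]; ring
  have hfin := (l3.sub l2).sub l1
  have hval : (∫ x in Ioo (0 : ℝ) 1, fhat x * (θ x * v₀ x)) -
      (∫ x in Ioo (0 : ℝ) 1, r x * (flux p (u₀ x) * (θ x * v₀ x))) -
      (∫ x in Ioo (0 : ℝ) 1, σ x * (deriv θ x * v₀ x)) =
      ∫ x in Ioo (0 : ℝ) 1, θ x * (σ x * v₀' x) := by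
    rw [← H.integral_eq hp hθv, add_sub_cancel_right]
    have i1 := integrable_mul_of_memLp hp H.memLp_flux hθv'
    have i2 := integrable_mul_of_memLp hp H.memLp_flux hθ'v
    simp only [mul_add]
    rw [integral_add i1 i2, add_sub_cancel_right]
    congr 1; ext x; ring
  rw [hval] at hfin
  refine hfin.congr fun n => ?_
  have hm := (hV n).cutoff_mul hp.lt (H.height n) (hhS n) hθ hc (hle n)
  have hk := (memLp_cutoff_smul hp.lt (H.height n) (hhS n) hθ.continuous hM (hle n)
    (hV n).memLp_grad).1
  have hd : MemLp (fun z => deriv θ z.1 * V n z) (ENNReal.ofReal p) (volume.restrict (thin (h n))) :=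
    (memLp_cutoff_smul hp.lt (H.height n) (hhS n) hθ' hM' (hle' n) (hV n).memLp).1
  have i1 := integrable_inner_of_memLp hp (RoughThin.memLp_flux hp (H.memScaledW n).memLp_grad) hk
  have i2 := integrable_mul_of_memLp hp (H.memLp_flux_apply hp n 0) hd
  have i3 := integrable_mul_of_memLp hp (H.memLp_flux_u hp n) hm.memLp
  have h1 := H.eq n _ _ hm
  simp only [inner_add_right, inner_smul_e₁] at h1
  have i12 : IntegrableOn (fun z => inner ℝ (flux p (g n z)) (θ z.1 • k n z) +
      flux p (g n z) 0 * (deriv θ z.1 * V n z)) (thin (h n)) := i1.add i2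
  rw [integral_add i12 i3, integral_add i1 i2] at h1
  simp only [inner_smul_right] at h1
  linarith

end IsThinLimit

end PassageToLimit

end RoughThin

/-! ### Oscillating functions -/

namespace RoughThin

variable {p p' L H₀ H₁ ε : ℝ} {Γ : ℝ → ℝ} {F : Type*} [NormedAddCommGroup F]

theorem shiftedCell_eq_preimage (hΓ : IsCellProfile L Γ H₀ H₁) (j : ℤ) :
    shiftedCell L Γ j = diagMap 1 (-(j * L)) 1 ⁻¹' cell L Γ := by
  ext z
  rw [mem_shiftedCell hΓ, mem_preimage]
  have h1 := hΓ.periodic_int (-j) z.1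
  have h2 : z.1 + ((-j : ℤ) : ℝ) * L = z.1 + -(j * L) := by push_cast; ring
  rw [h2] at h1
  simp only [strip, cell, diagMap, Set.mem_ofPred_eq, one_mul, h1, mem_Ioo]
  constructor
  · rintro ⟨⟨a, b⟩, c, d⟩; exact ⟨⟨by linarith, by linarith⟩, a, b⟩
  · rintro ⟨⟨a, b⟩, c, d⟩; exact ⟨⟨c, d⟩, by linarith, by linarith⟩

theorem memLp_perExt_shiftedCell (hΓ : IsCellProfile L Γ H₀ H₁) (j : ℤ) {f : ℝ × ℝ → F}
    (hf : MemLp f (ENNReal.ofReal p) (volume.restrict (cell L Γ))) :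
    MemLp (perExt L f) (ENNReal.ofReal p) (volume.restrict (shiftedCell L Γ j)) ∧
    ∫ z in shiftedCell L Γ j, ‖perExt L f z‖ ^ p = ∫ z in cell L Γ, ‖f z‖ ^ p := by
  have he : ∀ z ∈ shiftedCell L Γ j, f (diagMap 1 (-(j * L)) 1 z) = perExt L f z := by
    intro z hz
    rw [perExt_of_mem_shiftedCell hΓ.period_pos hz]
    simp only [diagMap, one_mul, sub_eq_add_neg]
  have hm := measurableSet_shiftedCell hΓ j
  constructor
  · have h1 := memLp_comp_diagMap (α := 1) (β := -(j * L)) (γ := 1) one_ne_zero one_ne_zero hf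
    rw [← shiftedCell_eq_preimage hΓ] at h1
    exact h1.ae_eq ((ae_restrict_iff' hm).2 (ae_of_all _ he))
  · have h1 := setIntegral_comp_diagMap (α := 1) (β := -(j * L)) (γ := 1) one_ne_zero one_ne_zero
      (cell L Γ) fun z => ‖f z‖ ^ p
    rw [← shiftedCell_eq_preimage hΓ] at h1
    simp only [inv_one, mul_one, abs_one, one_smul] at h1
    rw [← h1]
    exact setIntegral_congr_fun hm fun z hz => by simp only [he z hz]

/-- Up to a null set, a slab of length `X ≤ J L` is covered by the first `J` period cells. -/
theorem ae_slab_mem_shiftedCell (hΓ : IsCellProfile L Γ H₀ H₁) {X : ℝ} {J : ℕ} (hJ : X ≤ J * L) :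
    (cell X Γ : Set (ℝ × ℝ)) ≤ᵐ[volume] ⋃ j ∈ Finset.Ico (0 : ℤ) J, shiftedCell L Γ j := by
  have hL := hΓ.period_pos
  have h1 := (ae_restrict_iff' hΓ.isOpen_strip.measurableSet).1 (ae_strip_mem_shiftedCell hΓ)
  filter_upwards [h1] with z hz hzX
  obtain ⟨j, hj⟩ := hz hzX.2
  refine mem_biUnion (x := j) ?_ hj
  obtain ⟨-, h2, h3⟩ := (mem_shiftedCell hΓ).1 hj
  obtain ⟨h4, h5⟩ := hzX.1
  have h6 : (0 : ℝ) < j + 1 := by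
    by_contra! h; have := mul_nonpos_of_nonpos_of_nonneg h hL.le; linarith
  have h7 : (j : ℝ) < J := by
    by_contra! h; have := mul_le_mul_of_nonneg_right h hL.le; linarith
  have h6' : (0 : ℤ) < j + 1 := by exact_mod_cast h6
  have h7' : j < (J : ℤ) := by exact_mod_cast h7
  simp only [Finset.coe_Ico, mem_Ico]
  omega

/-- A periodic extension on a slab of length `X ≤ J L` costs at most `J` cells. -/
theorem memLp_perExt_slab (hp : 1 < p) (hΓ : IsCellProfile L Γ H₀ H₁) {X : ℝ} {J : ℕ}
    (hJ : X ≤ J * L) {f : ℝ × ℝ → F}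
    (hf : MemLp f (ENNReal.ofReal p) (volume.restrict (cell L Γ))) :
    MemLp (perExt L f) (ENNReal.ofReal p) (volume.restrict (cell X Γ)) ∧
    ∫ z in cell X Γ, ‖perExt L f z‖ ^ p ≤ J * ∫ z in cell L Γ, ‖f z‖ ^ p := by
  have hsub := ae_slab_mem_shiftedCell hΓ hJ
  have hcell := fun j => memLp_perExt_shiftedCell hΓ j hf
  have hint : IntegrableOn (fun z => ‖perExt L f z‖ ^ p)
      (⋃ j ∈ Finset.Ico (0 : ℤ) J, shiftedCell L Γ j) :=
    integrableOn_finset_iUnion.2 fun j _ => integrable_norm_rpow hp (hcell j).1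
  constructor
  · refine MemLp.mono_measure (Measure.restrict_mono_ae hsub) (memLp_of_integrable_norm_rpow hp ?_ hint)
    have h1 : AEStronglyMeasurable (perExt L f) (volume.restrict (⋃ j : ℤ, shiftedCell L Γ j)) :=
      aestronglyMeasurable_iUnion_iff.2 fun j => (hcell j).1.1
    exact h1.mono_measure (Measure.restrict_mono (iUnion₂_subset_iUnion _ _) le_rfl)
  · refine (setIntegral_mono_set hint (ae_of_all _ fun z => by positivity) hsub).trans ?_
    rw [integral_biUnion_finset]
    · simp [(hcell _).2]
    · exact fun j _ => measurableSet_shiftedCell hΓ j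
    · intro i _ j _ hij
      refine Set.disjoint_left.2 fun z hi hj => hij ?_
      obtain ⟨-, h2, h3⟩ := (mem_shiftedCell hΓ).1 hi
      obtain ⟨-, h4, h5⟩ := (mem_shiftedCell hΓ).1 hj
      have hL := hΓ.period_pos
      have h6 : (i : ℝ) < j + 1 := lt_of_mul_lt_mul_right (h2.trans h5) hL.le
      have h7 : (j : ℝ) < i + 1 := lt_of_mul_lt_mul_right (h4.trans h3) hL.le
      have h6' : i < j + 1 := by exact_mod_cast h6
      have h7' : j < i + 1 := by exact_mod_cast h7
      omega
    · exact fun j _ => integrable_norm_rpow hp (hcell j).1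

/-- The oscillating function `(x, y) ↦ f(x/ε, y)`, with `f` extended `L`-periodically in its first
variable. -/
noncomputable def osc {β : Type*} (L ε : ℝ) (f : ℝ × ℝ → β) (z : ℝ × ℝ) : β :=
  perExt L f (diagMap ε⁻¹ 0 1 z)

/-- A slab of `X` units in the fast variable, seen in the slow variable `x = ε y₁`. -/
theorem subgraph_osc (hε : 0 < ε) (X : ℝ) :
    subgraph (Ioo 0 (ε * X)) (fun x => Γ (x / ε)) = diagMap ε⁻¹ 0 1 ⁻¹' cell X Γ := by
  ext z
  have : ε⁻¹ * z.1 + 0 = z.1 / ε := by rw [add_zero, div_eq_inv_mul]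
  simp only [subgraph, cell, diagMap, Set.mem_ofPred_eq, mem_preimage, this, one_mul, mem_Ioo,
    lt_div_iff₀ hε, div_lt_iff₀ hε, zero_mul, mul_comm ε X]

theorem thin_osc (hε : 0 < ε) :
    thin (fun x => Γ (x / ε)) = diagMap ε⁻¹ 0 1 ⁻¹' cell ε⁻¹ Γ := by
  rw [← subgraph_osc hε, mul_inv_cancel₀ hε.ne']

theorem IsHeight.osc {U : Set ℝ} {h : ℝ → ℝ} {S₀ S₁ : ℝ} (hh : IsHeight U h S₀ S₁)
    (hΓ : IsCellProfile L Γ H₀ H₁) (ε : ℝ) : IsHeight U (fun x => Γ (x / ε)) H₀ H₁ where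
  isOpen := hh.isOpen
  subset := hh.subset
  null := hh.null
  continuousOn := (hΓ.continuous.comp (continuous_id.div_const ε)).continuousOn
  lower_pos := hΓ.lower_pos
  lower _ _ := hΓ.lower _
  upper _ _ := hΓ.upper _

/-- The norm of an oscillating function on the thin domain is bounded for bounded `ε`: about
`1 / (ε L)` cells are involved, each contributing `ε` times the integral over the unit cell. -/
theorem memLp_osc (hp : 1 < p) (hΓ : IsCellProfile L Γ H₀ H₁) (hε : 0 < ε) {f : ℝ × ℝ → F}
    (hf : MemLp f (ENNReal.ofReal p) (volume.restrict (cell L Γ))) :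
    MemLp (osc L ε f) (ENNReal.ofReal p) (volume.restrict (thin fun x => Γ (x / ε))) ∧
    ∫ z in thin (fun x => Γ (x / ε)), ‖osc L ε f z‖ ^ p ≤
      (1 / L + ε) * ∫ z in cell L Γ, ‖f z‖ ^ p := by
  have hL := hΓ.period_pos
  have hε' : ε⁻¹ ≠ 0 := inv_ne_zero hε.ne'
  have hJ : ε⁻¹ ≤ ⌈ε⁻¹ / L⌉₊ * L := by
    rw [← div_le_iff₀ hL]; exact Nat.le_ceil _
  obtain ⟨h1, h2⟩ := memLp_perExt_slab hp hΓ hJ hf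
  rw [thin_osc hε]
  refine ⟨memLp_comp_diagMap hε' one_ne_zero h1, ?_⟩
  have h3 := setIntegral_comp_diagMap (β := 0) hε' one_ne_zero (cell ε⁻¹ Γ)
    fun z => ‖perExt L f z‖ ^ p
  simp only [inv_inv, inv_one, mul_one, abs_of_pos hε, smul_eq_mul] at h3
  simp only [osc]
  rw [h3]
  have h4 : (⌈ε⁻¹ / L⌉₊ : ℝ) ≤ ε⁻¹ / L + 1 := (Nat.ceil_lt_add_one (by positivity)).le
  have h5 : 0 ≤ ∫ z in cell L Γ, ‖f z‖ ^ p := integral_norm_rpow_nonneg _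
  calc ε * ∫ z in cell ε⁻¹ Γ, ‖perExt L f z‖ ^ p
      ≤ ε * ((ε⁻¹ / L + 1) * ∫ z in cell L Γ, ‖f z‖ ^ p) :=
        mul_le_mul_of_nonneg_left (h2.trans (mul_le_mul_of_nonneg_right h4 h5)) hε.le
    _ = _ := by field_simp

/-- The oscillating trial function `x + ε w(x/ε, y)` built from the corrector `w = v - y₁`; its
scaled gradient is the oscillating cell gradient. -/
theorem IsCellSolution.memScaledW_osc (hp : 1 < p) (hΓ : IsCellProfile L Γ H₀ H₁) (hε : 0 < ε)
    {v : ℝ × ℝ → ℝ} {dv : ℝ × ℝ → Vec2} (h : IsCellSolution p L Γ v dv) :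
    MemScaledW p ε (thin fun x => Γ (x / ε)) (fun z => z.1 + ε * osc L ε (fun y => v y - y.1) z)
      (osc L ε dv) ∧
    ∫ z in thin (fun x => Γ (x / ε)), ‖z.1 + ε * osc L ε (fun y => v y - y.1) z - z.1‖ ^ p ≤
      ε ^ p * ((1 / L + ε) * ∫ z in cell L Γ, ‖v z - z.1‖ ^ p) := by
  obtain ⟨⟨m1, m2, -⟩, d1, d2⟩ := h.1
  have hε' : ε⁻¹ ≠ 0 := inv_ne_zero hε.ne'
  obtain ⟨o1, o2⟩ := memLp_osc hp hΓ hε m1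
  obtain ⟨o3, -⟩ := memLp_osc hp hΓ hε (h.memLp hΓ)
  have hsub : thin (fun x => Γ (x / ε)) ⊆ diagMap ε⁻¹ 0 1 ⁻¹' strip Γ := by
    rw [thin_osc hε]; exact preimage_mono cell_subset_strip
  have w1 := ((d1.comp_diagMap_fst (β := 0) hε' one_ne_zero).mono hsub).const_mul ε
  have w2 := ((d2.comp_diagMap_snd (β := 0) hε' one_ne_zero).mono hsub).const_mul ε
  have hx : MemLp (fun z : ℝ × ℝ => z.1) (ENNReal.ofReal p)
      (volume.restrict (thin fun x => Γ (x / ε))) :=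
    RoughThin.memLp_comp_fst hp (H₁ := H₁) (fun x _ => hΓ.upper _) (φ := fun x => x)
      (memLp_of_bounded (a := 0) (b := 1) ((ae_restrict_iff' measurableSet_Ioo).2
        (ae_of_all _ fun x hx => ⟨hx.1.le, hx.2.le⟩)) measurable_id.aestronglyMeasurable _)
  have l1 : LocInt (thin fun x => Γ (x / ε)) fun z : ℝ × ℝ => z.1 := LocInt.of_memLp hp hx
  have l2 := LocInt.of_memLp hp (o1.const_mul ε)
  have l3 : ∀ i, LocInt (thin fun x => Γ (x / ε)) fun z => osc L ε dv z i :=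
    fun i => LocInt.of_memLp hp (memLp_apply o3 i)
  have c : ∀ c : ℝ, LocInt (thin fun x => Γ (x / ε)) fun _ : ℝ × ℝ => c :=
    fun c => LocInt.of_continuous continuous_const
  have s1 : HasWeakDeriv (thin fun x => Γ (x / ε)) (fun z : ℝ × ℝ => z.1) (1, 0) fun _ => 1 :=
    (hasWeakDeriv_of_smooth contDiff_fst (1, 0)).congr_on (fun _ _ => rfl) fun z _ => by
      rw [fderiv_fst]; rfl
  have s2 : HasWeakDeriv (thin fun x => Γ (x / ε)) (fun z : ℝ × ℝ => z.1) (0, 1) fun _ => 0 :=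
    (hasWeakDeriv_of_smooth contDiff_fst (0, 1)).congr_on (fun _ _ => rfl) fun z _ => by
      rw [fderiv_fst]; rfl
  refine ⟨⟨?_, o3, ?_, ?_⟩, ?_⟩
  · exact (hx.add (o1.const_mul ε)).ae_eq (ae_of_all _ fun z => by simp)
  · have w1' : HasWeakDeriv (thin fun x => Γ (x / ε))
        (fun z => ε * osc L ε (fun y => v y - y.1) z) (1, 0) (fun z => osc L ε dv z 0 - 1) := by
      refine w1.congr_on (fun _ _ => rfl) fun z _ => ?_
      rw [← mul_assoc, mul_inv_cancel₀ hε.ne', one_mul]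
      simp [osc, perExt]
    refine (s1.add w1' l1 (c 1) l2 ?_).congr_on (fun _ _ => rfl) fun z _ => by ring
    have := LocInt.of_memLp hp (Ω := thin fun x => Γ (x / ε)) (u := fun z => osc L ε dv z 0 - 1)
      (p := p) (((memLp_apply (memLp_osc hp hΓ hε m2).1 0)).ae_eq (ae_of_all _ fun z => by
        simp [osc, perExt]))
    exact this
  · have w2' : HasWeakDeriv (thin fun x => Γ (x / ε))
        (fun z => ε * osc L ε (fun y => v y - y.1) z) (0, 1) (fun z => ε * osc L ε dv z 1) := by
      refine w2.congr_on (fun _ _ => rfl) fun z _ => ?_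
      simp [osc, perExt]
    refine (s2.add w2' l1 (c 0) l2 ?_).congr_on (fun _ _ => rfl) fun z _ => by ring
    exact LocInt.of_memLp hp ((memLp_apply o3 1).const_mul ε)
  · have e : ∀ z : ℝ × ℝ, ‖z.1 + ε * osc L ε (fun y => v y - y.1) z - z.1‖ ^ p =
        ε ^ p * ‖osc L ε (fun y => v y - y.1) z‖ ^ p := fun z => by
      rw [add_sub_cancel_left, norm_mul, Real.norm_of_nonneg hε.le,
        Real.mul_rpow hε.le (norm_nonneg _)]
    simp only [e]
    rw [integral_const_mul]
    exact mul_le_mul_of_nonneg_left o2 (by positivity)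

end RoughThin

/-! ### The oscillating cell flux is divergence free -/

namespace RoughThin

variable {p p' L H₀ H₁ ε : ℝ} {Γ : ℝ → ℝ} {F : Type*} [NormedAddCommGroup F]

theorem inner_vec2 (s t : Vec2) : inner ℝ s t = s 0 * t 0 + s 1 * t 1 := by
  rw [PiLp.inner_apply, Fin.sum_univ_two]; simp [mul_comm]

theorem strip_eq_preimage (hΓ : IsCellProfile L Γ H₀ H₁) (j : ℤ) :
    strip Γ = diagMap 1 (j * L) 1 ⁻¹' strip Γ := by
  ext z
  simp only [strip, diagMap, Set.mem_ofPred_eq, mem_preimage, one_mul, hΓ.periodic_int j z.1]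

theorem memLp_translate (hΓ : IsCellProfile L Γ H₀ H₁) {f : ℝ × ℝ → F}
    (hf : MemLp f (ENNReal.ofReal p) (volume.restrict (strip Γ))) (j : ℤ) :
    MemLp (fun z : ℝ × ℝ => f (z.1 + j * L, z.2)) (ENNReal.ofReal p)
      (volume.restrict (cell L Γ)) := by
  have h1 := memLp_comp_diagMap (α := 1) (β := j * L) (γ := 1) one_ne_zero one_ne_zero hf
  rw [← strip_eq_preimage hΓ] at h1
  simp only [diagMap, one_mul] at h1
  exact h1.mono_measure (Measure.restrict_mono cell_subset_strip le_rfl)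

theorem memLp_perSum (hΓ : IsCellProfile L Γ H₀ H₁) {R : ℝ} {f : ℝ × ℝ → F}
    (hf0 : ∀ z : ℝ × ℝ, R < |z.1| → f z = 0)
    (hf : MemLp f (ENNReal.ofReal p) (volume.restrict (strip Γ))) :
    MemLp (perSum L f) (ENNReal.ofReal p) (volume.restrict (cell L Γ)) := by
  obtain ⟨J, hJ⟩ := exists_nat_mul_gt hΓ.period_pos (R + L)
  refine (memLp_finsetSum (Finset.Icc (-(J : ℤ)) J) fun j _ => memLp_translate hΓ hf j).ae_eq ?_
  refine (ae_restrict_iff' hΓ.isOpen_cell.measurableSet).2 (ae_of_all _ fun z hz => ?_)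
  refine (perSum_eq_sum hΓ.period_pos hf0 hJ ?_).symm
  rw [abs_of_pos hz.1.1]; exact hz.1.2.le

theorem perSum_apply (hL : 0 < L) {R : ℝ} {f : ℝ × ℝ → Vec2}
    (hf0 : ∀ z : ℝ × ℝ, R < |z.1| → f z = 0) (z : ℝ × ℝ) (i : Fin 2) :
    perSum L f z i = perSum L (fun z => f z i) z := by
  obtain ⟨J, hJ⟩ := exists_nat_mul_gt hL (R + |z.1|)
  rw [perSum_eq_sum hL hf0 hJ le_rfl,
    perSum_eq_sum hL (R := R) (fun z hz => by rw [hf0 z hz]; rfl) hJ le_rfl]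
  simp

/-- The cell problem unfolded: the periodically extended flux of a cell solution is weakly
divergence free on the strip, with vanishing flux through the top and the bottom. -/
theorem IsCellSolution.integral_strip_eq_zero (hp : p.HolderConjugate p')
    (hΓ : IsCellProfile L Γ H₀ H₁) {v : ℝ × ℝ → ℝ} {dv : ℝ × ℝ → Vec2}
    (h : IsCellSolution p L Γ v dv) {η : ℝ × ℝ → ℝ} {g : ℝ × ℝ → Vec2} {R : ℝ}
    (hη0 : ∀ z : ℝ × ℝ, R < |z.1| → η z = 0) (hg0 : ∀ z : ℝ × ℝ, R < |z.1| → g z = 0)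
    (hη : MemW p (strip Γ) η g) :
    ∫ z in strip Γ, inner ℝ (flux p (perExt L dv z)) (g z) = 0 := by
  have hL := hΓ.period_pos
  have hgi0 : ∀ i, ∀ z : ℝ × ℝ, R < |z.1| → (fun z => g z i) z = 0 := fun i z hz => by
    simp only [hg0 z hz]; rfl
  have hW : MemWPer p L Γ (perSum L η) (perSum L g) := by
    refine memWPer_of_strip hΓ (memLp_perSum hΓ hη0 hη.1) (memLp_perSum hΓ hg0 hη.2.1) ?_
    rw [perExt_perSum hL, perExt_perSum hL]
    have hl : LocInt (strip Γ) η := LocInt.of_memLp hp.lt hη.1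
    have hl' : ∀ i, LocInt (strip Γ) fun z => g z i :=
      fun i => LocInt.of_memLp hp.lt (memLp_apply hη.2.1 i)
    constructor
    · refine (hasWeakDeriv_perSum hΓ hη0 (hgi0 0) hl (hl' 0) hη.2.2.1).congr_on
        (fun _ _ => rfl) fun z _ => (perSum_apply hL hg0 z 0).symm
    · refine (hasWeakDeriv_perSum hΓ hη0 (hgi0 1) hl (hl' 1) hη.2.2.2).congr_on
        (fun _ _ => rfl) fun z _ => (perSum_apply hL hg0 z 1).symm
  have h0 := h.integral_inner_eq_zero hp.lt hΓ hW
  have hF : ∀ i, MemLp (fun z => flux p (dv z) i) (ENNReal.ofReal p')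
    (volume.restrict (cell L Γ)) := fun i => memLp_apply (h.memLp_flux hp hΓ) i
  have hgi : ∀ i, MemLp (fun z => g z i) (ENNReal.ofReal p) (volume.restrict (strip Γ)) :=
    fun i => memLp_apply hη.2.1 i
  have hu : ∀ i, _ := fun i => integral_perExt_mul hΓ (f := fun z => flux p (dv z) i)
    (ρ := fun z => g z i) (hgi0 i) fun j =>
      integrable_mul_of_memLp hp (hF i) (memLp_translate hΓ (hgi i) j)
  have hi : ∀ i, Integrable (fun z => flux p (dv z) i * perSum L (fun z => g z i) z)
      (volume.restrict (cell L Γ)) := fun i =>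
    integrable_mul_of_memLp hp (hF i) (memLp_perSum hΓ (hgi0 i) (hgi i))
  simp only [inner_vec2]
  refine (integral_add (hu 0).1 (hu 1).1).trans ?_
  refine (congrArg₂ (· + ·) (hu 0).2 (hu 1).2).trans ?_
  rw [← integral_add (hi 0) (hi 1), ← h0]
  simp only [inner_vec2, perSum_apply hL hg0]

/-- Extension by zero of `L^p` functions. -/
theorem memLp_of_eq_zero {α : Type*} [MeasurableSpace α] {μ : Measure α} {q : ℝ≥0∞} {S Ω : Set α}
    (hS : MeasurableSet S) (hΩ : MeasurableSet Ω) (hsub : S ⊆ Ω) {f : α → F}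
    (hf : MemLp f q (μ.restrict S)) (h0 : ∀ z ∈ Ω, z ∉ S → f z = 0) : MemLp f q (μ.restrict Ω) := by
  have h1 : MemLp (S.indicator f) q (μ.restrict Ω) := by
    rw [memLp_indicator_iff_restrict hS, Measure.restrict_restrict hS, inter_eq_left.2 hsub]
    exact hf
  refine h1.ae_eq ((ae_restrict_iff' hΩ).2 (ae_of_all _ fun z hz => ?_))
  by_cases hzS : z ∈ S
  · exact indicator_of_mem hzS f
  · rw [indicator_of_notMem hzS, h0 z hz hzS]

/-- The oscillating cell flux is divergence free on the thin domain. The test function is a cut-off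
of a function that lives on a possibly taller thin domain. -/
theorem IsCellSolution.integral_osc_eq_zero (hp : p.HolderConjugate p')
    (hΓ : IsCellProfile L Γ H₀ H₁) {v : ℝ × ℝ → ℝ} {dv : ℝ × ℝ → Vec2}
    (h : IsCellSolution p L Γ v dv) (hε : 0 < ε) {U : Set ℝ} {hS : ℝ → ℝ} {S₀ S₁ : ℝ}
    (hhS : IsHeight U hS S₀ S₁) {V : ℝ × ℝ → ℝ} {k : ℝ × ℝ → Vec2}
    (hV : MemScaledW p ε (thin hS) V k) {θ : ℝ → ℝ} (hθ : IsTest (Ioo (0 : ℝ) 1) θ)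
    (hle : ∀ x ∈ Ioo (0 : ℝ) 1, x ∈ tsupport θ → Γ (x / ε) ≤ hS x) :
    ∫ z in thin (fun x => Γ (x / ε)), inner ℝ (flux p (osc L ε dv z))
      (θ z.1 • k z + (deriv θ z.1 * V z) • e₁) = 0 := by
  have hε' : ε⁻¹ ≠ 0 := inv_ne_zero hε.ne'
  have hT := hhS.osc hΓ ε
  obtain ⟨m1, m2, -, -⟩ := MemScaledW.cutoff_mul hp.lt hT hhS hV hθ.smooth hθ.compact hle
  set K : ℝ × ℝ → Vec2 := fun z => θ z.1 • k z + (deriv θ z.1 * V z) • e₁ with hK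
  have hK0 : ∀ z : ℝ × ℝ, z.1 ∉ Ioo (0 : ℝ) 1 → K z = 0 := fun z hz => by
    have h2 : deriv θ z.1 = 0 := by rw [← fderiv_apply_one_eq_deriv, hθ.fderiv_eq_zero hz]; rfl
    simp [hK, hθ.eq_zero hz, h2]
  have hD : cell ε⁻¹ Γ = diagMap ε 0 1 ⁻¹' thin (fun x => Γ (x / ε)) := by
    ext z
    rw [thin_osc hε, mem_preimage, mem_preimage]
    have := diagMap_symm_left (α := ε) (β := 0) (γ := 1) hε.ne' one_ne_zero z
    simp only [mul_zero, neg_zero, inv_one] at this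
    rw [this]
  have hcs : cell ε⁻¹ Γ ⊆ strip Γ := cell_subset_strip
  have hcm : MeasurableSet (cell ε⁻¹ Γ) := by
    rw [cell_eq_subgraph]
    exact (isOpen_subgraph isOpen_Ioo hΓ.continuous.continuousOn).measurableSet
  have hout : ∀ z ∈ strip Γ, z ∉ cell ε⁻¹ Γ → (diagMap ε 0 1 z).1 ∉ Ioo (0 : ℝ) 1 := by
    intro z hz hzc h1
    refine hzc ⟨?_, hz⟩
    simp only [diagMap, add_zero, mem_Ioo] at h1
    exact ⟨by nlinarith [h1.1], by rw [lt_inv_comm₀ (by nlinarith [h1.1]) hε, ← one_div,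
      lt_div_iff₀ (by nlinarith [h1.1])]; exact h1.2⟩
  have hfar : ∀ z : ℝ × ℝ, ε⁻¹ < |z.1| → (diagMap ε 0 1 z).1 ∉ Ioo (0 : ℝ) 1 := by
    intro z hz h1
    simp only [diagMap, add_zero, mem_Ioo] at h1
    have h2 : 0 < z.1 := by nlinarith [h1.1]
    rw [abs_of_pos h2, inv_lt_iff_one_lt_mul₀ hε] at hz
    linarith
  -- the test function is expressed in the fast variable `x / ε`, where it extends by zero to the
  -- whole periodic strip
  set η : ℝ × ℝ → ℝ := fun z => θ (diagMap ε 0 1 z).1 * V (diagMap ε 0 1 z) with hη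
  set g : ℝ × ℝ → Vec2 := fun z => ε • K (diagMap ε 0 1 z) with hg
  have hW : MemW p (strip Γ) η g := by
    refine ⟨?_, ?_, ?_⟩
    · refine memLp_of_eq_zero hcm hΓ.isOpen_strip.measurableSet hcs ?_ fun z hz hzc => by
        simp only [hη, hθ.eq_zero (hout z hz hzc), zero_mul]
      rw [hD]
      exact memLp_comp_diagMap hε.ne' one_ne_zero m1
    · refine memLp_of_eq_zero hcm hΓ.isOpen_strip.measurableSet hcs ?_ fun z hz hzc => by
        simp only [hg, hK0 _ (hout z hz hzc), smul_zero]
      rw [hD]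
      exact (memLp_comp_diagMap hε.ne' one_ne_zero m2).const_smul ε
    · have hsm : ContDiff ℝ ∞ fun z : ℝ × ℝ => θ (diagMap ε 0 1 z).1 :=
        hθ.smooth.comp (contDiff_fst.comp contDiff_diagMap)
      have hts : tsupport (fun z : ℝ × ℝ => θ (diagMap ε 0 1 z).1) ∩ strip Γ ⊆
          diagMap ε 0 1 ⁻¹' thin hS := by
        rintro z ⟨h1, h2⟩
        have h3 : (diagMap ε 0 1 z).1 ∈ tsupport θ :=
          (tsupport_comp_subset_preimage θ (f := fun z : ℝ × ℝ => (diagMap ε 0 1 z).1)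
            (continuous_fst.comp contDiff_diagMap.continuous)) h1
        have h4 := hθ.subset h3
        have h5 := hle _ h4 h3
        have h6 : (diagMap ε 0 1 z).1 / ε = z.1 := by
          simp only [diagMap, add_zero]; field_simp
        rw [h6] at h5
        refine ⟨h4, ?_, ?_⟩
        · simpa [diagMap] using h2.1
        · have := h2.2.trans_le h5
          simpa [diagMap] using this
      have l1 : LocInt (diagMap ε 0 1 ⁻¹' thin hS) fun z => V (diagMap ε 0 1 z) :=
        LocInt.of_memLp hp.lt (memLp_comp_diagMap hε.ne' one_ne_zero hV.memLp)
      have l2 : ∀ i (c : ℝ), LocInt (diagMap ε 0 1 ⁻¹' thin hS) fun z => c * k (diagMap ε 0 1 z) i :=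
        fun i c => LocInt.of_memLp hp.lt
          ((memLp_comp_diagMap hε.ne' one_ne_zero (memLp_apply hV.memLp_grad i)).const_mul c)
      have hfd : ∀ z w : ℝ × ℝ, fderiv ℝ (fun z : ℝ × ℝ => θ (diagMap ε 0 1 z).1) z w =
          deriv θ (diagMap ε 0 1 z).1 * (ε * w.1) := fun z w => by
        have h1 := fderiv_comp_diagMap (α := ε) (β := 0) (γ := 1)
          (φ := fun z : ℝ × ℝ => θ z.1)
          ((hθ.smooth.comp contDiff_fst).differentiable (by simp)) z w
        rw [h1, fderiv_comp_fst hθ.smooth]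
      constructor
      · refine ((hV.deriv_fst.comp_diagMap_fst (β := 0) hε.ne' one_ne_zero).smooth_mul hsm hts l1
          (l2 0 ε)).congr_on (fun _ _ => rfl) fun z _ => ?_
        rw [hfd]
        simp only [hg, hK, PiLp.smul_apply, PiLp.add_apply, smul_eq_mul, e₁]
        simp; ring
      · have h2 := hV.deriv_snd.comp_diagMap_snd (α := ε) (β := 0) (γ := 1) hε.ne' one_ne_zero
        simp only [one_mul] at h2
        refine (h2.smooth_mul hsm hts l1 (l2 1 ε)).congr_on (fun _ _ => rfl) fun z _ => ?_
        rw [hfd]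
        simp only [hg, hK, PiLp.smul_apply, PiLp.add_apply, smul_eq_mul, e₁]
        simp; ring
  -- the cell equation on the strip, transported back to the thin domain
  have h0 := h.integral_strip_eq_zero hp hΓ (R := ε⁻¹) (fun z hz => by
    simp only [hη, hθ.eq_zero (hfar z hz), zero_mul]) (fun z hz => by
    simp only [hg, hK0 _ (hfar z hz), smul_zero]) hW
  have h1 := setIntegral_comp_diagMap (β := 0) hε' one_ne_zero (cell ε⁻¹ Γ)
    fun z => inner ℝ (flux p (perExt L dv z)) (g z)
  rw [← thin_osc hε, ← setIntegral_eq_of_subset_of_forall_sdiff_eq_zero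
    hΓ.isOpen_strip.measurableSet hcs fun z hz => by
      simp only [hg, hK0 _ (hout z hz.1 hz.2), smul_zero, inner_zero_right], h0, smul_zero] at h1
  have h2 : ∀ z, g (diagMap ε⁻¹ 0 1 z) = ε • K z := fun z => by
    have := diagMap_symm_right (α := ε) (β := 0) (γ := 1) hε.ne' one_ne_zero z
    simp only [mul_zero, neg_zero, inv_one] at this
    simp only [hg, this]
  simp only [h2, inner_smul_right] at h1
  rw [integral_const_mul] at h1
  exact (mul_eq_zero.1 h1).resolve_left hε.ne'

end RoughThin

/-! ### Limits against the oscillating flux -/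

namespace RoughThin

variable {p p' L H₀ H₁ : ℝ} {Γ : ℝ → ℝ} {U : Set ℝ} {S₀ S₁ : ℝ}

theorem MemLp.flux_osc (hp : p.HolderConjugate p') (hΓ : IsCellProfile L Γ H₀ H₁) {ε : ℝ}
    (hε : 0 < ε) {dv : ℝ × ℝ → Vec2}
    (h : MemLp dv (ENNReal.ofReal p) (volume.restrict (cell L Γ))) :
    MemLp (fun z => flux p (osc L ε dv z)) (ENNReal.ofReal p')
      (volume.restrict (thin fun x => Γ (x / ε))) :=
  memLp_flux hp (memLp_osc hp.lt hΓ hε h).1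

/-- The horizontal flux of the cell solution through a vertical section does not depend on the
section, so it equals its average over a period. -/
theorem IsCellSolution.fiberInt_osc (hp : p.HolderConjugate p')
    (hΓ : IsCellProfile L Γ H₀ H₁) {v : ℝ × ℝ → ℝ} {dv : ℝ × ℝ → Vec2}
    (h : IsCellSolution p L Γ v dv) {ε : ℝ} (hε : 0 < ε) (hεL : ε * L ≤ 1) {h₀ : ℝ → ℝ}
    (hh : IsHeight U h₀ S₀ S₁) :
    ∀ᵐ x ∂volume.restrict (Ioo (0 : ℝ) 1),
      fiberInt (fun x => Γ (x / ε)) (fun z => flux p (osc L ε dv z) 0) x =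
        1 / L * ∫ y in cell L Γ, flux p (dv y) 0 := by
  have hL := hΓ.period_pos
  have hT := hh.osc hΓ ε
  have hF := memLp_apply (MemLp.flux_osc hp hΓ hε (h.memLp hΓ)) 0
  have hFi := hT.integrableOn hp.symm.lt hF
  have hai := hT.integrableOn_fiberInt hFi
  -- testing with functions of `x` alone shows that the section flux has zero derivative
  obtain ⟨c, hc⟩ := exists_ae_eq_const one_pos hai (by
    intro θ h1 h2 h3
    have hθ : IsTest (Ioo (0 : ℝ) 1) θ := ⟨h1, h2, h3⟩
    have hfin := hT.isFiniteMeasure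
    have hone : MemScaledW p ε (thin fun x => Γ (x / ε)) (fun _ => 1) (fun _ => 0) :=
      ⟨memLp_const 1, memLp_const 0, hasWeakDeriv_const 1 _,
        (hasWeakDeriv_const 1 _).congr_on (fun _ _ => rfl) fun _ _ => by simp⟩
    have h4 := h.integral_osc_eq_zero hp hΓ hε hT hone hθ fun x _ _ => le_rfl
    simp only [smul_zero, zero_add, mul_one, inner_smul_right, inner_e₁] at h4
    obtain ⟨M, hM0, hM⟩ := exists_bound_of_hasCompactSupport
      (hθ.smooth.continuous_deriv (by simp)) hθ.compact.deriv
    have hi : IntegrableOn (fun z => flux p (osc L ε dv z) 0 * deriv θ z.1)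
        (thin fun x => Γ (x / ε)) := by
      refine Integrable.mul_bdd (c := M) hFi ?_ (ae_of_all _ fun z => hM z.1)
      exact ((hθ.smooth.continuous_deriv (by simp)).comp continuous_fst).aestronglyMeasurable
    simp only [fderiv_apply_one_eq_deriv, zero_mul, integral_zero, neg_zero]
    rw [← hT.integral_mul_comp_fst hi, ← h4]
    congr 1; ext z; ring)
  -- the constant is found by integrating over one period `(0, ε L)`
  have hsub : Ioo (0 : ℝ) (ε * L) ⊆ Ioo 0 1 := Ioo_subset_Ioo_right hεL
  have e1 : ∫ x in Ioo (0 : ℝ) (ε * L),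
      fiberInt (fun x => Γ (x / ε)) (fun z => flux p (osc L ε dv z) 0) x = ε * L * c := by
    rw [integral_congr_ae (ae_restrict_of_ae_restrict_of_subset hsub hc), setIntegral_const]
    simp [(mul_pos hε hL).le]
  have e2 : ∫ x in Ioo (0 : ℝ) (ε * L),
      fiberInt (fun x => Γ (x / ε)) (fun z => flux p (osc L ε dv z) 0) x =
        ε * ∫ y in cell L Γ, flux p (dv y) 0 := by
    have hcont : Continuous fun x => Γ (x / ε) := hΓ.continuous.comp (continuous_id.div_const ε)
    have h1 := integral_subgraph (A := Ioo (0 : ℝ) (ε * L)) isOpen_Ioo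
      hcont.continuousOn (hFi.mono_set (subgraph_mono hsub fun _ _ => le_rfl))
    simp only [fiberInt]
    rw [← h1, subgraph_osc hε]
    have h2 := setIntegral_comp_diagMap (β := 0) (inv_ne_zero hε.ne') one_ne_zero (cell L Γ)
      fun z => flux p (perExt L dv z) 0
    simp only [inv_inv, inv_one, mul_one, abs_of_pos hε, smul_eq_mul] at h2
    refine h2.trans (congrArg (ε * ·) (setIntegral_congr_fun hΓ.isOpen_cell.measurableSet ?_))
    intro z hz
    simp only [perExt_of_mem_cell hL hz]
  have e3 : 1 / L * ∫ y in cell L Γ, flux p (dv y) 0 = c := by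
    have h3 := e1.symm.trans e2
    have h4 : L * c = ∫ y in cell L Γ, flux p (dv y) 0 := by
      apply mul_left_cancel₀ hε.ne'; linarith
    rw [← h4]; field_simp
  rw [e3]
  exact hc

theorem qCoeff_eq_flux : qCoeff p L Γ = 1 / L * ∫ y in cell L Γ, flux p (cellGrad p L Γ y) 0 := rfl

/-- The limit of the pairing of the oscillating cell flux with gradients of functions that are
`ε`-close to functions of `x`. -/
theorem IsCellProfile.tendsto_integral_osc_inner (hp : p.HolderConjugate p')
    (hΓ : IsCellProfile L Γ H₀ H₁) {ε : ℕ → ℝ} (hε0 : ∀ n, 0 < ε n) (hε : Tendsto ε atTop (𝓝 0))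
    {hS : ℕ → ℝ → ℝ} (hhS : ∀ n, IsHeight U (hS n) S₀ S₁) {V : ℕ → ℝ × ℝ → ℝ}
    {k : ℕ → ℝ × ℝ → Vec2} (hV : ∀ n, MemScaledW p (ε n) (thin (hS n)) (V n) (k n))
    {v : ℕ → ℝ → ℝ} {v₀ v₀' : ℝ → ℝ}
    (hv : ∀ n, MemLp (v n) (ENNReal.ofReal p) (volume.restrict (Ioo 0 1))) (hv₀ : MemW01 p v₀ v₀')
    (hvlim : Tendsto (fun n => ∫ x in Ioo (0 : ℝ) 1, ‖v n x - v₀ x‖ ^ p) atTop (𝓝 0)) {D : ℝ}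
    (hclose : ∀ n, ∫ z in thin (hS n), ‖V n z - v n z.1‖ ^ p ≤ ε n ^ p * D) {θ : ℝ → ℝ}
    (hθ : IsTest (Ioo (0 : ℝ) 1) θ)
    (hle : ∀ n, ∀ x ∈ Ioo (0 : ℝ) 1, x ∈ tsupport θ → Γ (x / ε n) ≤ hS n x) :
    Tendsto (fun n => ∫ z in thin (fun x => Γ (x / ε n)),
        θ z.1 * inner ℝ (flux p (osc L (ε n) (cellGrad p L Γ) z)) (k n z)) atTop
      (𝓝 (qCoeff p L Γ * ∫ x in Ioo (0 : ℝ) 1, θ x * v₀' x)) := by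
  obtain ⟨w, hw⟩ := exists_isCellSolution_cellGrad hp hΓ
  set B := cellGrad p L Γ with hB
  have hL := hΓ.period_pos
  have hT : ∀ n, IsHeight U (fun x => Γ (x / ε n)) H₀ H₁ := fun n => (hhS n).osc hΓ (ε n)
  have hFm := fun n => MemLp.flux_osc hp hΓ (hε0 n) (hw.memLp hΓ)
  have hF0 := fun n => memLp_apply (hFm n) 0
  have hθ' : Continuous (deriv θ) := hθ.smooth.continuous_deriv (by simp)
  have hc' : HasCompactSupport (deriv θ) := hθ.compact.deriv
  obtain ⟨M, hM0, hM⟩ := exists_bound_of_hasCompactSupport hθ.continuous hθ.compact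
  obtain ⟨M', hM0', hM'⟩ := exists_bound_of_hasCompactSupport hθ' hc'
  have hle' : ∀ n, ∀ x ∈ Ioo (0 : ℝ) 1, x ∈ tsupport (deriv θ) → Γ (x / ε n) ≤ hS n x :=
    fun n x hx hxs => hle n x hx (tsupport_deriv_subset hxs)
  obtain ⟨E, hE⟩ : ∃ E, ∀ n, ε n ≤ E := by
    obtain ⟨E, hE⟩ := hε.bddAbove_range
    exact ⟨E, fun n => hE ⟨n, rfl⟩⟩
  have hA : ∀ n, ∫ z in thin (fun x => Γ (x / ε n)), ‖flux p (osc L (ε n) B z) 0‖ ^ p' ≤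
      (1 / L + E) * ∫ z in cell L Γ, ‖B z‖ ^ p := fun n => by
    refine (integral_apply_rpow_le hp.symm.lt (hFm n) 0).trans ?_
    simp only [norm_flux_rpow hp]
    refine (memLp_osc hp.lt hΓ (hε0 n) (hw.memLp hΓ)).2.trans ?_
    exact mul_le_mul_of_nonneg_right (by linarith [hE n]) (integral_norm_rpow_nonneg _)
  have hVlim := tendsto_of_close hp hε hhS (fun n => (hV n).memLp) hv hv₀.1 hvlim hclose
  have hθ'v : MemLp (fun x => deriv θ x * v₀ x) (ENNReal.ofReal p) (volume.restrict (Ioo 0 1)) :=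
    memLp_mul_of_bound hθ'.aestronglyMeasurable hM' hv₀.1
  have hsmall : ∀ᶠ n in atTop, ε n * L ≤ 1 := by
    have h1 := hε.mul_const L
    rw [zero_mul] at h1
    exact (h1.eventually (gt_mem_nhds one_pos)).mono fun n hn => hn.le
  -- the section flux against functions of `x` is constant as soon as one period fits into `(0, 1)`
  have hℓ : Tendsto (fun n => ∫ x in Ioo (0 : ℝ) 1, fiberInt (fun x => Γ (x / ε n))
      (fun z => flux p (osc L (ε n) B z) 0) x * (deriv θ x * v₀ x)) atTop
      (𝓝 (qCoeff p L Γ * ∫ x in Ioo (0 : ℝ) 1, deriv θ x * v₀ x)) := by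
    refine tendsto_const_nhds.congr' (hsmall.mono fun n hn => ?_)
    rw [← integral_const_mul]
    refine integral_congr_ae ?_
    filter_upwards [hw.fiberInt_osc hp hΓ (hε0 n) hn (hhS n)] with x hx
    rw [hx, qCoeff_eq_flux]
  have l1 := tendsto_integral_cutoff hp hT hhS (fun n => (hV n).memLp) hv₀.1 hVlim hF0 hA hθ' hc'
    hle' hℓ
  have hwk : ∫ x in Ioo (0 : ℝ) 1, deriv θ x * v₀ x = - ∫ x in Ioo (0 : ℝ) 1, θ x * v₀' x := by
    have h1 := hv₀.2.2 θ hθ.smooth hθ.compact hθ.subset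
    simp only [fderiv_apply_one_eq_deriv] at h1
    simp only [mul_comm (deriv θ _), mul_comm (θ _)]
    exact h1
  rw [hwk, mul_neg] at l1
  refine (neg_neg (qCoeff p L Γ * _) ▸ l1.neg).congr fun n => ?_
  -- the oscillating flux is orthogonal to the gradient of `θ V`, so the pairing with `θ ∇V` equals
  -- minus the pairing with `θ' V e₁`
  have h0 := hw.integral_osc_eq_zero hp hΓ (hε0 n) (hhS n) (hV n) hθ (hle n)
  have hk := (memLp_cutoff_smul hp.lt (hT n) (hhS n) hθ.continuous hM (hle n) (hV n).memLp_grad).1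
  have hVc := (memLp_cutoff_smul hp.lt (hT n) (hhS n) hθ' hM' (hle' n) (hV n).memLp).1
  have i1 := integrable_inner_of_memLp hp (hFm n) hk
  have i2 := integrable_mul_of_memLp hp (hF0 n) hVc
  simp only [inner_add_right, inner_smul_right, inner_e₁] at h0
  simp only [inner_smul_right] at i1
  simp only [smul_eq_mul] at i2
  have e : ∀ z, deriv θ z.1 * V n z * flux p (osc L (ε n) B z) 0 =
    flux p (osc L (ε n) B z) 0 * (deriv θ z.1 * V n z) := fun z => mul_comm _ _
  simp only [e] at h0
  rw [integral_add i1 i2] at h0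
  linarith

end RoughThin

/-! ### Comparison with periodic profiles -/

namespace RoughThin

section Cutoff

variable {p p' : ℝ} {U : Set ℝ} {h hS : ℝ → ℝ} {H₀ H₁ S₀ S₁ : ℝ} {θ : ℝ → ℝ}

/-- A cut-off function that vanishes where `h > hS` carries integrability from the domain below
`hS` to the domain below `h`. -/
theorem integrableOn_cutoff_mul (hh : IsHeight U h H₀ H₁) (hhS : IsHeight U hS S₀ S₁)
    (hle : ∀ x ∈ Ioo (0 : ℝ) 1, x ∈ tsupport θ → h x ≤ hS x) {f : ℝ × ℝ → ℝ}
    (hf : IntegrableOn (fun z => θ z.1 * f z) (thin hS)) :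
    IntegrableOn (fun z => θ z.1 * f z) (thin h) := by
  rw [IntegrableOn, hhS.restrict_thin] at hf
  have hae : (fun z => θ z.1 * f z) =ᵐ[volume.restrict (thin h)]
      (subgraph U hS).indicator fun z => θ z.1 * f z := by
    filter_upwards [ae_mem_of_mem_tsupport hh hle] with z hz
    by_cases h0 : θ z.1 = 0
    · rw [eq_comm, h0, zero_mul]
      exact indicator_apply_eq_zero.2 fun _ => by rw [h0, zero_mul]
    · rw [indicator_of_mem (hz (subset_tsupport _ h0))]
  exact (((integrable_indicator_iff hhS.measurableSet).2 hf).restrict).congr hae.symm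

theorem integrable_comp_fst_mul (hθ : Continuous θ) {M : ℝ} (hM : ∀ x, |θ x| ≤ M)
    {μ : Measure (ℝ × ℝ)} {f : ℝ × ℝ → ℝ} (hf : Integrable f μ) :
    Integrable (fun z => θ z.1 * f z) μ :=
  hf.bdd_mul (hθ.comp continuous_fst).aestronglyMeasurable (ae_of_all _ fun z => hM z.1)

/-- Young's inequality `|s|^{p-2} s · t ≤ |s|^p / p' + |t|^p / p` under a nonnegative cut-off. -/
theorem integral_cutoff_young (hp : p.HolderConjugate p') (hθ : ∀ x, 0 ≤ θ x)
    {μ : Measure (ℝ × ℝ)} {s t : ℝ × ℝ → Vec2}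
    (i1 : Integrable (fun z => θ z.1 * inner ℝ (flux p (s z)) (t z)) μ)
    (i2 : Integrable (fun z => θ z.1 * ‖s z‖ ^ p) μ)
    (i3 : Integrable (fun z => θ z.1 * ‖t z‖ ^ p) μ) :
    ∫ z, θ z.1 * inner ℝ (flux p (s z)) (t z) ∂μ ≤
      (∫ z, θ z.1 * ‖s z‖ ^ p ∂μ) / p' + (∫ z, θ z.1 * ‖t z‖ ^ p ∂μ) / p := by
  rw [← integral_div, ← integral_div, ← integral_add (i2.div_const _) (i3.div_const _)]
  refine integral_mono i1 ((i2.div_const _).add (i3.div_const _)) fun z => ?_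
  have := mul_le_mul_of_nonneg_left (inner_flux_le hp (s z) (t z)) (hθ z.1)
  refine this.trans_eq ?_
  ring

theorem memW01_id : MemW01 p (fun x => x) (fun _ => 1) := by
  refine ⟨memLp_of_bounded (a := 0) (b := 1) ((ae_restrict_iff' measurableSet_Ioo).2
    (ae_of_all _ fun x hx => ⟨hx.1.le, hx.2.le⟩)) measurable_id.aestronglyMeasurable _,
    memLp_const 1, (hasWeakDeriv_of_smooth contDiff_id 1).congr_on (fun _ _ => rfl) fun x _ => ?_⟩
  simp

end Cutoff

variable {p p' L H₀ H₁ : ℝ} {Γ : ℝ → ℝ}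

/-- Along a bounded sequence of periods, the oscillating trial functions are `ε`-close to `x`. -/
theorem IsCellProfile.exists_trial (hp : p.HolderConjugate p') (hΓ : IsCellProfile L Γ H₀ H₁)
    {ε : ℕ → ℝ} (hε0 : ∀ n, 0 < ε n) (hε : Tendsto ε atTop (𝓝 0)) :
    ∃ (V : ℕ → ℝ × ℝ → ℝ) (D : ℝ), 0 ≤ D ∧
      (∀ n, MemScaledW p (ε n) (thin fun x => Γ (x / ε n)) (V n)
        (osc L (ε n) (cellGrad p L Γ))) ∧
      ∀ n, ∫ z in thin (fun x => Γ (x / ε n)), ‖V n z - z.1‖ ^ p ≤ ε n ^ p * D := by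
  obtain ⟨v, hv⟩ := exists_isCellSolution_cellGrad hp hΓ
  obtain ⟨E, hE⟩ : ∃ E, ∀ n, ε n ≤ E := by
    obtain ⟨E, hE⟩ := hε.bddAbove_range
    exact ⟨E, fun n => hE ⟨n, rfl⟩⟩
  have hL := hΓ.period_pos
  have h0 : 0 ≤ ∫ z in cell L Γ, ‖v z - z.1‖ ^ p := integral_norm_rpow_nonneg _
  have hE0 : 0 ≤ E := (hε0 0).le.trans (hE 0)
  refine ⟨fun n z => z.1 + ε n * osc L (ε n) (fun y => v y - y.1) z,
    (1 / L + E) * ∫ z in cell L Γ, ‖v z - z.1‖ ^ p, by positivity,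
    fun n => (hv.memScaledW_osc hp.lt hΓ (hε0 n)).1, fun n => ?_⟩
  refine (hv.memScaledW_osc hp.lt hΓ (hε0 n)).2.trans ?_
  refine mul_le_mul_of_nonneg_left ?_ (Real.rpow_nonneg (hε0 n).le _)
  exact mul_le_mul_of_nonneg_right (by linarith [hE n]) h0

variable {U : Set ℝ} {ε : ℕ → ℝ} {h : ℕ → ℝ → ℝ}
    {f u : ℕ → ℝ × ℝ → ℝ} {g : ℕ → ℝ × ℝ → Vec2} {fhat r : ℝ → ℝ} {C : ℝ} {m : ℕ → ℝ → ℝ}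
    {u₀ u₀' σ θ : ℝ → ℝ}

/-- The localized comparison with two periodic profiles. Young's inequality pairs the flux of the
solution with `t` times the oscillating gradient of the larger profile, and `t` times the
oscillating flux of the smaller profile with the gradient of the solution; all the integrals have
limits. -/
theorem IsThinLimit.integral_comparison (H : IsThinLimit p p' U H₀ H₁ ε h f u g fhat r C m u₀ u₀' σ)
    (hp : p.HolderConjugate p') {Γm Γp : ℝ → ℝ} {A₀ A₁ B₀ B₁ : ℝ} (hm : IsCellProfile L Γm A₀ A₁)
    (hP : IsCellProfile L Γp B₀ B₁) (hθ : IsTest (Ioo (0 : ℝ) 1) θ) (hθ0 : ∀ x, 0 ≤ θ x)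
    (hlem : ∀ n, ∀ x ∈ Ioo (0 : ℝ) 1, x ∈ tsupport θ → Γm (x / ε n) ≤ h n x)
    (hleP : ∀ n, ∀ x ∈ Ioo (0 : ℝ) 1, x ∈ tsupport θ → h n x ≤ Γp (x / ε n)) (t : ℝ) :
    t * (∫ x in Ioo (0 : ℝ) 1, θ x * σ x) +
        flux p t * (qCoeff p L Γm * ∫ x in Ioo (0 : ℝ) 1, θ x * u₀' x) ≤
      (∫ x in Ioo (0 : ℝ) 1, θ x * (σ x * u₀' x)) +
        |t| ^ p * ((qCoeff p L Γp * ∫ x in Ioo (0 : ℝ) 1, θ x) / p +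
          (qCoeff p L Γm * ∫ x in Ioo (0 : ℝ) 1, θ x) / p') := by
  have hTm : ∀ n, IsHeight U (fun x => Γm (x / ε n)) A₀ A₁ := fun n => (H.height n).osc hm (ε n)
  have hTP : ∀ n, IsHeight U (fun x => Γp (x / ε n)) B₀ B₁ := fun n => (H.height n).osc hP (ε n)
  obtain ⟨Vm, Dm, hDm, hVm, hcm⟩ := hm.exists_trial hp H.eps_pos H.eps_tendsto
  obtain ⟨VP, DP, hDP, hVP, hcP⟩ := hP.exists_trial hp H.eps_pos H.eps_tendsto
  set Bm := cellGrad p L Γm with hBm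
  set BP := cellGrad p L Γp with hBP
  have hid := memW01_id (p := p)
  have hid0 : Tendsto (fun _ : ℕ => ∫ x in Ioo (0 : ℝ) 1, ‖x - x‖ ^ p) atTop (𝓝 0) := by
    simp [Real.zero_rpow hp.ne_zero]
  obtain ⟨M, hM0, hM⟩ := exists_bound_of_hasCompactSupport hθ.continuous hθ.compact
  -- with `g` the gradient of the solution and `B±` the oscillating cell gradients of `Γp` and `Γm`,
  -- the limits are those of `|g|^{p-2} g · B₊` (`l1`), `|B₋|^{p-2} B₋ · g` (`l2`), `|g|^p` (`l3`),
  -- `|B₊|^p` (`l4`) and `|B₋|^p` (`l5`)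
  have l1 := H.tendsto_integral_cutoff_inner hp hTP hVP (fun _ => hid.1) hid hid0 hDP hcP
    hθ.smooth hθ.compact hleP
  have l2 := hm.tendsto_integral_osc_inner hp H.eps_pos H.eps_tendsto H.height H.memScaledW
    H.memLp_mean H.memW01 H.mean_tendsto H.close hθ hlem
  have l3 := H.tendsto_integral_cutoff_inner hp H.height H.memScaledW H.memLp_mean H.memW01
    H.mean_tendsto H.nonneg H.close hθ.smooth hθ.compact fun _ _ _ _ => le_rfl
  have l4 := hP.tendsto_integral_osc_inner hp H.eps_pos H.eps_tendsto hTP hVP (fun _ => hid.1) hid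
    hid0 hcP hθ fun _ _ _ _ => le_rfl
  have l5 := hm.tendsto_integral_osc_inner hp H.eps_pos H.eps_tendsto hTm hVm (fun _ => hid.1) hid
    hid0 hcm hθ fun _ _ _ _ => le_rfl
  rw [← hBP] at l4
  rw [← hBm] at l2 l5
  simp only [inner_flux_self hp.lt, mul_one] at l1 l3 l4 l5
  refine le_of_tendsto_of_tendsto' ((l1.const_mul t).add (l2.const_mul (flux p t)))
    (l3.add (((l4.div_const p).add (l5.div_const p')).const_mul (|t| ^ p))) fun n => ?_
  have hg := (H.memScaledW n).memLp_grad
  have hBmn := (hVm n).memLp_grad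
  have hBPn := (hVP n).memLp_grad
  have ig := integrable_comp_fst_mul hθ.continuous hM (integrable_norm_rpow hp.lt hg)
  have im := integrable_comp_fst_mul hθ.continuous hM (integrable_norm_rpow hp.lt hBmn)
  have iP := integrable_comp_fst_mul hθ.continuous hM (integrable_norm_rpow hp.lt hBPn)
  have ig' := integrableOn_cutoff_mul (hTm n) (H.height n) (hlem n) ig
  have iP' := integrableOn_cutoff_mul (H.height n) (hTP n) (hleP n) iP
  have cg := (memLp_cutoff_smul hp.lt (hTm n) (H.height n) hθ.continuous hM (hlem n) hg).1
  have cP := (memLp_cutoff_smul hp.lt (H.height n) (hTP n) hθ.continuous hM (hleP n) hBPn).1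
  have jP := integrable_inner_of_memLp hp (RoughThin.memLp_flux hp hg) cP
  have jm := integrable_inner_of_memLp hp (RoughThin.memLp_flux hp hBmn) cg
  simp only [inner_smul_right] at jP jm
  have hns : ∀ s : Vec2, ‖t • s‖ ^ p = |t| ^ p * ‖s‖ ^ p := fun s => by
    rw [norm_smul, Real.norm_eq_abs, Real.mul_rpow (abs_nonneg _) (norm_nonneg _)]
  have y1 := integral_cutoff_young hp hθ0 (μ := volume.restrict (thin (h n))) (s := g n)
    (t := fun z => t • osc L (ε n) BP z) (by
      refine (jP.const_mul t).congr (ae_of_all _ fun z => ?_)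
      simp only [inner_smul_right]; ring) ig (by
      refine (iP'.const_mul (|t| ^ p)).congr (ae_of_all _ fun z => ?_)
      simp only [hns]; ring)
  have y2 := integral_cutoff_young hp hθ0 (μ := volume.restrict (thin fun x => Γm (x / ε n)))
    (s := fun z => t • osc L (ε n) Bm z) (t := g n) (by
      refine (jm.const_mul (flux p t)).congr (ae_of_all _ fun z => ?_)
      simp only [flux_smul, real_inner_smul_left]; ring) (by
      refine (im.const_mul (|t| ^ p)).congr (ae_of_all _ fun z => ?_)
      simp only [hns]; ring) ig'
  simp only [flux_smul, real_inner_smul_left, inner_smul_right, hns,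
    mul_left_comm (θ _)] at y1 y2
  rw [integral_const_mul, integral_const_mul] at y1 y2
  -- `|g|^p` is integrated below `Γm` and `|B₊|^p` below `h`; enlarging both domains brings them to
  -- those of the limits `l3` and `l4`
  have m1 := integral_cutoff_mul_mono (hTm n) (H.height n) hθ0 (hlem n)
    (f := fun z => ‖g n z‖ ^ p) (fun z => by positivity) ig
  have m2 := integral_cutoff_mul_mono (H.height n) (hTP n) hθ0 (hleP n)
    (f := fun z => ‖osc L (ε n) BP z‖ ^ p) (fun z => by positivity) iP
  have hp0 := hp.pos
  have hp0' := hp.symm.pos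
  have m1' := div_le_div_of_nonneg_right m1 hp0.le
  have m2' := mul_le_mul_of_nonneg_left (div_le_div_of_nonneg_right m2 hp0.le)
    (Real.rpow_nonneg (abs_nonneg t) p)
  -- `1/p + 1/p' = 1` recombines the two energies of the solution
  have e := add_div_conj hp (∫ z in thin (h n), θ z.1 * ‖g n z‖ ^ p)
  rw [mul_div_assoc] at y1 y2
  rw [mul_add]
  linarith

end RoughThin

/-! ### Identification of the limit flux -/

namespace RoughThin

/-- A family of periodic profiles `G x`, depending continuously on `x` in an open set `U` of full
measure in `(0,1)`, in the sense of uniform convergence. -/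
structure IsProfileFamily (L : ℝ) (U : Set ℝ) (G : ℝ → ℝ → ℝ) (H₀ H₁ : ℝ) : Prop where
  isOpen : IsOpen U
  subset : U ⊆ Ioo 0 1
  null : volume (Ioo 0 1 \ U) = 0
  lower_pos : 0 < H₀
  bounds : ∀ x ∈ Ioo (0 : ℝ) 1, ∀ y, H₀ ≤ G x y ∧ G x y ≤ H₁
  cellProfile : ∀ x ∈ U, IsCellProfile L (G x) H₀ H₁
  eventually_close : ∀ x ∈ U, ∀ η > 0, ∀ᶠ a in 𝓝 x, ∀ y, |G a y - G x y| ≤ η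

variable {p p' L H₀ H₁ : ℝ} {U : Set ℝ} {G : ℝ → ℝ → ℝ}

namespace IsProfileFamily

theorem continuousOn (hG : IsProfileFamily L U G H₀ H₁) :
    ContinuousOn (fun z : ℝ × ℝ => G z.1 z.2) (U ×ˢ univ) := by
  rintro ⟨x, y⟩ ⟨hx, -⟩
  refine ContinuousAt.continuousWithinAt (Metric.tendsto_nhds.2 fun η hη => ?_)
  have h1 := (hG.cellProfile x hx).continuous.continuousAt (x := y)
  have h2 := Metric.tendsto_nhds.1 h1 (η / 2) (by positivity)
  rw [nhds_prod_eq]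
  filter_upwards [(hG.eventually_close x hx (η / 2) (by positivity)).prod_mk h2] with z hz
  have h3 := hz.1 z.2
  have h4 := hz.2
  rw [Real.dist_eq] at h4 ⊢
  calc |G z.1 z.2 - G x y| = |(G z.1 z.2 - G x z.2) + (G x z.2 - G x y)| := by congr 1; ring
    _ ≤ |G z.1 z.2 - G x z.2| + |G x z.2 - G x y| := abs_add_le _ _
    _ < η := by linarith

theorem isHeight (hG : IsProfileFamily L U G H₀ H₁) (ε : ℝ) :
    IsHeight U (fun x => G x (x / ε)) H₀ H₁ where
  isOpen := hG.isOpen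
  subset := hG.subset
  null := hG.null
  continuousOn := hG.continuousOn.comp (f := fun x : ℝ => (x, x / ε))
    (continuous_id.prodMk (continuous_id.div_const ε)).continuousOn fun _ hx => ⟨hx, mem_univ _⟩
  lower_pos := hG.lower_pos
  lower x hx := (hG.bounds x hx _).1
  upper x hx := (hG.bounds x hx _).2

/-- The lower bound `H₀` turns uniform closeness into a multiplicative pinching. -/
theorem pinch (hG : IsProfileFamily L U G H₀ H₁) {a b δ : ℝ} (hb : b ∈ U) (hδ : 0 ≤ δ)
    (h : ∀ y, |G a y - G b y| ≤ δ * H₀) (y : ℝ) :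
    (1 - δ) * G b y ≤ G a y ∧ G a y ≤ (1 + δ) * G b y := by
  have h1 := abs_le.1 (h y)
  have h2 := mul_le_mul_of_nonneg_left ((hG.cellProfile b hb).lower y) hδ
  constructor <;> linarith [h1.1, h1.2]

theorem restrict_unit (hG : IsProfileFamily L U G H₀ H₁) :
    volume.restrict (Ioo (0 : ℝ) 1) = volume.restrict U := (hG.isHeight 1).restrict_unit

end IsProfileFamily

/-- Minty's argument on the line. -/
theorem eq_mul_flux_of_forall_rat (hp : 1 < p) {s q d : ℝ}
    (h : ∀ t : ℚ, 0 ≤ (s - q * flux p (t : ℝ)) * (d - t)) : s = q * flux p d := by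
  have hcont : Continuous (flux p : ℝ → ℝ) := continuous_flux hp
  have h1 : ∀ t : ℝ, 0 ≤ (s - q * flux p t) * (d - t) := by
    intro t
    have hcl : IsClosed {t : ℝ | 0 ≤ (s - q * flux p t) * (d - t)} :=
      isClosed_le continuous_const (by fun_prop)
    exact hcl.closure_subset_iff.2 (by rintro _ ⟨r, rfl⟩; exact h r)
      (Rat.denseRange_cast (𝕜 := ℝ) t)
  have hlim : ∀ c : ℝ, Tendsto (fun n : ℕ => q * flux p (d + c / (n + 1))) atTop
      (𝓝 (q * flux p d)) := fun c => by
    have h2 : Tendsto (fun n : ℕ => d + c / (n + 1 : ℝ)) atTop (𝓝 d) := by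
      have := (tendsto_one_div_add_atTop_nhds_zero_nat (𝕜 := ℝ)).const_mul c
      simpa [div_eq_mul_inv] using this.const_add d
    exact ((hcont.tendsto d).comp h2).const_mul q
  apply le_antisymm
  -- slopes slightly above `d` bound `s` from above, slopes slightly below `d` from below
  · refine ge_of_tendsto' (hlim 1) fun n => ?_
    have h2 := h1 (d + 1 / (n + 1))
    have h3 : (0 : ℝ) < 1 / (n + 1) := by positivity
    nlinarith
  · refine le_of_tendsto' (hlim (-1)) fun n => ?_
    have h2 := h1 (d + -1 / (n + 1))
    have h3 : (-1 : ℝ) / (n + 1) < 0 := div_neg_of_neg_of_pos (by norm_num) (by positivity)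
    nlinarith

variable {ε : ℕ → ℝ} {f u : ℕ → ℝ × ℝ → ℝ} {g : ℕ → ℝ × ℝ → Vec2} {fhat r : ℝ → ℝ} {C : ℝ}
  {m : ℕ → ℝ → ℝ} {u₀ u₀' σ θ : ℝ → ℝ}

/-- The comparison inequality on an interval on which the profile is pinched between multiples of
one periodic profile `Γ`. -/
theorem IsThinLimit.ae_comparison
    (H : IsThinLimit p p' U H₀ H₁ ε (fun n x => G x (x / ε n)) f u g fhat r C m u₀ u₀' σ)
    (hp : p.HolderConjugate p') {Γ : ℝ → ℝ} {A₀ A₁ : ℝ} (hΓ : IsCellProfile L Γ A₀ A₁) {a b δ : ℝ}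
    (hab : Ioo a b ⊆ Ioo 0 1) (hδ : 0 ≤ δ) (hδ1 : δ < 1)
    (hpin : ∀ x ∈ Ioo a b, ∀ y, (1 - δ) * Γ y ≤ G x y ∧ G x y ≤ (1 + δ) * Γ y) (t : ℝ) :
    ∀ᵐ x ∂volume.restrict (Ioo a b),
      t * σ x + flux p t * (qCoeff p L (fun y => (1 - δ) * Γ y) * u₀' x) ≤
        σ x * u₀' x + |t| ^ p * (qCoeff p L (fun y => (1 + δ) * Γ y) / p +
          qCoeff p L (fun y => (1 - δ) * Γ y) / p') := by
  have hm := hΓ.const_mul (c := 1 - δ) (by linarith)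
  have hP := hΓ.const_mul (c := 1 + δ) (by linarith)
  set qm := qCoeff p L (fun y => (1 - δ) * Γ y)
  set qp := qCoeff p L (fun y => (1 + δ) * Γ y)
  have i1 : IntegrableOn σ (Ioo 0 1) := integrableOn_unit hp.symm.lt H.memLp_flux
  have i2 : IntegrableOn u₀' (Ioo 0 1) := integrableOn_unit hp.lt H.memW01.2.1
  have i3 : IntegrableOn (fun x => σ x * u₀' x) (Ioo 0 1) :=
    integrable_mul_of_memLp hp H.memLp_flux H.memW01.2.1
  have i4 : IntegrableOn (fun _ : ℝ => |t| ^ p * (qp / p + qm / p')) (Ioo (0 : ℝ) 1) :=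
    integrable_const _
  have i5 : IntegrableOn (fun x => (σ x * u₀' x + |t| ^ p * (qp / p + qm / p')) -
      (t * σ x + flux p t * (qm * u₀' x))) (Ioo 0 1) :=
    (i3.add i4).sub ((i1.const_mul t).add ((i2.const_mul qm).const_mul (flux p t)))
  have key := ae_nonneg_of_integral_test_nonneg isOpen_Ioo (i5.mono_set hab) fun θ hθ hθ0 => by
    have hθ1 := hθ.mono hab
    obtain ⟨M, hM0, hM⟩ := exists_bound_of_hasCompactSupport hθ.continuous hθ.compact
    have hc := H.integral_comparison hp hm hP hθ1 hθ0
      (fun n x _ hx => (hpin x (hθ.subset hx) _).1) (fun n x _ hx => (hpin x (hθ.subset hx) _).2) t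
    have hb : ∀ {F : ℝ → ℝ}, IntegrableOn F (Ioo 0 1) →
        Integrable (fun x => θ x * F x) (volume.restrict (Ioo 0 1)) := fun {F} hF =>
      Integrable.bdd_mul hF hθ.continuous.aestronglyMeasurable (ae_of_all _ hM)
    have j0 : Integrable θ (volume.restrict (Ioo 0 1)) := by
      simpa using hb (F := fun _ => 1) (integrable_const _)
    rw [← setIntegral_eq_of_subset_of_forall_sdiff_eq_zero measurableSet_Ioo hab fun x hx => by
      rw [hθ.eq_zero hx.2, zero_mul]]
    have e : ∀ x, θ x * ((σ x * u₀' x + |t| ^ p * (qp / p + qm / p')) -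
        (t * σ x + flux p t * (qm * u₀' x))) =
        (θ x * (σ x * u₀' x) + (|t| ^ p * (qp / p + qm / p')) * θ x) -
        (t * (θ x * σ x) + (flux p t * qm) * (θ x * u₀' x)) := fun x => by ring
    simp only [e]
    have k1 : Integrable (fun x => θ x * (σ x * u₀' x) + |t| ^ p * (qp / p + qm / p') * θ x)
        (volume.restrict (Ioo 0 1)) := (hb i3).add (j0.const_mul _)
    have k2 : Integrable (fun x => t * (θ x * σ x) + flux p t * qm * (θ x * u₀' x))
        (volume.restrict (Ioo 0 1)) := ((hb i1).const_mul t).add ((hb i2).const_mul _)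
    rw [integral_sub k1 k2, integral_add (hb i3) (j0.const_mul _),
      integral_add ((hb i1).const_mul t) ((hb i2).const_mul _), integral_const_mul,
      integral_const_mul, integral_const_mul]
    have e2 : |t| ^ p * ((qp * ∫ x in Ioo (0 : ℝ) 1, θ x) / p +
        (qm * ∫ x in Ioo (0 : ℝ) 1, θ x) / p') =
        |t| ^ p * (qp / p + qm / p') * ∫ x in Ioo (0 : ℝ) 1, θ x := by ring
    rw [e2] at hc
    linarith
  filter_upwards [key] with x hx
  linarith

/-- Identification of the limit flux. Near almost every `x` the profile is pinched between
`(1 ± δ) G(x₀, ·)` for some rational `x₀`, and both coefficients tend to `q(x)` as `δ → 0`. In the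
limit the comparison inequality becomes Minty's inequality `0 ≤ (σ - q flux t) (u₀' - t)`. -/
theorem IsThinLimit.flux_eq
    (H : IsThinLimit p p' U H₀ H₁ ε (fun n x => G x (x / ε n)) f u g fhat r C m u₀ u₀' σ)
    (hp : p.HolderConjugate p') (hG : IsProfileFamily L U G H₀ H₁) :
    ∀ᵐ x ∂volume.restrict (Ioo (0 : ℝ) 1), σ x = qCoeff p L (G x) * flux p (u₀' x) := by
  set δ : ℕ → ℝ := fun k => 1 / (k + 2) with hδ
  have hδ0 : ∀ k, 0 < δ k := fun k => by positivity
  have hδ1 : ∀ k, δ k < 1 := fun k => by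
    simp only [hδ]; rw [div_lt_one (by positivity)]; linarith [k.cast_nonneg (α := ℝ)]
  -- countably many intervals with rational centre and radius, accuracies and slopes
  have hall : ∀ᵐ x ∂volume.restrict (Ioo (0 : ℝ) 1), ∀ (x₀ s t : ℚ) (k : ℕ), (x₀ : ℝ) ∈ U →
      Ioo (x₀ - s : ℝ) (x₀ + s) ⊆ Ioo 0 1 →
      (∀ a ∈ Ioo (x₀ - s : ℝ) (x₀ + s), ∀ y, |G a y - G x₀ y| ≤ δ k * H₀) →
      x ∈ Ioo (x₀ - s : ℝ) (x₀ + s) →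
      t * σ x + flux p (t : ℝ) * (qCoeff p L (fun y => (1 - δ k) * G x₀ y) * u₀' x) ≤
        σ x * u₀' x + |(t : ℝ)| ^ p * (qCoeff p L (fun y => (1 + δ k) * G x₀ y) / p +
          qCoeff p L (fun y => (1 - δ k) * G x₀ y) / p') := by
    simp only [ae_all_iff]
    intro x₀ s t k hx₀ hs hclose
    have h1 := H.ae_comparison hp (hG.cellProfile x₀ hx₀) hs (hδ0 k).le (hδ1 k)
      (fun a ha => hG.pinch hx₀ (hδ0 k).le (hclose a ha)) t
    exact ae_restrict_of_ae ((ae_restrict_iff' measurableSet_Ioo).1 h1)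
  rw [hG.restrict_unit] at hall ⊢
  filter_upwards [hall, ae_restrict_mem hG.isOpen.measurableSet] with x hx hxU
  refine eq_mul_flux_of_forall_rat hp.lt fun t => ?_
  have hq := qCoeff_nonneg hp (hG.cellProfile x hxU)
  set q := qCoeff p L (G x) with hqdef
  set A := |flux p (t : ℝ) * u₀' x| + |(t : ℝ)| ^ p with hA
  have hA0 : 0 ≤ A := by positivity
  have hlim : Tendsto (fun k : ℕ => 2 * (1 / ((k : ℝ) + 1)) * (q * A)) atTop (𝓝 0) := by
    have := ((tendsto_one_div_add_atTop_nhds_zero_nat (𝕜 := ℝ)).const_mul 2).mul_const (q * A)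
    simpa using this
  -- the comparison inequality in the limit `δ → 0`; the error is at most `(c - 1) q A` with `c → 1`
  have hgoal : t * σ x + flux p (t : ℝ) * u₀' x * q - σ x * u₀' x - |(t : ℝ)| ^ p * q ≤ 0 := by
    refine ge_of_tendsto' hlim fun k => ?_
    -- a rational interval around `x` on which the profile varies little
    obtain ⟨ρ, hρ, hball⟩ := Metric.eventually_nhds_iff_ball.1
      ((hG.isOpen.eventually_mem hxU).and (hG.eventually_close x hxU (δ k * H₀ / 2)
        (by have := hδ0 k; have := hG.lower_pos; positivity)))
    obtain ⟨s, hs0, hsρ⟩ := exists_rat_btwn (half_pos hρ)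
    obtain ⟨x₀, hx1, hx2⟩ := exists_rat_btwn (show x - s < x + s by linarith)
    have hin : ∀ a ∈ Ioo (x₀ - s : ℝ) (x₀ + s), a ∈ Metric.ball x ρ := fun a ha => by
      rw [Metric.mem_ball, Real.dist_eq, abs_lt]
      constructor <;> linarith [ha.1, ha.2]
    have hx₀b : (x₀ : ℝ) ∈ Metric.ball x ρ := hin _ ⟨by linarith, by linarith⟩
    have hx₀ := (hball _ hx₀b).1
    have hclose : ∀ a ∈ Ioo (x₀ - s : ℝ) (x₀ + s), ∀ y, |G a y - G x₀ y| ≤ δ k * H₀ := by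
      intro a ha y
      have h1 := (hball _ (hin a ha)).2 y
      have h2 := (hball _ hx₀b).2 y
      rw [abs_sub_comm] at h2
      calc |G a y - G x₀ y| = |(G a y - G x y) + (G x y - G x₀ y)| := by congr 1; ring
        _ ≤ |G a y - G x y| + |G x y - G x₀ y| := abs_add_le _ _
        _ ≤ _ := by linarith
    have hxI : x ∈ Ioo (x₀ - s : ℝ) (x₀ + s) := ⟨by linarith, by linarith⟩
    have hineq := hx x₀ s t k hx₀ (fun a ha => hG.subset (hball _ (hin a ha)).1) hclose hxI
    -- the two coefficients are close to `q`
    have hpin := hG.pinch hx₀ (hδ0 k).le (hclose x hxI)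
    have hΓ := hG.cellProfile x₀ hx₀
    have hX := hG.cellProfile x hxU
    have hd : 0 < 1 - δ k := by linarith [hδ1 k]
    have hd' : 0 < 1 + δ k := by linarith [hδ0 k]
    have hm := hΓ.const_mul hd
    have hP := hΓ.const_mul hd'
    set qm := qCoeff p L (fun y => (1 - δ k) * G x₀ y)
    set qp := qCoeff p L (fun y => (1 + δ k) * G x₀ y)
    -- `c = (1 + δ) / (1 - δ)`, which maps the lower profile to the upper one
    set c : ℝ := 1 + 2 * (1 / ((k : ℝ) + 1)) with hc
    have hc1 : 1 ≤ c := by have : 0 ≤ 2 * (1 / ((k : ℝ) + 1)) := by positivity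
                           linarith
    have hcδ : c * (1 - δ k) = 1 + δ k := by simp only [hc, hδ]; field_simp; ring
    have q1 : qm ≤ q := qCoeff_mono hp hm hX fun y => (hpin y).1
    have q2 : q ≤ qp := qCoeff_mono hp hX hP fun y => (hpin y).2
    have q3 : qp ≤ c * q :=
      (qCoeff_mono hp hP (hX.const_mul (c := c) (by linarith)) fun y => by
        rw [← hcδ, mul_assoc]; exact mul_le_mul_of_nonneg_left (hpin y).1 (by linarith)).trans
      (qCoeff_const_mul_le hp hX hc1)
    have q4 : qp ≤ c * qm := by
      have h1 := qCoeff_const_mul_le hp hm hc1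
      have h2 : (fun y => c * ((1 - δ k) * G x₀ y)) = fun y => (1 + δ k) * G x₀ y := by
        ext y; rw [← mul_assoc, hcδ]
      rwa [h2] at h1
    have q5 : q - qm ≤ (c - 1) * q := by
      have := q2.trans q4
      have := mul_le_mul_of_nonneg_left q1 (show 0 ≤ c - 1 by linarith)
      linarith
    have b1 : flux p (t : ℝ) * u₀' x * (q - qm) ≤ |flux p (t : ℝ) * u₀' x| * ((c - 1) * q) :=
      (mul_le_mul_of_nonneg_right (le_abs_self _) (by linarith)).trans
        (mul_le_mul_of_nonneg_left q5 (abs_nonneg _))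
    have hp0 := hp.pos
    have hp0' := hp.symm.pos
    have b2 : qp / p + qm / p' ≤ c * q := by
      have h1 : qp / p ≤ c * q / p := div_le_div_of_nonneg_right q3 hp0.le
      have h2 : qm / p' ≤ c * q / p' :=
        div_le_div_of_nonneg_right (q1.trans (le_mul_of_one_le_left hq hc1)) hp0'.le
      have h3 := add_div_conj hp (c * q)
      linarith
    have b3 := mul_le_mul_of_nonneg_left b2 (Real.rpow_nonneg (abs_nonneg (t : ℝ)) p)
    have e1 : 2 * (1 / ((k : ℝ) + 1)) = c - 1 := by rw [hc]; ring
    rw [e1, hA]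
    linarith
  have e : flux p (t : ℝ) * t = |(t : ℝ)| ^ p := by
    have := inner_flux_self hp.lt (t : ℝ)
    rw [Real.norm_eq_abs] at this
    rw [← this, real_inner_eq_re_inner]
    simp [mul_comm]
  have e' : (σ x - q * flux p (t : ℝ)) * (u₀' x - t) =
    -(t * σ x + flux p (t : ℝ) * u₀' x * q - σ x * u₀' x - (flux p (t : ℝ) * t) * q) := by ring
  rw [e', e]
  linarith

end RoughThin

/-! ### Averaging of oscillating heights -/

namespace RoughThin

section Averaging

variable {L K R : ℝ} {F : ℝ × ℝ → ℝ} {ε : ℕ → ℝ}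

theorem integrable_of_bounded_of_support {F : ℝ × ℝ → ℝ} (hF : Measurable F) (hK : ∀ z, |F z| ≤ K)
    (h0 : ∀ z : ℝ × ℝ, R < |z.1| → F z = 0) :
    Integrable F ((volume : Measure ℝ).prod (volume.restrict (Ioc 0 L))) := by
  have hS : MeasurableSet (Icc (-R) R ×ˢ (univ : Set ℝ)) := measurableSet_Icc.prod .univ
  have h1 : Integrable ((Icc (-R) R ×ˢ (univ : Set ℝ)).indicator fun _ : ℝ × ℝ => K)
      ((volume : Measure ℝ).prod (volume.restrict (Ioc 0 L))) := by
    rw [integrable_indicator_iff hS]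
    refine integrableOn_const ?_
    rw [Measure.prod_prod]
    exact (ENNReal.mul_lt_top (by simp) (by simp)).ne
  refine h1.mono' hF.aestronglyMeasurable (ae_of_all _ fun z => ?_)
  by_cases hz : R < |z.1|
  · rw [h0 z hz, norm_zero]
    exact indicator_nonneg (fun _ _ => (abs_nonneg _).trans (hK z)) _
  · rw [indicator_of_mem (show z ∈ Icc (-R) R ×ˢ (univ : Set ℝ) from
      ⟨abs_le.1 (not_lt.1 hz), mem_univ _⟩)]
    exact hK z

/-- Averaging of a function that is periodic in the fast variable: `F(x, x/ε)` is compared with its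
translates by `ε s`, `0 < s < L`, which only move the slow variable when averaged over `s`. -/
theorem tendsto_integral_average (hL : 0 < L) (hF : Measurable F) (hK : ∀ z, |F z| ≤ K)
    (h0 : ∀ z : ℝ × ℝ, R < |z.1| → F z = 0) (hper : ∀ x y, F (x, y + L) = F (x, y))
    (hcont : ∀ᵐ x : ℝ, ∀ η > 0, ∀ᶠ a in 𝓝 x, ∀ y, |F (a, y) - F (x, y)| ≤ η)
    (hε0 : ∀ n, 0 < ε n) (hε : Tendsto ε atTop (𝓝 0)) :
    Tendsto (fun n => ∫ x, F (x, x / ε n)) atTop (𝓝 (∫ x, 1 / L * ∫ y in Ioc 0 L, F (x, y))) := by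
  obtain ⟨E, hE⟩ : ∃ E, ∀ n, ε n ≤ E := by
    obtain ⟨E, hE⟩ := hε.bddAbove_range
    exact ⟨E, fun n => hE ⟨n, rfl⟩⟩
  have hE0 : 0 ≤ E := (hε0 0).le.trans (hE 0)
  have hK0 : 0 ≤ K := (abs_nonneg _).trans (hK 0)
  have m1 : ∀ n, Measurable fun z : ℝ × ℝ => F (z.1 + ε n * z.2, z.1 / ε n + z.2) := fun n =>
    hF.comp (by fun_prop)
  have m2 : ∀ n, Measurable fun z : ℝ × ℝ => F (z.1, z.1 / ε n + z.2) := fun n =>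
    hF.comp (by fun_prop)
  have i2 : ∀ n, Integrable (fun z : ℝ × ℝ => F (z.1, z.1 / ε n + z.2))
      ((volume : Measure ℝ).prod (volume.restrict (Ioc 0 L))) := fun n =>
    integrable_of_bounded_of_support (m2 n) (fun z => hK _) fun z hz => h0 _ hz
  -- the translated function, cut off to bounded `s`
  have i1 : ∀ n, Integrable (fun z : ℝ × ℝ => F (z.1 + ε n * z.2, z.1 / ε n + z.2))
      ((volume : Measure ℝ).prod (volume.restrict (Ioc 0 L))) := fun n => by
    have hS : MeasurableSet ((univ : Set ℝ) ×ˢ Ioc 0 L) := MeasurableSet.univ.prod measurableSet_Ioc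
    have h1 := integrable_of_bounded_of_support (L := L) (R := R + E * L) (K := K)
      ((m1 n).indicator hS) (fun z => by
        by_cases hz : z ∈ (univ : Set ℝ) ×ˢ Ioc 0 L
        · rw [indicator_of_mem hz]; exact hK _
        · rw [indicator_of_notMem hz, abs_zero]; exact hK0) fun z hz => by
        by_cases hzS : z ∈ (univ : Set ℝ) ×ˢ Ioc 0 L
        · rw [indicator_of_mem hzS]
          refine h0 _ ?_
          have hz2 := hzS.2
          have h2 : |ε n * z.2| ≤ E * L := by
            rw [abs_of_nonneg (mul_nonneg (hε0 n).le hz2.1.le)]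
            exact mul_le_mul (hE n) hz2.2 hz2.1.le hE0
          have h3 := abs_sub_abs_le_abs_sub z.1 (-(ε n * z.2))
          rw [abs_neg, sub_neg_eq_add] at h3
          simp only
          linarith
        · exact indicator_of_notMem hzS _
    refine h1.congr ?_
    have h2 : ∀ᵐ z ∂((volume : Measure ℝ).prod (volume.restrict (Ioc 0 L))),
        z ∈ (univ : Set ℝ) ×ˢ Ioc 0 L := by
      have : (volume : Measure ℝ).prod (volume.restrict (Ioc 0 L)) =
          ((volume : Measure ℝ).prod volume).restrict (univ ×ˢ Ioc 0 L) := by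
        rw [← Measure.prod_restrict, Measure.restrict_univ]
      rw [this]
      exact ae_restrict_mem hS
    filter_upwards [h2] with z hz
    rw [indicator_of_mem hz]
  -- for fixed `s` the integrand is the translate of `x ↦ F(x, x/ε)` by `ε s`
  have s1 : ∀ n, ∫ x, ∫ s in Ioc 0 L, F (x + ε n * s, x / ε n + s) = L * ∫ x, F (x, x / ε n) := by
    intro n
    rw [integral_integral_swap (i1 n)]
    have h1 : ∀ s : ℝ, ∫ x, F (x + ε n * s, x / ε n + s) = ∫ x, F (x, x / ε n) := fun s => by
      rw [← integral_add_right_eq_self (fun x => F (x, x / ε n)) (ε n * s)]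
      congr 1; ext x
      congr 2
      have := (hε0 n).ne'
      field_simp
    simp only [h1]
    rw [setIntegral_const]
    simp [hL.le]
  -- periodicity in the fast variable
  have s2 : ∀ n x, ∫ s in Ioc 0 L, F (x, x / ε n + s) = ∫ y in Ioc 0 L, F (x, y) := by
    intro n x
    rw [← intervalIntegral.integral_of_le hL.le, ← intervalIntegral.integral_of_le hL.le,
      intervalIntegral.integral_comp_add_left (fun y => F (x, y)), add_zero]
    have hp : Function.Periodic (fun y => F (x, y)) L := hper x
    have := hp.intervalIntegral_add_eq (x / ε n) 0
    rwa [zero_add] at this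
  have hJ : Tendsto (fun n => ∫ x, ∫ s in Ioc 0 L,
      (F (x + ε n * s, x / ε n + s) - F (x, x / ε n + s))) atTop (𝓝 0) := by
    rw [show 𝓝 (0 : ℝ) = 𝓝 (∫ _ : ℝ, (0 : ℝ)) by simp]
    refine tendsto_integral_of_dominated_convergence
      ((Icc (-(R + E * L)) (R + E * L)).indicator fun _ => L * (K + K)) ?_ ?_ ?_ ?_
    · intro n
      exact ((m1 n).sub (m2 n)).stronglyMeasurable.integral_prod_right'.aestronglyMeasurable
    · exact (integrable_indicator_iff measurableSet_Icc).2 (integrableOn_const (by simp))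
    · intro n
      refine ae_of_all _ fun x => ?_
      by_cases hx : x ∈ Icc (-(R + E * L)) (R + E * L)
      · rw [indicator_of_mem hx]
        have := norm_setIntegral_le_of_norm_le_const (μ := volume) (s := Ioc 0 L) (C := K + K)
          (f := fun s => F (x + ε n * s, x / ε n + s) - F (x, x / ε n + s)) (by simp)
          fun s _ => (norm_sub_le _ _).trans (add_le_add (hK _) (hK _))
        rw [mul_comm]
        simpa [hL.le] using this
      · rw [indicator_of_notMem hx, setIntegral_eq_zero_of_forall_eq_zero, norm_zero]
        intro s hs
        have hx' : R + E * L < |x| := by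
          by_contra! h; exact hx (abs_le.1 h)
        have h2 : |ε n * s| ≤ E * L := by
          rw [abs_of_nonneg (mul_nonneg (hε0 n).le hs.1.le)]
          exact mul_le_mul (hE n) hs.2 hs.1.le hE0
        have h3 := abs_sub_abs_le_abs_sub x (-(ε n * s))
        rw [abs_neg, sub_neg_eq_add] at h3
        have hEL : 0 ≤ E * L := by positivity
        rw [h0 _ (show R < |x + ε n * s| by linarith), h0 _ (show R < |x| by linarith), sub_zero]
    · filter_upwards [hcont] with x hx
      rw [Metric.tendsto_atTop]
      intro η hη
      obtain ⟨ρ, hρ, hball⟩ := Metric.eventually_nhds_iff_ball.1 (hx (η / 2 / L) (by positivity))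
      have h1 := hε.mul_const L
      rw [zero_mul] at h1
      obtain ⟨N, hN⟩ := eventually_atTop.1 (h1.eventually (gt_mem_nhds hρ))
      refine ⟨N, fun n hn => ?_⟩
      rw [dist_zero_right]
      have := norm_setIntegral_le_of_norm_le_const (μ := volume) (s := Ioc 0 L) (C := η / 2 / L)
        (f := fun s => F (x + ε n * s, x / ε n + s) - F (x, x / ε n + s)) (by simp)
        fun s hs => by
          refine hball _ ?_ _
          rw [Metric.mem_ball, Real.dist_eq, add_sub_cancel_left,
            abs_of_nonneg (mul_nonneg (hε0 n).le hs.1.le)]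
          exact (mul_le_mul_of_nonneg_left hs.2 (hε0 n).le).trans_lt (hN n hn)
      refine this.trans_lt ?_
      have h2 : volume.real (Ioc 0 L) = L := by simp [hL.le]
      rw [h2, div_mul_cancel₀ _ hL.ne']
      linarith
  have hJ' : ∀ n, ∫ x, ∫ s in Ioc 0 L, (F (x + ε n * s, x / ε n + s) - F (x, x / ε n + s)) =
      L * (∫ x, F (x, x / ε n)) - ∫ x, ∫ y in Ioc 0 L, F (x, y) := by
    intro n
    have h1 := integral_prod _ ((i1 n).sub (i2 n))
    have h2 := integral_prod _ (i1 n)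
    have h3 := integral_prod _ (i2 n)
    simp only [Pi.sub_apply] at h1
    rw [← h1, integral_sub (i1 n) (i2 n), h2, h3, s1]
    simp only [s2]
  simp only [hJ'] at hJ
  rw [integral_const_mul]
  have h1 := (hJ.const_mul (1 / L)).add_const (1 / L * ∫ x, ∫ y in Ioc 0 L, F (x, y))
  rw [mul_zero, zero_add] at h1
  refine h1.congr fun n => ?_
  field_simp
  ring

end Averaging

variable {p p' L H₀ H₁ : ℝ} {U : Set ℝ} {G : ℝ → ℝ → ℝ}

theorem IsCellProfile.volume_cell {Γ : ℝ → ℝ} (hΓ : IsCellProfile L Γ H₀ H₁) :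
    (volume (cell L Γ)).toReal = ∫ y in Ioc 0 L, Γ y := by
  have h1 := integral_comp_fst (A := Ioo 0 L) (h := Γ) (H₁ := H₁) isOpen_Ioo
    hΓ.continuous.continuousOn (fun x _ => hΓ.upper x)
    (fun x _ => hΓ.lower_pos.le.trans (hΓ.lower x)) (φ := fun _ => 1) (by
      exact integrableOn_const (by simp))
  rw [← cell_eq_subgraph] at h1
  simp only [mul_one] at h1
  rw [integral_Ioc_eq_integral_Ioo, ← h1, setIntegral_const]
  simp [Measure.real]

theorem IsCellProfile.rCoeff_eq {Γ : ℝ → ℝ} (hΓ : IsCellProfile L Γ H₀ H₁) :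
    rCoeff L Γ = 1 / L * ∫ y in Ioc 0 L, Γ y := by
  rw [rCoeff, hΓ.volume_cell]; ring

theorem IsCellProfile.rCoeff_bounds {Γ : ℝ → ℝ} (hΓ : IsCellProfile L Γ H₀ H₁) :
    H₀ ≤ rCoeff L Γ ∧ rCoeff L Γ ≤ H₁ := by
  have hL := hΓ.period_pos
  have hi : IntegrableOn Γ (Ioc 0 L) := hΓ.continuous.integrableOn_Ioc
  have hc : ∀ c : ℝ, ∫ y in Ioc (0 : ℝ) L, c = L * c := fun c => by
    rw [setIntegral_const]; simp [hL.le]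
  have h1 : L * H₀ ≤ ∫ y in Ioc 0 L, Γ y := by
    rw [← hc]
    exact integral_mono (integrable_const _) hi hΓ.lower
  have h2 : ∫ y in Ioc 0 L, Γ y ≤ L * H₁ := by
    rw [← hc]
    exact integral_mono hi (integrable_const _) hΓ.upper
  rw [hΓ.rCoeff_eq, one_div, inv_mul_eq_div, le_div_iff₀ hL, div_le_iff₀ hL]
  constructor <;> linarith

namespace IsProfileFamily

theorem continuousOn_rCoeff (hG : IsProfileFamily L U G H₀ H₁) :
    ContinuousOn (fun x => rCoeff L (G x)) U := by
  intro x hx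
  refine ContinuousAt.continuousWithinAt (Metric.tendsto_nhds.2 fun η hη => ?_)
  have hX := hG.cellProfile x hx
  have hL := hX.period_pos
  filter_upwards [hG.isOpen.mem_nhds hx, hG.eventually_close x hx (η / 2) (by positivity)]
    with a ha hax
  have hA := hG.cellProfile a ha
  rw [Real.dist_eq, hX.rCoeff_eq, hA.rCoeff_eq, ← mul_sub, ← integral_sub
    hA.continuous.integrableOn_Ioc hX.continuous.integrableOn_Ioc, abs_mul,
    abs_of_pos (by positivity)]
  have h1 := norm_setIntegral_le_of_norm_le_const (μ := volume) (s := Ioc 0 L) (C := η / 2)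
    (f := fun y => G a y - G x y) (by simp) fun y _ => hax y
  have h2 : volume.real (Ioc 0 L) = L := by simp [hL.le]
  rw [h2, Real.norm_eq_abs] at h1
  calc 1 / L * |∫ y in Ioc 0 L, (G a y - G x y)| ≤ 1 / L * (η / 2 * L) :=
        mul_le_mul_of_nonneg_left h1 (by positivity)
    _ = η / 2 := by field_simp
    _ < η := by linarith

/-- Oscillating heights converge weakly to the mean height of the cell. -/
theorem tendsto_integral_height (hG : IsProfileFamily L U G H₀ H₁) {ε : ℕ → ℝ}
    (hε0 : ∀ n, 0 < ε n) (hε : Tendsto ε atTop (𝓝 0)) {ψ : ℝ → ℝ} (hψ : IntegrableOn ψ (Ioo 0 1)) :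
    Tendsto (fun n => ∫ x in Ioo (0 : ℝ) 1, G x (x / ε n) * ψ x) atTop
      (𝓝 (∫ x in Ioo (0 : ℝ) 1, rCoeff L (G x) * ψ x)) := by
  have hUm := hG.isOpen.measurableSet
  have hH1 : 0 < H₁ := (hG.isHeight 1).upper_pos
  have hUne : U.Nonempty := by
    by_contra! h
    have := hG.null
    rw [h, sdiff_empty] at this
    simp at this
  obtain ⟨x₀, hx₀⟩ := hUne
  have hL := (hG.cellProfile x₀ hx₀).period_pos
  -- continuous weights
  have hcase : ∀ g : ℝ → ℝ, HasCompactSupport g → Continuous g →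
      Tendsto (fun n => ∫ x in Ioo (0 : ℝ) 1, G x (x / ε n) * g x) atTop
        (𝓝 (∫ x in Ioo (0 : ℝ) 1, rCoeff L (G x) * g x)) := by
    intro g hgc hg
    obtain ⟨M, hM0, hM⟩ := exists_bound_of_hasCompactSupport hg hgc
    set F : ℝ × ℝ → ℝ := (U ×ˢ (univ : Set ℝ)).indicator fun z => G z.1 z.2 * g z.1 with hF
    have hFU : ∀ x ∈ U, ∀ y, F (x, y) = G x y * g x := fun x hx y =>
      indicator_of_mem (show (x, y) ∈ U ×ˢ (univ : Set ℝ) from ⟨hx, mem_univ _⟩) _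
    have hFU' : ∀ x ∉ U, ∀ y, F (x, y) = 0 := fun x hx y =>
      indicator_of_notMem (fun h => hx h.1) _
    have hGabs : ∀ x ∈ U, ∀ y, |G x y| ≤ H₁ := fun x hx y => by
      have := hG.bounds x (hG.subset hx) y
      rw [abs_of_pos (hG.lower_pos.trans_le this.1)]; exact this.2
    have hFm : Measurable F := by
      have hUo : MeasurableSet (U ×ˢ (univ : Set ℝ)) := hUm.prod .univ
      classical
      rw [hF, ← piecewise_eq_indicator]
      exact (hG.continuousOn.mul (hg.comp continuous_fst).continuousOn).measurable_piecewise
        continuous_zero.continuousOn hUo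
    have key := tendsto_integral_average (K := H₁ * M) (R := 1) hL hFm (fun z => by
        by_cases hz : z.1 ∈ U
        · rw [show F z = G z.1 z.2 * g z.1 from hFU _ hz _, abs_mul]
          exact mul_le_mul (hGabs _ hz _) (hM _) (abs_nonneg _) hH1.le
        · rw [show F z = 0 from hFU' _ hz _, abs_zero]; positivity)
      (fun z hz => hFU' _ (fun h => by
        have := hG.subset h
        rw [abs_of_pos this.1] at hz
        linarith [this.2]) _)
      (fun x y => by
        by_cases hx : x ∈ U
        · rw [hFU x hx, hFU x hx, (hG.cellProfile x hx).periodic]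
        · rw [hFU' x hx, hFU' x hx]) ?_ hε0 hε
    · have e1 : ∀ n, ∫ x, F (x, x / ε n) = ∫ x in Ioo (0 : ℝ) 1, G x (x / ε n) * g x := fun n => by
        rw [hG.restrict_unit, ← integral_indicator hUm]
        congr 1; ext x
        by_cases hx : x ∈ U
        · rw [hFU x hx, indicator_of_mem hx]
        · rw [hFU' x hx, indicator_of_notMem hx]
      have e2 : ∫ x, 1 / L * ∫ y in Ioc 0 L, F (x, y) =
          ∫ x in Ioo (0 : ℝ) 1, rCoeff L (G x) * g x := by
        rw [hG.restrict_unit, ← integral_indicator hUm]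
        congr 1; ext x
        by_cases hx : x ∈ U
        · simp only [hFU x hx]
          rw [indicator_of_mem hx, (hG.cellProfile x hx).rCoeff_eq, integral_mul_const]; ring
        · simp only [hFU' x hx]
          rw [indicator_of_notMem hx]; simp
      rw [e2] at key
      exact key.congr e1
    · -- away from a null set, either `x ∈ U` or `x ∉ [0,1]`
      have h1 : ∀ᵐ x : ℝ, x ∉ Icc (0 : ℝ) 1 \ U := by
        refine measure_eq_zero_iff_ae_notMem.1 ?_
        refine measure_mono_null (t := (Ioo 0 1 \ U) ∪ {0, 1}) ?_ ?_
        · rintro x ⟨hx, hxU⟩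
          rcases eq_or_lt_of_le hx.1 with h | h
          · right; left; exact h.symm
          · rcases eq_or_lt_of_le hx.2 with h' | h'
            · right; right; exact h'
            · left; exact ⟨⟨h, h'⟩, hxU⟩
        · exact measure_union_null hG.null ((toFinite _).measure_zero _)
      filter_upwards [h1] with x hx η hη
      by_cases hxU : x ∈ U
      · have hg' := Metric.tendsto_nhds.1 (hg.continuousAt (x := x)) (η / (2 * H₁)) (by positivity)
        filter_upwards [hG.isOpen.mem_nhds hxU,
          hG.eventually_close x hxU (η / (2 * (M + 1))) (by positivity), hg'] with a ha hax hga y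
        rw [hFU a ha, hFU x hxU]
        rw [Real.dist_eq] at hga
        have b1 : |G a y - G x y| * |g x| ≤ η / 2 := by
          refine (mul_le_mul (hax y) (hM x) (abs_nonneg _) (by positivity)).trans ?_
          rw [div_mul_eq_mul_div, div_le_div_iff₀ (by positivity) (by positivity)]
          nlinarith
        have b2 : |G a y| * |g a - g x| ≤ η / 2 := by
          refine (mul_le_mul (hGabs a ha y) hga.le (abs_nonneg _) hH1.le).trans_eq ?_
          field_simp
        calc |G a y * g a - G x y * g x| = |(G a y - G x y) * g x + G a y * (g a - g x)| := by
              congr 1; ring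
          _ ≤ |G a y - G x y| * |g x| + |G a y| * |g a - g x| := by
              rw [← abs_mul, ← abs_mul]; exact abs_add_le _ _
          _ ≤ η := by linarith
      · have hx' : x ∉ Icc (0 : ℝ) 1 := fun h => hx ⟨h, hxU⟩
        filter_upwards [isClosed_Icc.isOpen_compl.mem_nhds hx'] with a ha y
        rw [hFU' a (fun h => ha (Ioo_subset_Icc_self (hG.subset h))), hFU' x hxU, sub_zero, abs_zero]
        exact hη.le
  -- density of continuous weights
  rw [Metric.tendsto_atTop]
  intro η hη
  obtain ⟨g, hgc, hgη, hg, hgi⟩ := hψ.exists_hasCompactSupport_integral_sub_le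
    (show 0 < η / (4 * H₁) by positivity)
  obtain ⟨N, hN⟩ := Metric.tendsto_atTop.1 (hcase g hgc hg) (η / 2) (by positivity)
  refine ⟨N, fun n hn => ?_⟩
  have hbd : ∀ w : ℝ → ℝ, AEStronglyMeasurable w (volume.restrict (Ioo 0 1)) →
      (∀ᵐ x ∂volume.restrict (Ioo (0 : ℝ) 1), |w x| ≤ H₁) →
      |(∫ x in Ioo (0 : ℝ) 1, w x * ψ x) - ∫ x in Ioo (0 : ℝ) 1, w x * g x| ≤ η / 4 := by
    intro w hwm hw
    have j1 : Integrable (fun x => w x * ψ x) (volume.restrict (Ioo 0 1)) :=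
      Integrable.bdd_mul hψ hwm hw
    have j2 : Integrable (fun x => w x * g x) (volume.restrict (Ioo 0 1)) :=
      Integrable.bdd_mul hgi hwm hw
    rw [← integral_sub j1 j2, ← Real.norm_eq_abs]
    refine (norm_integral_le_of_norm_le (((hψ.sub hgi).norm).const_mul H₁) ?_).trans ?_
    · filter_upwards [hw] with x hx
      rw [← mul_sub, norm_mul]
      exact mul_le_mul_of_nonneg_right hx (norm_nonneg _)
    · rw [integral_const_mul]
      refine (mul_le_mul_of_nonneg_left hgη hH1.le).trans_eq ?_
      field_simp
  have hmem : ∀ᵐ x ∂volume.restrict (Ioo (0 : ℝ) 1), x ∈ U := by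
    rw [hG.restrict_unit]; exact ae_restrict_mem hUm
  have c1 := hbd (fun x => G x (x / ε n)) (by
      rw [hG.restrict_unit]
      exact (hG.isHeight (ε n)).continuousOn.aestronglyMeasurable hUm) (by
      filter_upwards [hmem] with x hx
      have := hG.bounds x (hG.subset hx) (x / ε n)
      rw [abs_of_pos (hG.lower_pos.trans_le this.1)]; exact this.2)
  have c2 := hbd (fun x => rCoeff L (G x)) (by
      rw [hG.restrict_unit]
      exact hG.continuousOn_rCoeff.aestronglyMeasurable hUm) (by
      filter_upwards [hmem] with x hx
      have := (hG.cellProfile x hx).rCoeff_bounds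
      rw [abs_of_pos (hG.lower_pos.trans_le this.1)]; exact this.2)
  have c3 := hN n hn
  rw [Real.dist_eq] at c3 ⊢
  rw [abs_lt] at c3 ⊢
  rw [abs_le] at c1 c2
  constructor <;> linarith [c1.1, c1.2, c2.1, c2.2, c3.1, c3.2]

end IsProfileFamily

end RoughThin

/-! ### Piecewise `C¹` profiles -/

namespace RoughThin

variable {p p' L G₀ G₁ ε : ℝ} {N : ℕ} {ξ : Fin (N + 1) → ℝ} {G : ℝ → ℝ → ℝ}

namespace IsProfile

/-- Every point of `(0,1)` other than a breakpoint lies in one of the intervals of smoothness. -/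
theorem exists_mem_component (hG : IsProfile G L G₀ G₁ ξ) {x : ℝ}
    (hx : x ∈ Ioo (0 : ℝ) 1 \ range ξ) :
    ∃ i : Fin N, x ∈ Ioo (ξ i.castSucc) (ξ i.succ) := by
  by_contra! hcon
  have hlt : ∀ j : Fin (N + 1), ξ j < x := by
    intro j
    induction j using Fin.induction with
    | zero => rw [hG.first]; exact hx.1.1
    | succ i ih =>
      refine lt_of_le_of_ne ?_ fun h => hx.2 ⟨_, h⟩
      by_contra! h
      exact hcon i ⟨ih, h⟩
  have := hlt (Fin.last N)
  rw [hG.last] at this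
  exact absurd hx.1.2 (not_lt.2 this.le)

/-- A piecewise `C¹` profile with bounded derivatives is a continuous family of periodic profiles
away from its breakpoints. -/
theorem isProfileFamily (hG : IsProfile G L G₀ G₁ ξ) :
    IsProfileFamily L (Ioo 0 1 \ range ξ) G G₀ G₁ where
  isOpen := isOpen_Ioo.sdiff (finite_range ξ).isClosed
  subset := sdiff_subset
  null := measure_mono_null (fun x hx => by
    by_contra h; exact hx.2 ⟨hx.1, h⟩) ((finite_range ξ).measure_zero volume)
  lower_pos := hG.lower_pos
  bounds := hG.bounds
  cellProfile x hx := by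
    obtain ⟨i, hi⟩ := hG.exists_mem_component hx
    refine ⟨hG.period_pos, hG.lower_pos, ?_, hG.periodic x hx.1, fun y => (hG.bounds x hx.1 y).1,
      fun y => (hG.bounds x hx.1 y).2⟩
    exact (hG.contDiffOn i).continuousOn.comp_continuous (f := fun y : ℝ => (x, y))
      (by fun_prop) fun y => ⟨hi, mem_univ _⟩
  eventually_close x hx η hη := by
    obtain ⟨i, hi⟩ := hG.exists_mem_component hx
    obtain ⟨M, hM⟩ := hG.deriv_bounded
    have hM0 : 0 ≤ M := (abs_nonneg _).trans (hM i x hi 0).1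
    have hdiff : ∀ y, ∀ s ∈ Ioo (ξ i.castSucc) (ξ i.succ),
        DifferentiableAt ℝ (fun s => G s y) s := fun y s hs => by
      have h1 : DifferentiableAt ℝ (fun z : ℝ × ℝ => G z.1 z.2) (s, y) :=
        ((hG.contDiffOn i).differentiableOn (by simp)).differentiableAt
          ((isOpen_Ioo.prod isOpen_univ).mem_nhds ⟨hs, mem_univ _⟩)
      exact h1.comp s (f := fun s : ℝ => (s, y)) (by fun_prop)
    filter_upwards [isOpen_Ioo.mem_nhds hi, Metric.ball_mem_nhds x
      (show 0 < η / (M + 1) by positivity)] with a ha hax y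
    have h1 := (convex_Ioo (ξ i.castSucc) (ξ i.succ)).norm_image_sub_le_of_norm_deriv_le
      (hdiff y) (fun s hs => (hM i s hs y).1) hi ha
    rw [Metric.mem_ball, Real.dist_eq, lt_div_iff₀ (by positivity)] at hax
    rw [Real.norm_eq_abs, Real.norm_eq_abs] at h1
    nlinarith [abs_nonneg (a - x)]

end IsProfile

/-! ### Rescaling -/

theorem thin_eq_preimage (hε : 0 < ε) :
    thin (fun x => G x (x / ε)) = diagMap 1 0 ε ⁻¹' thinDomain G ε := by
  ext z
  simp only [subgraph, thinDomain, diagMap, Set.mem_ofPred_eq, mem_preimage, one_mul, add_zero,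
    mul_pos_iff_of_pos_left hε, mul_lt_mul_iff_right₀ hε]

theorem thinDomain_eq_preimage (hε : 0 < ε) :
    thinDomain G ε = diagMap 1 0 ε⁻¹ ⁻¹' thin (fun x => G x (x / ε)) := by
  ext z
  rw [thin_eq_preimage hε, mem_preimage, mem_preimage]
  have := diagMap_symm_right (α := 1) (β := 0) (γ := ε) one_ne_zero hε.ne' z
  simp only [mul_zero, neg_zero, inv_one] at this
  rw [this]

/-- The factor `1/ε` in the vertical mean is absorbed by stretching the domain vertically. -/
theorem vertInt_eq_fiberInt (h₀ : 0 < G₀) (hbd : ∀ x ∈ Ioo (0 : ℝ) 1, ∀ y, G₀ ≤ G x y)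
    (hε : 0 < ε) (f : ℝ × ℝ → ℝ) {x : ℝ} (hx : x ∈ Ioo (0 : ℝ) 1) :
    vertInt G ε f x = fiberInt (fun x => G x (x / ε)) (fun z => f (diagMap 1 0 ε z)) x := by
  have h1 := intervalIntegral.integral_comp_mul_left (a := 0) (b := G x (x / ε))
    (fun y => f (x, y)) hε.ne'
  rw [mul_zero, smul_eq_mul] at h1
  rw [vertInt, fiberInt, one_div, ← h1, intervalIntegral.integral_of_le
    (h₀.le.trans (hbd x hx _)), integral_Ioc_eq_integral_Ioo]
  simp only [diagMap, one_mul, add_zero]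

/-- A planar function in `W^{1,p}` of the thin domain, pulled back to the rescaled domain. -/
theorem MemW.memScaledW (hε : 0 < ε) {u : ℝ × ℝ → ℝ} {du : ℝ × ℝ → Vec2}
    (h : MemW p (thinDomain G ε) u du) :
    MemScaledW p ε (thin fun x => G x (x / ε)) (fun z => u (diagMap 1 0 ε z))
      (fun z => du (diagMap 1 0 ε z)) := by
  rw [thin_eq_preimage hε]
  refine ⟨memLp_comp_diagMap one_ne_zero hε.ne' h.1, memLp_comp_diagMap one_ne_zero hε.ne' h.2.1,
    ?_, h.2.2.2.comp_diagMap_snd one_ne_zero hε.ne'⟩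
  have := h.2.2.1.comp_diagMap_fst (α := 1) (β := 0) (γ := ε) one_ne_zero hε.ne'
  simpa only [one_mul] using this

/-- The inverse passage: functions on the rescaled domain give test functions on the thin domain. -/
theorem MemScaledW.memW (hε : 0 < ε) {φ : ℝ × ℝ → ℝ} {k : ℝ × ℝ → Vec2}
    (h : MemScaledW p ε (thin fun x => G x (x / ε)) φ k) :
    MemW p (thinDomain G ε) (fun z => φ (diagMap 1 0 ε⁻¹ z)) (fun z => k (diagMap 1 0 ε⁻¹ z)) := by
  have hε' := inv_ne_zero hε.ne'
  rw [thinDomain_eq_preimage hε]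
  refine ⟨memLp_comp_diagMap one_ne_zero hε' h.memLp, memLp_comp_diagMap one_ne_zero hε'
    h.memLp_grad, ?_, ?_⟩
  · have := h.deriv_fst.comp_diagMap_fst (α := 1) (β := 0) one_ne_zero hε'
    simpa only [one_mul] using this
  · refine (h.deriv_snd.comp_diagMap_snd (α := 1) (β := 0) one_ne_zero hε').congr_on
      (fun _ _ => rfl) fun z _ => ?_
    rw [← mul_assoc, inv_mul_cancel₀ hε.ne', one_mul]

theorem integral_thin_comp (hε : 0 < ε) (F : ℝ × ℝ → ℝ) :
    ∫ z in thin (fun x => G x (x / ε)), F (diagMap 1 0 ε z) =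
      ε⁻¹ * ∫ z in thinDomain G ε, F z := by
  have h1 := setIntegral_comp_diagMap (α := 1) (β := 0) one_ne_zero hε.ne' (thinDomain G ε) F
  rw [← thin_eq_preimage hε] at h1
  rw [h1]
  simp [abs_of_pos hε]

/-- The Neumann problem on the thin domain, rescaled. -/
theorem IsNeumannSolution.exists_scaled (hε : 0 < ε) {f u : ℝ × ℝ → ℝ}
    (h : IsNeumannSolution p (thinDomain G ε) f u) :
    ∃ g : ℝ × ℝ → Vec2,
      MemScaledW p ε (thin fun x => G x (x / ε)) (fun z => u (diagMap 1 0 ε z)) g ∧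
      ∀ φ k, MemScaledW p ε (thin fun x => G x (x / ε)) φ k →
        ∫ z in thin (fun x => G x (x / ε)),
          (inner ℝ (flux p (g z)) (k z) + flux p (u (diagMap 1 0 ε z)) * φ z) =
        ∫ z in thin (fun x => G x (x / ε)), f (diagMap 1 0 ε z) * φ z := by
  obtain ⟨du, hu, heq⟩ := h
  refine ⟨_, hu.memScaledW hε, fun φ k hφ => ?_⟩
  have hinv : ∀ z, diagMap 1 0 ε⁻¹ (diagMap 1 0 ε z) = z := fun z => by
    have := diagMap_symm_left (α := 1) (β := 0) (γ := ε) one_ne_zero hε.ne' z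
    simpa only [mul_zero, neg_zero, inv_one] using this
  have h1 := heq _ _ (hφ.memW hε)
  have h2 := integral_thin_comp (G := G) hε fun z => inner ℝ (pFlux p (du z))
    (k (diagMap 1 0 ε⁻¹ z)) + pPow p (u z) * φ (diagMap 1 0 ε⁻¹ z)
  have h3 := integral_thin_comp (G := G) hε fun z => f z * φ (diagMap 1 0 ε⁻¹ z)
  rw [h1, ← h3] at h2
  simpa only [hinv, pFlux_eq_flux, pPow_eq_flux] using h2

end RoughThin

/-! ### The homogenized problem -/

namespace RoughThin

variable {p p' L H₀ H₁ : ℝ} {U : Set ℝ} {G : ℝ → ℝ → ℝ}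

namespace IsProfileFamily

theorem ae_mem (hG : IsProfileFamily L U G H₀ H₁) :
    ∀ᵐ x ∂volume.restrict (Ioo (0 : ℝ) 1), x ∈ U := by
  rw [hG.restrict_unit]; exact ae_restrict_mem hG.isOpen.measurableSet

theorem aestronglyMeasurable_rCoeff (hG : IsProfileFamily L U G H₀ H₁) :
    AEStronglyMeasurable (fun x => rCoeff L (G x)) (volume.restrict (Ioo 0 1)) := by
  rw [hG.restrict_unit]
  exact hG.continuousOn_rCoeff.aestronglyMeasurable hG.isOpen.measurableSet

theorem ae_rCoeff_le (hG : IsProfileFamily L U G H₀ H₁) :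
    ∀ᵐ x ∂volume.restrict (Ioo (0 : ℝ) 1), |rCoeff L (G x)| ≤ H₁ := by
  filter_upwards [hG.ae_mem] with x hx
  have := (hG.cellProfile x hx).rCoeff_bounds
  rw [abs_of_pos (hG.lower_pos.trans_le this.1)]; exact this.2

/-- Multiplication by `1 / r` preserves `L^q`, since `r ≥ H₀`. -/
theorem memLp_inv_rCoeff_mul (hG : IsProfileFamily L U G H₀ H₁) {φ : ℝ → ℝ} {q : ℝ≥0∞}
    (hφ : MemLp φ q (volume.restrict (Ioo 0 1))) :
    MemLp (fun x => (rCoeff L (G x))⁻¹ * φ x) q (volume.restrict (Ioo 0 1)) := by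
  refine memLp_mul_of_ae_bound (M := H₀⁻¹)
    hG.aestronglyMeasurable_rCoeff.aemeasurable.inv.aestronglyMeasurable ?_ hφ
  filter_upwards [hG.ae_mem] with x hx
  have h1 := (hG.cellProfile x hx).rCoeff_bounds.1
  rw [abs_of_pos (inv_pos.2 (hG.lower_pos.trans_le h1))]
  exact inv_anti₀ hG.lower_pos h1

end IsProfileFamily

section Limit

variable {ε : ℕ → ℝ} {f u : ℕ → ℝ × ℝ → ℝ} {g : ℕ → ℝ × ℝ → Vec2} {fhat : ℝ → ℝ} {C : ℝ}
  {m : ℕ → ℝ → ℝ} {u₀ u₀' σ : ℝ → ℝ}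

/-- Inserting the identified flux into the limit equation gives the homogenized problem. -/
theorem IsThinLimit.solvesHomogenized
    (H : IsThinLimit p p' U H₀ H₁ ε (fun n x => G x (x / ε n)) f u g fhat
      (fun x => rCoeff L (G x)) C m u₀ u₀' σ)
    (hp : p.HolderConjugate p') (hG : IsProfileFamily L U G H₀ H₁) :
    SolvesHomogenized p (fun x => qCoeff p L (G x)) (fun x => rCoeff L (G x)) fhat u₀ u₀' := by
  intro φ φ' hφ
  have hσ := H.flux_eq hp hG
  have i1 : Integrable (fun x => σ x * φ' x) (volume.restrict (Ioo 0 1)) :=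
    integrable_mul_of_memLp hp H.memLp_flux hφ.2.1
  have i2 : Integrable (fun x => rCoeff L (G x) * (flux p (u₀ x) * φ x))
      (volume.restrict (Ioo 0 1)) :=
    Integrable.bdd_mul (H.integrableOn_flux_mul hp hφ.1) hG.aestronglyMeasurable_rCoeff
      hG.ae_rCoeff_le
  have hae : (fun x => σ x * φ' x + rCoeff L (G x) * (flux p (u₀ x) * φ x))
      =ᵐ[volume.restrict (Ioo 0 1)] fun x => qCoeff p L (G x) * pPow p (u₀' x) * φ' x +
        rCoeff L (G x) * pPow p (u₀ x) * φ x := by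
    filter_upwards [hσ] with x hx
    rw [hx, pPow_eq_flux, pPow_eq_flux]; ring
  refine ⟨(i1.add i2).congr hae, integrable_mul_of_memLp hp H.memLp_fhat hφ.1, ?_⟩
  rw [← integral_congr_ae hae, integral_add i1 i2]
  exact H.integral_eq hp hφ

/-- The rescaled vertical averages of the solutions converge weakly to `u₀`. -/
theorem IsThinLimit.tendsto_average
    (H : IsThinLimit p p' U H₀ H₁ ε (fun n x => G x (x / ε n)) f u g fhat
      (fun x => rCoeff L (G x)) C m u₀ u₀' σ)
    (hp : p.HolderConjugate p') (hG : IsProfileFamily L U G H₀ H₁) {φ : ℝ → ℝ}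
    (hφ : MemLp φ (ENNReal.ofReal p') (volume.restrict (Ioo 0 1))) :
    Tendsto (fun n => ∫ x in Ioo (0 : ℝ) 1,
      (rCoeff L (G x))⁻¹ * fiberInt (fun x => G x (x / ε n)) (u n) x * φ x) atTop
      (𝓝 (∫ x in Ioo (0 : ℝ) 1, u₀ x * φ x)) := by
  have hψ := hG.memLp_inv_rCoeff_mul hφ
  have hψc := fun n => (H.height n).memLp_comp_fst hp.symm.lt hψ
  have hu₀c := fun n => (H.height n).memLp_comp_fst hp.lt H.memW01.1
  have hd : ∀ n, MemLp (fun z => u n z - u₀ z.1) (ENNReal.ofReal p)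
      (volume.restrict (thin fun x => G x (x / ε n))) := fun n =>
    (H.memScaledW n).memLp.sub (hu₀c n)
  -- `u` is replaced by its strong limit `u₀`, after which only the weak limit of the heights enters
  have h1 := tendsto_integral_mul_zero hp hψc hd
    (fun n => (H.height n).integral_norm_rpow_comp_fst_le hp.symm.lt hψ) (H.tendsto hp)
  have i0 : IntegrableOn (fun x => u₀ x * ((rCoeff L (G x))⁻¹ * φ x)) (Ioo 0 1) :=
    integrable_mul_of_memLp hp.symm H.memW01.1 hψ
  have h2 := h1.add (H.weak_height _ i0)
  rw [zero_add] at h2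
  have e0 : ∫ x in Ioo (0 : ℝ) 1, rCoeff L (G x) * (u₀ x * ((rCoeff L (G x))⁻¹ * φ x)) =
      ∫ x in Ioo (0 : ℝ) 1, u₀ x * φ x := by
    refine integral_congr_ae ?_
    filter_upwards [hG.ae_mem] with x hx
    have := (hG.lower_pos.trans_le (hG.cellProfile x hx).rCoeff_bounds.1).ne'
    field_simp
  rw [e0] at h2
  refine h2.congr fun n => ?_
  have i1 := integrable_mul_of_memLp hp.symm (H.memScaledW n).memLp (hψc n)
  have i2 := integrable_mul_of_memLp hp.symm (hu₀c n) (hψc n)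
  have e1 : ∫ x in Ioo (0 : ℝ) 1,
      (rCoeff L (G x))⁻¹ * fiberInt (fun x => G x (x / ε n)) (u n) x * φ x =
      ∫ x in Ioo (0 : ℝ) 1, fiberInt (fun x => G x (x / ε n)) (u n) x *
        ((rCoeff L (G x))⁻¹ * φ x) := by
    congr 1; ext x; ring
  rw [e1, ← (H.height n).integral_mul_comp_fst (φ := fun x => (rCoeff L (G x))⁻¹ * φ x) i1,
    ← (H.height n).integral_comp_fst i0, ← integral_add
      (integrable_mul_of_memLp hp (hψc n) (hd n)) i2]
  congr 1; ext z; ring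

end Limit

theorem MemW01.sub (hp : 1 < p) {u v u' v' : ℝ → ℝ} (hu : MemW01 p u u') (hv : MemW01 p v v') :
    MemW01 p (fun x => u x - v x) (fun x => u' x - v' x) :=
  ⟨hu.1.sub hv.1, hu.2.1.sub hv.2.1, hu.2.2.sub hv.2.2 (LocInt.of_memLp hp hu.1)
    (LocInt.of_memLp hp hu.2.1) (LocInt.of_memLp hp hv.1) (LocInt.of_memLp hp hv.2.1)⟩

/-- Uniqueness for the homogenized problem, by monotonicity. -/
theorem SolvesHomogenized.ae_eq (hp : p.HolderConjugate p') {q r f : ℝ → ℝ}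
    {u u' v v' : ℝ → ℝ} (hq : ∀ᵐ x ∂volume.restrict (Ioo (0 : ℝ) 1), 0 ≤ q x)
    (hr : ∀ᵐ x ∂volume.restrict (Ioo (0 : ℝ) 1), 0 < r x) (hu : MemW01 p u u')
    (hv : MemW01 p v v') (h1 : SolvesHomogenized p q r f u u')
    (h2 : SolvesHomogenized p q r f v v') : u =ᵐ[volume.restrict (Ioo 0 1)] v := by
  obtain ⟨i1, -, e1⟩ := h1 _ _ (hu.sub hp.lt hv)
  obtain ⟨i2, -, e2⟩ := h2 _ _ (hu.sub hp.lt hv)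
  have hmono : ∀ a b : ℝ, 0 ≤ (flux p a - flux p b) * (a - b) := fun a b => by
    have := flux_mono hp a b
    simpa [mul_comm] using this
  have e3 := integral_sub i1 i2
  rw [e1, e2, sub_self] at e3
  have hnn : 0 ≤ᵐ[volume.restrict (Ioo 0 1)] fun x =>
      (q x * pPow p (u' x) * (u' x - v' x) + r x * pPow p (u x) * (u x - v x)) -
      (q x * pPow p (v' x) * (u' x - v' x) + r x * pPow p (v x) * (u x - v x)) := by
    filter_upwards [hq, hr] with x hqx hrx
    simp only [Pi.zero_apply, pPow_eq_flux]
    have := mul_nonneg hqx (hmono (u' x) (v' x))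
    have := mul_nonneg hrx.le (hmono (u x) (v x))
    linarith
  have h0 := (integral_eq_zero_iff_of_nonneg_ae hnn (i1.sub i2)).1 e3
  filter_upwards [h0, hq, hr] with x hx hqx hrx
  simp only [Pi.zero_apply, pPow_eq_flux] at hx
  have b1 := mul_nonneg hqx (hmono (u' x) (v' x))
  have b2 := mul_nonneg hrx.le (hmono (u x) (v x))
  have b3 : r x * ((flux p (u x) - flux p (v x)) * (u x - v x)) = 0 := by linarith
  have b4 := (mul_eq_zero.1 b3).resolve_left hrx.ne'
  refine eq_of_flux_mono_eq_zero hp (s := u x) (t := v x) ?_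
  simpa [mul_comm] using b4

/-- Along any sequence of small parameters, the rescaled solutions form a sequence to which the
compactness argument applies. -/
theorem IsProfileFamily.isThinSequence (hp : p.HolderConjugate p')
    (hG : IsProfileFamily L U G H₀ H₁) {f u : ℝ → ℝ × ℝ → ℝ}
    (hf : ∀ ε > 0, MemLp (f ε) (ENNReal.ofReal p') (volume.restrict (thinDomain G ε)))
    (hu : ∀ ε > 0, IsNeumannSolution p (thinDomain G ε) (f ε) (u ε)) {fhat : ℝ → ℝ}
    (hfhat : WeakTendsto p' p (fun ε => vertInt G ε (f ε)) fhat) {ε : ℕ → ℝ}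
    (hε0 : ∀ n, 0 < ε n) (hε : Tendsto ε atTop (𝓝[>] 0)) {C : ℝ≥0}
    (hC : ∀ n, eLpNorm (f (ε n)) (ENNReal.ofReal p') (volume.restrict (thinDomain G (ε n))) ≤ C) :
    ∃ g : ℕ → ℝ × ℝ → Vec2, IsThinSequence p p' U H₀ H₁ ε (fun n x => G x (x / ε n))
      (fun n z => f (ε n) (diagMap 1 0 (ε n) z)) (fun n z => u (ε n) (diagMap 1 0 (ε n) z)) g fhat
      (fun x => rCoeff L (G x)) := by
  choose g hg1 hg2 using fun n => (hu (ε n) (hε0 n)).exists_scaled (hε0 n)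
  have hε' : Tendsto ε atTop (𝓝 0) := hε.mono_right nhdsWithin_le_nhds
  refine ⟨g, ⟨hε0, hε', fun n => hG.isHeight _, fun n => ?_, hg1, hg2, ?_, hfhat.2.1,
    fun φ hφ => ?_, fun ψ hψ => hG.tendsto_integral_height hε0 hε' hψ⟩⟩
  · rw [thin_eq_preimage (hε0 n)]
    exact memLp_comp_diagMap one_ne_zero (hε0 n).ne' (hf _ (hε0 n))
  -- rescaling multiplies `∫ |f|^{p'}` by `1/ε`; the weight `ε^{p'}`, which pairs `f` with the
  -- oscillation of a test function over a section, leaves the factor `ε^{p' - 1}`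
  · have hlim : Tendsto (fun n => ε n ^ (p' - 1) * (C : ℝ) ^ p') atTop (𝓝 0) := by
      have h1 := hε'.rpow_const (p := p' - 1) (Or.inr (by linarith [hp.symm.lt]))
      rw [Real.zero_rpow (by linarith [hp.symm.lt])] at h1
      simpa using h1.mul_const ((C : ℝ) ^ p')
    refine squeeze_zero (fun n => mul_nonneg (Real.rpow_nonneg (hε0 n).le _)
      (integral_norm_rpow_nonneg _)) (fun n => ?_) hlim
    rw [integral_thin_comp (G := G) (hε0 n) fun z => ‖f (ε n) z‖ ^ p', ← mul_assoc,
      ← Real.rpow_neg_one (ε n), ← Real.rpow_add (hε0 n), ← sub_eq_add_neg]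
    refine mul_le_mul_of_nonneg_left ?_ (Real.rpow_nonneg (hε0 n).le _)
    exact integral_norm_rpow_le_of_eLpNorm_le hp.symm.lt (hf _ (hε0 n)) C.2
      (by rw [ENNReal.ofReal_coe_nnreal]; exact hC n)
  · refine ((hfhat.2.2 φ hφ).comp hε).congr fun n => ?_
    refine setIntegral_congr_fun measurableSet_Ioo fun x hx => ?_
    simp only
    rw [vertInt_eq_fiberInt hG.lower_pos (fun x hx y => (hG.bounds x hx y).1) (hε0 n) _ hx]

end RoughThin

theorem theorem1p1 (p p' : ℝ) (hp : p.HolderConjugate p')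
    (N : ℕ) (ξ : Fin (N + 1) → ℝ) (L G₀ G₁ : ℝ) (G : ℝ → ℝ → ℝ)
    (hG : RoughThin.IsProfile G L G₀ G₁ ξ)
    (f u : ℝ → ℝ × ℝ → ℝ)
    (hf : ∀ ε > 0, MemLp (f ε) (ENNReal.ofReal p')
      (volume.restrict (RoughThin.thinDomain G ε)))
    (hf_bdd : ∃ C : ℝ≥0, ∀ᶠ ε in 𝓝[>] (0 : ℝ),
      eLpNorm (f ε) (ENNReal.ofReal p') (volume.restrict (RoughThin.thinDomain G ε)) ≤ C)
    (hu : ∀ ε > 0, RoughThin.IsNeumannSolution p (RoughThin.thinDomain G ε) (f ε) (u ε))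
    (fhat : ℝ → ℝ)
    (hfhat : RoughThin.WeakTendsto p' p (fun ε => RoughThin.vertInt G ε (f ε)) fhat) :
    (∀ x ∈ Ioo (0 : ℝ) 1, x ∉ range ξ → RoughThin.CellWellPosed p L (G x)) ∧
    ∃ u₀ u₀' : ℝ → ℝ, RoughThin.MemW01 p u₀ u₀' ∧
      RoughThin.WeakTendsto p p'
        (fun ε x => L / (volume (RoughThin.cell L (G x))).toReal *
          RoughThin.vertInt G ε (u ε) x) u₀ ∧
      RoughThin.SolvesHomogenized p (fun x => RoughThin.qCoeff p L (G x))
        (fun x => RoughThin.rCoeff L (G x)) fhat u₀ u₀' := by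
  have hF := hG.isProfileFamily
  refine ⟨fun x hx hxξ => RoughThin.cellWellPosed hp (hF.cellProfile x ⟨hx, hxξ⟩), ?_⟩
  obtain ⟨C, hC⟩ := hf_bdd
  have hlow : ∀ x ∈ Ioo (0 : ℝ) 1, ∀ y, G₀ ≤ G x y := fun x hx y => (hF.bounds x hx y).1
  have hfac : ∀ x, L / (volume (RoughThin.cell L (G x))).toReal =
      (RoughThin.rCoeff L (G x))⁻¹ := fun x => by rw [RoughThin.rCoeff, inv_div]
  -- every sequence has a subsequence along which the averages converge to a solution
  have hsub : ∀ s : ℕ → ℝ, Tendsto s atTop (𝓝[>] 0) → ∃ (k : ℕ → ℕ) (u₀ u₀' : ℝ → ℝ),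
      RoughThin.MemW01 p u₀ u₀' ∧
      RoughThin.SolvesHomogenized p (fun x => RoughThin.qCoeff p L (G x))
        (fun x => RoughThin.rCoeff L (G x)) fhat u₀ u₀' ∧
      ∀ φ : ℝ → ℝ, MemLp φ (ENNReal.ofReal p') (volume.restrict (Ioo 0 1)) →
        Tendsto (fun n => ∫ x in Ioo (0 : ℝ) 1, L / (volume (RoughThin.cell L (G x))).toReal *
          RoughThin.vertInt G (s (k n)) (u (s (k n))) x * φ x) atTop
          (𝓝 (∫ x in Ioo (0 : ℝ) 1, u₀ x * φ x)) := by
    intro s hs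
    -- the bound on `f` holds only for small `ε`: the first terms are dropped
    obtain ⟨M, hM⟩ := eventually_atTop.1 (hs.eventually (hC.and self_mem_nhdsWithin))
    have hs' : Tendsto (fun n => s (n + M)) atTop (𝓝[>] 0) := hs.comp (tendsto_add_atTop_nat M)
    obtain ⟨g, hT⟩ := hF.isThinSequence hp hf hu hfhat (ε := fun n => s (n + M))
      (fun n => (hM _ (by lia)).2) hs' (fun n => (hM _ (by lia)).1)
    obtain ⟨k, D, m, u₀, u₀', σ, -, H⟩ := hT.exists_isThinLimit hp hF.lower_pos
    refine ⟨fun n => k n + M, u₀, u₀', H.memW01,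
      RoughThin.IsThinLimit.solvesHomogenized (ε := (fun n => s (n + M)) ∘ k) H hp hF,
      fun φ hφ => ?_⟩
    refine (RoughThin.IsThinLimit.tendsto_average (ε := (fun n => s (n + M)) ∘ k) H hp hF hφ).congr
      fun n => ?_
    refine setIntegral_congr_fun measurableSet_Ioo fun x hx => ?_
    simp only [hfac, Function.comp_apply]
    rw [RoughThin.vertInt_eq_fiberInt hF.lower_pos hlow (hM (k n + M) (by lia)).2 _ hx]
  -- the limit is defined along one sequence and then shown not to depend on it
  have hseq : Tendsto (fun n : ℕ => 1 / ((n : ℝ) + 1)) atTop (𝓝[>] 0) :=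
    tendsto_nhdsWithin_iff.2 ⟨tendsto_one_div_add_atTop_nhds_zero_nat,
      Eventually.of_forall fun n => Set.mem_Ioi.2 (by positivity)⟩
  obtain ⟨-, u₀, u₀', hW, hsol, -⟩ := hsub _ hseq
  have hq : ∀ᵐ x ∂volume.restrict (Ioo (0 : ℝ) 1), 0 ≤ RoughThin.qCoeff p L (G x) :=
    hF.ae_mem.mono fun x hx => RoughThin.qCoeff_nonneg hp (hF.cellProfile x hx)
  have hr : ∀ᵐ x ∂volume.restrict (Ioo (0 : ℝ) 1), 0 < RoughThin.rCoeff L (G x) :=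
    hF.ae_mem.mono fun x hx => hF.lower_pos.trans_le (hF.cellProfile x hx).rCoeff_bounds.1
  refine ⟨u₀, u₀', hW, ⟨fun ε hε => ?_, hW.1, fun φ hφ => ?_⟩, hsol⟩
  · obtain ⟨du, hdu, -⟩ := hu ε hε
    have h1 := ((hF.isHeight ε).memLp_fiberInt hp (hdu.memScaledW hε).memLp).1
    refine (hF.memLp_inv_rCoeff_mul h1).ae_eq ((ae_restrict_iff' measurableSet_Ioo).2
      (ae_of_all _ fun x hx => ?_))
    simp only [hfac]
    rw [RoughThin.vertInt_eq_fiberInt hF.lower_pos hlow hε _ hx]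
  -- every sequence has a subsequence converging to a solution, which by uniqueness is `u₀`
  · refine tendsto_of_subseq_tendsto fun s hs => ?_
    obtain ⟨k, v₀, v₀', hV, hsol', hlim⟩ := hsub s hs
    refine ⟨k, ?_⟩
    have heq := RoughThin.SolvesHomogenized.ae_eq hp hq hr hV hW hsol' hsol
    have h1 := hlim φ hφ
    rwa [integral_congr_ae (heq.mono fun x hx => by
      simp only [hx] : (fun x => v₀ x * φ x) =ᵐ[volume.restrict (Ioo 0 1)]
        fun x => u₀ x * φ x)] at h1
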